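/- Let $n\ge 2$, $A=\mathrm{diag}(A_1,\dots,A_n)$ with all $A_i>0$, $(x,y)=\sum x_iy_i$, $x\wedge y=xy^T-yx^T$ and $\langle X,Y\rangle=-\frac12\operatorname{tr}(XY)$ on $so(n)$. The $n$-dimensional Veselova LR system with inertia operator $\mathcal I(E_i\wedge E_j)=\frac{A_iA_j}{\det A}E_i\wedge E_j$ describes curves $g(t)\in SO(n)$ for which $\omega=g^{-1}\dot g$ and $e_i=g^{-1}E_i$ satisfy $$\langle\omega,e_p\wedge e_r\rangle=0\ (2\le p<r\le n),\qquad \tfrac{d}{dt}(\mathcal I\omega)=[\mathcal I\omega,\omega]+\sum_{2\le p<r\le n}\mu_{pr}\,e_p\wedge e_r$$ with multipliers $\mu_{pr}$. The curves $q(t)=e_1(t)$ are exactly the solutions of the reduced system on $S^{n-1}=\{(q,q)=1\}$, $$\Big(\frac{\partial L}{\partial q}-\frac{d}{dt}\frac{\partial L}{\partial\dot q},\xi\Big)=\frac1{\det A}\big[(\dot q,A\dot q)(Aq,\xi)-(\dot q,Aq)(A\dot q,\xi)\big]\quad\text{for all }\xi\perp q,$$ $$L=\frac1{2\det A}\big[(A\dot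 q,\dot q)(Aq,q)-(Aq,\dot q)^2\big],$$ and with $p=\partial L/\partial\dot q$ this system is equivalent to the following system on $T^*S^{n-1}=\{(q,q)=1,\ (q,p)=0\}$: $$\dot q=\frac{\det A}{(q,Aq)}\big[A^{-1}p-(p,A^{-1}q)q\big],\qquad \dot p=-\det A\,\frac{(p,A^{-1}p)-(p,q)(q,A^{-1}p)}{(q,Aq)}\,q .$$ 1) Put $\mathcal N(q)=\sqrt{\det A/(Aq,q)}$. Under the time substitution $d\tau=\mathcal N(q)\,dt$ and the change of momenta $\tilde p=\mathcal N(q)\,p$ the reduced system becomes the Hamiltonian system on $T^*S^{n-1}$, with its canonical symplectic form, whose Hamiltonian $H^*(q,\tilde p)=\frac12(\tilde p,A^{-1}\tilde p)$ is the Legendre transform of $$L^*(q,q')=\tfrac12(q,Aq)^{-1}\big[(Aq',q')(Aq,q)-(Aq,q')^2\big],\qquad q'=\frac{dq}{d\tau},$$ that is, the geodesic flow on $S^{n-1}$ of the Riemannian metric with Lagrangian $L^*$. 2) Let $A_1<\dots<A_n$ and $I_i=A_i^{-1}$. In the spheroconic coordinates $\lambda_1,\dots,\lambda_{n-1}$ on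 $S^{n-1}$, given by $$q_i^2=\frac{(I_i-\lambda_1)\cdots(I_i-\lambda_{n-1})}{\prod_{j\ne i}(I_i-I_j)},$$ the Lagrangian takes the Stäckel form $$L^*=-\frac18\sum_{k=1}^{n-1}\frac{\prod_{s\ne k}(\lambda_k-\lambda_s)}{(\lambda_k-I_1)\cdots(\lambda_k-I_n)\,\lambda_k}\Big(\frac{d\lambda_k}{d\tau}\Big)^2 .$$ The system has constants of motion $h=L^*$ and, for $h>0$, real $c_2\le\dots\le c_{n-1}$, determined by the fact that the polynomial in $z$ $$\tfrac12\Big[z\sum_{i<j}(q_i\tilde p_j-q_j\tilde p_i)^2\prod_{l\ne i,j}(z-I_l)-(\tilde p,\tilde p)\sum_i q_i^2\prod_{l\ne i}(z-I_l)\Big]$$ equals $h\,(z-c_2)\cdots(z-c_{n-1})$. The evolution of the $\lambda_k$ is described by the Abel–Jacobi quadratures $$\frac{\lambda_1^{k-1}d\lambda_1}{2\sqrt{R(\lambda_1)}}+\dots+\frac{\lambda_{n-1}^{k-1}d\lambda_{n-1}}{2\sqrt{R(\lambda_{n-1})}}=\delta_{k,n-1}\sqrt{2h}\,d\tau,\qquad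 k=1,\dots,n-1,$$ $$R(\lambda)=-(\lambda-I_1)\cdots(\lambda-I_n)\,\lambda\,(\lambda-c_2)\cdots(\lambda-c_{n-1}),$$ where $\sqrt{R(\lambda_k)}$ stands for one of the two roots. If the roots of $R$ are simple and $h>0$, each connected component of the manifold of all $(q,\tilde p)\in T^*S^{n-1}$ with the constants $h,c_2,\dots,c_{n-1}$ is an invariant $(n-1)$-dimensional torus on which the flow is linear in $\tau$; the points with such generic constants form an open dense subset of $T^*S^{n-1}$. Moreover the system is algebraically completely integrable, in the following sense. Over $\mathbb R$ and over $\mathbb C$, the $n-1$ coefficients $F_0,\dots,F_{n-2}=H^*$ of the above polynomial in $z$ are in involution on $T^*S^{n-1}$, and independent at all points of the level sets with $h\ne0$ for which $R$ has simple roots. Over $\mathbb C$, the flow of each $F_l$ is linearized by the Abel–Jacobi map of the hyperelliptic curve $\Gamma: w^2=R(\lambda)$ of genus $n-1$: with $w_k$ as below, $\sum_k\lambda_k^{j}\,d\lambda_k/(2w_k)=\delta_{jl}\sqrt{2h}\,ds$ for $j=0,\dots,n-2$, $s$ being the time of this flow. And for $h\ne0$ and $R$ with simple roots the complex level set is invariant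 under the sign changes $(q_i,\tilde p_i)\mapsto(\varepsilon_iq_i,\varepsilon_i\tilde p_i)$, $\varepsilon_i=\pm1$, which act freely on it. Assign to a point the divisor $\sum_k(\lambda_k,w_k)$ with $w_k=-\lambda_k\sum_iq_i\tilde p_i\prod_{l\ne i}(\lambda_k-I_l)/\sqrt{2h}$; then $(\lambda_k,w_k)\in\Gamma$ and $\lambda_k\ne0$. For divisors with pairwise different $\lambda_k$, all those with all $(\lambda_k,w_k)\in\Gamma$ and all $\lambda_k\neq0$ occur, and the points with the same divisor form one orbit of the group of sign changes. -/

import Mathlib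

open Polynomial
open scoped ContDiff

noncomputable section

namespace Veselova

/-! ### The multidimensional Veselova system on `SO(n)`

The indices `1, …, n` are the elements `0, …, n - 1` of `Fin n`, and
`(x, y) = x ⬝ᵥ y` is the Euclidean scalar product. -/

/-- `x ∧ y = x yᵀ - y xᵀ`. -/
def wedge {n : ℕ} (x y : Fin n → ℝ) : Matrix (Fin n) (Fin n) ℝ :=
  Matrix.vecMulVec x y - Matrix.vecMulVec y x

/-- The invariant scalar product `⟨X, Y⟩ = -½ tr (X Y)` on `so(n)`. -/
def killing {n : ℕ} (X Y : Matrix (Fin n) (Fin n) ℝ) : ℝ :=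
  -(1 / 2) * (X * Y).trace

/-- The inertia operator, `E_i ∧ E_j ↦ (A_i A_j / det A) E_i ∧ E_j`. -/
def inertia {n : ℕ} (A : Fin n → ℝ) (X : Matrix (Fin n) (Fin n) ℝ) :
    Matrix (Fin n) (Fin n) ℝ :=
  Matrix.of fun i j => A i * A j / (∏ l, A l) * X i j

/-- The vector `e_i = g⁻¹ E_i`: the `i`-th vector of the frame fixed in space, written in the
moving frame. For `g ∈ SO(n)` it is the `i`-th row of `g`. -/
def frame {n : ℕ} (g : Matrix (Fin n) (Fin n) ℝ) (i : Fin n) : Fin n → ℝ :=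
  fun k => g i k

/-- The angular velocity `ω = g⁻¹ ġ` of a curve in `SO(n)` (where `g⁻¹ = gᵀ`). -/
def angularVelocity {n : ℕ} (g : ℝ → Matrix (Fin n) (Fin n) ℝ) (t : ℝ) :
    Matrix (Fin n) (Fin n) ℝ :=
  (g t).transpose * Matrix.of fun i j => deriv (fun s => g s i j) t

/-- `g` is, on the open set `J` of times, a motion of the Veselova LR system on `SO(n)`,
`n = m + 2`: the right-invariant constraints `⟨ω, e_p ∧ e_r⟩ = 0` (`p < r`, both different from
the first index) hold, and
`d/dt (Iω) = [Iω, ω] + ∑_{p < r} μ_{pr} e_p ∧ e_r` with multipliers `μ_{pr}`. -/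
structure IsVeselovaMotion {m : ℕ} (A : Fin (m + 2) → ℝ) (J : Set ℝ)
    (g : ℝ → Matrix (Fin (m + 2)) (Fin (m + 2)) ℝ) : Prop where
  mem : ∀ t ∈ J, g t ∈ Matrix.specialOrthogonalGroup (Fin (m + 2)) ℝ
  smooth : ∀ i j, ContDiffOn ℝ 2 (fun t => g t i j) J
  constraint : ∀ t ∈ J, ∀ p r : Fin (m + 2), 0 < p → p < r →
    killing (angularVelocity g t) (wedge (frame (g t) p) (frame (g t) r)) = 0
  eqn : ∀ t ∈ J, ∃ μ : Fin (m + 2) → Fin (m + 2) → ℝ, ∀ i j,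
    HasDerivAt (fun s => inertia A (angularVelocity g s) i j)
      ((inertia A (angularVelocity g t) * angularVelocity g t
        - angularVelocity g t * inertia A (angularVelocity g t)
        + ∑ p, ∑ r, (if 0 < p ∧ p < r then
            μ p r • wedge (frame (g t) p) (frame (g t) r) else 0)) i j) t

/-! ### Lagrangian systems on the unit sphere, and the reduced system -/

/-- `(A x, y)` for the diagonal matrix `A`. -/
def bil {n : ℕ} (A x y : Fin n → ℝ) : ℝ := ∑ i, A i * x i * y i

/-- The momentum `∂L/∂v (q, v)`. -/
def momentum {n : ℕ} (L : (Fin n → ℝ) → (Fin n → ℝ) → ℝ) (q v : Fin n → ℝ) : Fin n → ℝ :=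
  fun i => fderiv ℝ (L q) v (Pi.single i 1)

/-- On the open set `J` of times, `q` is a curve on the unit sphere that satisfies
`(∂L/∂q - d/dt ∂L/∂q̇, ξ) = F(q, q̇, ξ)` for all tangent vectors `ξ` of the sphere at `q`. -/
structure IsLagrangeDAlembert {n : ℕ} (L : (Fin n → ℝ) → (Fin n → ℝ) → ℝ)
    (F : (Fin n → ℝ) → (Fin n → ℝ) → (Fin n → ℝ) → ℝ) (J : Set ℝ) (q : ℝ → Fin n → ℝ) :
    Prop where
  smooth : ContDiffOn ℝ 2 q J
  sphere : ∀ t ∈ J, q t ⬝ᵥ q t = 1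
  eqn : ∀ t ∈ J, ∀ ξ : Fin n → ℝ, q t ⬝ᵥ ξ = 0 →
    fderiv ℝ (fun x => L x (deriv q t)) (q t) ξ
      - deriv (fun s => momentum L (q s) (deriv q s) ⬝ᵥ ξ) t = F (q t) (deriv q t) ξ

/-- The reduced Lagrangian `L = (1 / (2 det A)) [(A q̇, q̇)(A q, q) - (A q, q̇)²]`. -/
def redLagrangian {n : ℕ} (A q v : Fin n → ℝ) : ℝ :=
  1 / (2 * ∏ l, A l) * (bil A v v * bil A q q - bil A q v ^ 2)

/-- The right-hand side of the reduced Lagrange-d'Alembert equations,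
`Ψ = (1 / det A) [(q̇, A q̇)(A q, ξ) - (q̇, A q)(A q̇, ξ)]`. -/
def redForce {n : ℕ} (A q v ξ : Fin n → ℝ) : ℝ :=
  1 / (∏ l, A l) * (bil A v v * bil A q ξ - bil A q v * bil A v ξ)

/-- The reduced system as a first-order system on `T*S^{n-1} = {(q, q) = 1, (q, p) = 0}`:
`q̇ = det A / (q, A q) · [A⁻¹p - (p, A⁻¹q) q]`,
`ṗ = - det A · ((p, A⁻¹p) - (p, q)(q, A⁻¹p)) / (q, A q) · q`. -/
structure IsReducedFlow {n : ℕ} (A : Fin n → ℝ) (J : Set ℝ) (q p : ℝ → Fin n → ℝ) :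
    Prop where
  sphere : ∀ t ∈ J, q t ⬝ᵥ q t = 1 ∧ q t ⬝ᵥ p t = 0
  eqn_q : ∀ t ∈ J, HasDerivAt q
    (((∏ l, A l) / bil A (q t) (q t)) •
      ((fun i => (A i)⁻¹ * p t i) - bil A⁻¹ (p t) (q t) • q t)) t
  eqn_p : ∀ t ∈ J, HasDerivAt p
    (-((∏ l, A l) * (bil A⁻¹ (p t) (p t) - (p t ⬝ᵥ q t) * bil A⁻¹ (q t) (p t))
        / bil A (q t) (q t)) • q t) t

/-- Chaplygin's reducing multiplier `𝒩(q) = √(det A / (A q, q))`. -/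
def multiplier {n : ℕ} (A q : Fin n → ℝ) : ℝ := √((∏ l, A l) / bil A q q)

/-- The Lagrangian `L* = ½ (q, A q)⁻¹ [(A q', q')(A q, q) - (A q, q')²]`. -/
def starLagrangian {n : ℕ} (A q v : Fin n → ℝ) : ℝ :=
  1 / 2 * (bil A q q)⁻¹ * (bil A v v * bil A q q - bil A q v ^ 2)

/-! ### Hamiltonian mechanics on the cotangent bundle of the (real or complex) sphere -/

section Phase

variable {𝕜 : Type} [RCLike 𝕜] {n m : ℕ}

/-- Pairs `(q, p)`. -/
abbrev Phase (𝕜 : Type) (n : ℕ) : Type := (Fin n → 𝕜) × (Fin n → 𝕜)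

/-- `T*S^{n-1}`, the set of `(q, p)` with `(q, q) = 1` and `(q, p) = 0`. -/
def cotangentSphere (𝕜 : Type) [RCLike 𝕜] (n : ℕ) : Set (Phase 𝕜 n) :=
  {x | x.1 ⬝ᵥ x.1 = 1 ∧ x.1 ⬝ᵥ x.2 = 0}

/-- The tangent space of `T*S^{n-1}` at `x = (q, p)`. -/
def tangent (x : Phase 𝕜 n) : Submodule 𝕜 (Phase 𝕜 n) where
  carrier := {Y | x.1 ⬝ᵥ Y.1 = 0 ∧ x.1 ⬝ᵥ Y.2 + x.2 ⬝ᵥ Y.1 = 0}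
  add_mem' := by
    rintro a b ⟨h1, h2⟩ ⟨h3, h4⟩
    refine ⟨?_, ?_⟩
    · simp [dotProduct_add, h1, h3]
    · simp only [Prod.fst_add, Prod.snd_add, dotProduct_add]
      linear_combination h2 + h4
  zero_mem' := by simp
  smul_mem' := by
    rintro c a ⟨h1, h2⟩
    refine ⟨?_, ?_⟩
    · simp [dotProduct_smul, h1]
    · simp only [Prod.smul_fst, Prod.smul_snd, dotProduct_smul, smul_eq_mul]
      linear_combination c * h2

/-- The canonical symplectic form; it is used on the tangent spaces of `T*S^{n-1}`. -/
def symp (X Y : Phase 𝕜 n) : 𝕜 := X.1 ⬝ᵥ Y.2 - X.2 ⬝ᵥ Y.1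

/-- `X` is the value at `x ∈ T*S^{n-1}` of the Hamiltonian vector field of the restriction of `F`
to `T*S^{n-1}`. -/
def IsHamVec (F : Phase 𝕜 n → 𝕜) (x X : Phase 𝕜 n) : Prop :=
  X ∈ tangent x ∧ ∀ Y ∈ tangent x, symp X Y = fderiv 𝕜 F x Y

/-- `γ` is, on the open set `U` of (real or complex) times, an integral curve of the Hamiltonian
vector field of `F` on `T*S^{n-1}`. -/
def IsHamCurve (F : Phase 𝕜 n → 𝕜) (U : Set 𝕜) (γ : 𝕜 → Phase 𝕜 n) : Prop :=
  ∀ s ∈ U, γ s ∈ cotangentSphere 𝕜 n ∧ ∃ X, HasDerivAt γ X s ∧ IsHamVec F (γ s) X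

/-- The Hamiltonian `H* = ½ ∑ I_i p_i²`, with `I_i = 1 / A_i`. -/
def starHamiltonian (I : Fin n → 𝕜) (x : Phase 𝕜 n) : 𝕜 := 1 / 2 * ∑ i, I i * x.2 i ^ 2

/-! ### Spheroconic coordinates and the constants of motion -/

/-- `q_i² = ∏_k (I_i - λ_k) / ∏_{j ≠ i} (I_i - I_j)` for all `i`. -/
def IsSpheroconic (I q : Fin (m + 2) → 𝕜) (lam : Fin (m + 1) → 𝕜) : Prop :=
  ∀ i, q i ^ 2 = (∏ k, (I i - lam k)) / ∏ j ∈ Finset.univ.erase i, (I i - I j)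

/-- The polynomial in `z` (of degree at most `n - 2` at the points of `T*S^{n-1}`)
`½ [z ∑_{i<j} (q_i p_j - q_j p_i)² ∏_{l ≠ i,j} (z - I_l) - (p, p) ∑_i q_i² ∏_{l ≠ i} (z - I_l)]`.
Its coefficients are quadratic in `p`; it has leading coefficient `h = H*`, and its roots are the
constants of motion `c_2, …, c_{n-1}`. -/
def integralPoly (I : Fin n → 𝕜) (x : Phase 𝕜 n) : 𝕜[X] :=
  C (1 / 2) *
    (X * ∑ i, ∑ j, (if i < j then
        C ((x.1 i * x.2 j - x.1 j * x.2 i) ^ 2) *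
          ∏ l ∈ (Finset.univ.erase i).erase j, (X - C (I l)) else 0)
      - C (x.2 ⬝ᵥ x.2) * ∑ i, C (x.1 i ^ 2) * ∏ l ∈ Finset.univ.erase i, (X - C (I l)))

/-- The `l`-th coefficient of `integralPoly`: a polynomial function of `(q, p)`. -/
def integral (I : Fin n → 𝕜) (l : ℕ) (x : Phase 𝕜 n) : 𝕜 := (integralPoly I x).coeff l

/-- The invariant set on which the energy is `h` and the other constants of motion are the `c_j`. -/
def levelSet (I : Fin (m + 2) → 𝕜) (h : 𝕜) (c : Fin m → 𝕜) : Set (Phase 𝕜 (m + 2)) :=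
  {x | x ∈ cotangentSphere 𝕜 (m + 2) ∧ integralPoly I x = C h * ∏ j, (X - C (c j))}

/-- The radicand `R(z) = - (z - I_1) ⋯ (z - I_n) z (z - c_2) ⋯ (z - c_{n-1})`. -/
def radicand (I : Fin (m + 2) → 𝕜) (c : Fin m → 𝕜) (z : 𝕜) : 𝕜 :=
  -((∏ i, (z - I i)) * z * ∏ j, (z - c j))

/-- Generic constants: for pairwise different nonzero `I_i`, all `2n - 1` roots of the radicand are
simple, so that `w² = R(z)` is a smooth hyperelliptic curve of genus `n - 1`. -/
def IsGeneric (I : Fin (m + 2) → 𝕜) (c : Fin m → 𝕜) : Prop :=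
  Function.Injective c ∧ ∀ j, c j ≠ 0 ∧ ∀ i, c j ≠ I i

/-- For a point `x = (q, p)` and a spheroconic coordinate `z` of `q`, the ordinate `w` of the point
of the hyperelliptic curve `w² = R(z)` that belongs to it; here `κ² = 2h`. -/
def ordinate (I : Fin n → 𝕜) (κ : 𝕜) (x : Phase 𝕜 n) (z : 𝕜) : 𝕜 :=
  -(z * ∑ i, x.1 i * x.2 i * ∏ l ∈ Finset.univ.erase i, (z - I l)) / κ

/-- The Hamiltonian flow of `F` on the level sets of the constants of motion is described, in the
spheroconic coordinates, by the Abel-Jacobi quadratures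
`∑_k λ_k^j dλ_k / (2 √R(λ_k)) = δ_{jl} √(2h) ds`, `j = 0, …, n - 2`.
The roots `w_k = √R(λ_k)` and `κ = √(2h)` are those of `ordinate`. Where `w_k = 0`, the quotient
`dλ_k / (2 w_k)` is the value `u_k ds` of the differential `dz / (2 w)` of the curve `w² = R(z)`,
which is holomorphic there. -/
def AbelJacobiQuadratures (I : Fin (m + 2) → 𝕜) (F : Phase 𝕜 (m + 2) → 𝕜) (l : Fin (m + 1)) :
    Prop :=
  ∀ (h κ : 𝕜) (c : Fin m → 𝕜) (U : Set 𝕜) (γ : 𝕜 → Phase 𝕜 (m + 2))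
    (lam : 𝕜 → Fin (m + 1) → 𝕜),
    h ≠ 0 → κ ^ 2 = 2 * h → IsOpen U → IsHamCurve F U γ → (∀ s ∈ U, γ s ∈ levelSet I h c) →
    ContinuousOn lam U →
    (∀ s ∈ U, Function.Injective (lam s) ∧ IsSpheroconic I (γ s).1 (lam s)) →
    ∀ s ∈ U,
      (∀ k, ordinate I κ (γ s) (lam s k) ^ 2 = radicand I c (lam s k)) ∧
      (∃ u : Fin (m + 1) → 𝕜,
        (∀ k, HasDerivAt (fun r => lam r k) (2 * ordinate I κ (γ s) (lam s k) * u k) s) ∧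
        ∀ j : Fin (m + 1), ∑ k, lam s k ^ (j : ℕ) * u k = if j = l then κ else 0) ∧
      ((∀ k, radicand I c (lam s k) ≠ 0) → ∀ j : Fin (m + 1),
        ∑ k, lam s k ^ (j : ℕ) * deriv (fun r => lam r k) s
          / (2 * ordinate I κ (γ s) (lam s k)) = if j = l then κ else 0)

/-- The Hamiltonian system of `H*` on the (real or complex) `T*S^{n-1}` is completely integrable in
the sense of Liouville, with polynomial integrals: the `n - 1` coefficients of `integralPoly`, of
which the last one is `H*`, are in involution, and they are independent at all points of the level
sets with generic constants. -/
def IsLiouvilleIntegrable (I : Fin (m + 2) → 𝕜) : Prop :=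
  (∀ x ∈ cotangentSphere 𝕜 (m + 2), (integralPoly I x).natDegree ≤ m ∧
    integral I m x = starHamiltonian I x) ∧
  (∀ x ∈ cotangentSphere 𝕜 (m + 2), ∀ l : Fin (m + 1),
    (∃! X, IsHamVec (integral I l) x X) ∧
    ∀ X, IsHamVec (integral I l) x X → ∀ l' : Fin (m + 1), fderiv 𝕜 (integral I l') x X = 0) ∧
  (∀ (h : 𝕜) (c : Fin m → 𝕜), h ≠ 0 → IsGeneric I c → ∀ x ∈ levelSet I h c,
    LinearIndependent 𝕜 fun l : Fin (m + 1) =>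
      (fderiv 𝕜 (integral I l) x).toLinearMap ∘ₗ (tangent x).subtype)

/-- Algebraic complete integrability, for the complexified system of `H*`: it is completely
integrable with polynomial integrals; the flows of all the integrals are linearized by the
Abel-Jacobi map of the hyperelliptic curve `Γ : w² = R(z)` of genus `g = n - 1`, for which
`z^j dz / (2 w)`, `j < g`, is the basis of holomorphic differentials; and sending `x` to the divisor
`∑_k (λ_k, w_k)` makes each generic complex invariant manifold an unramified covering, with the
group `{±1}^n` of sign changes `(q_i, p_i) ↦ (ε_i q_i, ε_i p_i)`, of an open part of the `g`-th
symmetric power of `Γ` (on the divisors of points with different abscissas, this part is given by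
`λ_k ≠ 0`). -/
def IsAlgebraicallyIntegrable (I : Fin (m + 2) → ℂ) : Prop :=
  IsLiouvilleIntegrable I ∧
  (∀ l : Fin (m + 1), AbelJacobiQuadratures I (integral I l) l) ∧
  ∀ (h κ : ℂ) (c : Fin m → ℂ), h ≠ 0 → κ ^ 2 = 2 * h → IsGeneric I c →
    -- the group acts freely on the level set
    (∀ x ∈ levelSet I h c, ∀ ε : Fin (m + 2) → ℂ, (∀ i, ε i ^ 2 = 1) →
      (ε * x.1, ε * x.2) ∈ levelSet I h c ∧ ((ε * x.1, ε * x.2) = x → ε = 1)) ∧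
    -- the points of a level set have divisors on the curve, away from `z = 0`
    (∀ x ∈ levelSet I h c, ∀ lam : Fin (m + 1) → ℂ, IsSpheroconic I x.1 lam →
      ∀ k, lam k ≠ 0 ∧ ordinate I κ x (lam k) ^ 2 = radicand I c (lam k)) ∧
    -- the fibres are the orbits of the group
    (∀ x ∈ levelSet I h c, ∀ y ∈ levelSet I h c, ∀ lam : Fin (m + 1) → ℂ,
      Function.Injective lam → IsSpheroconic I x.1 lam →
      ((IsSpheroconic I y.1 lam ∧ ∀ k, ordinate I κ y (lam k) = ordinate I κ x (lam k)) ↔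
        ∃ ε : Fin (m + 2) → ℂ, (∀ i, ε i ^ 2 = 1) ∧ y = (ε * x.1, ε * x.2))) ∧
    -- every such divisor occurs
    (∀ lam w : Fin (m + 1) → ℂ, Function.Injective lam →
      (∀ k, lam k ≠ 0 ∧ w k ^ 2 = radicand I c (lam k)) →
      ∃ x ∈ levelSet I h c, IsSpheroconic I x.1 lam ∧ ∀ k, ordinate I κ x (lam k) = w k)

/-- `S` is a smoothly embedded `d`-dimensional torus `ℝ^d / ℤ^d` that is invariant under the
Hamiltonian flow of `F`, and the flow on it is linear. -/
def IsInvariantTorus (F : Phase ℝ n → ℝ) (d : ℕ) (S : Set (Phase ℝ n)) : Prop :=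
  ∃ (φ : (Fin d → ℝ) → Phase ℝ n) (Ω : Fin d → ℝ),
    ContDiff ℝ ∞ φ ∧
    (∀ θ, Function.Injective (fderiv ℝ φ θ)) ∧
    (∀ θ θ', φ θ = φ θ' ↔ ∃ k : Fin d → ℤ, ∀ i, θ' i = θ i + k i) ∧
    Set.range φ = S ∧
    ∀ θ, IsHamCurve F Set.univ fun s => φ (θ + s • Ω)

end Phase

end Veselova

end

open Veselova

/-! Everything in the second half rests on one polynomial identity. Let `a = nodal I`, and let `U`,
`W`, `V` (`polyU`, `polyW`, `polyV`) be the numerators of the partial fractions over `a` with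
residues `q_i²`, `q_i p_i`, `I_i p_i²`. The generating polynomial `F` of the integrals satisfies `2
a F = U V - z W²` (`nodal_mul_integralPoly`). The spheroconic coordinates `λ_k` are the roots of
`U`; there the identity reads `2 a F = -λ_k W²`, which is the equation `w² = R` of the curve. A
phase point is thus, up to signs, a triple `(U, W, V)`: the abscissas of the divisor give `U`, the
ordinates give `W` by interpolation, division by `U` gives `V`, and the values at the nodes `I_i`
give back `q_i²`, `q_i p_i`, `p_i²`.

Differentiating the identity gives simple gradients of `F` (`sub_mul_gradP`, `sub_mul_gradQ`). A
summation of Christoffel-Darboux type turns them into the involution (`sum_grad_bracket`). The same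
sum at `λ_k` gives the velocity of `λ_k` as a multiple of `w_k` times a coefficient of `U / (X -
λ_k)`, and Lagrange interpolation yields the quadratures (`abelJacobiQuadratures`). For
independence, a functional annihilating all gradients produces a polynomial of degree less than `deg
U` that is divisible by `U`, because a common root of `U`, `X W`, `V` would be a double root of `a
F` (`functional_eq_zero`).

On the mechanical side, the constraints force `ω = q ∧ q̇`, and the reactions are exactly the skew
matrices that annihilate `q`; the equations of motion therefore say that one skew matrix kills `q`,
and this is the reduced equation (`exists_multipliers_iff_reduced`). The group motion is recovered
from `q` by parallel transport of a frame (`exists_motion`). The reduced force equals `∂L/∂q`, so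
the reduced equations say that `ṗ` is normal to the sphere, and the time substitution is a
computation with the logarithmic derivative of `𝒩`.

Over the reals, `2 a F = -λ_k W²` makes the signs of `F` alternate at the `λ_k`, which produces real
interlacing constants at points in general position; density and compactness extend this to all
points (`exists_interlacing`). The tori come from Liouville's argument: the commuting Hamiltonian
fields define orbit maps of `ℝ^{n-1}` into the compact level set, the orbits are open in it, and the
periods form a lattice (`exists_isOrbitMap`, `exists_torus`). -/

namespace Veselova

/-! ### Partial fractions and Lagrange interpolation at the nodes. -/

section Interpolation

variable {K : Type*} [Field K] {n : ℕ}

/-- `∏ (X - I_i)`. -/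
noncomputable def nodal (I : Fin n → K) : K[X] := ∏ i, (X - C (I i))

/-- `∏_{l ≠ i} (X - I_l)`. -/
noncomputable def conodal (I : Fin n → K) (i : Fin n) : K[X] :=
  ∏ l ∈ Finset.univ.erase i, (X - C (I l))

/-- `∑ f_i ∏_{l ≠ i} (X - I_l)`: the numerator of `∑ f_i / (X - I_i)`. -/
noncomputable def combo (I f : Fin n → K) : K[X] := ∑ i, C (f i) * conodal I i

theorem nodal_eq (I : Fin n → K) (i : Fin n) : nodal I = (X - C (I i)) * conodal I i :=
  (Finset.mul_prod_erase _ _ (Finset.mem_univ i)).symm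

theorem nodal_monic (I : Fin n → K) : (nodal I).Monic :=
  monic_prod_of_monic _ _ fun _ _ => monic_X_sub_C _

theorem conodal_monic (I : Fin n → K) (i : Fin n) : (conodal I i).Monic :=
  monic_prod_of_monic _ _ fun _ _ => monic_X_sub_C _

theorem natDegree_nodal (I : Fin n → K) : (nodal I).natDegree = n := by
  rw [nodal, natDegree_prod_of_monic _ _ fun _ _ => monic_X_sub_C _]
  simp

theorem natDegree_conodal (I : Fin n → K) (i : Fin n) : (conodal I i).natDegree = n - 1 := by
  rw [conodal, natDegree_prod_of_monic _ _ fun _ _ => monic_X_sub_C _]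
  simp

theorem coeff_conodal (I : Fin n → K) (i : Fin n) : (conodal I i).coeff (n - 1) = 1 := by
  have := conodal_monic I i
  rwa [Monic, leadingCoeff, natDegree_conodal] at this

theorem natDegree_combo_le (I f : Fin n → K) : (combo I f).natDegree ≤ n - 1 :=
  natDegree_sum_le_of_forall_le _ _ fun i _ =>
    (natDegree_C_mul_le _ _).trans (natDegree_conodal I i).le

theorem coeff_combo (I f : Fin n → K) : (combo I f).coeff (n - 1) = ∑ i, f i := by
  simp [combo, coeff_conodal]

theorem degree_combo_lt (I f : Fin n → K) : (combo I f).degree < n := by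
  rcases Nat.eq_zero_or_pos n with rfl | hn
  · simp [combo]
  · refine lt_of_le_of_lt (natDegree_le_iff_degree_le.1 (natDegree_combo_le I f)) ?_
    exact_mod_cast Nat.sub_lt hn one_pos

theorem natDegree_combo_le_of_sum_eq_zero {m : ℕ} (I f : Fin (m + 2) → K) (h : ∑ i, f i = 0) :
    (combo I f).natDegree ≤ m := by
  rw [natDegree_le_iff_coeff_eq_zero]
  intro k hk
  rcases (Nat.succ_le_of_lt hk).eq_or_lt with rfl | h2
  · simpa [h] using coeff_combo I f
  · refine coeff_eq_zero_of_natDegree_lt (lt_of_le_of_lt (natDegree_combo_le I f) ?_)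
    simpa using h2

theorem degree_combo_lt_of_sum_eq_zero {m : ℕ} (I f : Fin (m + 2) → K) (h : ∑ i, f i = 0) :
    (combo I f).degree < (m + 1 : ℕ) :=
  lt_of_le_of_lt (natDegree_le_iff_degree_le.1 (natDegree_combo_le_of_sum_eq_zero I f h))
    (by exact_mod_cast Nat.lt_succ_self m)

theorem combo_add (I f g : Fin n → K) : combo I (f + g) = combo I f + combo I g := by
  simp [combo, add_mul, Finset.sum_add_distrib]

theorem combo_smul (I f : Fin n → K) (c : K) : combo I (c • f) = C c * combo I f := by
  simp [combo, Finset.mul_sum, mul_assoc]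

/-- Write `I_i = X - (X - I_i)`: the second term completes `conodal I i` to the full product. The
correction disappears when the `f_i` sum to zero, as for `q_i p_i` on the cotangent bundle. -/
theorem combo_node_mul (I f : Fin n → K) :
    combo I (fun i => I i * f i) = X * combo I f - C (∑ i, f i) * nodal I := by
  rw [combo, combo, Finset.mul_sum, map_sum, Finset.sum_mul, ← Finset.sum_sub_distrib]
  refine Finset.sum_congr rfl fun i _ => ?_
  rw [nodal_eq I i, C_mul]
  ring

theorem eval_conodal_of_ne (I : Fin n → K) {i j : Fin n} (h : j ≠ i) :
    (conodal I j).eval (I i) = 0 := by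
  rw [conodal, eval_prod]
  exact Finset.prod_eq_zero (Finset.mem_erase.2 ⟨h.symm, Finset.mem_univ _⟩) (by simp)

theorem eval_combo_node (I f : Fin n → K) (i : Fin n) :
    (combo I f).eval (I i) = f i * (conodal I i).eval (I i) := by
  rw [combo, eval_finsetSum, Finset.sum_eq_single i]
  · simp
  · intro j _ hj
    simp [eval_conodal_of_ne I hj]
  · simp

theorem eval_nodal_node (I : Fin n → K) (i : Fin n) : (nodal I).eval (I i) = 0 := by
  simp [nodal_eq I i]

theorem eval_conodal (I : Fin n → K) (i : Fin n) (z : K) :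
    (conodal I i).eval z = ∏ l ∈ Finset.univ.erase i, (z - I l) := by
  simp [conodal, eval_prod]

theorem eval_nodal (I : Fin n → K) (z : K) : (nodal I).eval z = ∏ l, (z - I l) := by
  simp [nodal, eval_prod]

theorem eval_combo (I f : Fin n → K) (z : K) :
    (combo I f).eval z = ∑ i, f i * ∏ l ∈ Finset.univ.erase i, (z - I l) := by
  simp [combo, eval_finsetSum, eval_conodal]

theorem eval_conodal_ne_zero {I : Fin n → K} (hI : Function.Injective I) (i : Fin n) :
    (conodal I i).eval (I i) ≠ 0 := by
  rw [eval_conodal, Finset.prod_ne_zero_iff]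
  intro l hl
  exact sub_ne_zero.2 fun h => (Finset.mem_erase.1 hl).1 (hI h).symm

theorem eq_of_eval_node_eq {I : Fin n → K} (hI : Function.Injective I) {P Q : K[X]}
    (hP : P.degree < n) (hQ : Q.degree < n) (h : ∀ i, P.eval (I i) = Q.eval (I i)) : P = Q :=
  eq_of_degrees_lt_of_eval_index_eq Finset.univ hI.injOn (by simpa using hP)
    (by simpa using hQ) fun i _ => h i

theorem combo_injective {I : Fin n → K} (hI : Function.Injective I) {f g : Fin n → K}
    (h : combo I f = combo I g) : f = g := by
  funext i
  have := congrArg (eval (I i)) h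
  rw [eval_combo_node, eval_combo_node] at this
  exact mul_right_cancel₀ (eval_conodal_ne_zero hI i) this

/-- Lagrange interpolation; it makes polynomials of degree below `n` and coefficient vectors
interchangeable. -/
theorem combo_interpolate {I : Fin n → K} (hI : Function.Injective I) {P : K[X]}
    (hP : P.degree < n) :
    combo I (fun i => P.eval (I i) / (conodal I i).eval (I i)) = P := by
  refine eq_of_eval_node_eq hI (degree_combo_lt _ _) hP fun i => ?_
  rw [eval_combo_node, div_mul_cancel₀ _ (eval_conodal_ne_zero hI i)]

/-- The Christoffel-Darboux type identity for `∑ f_i / ((X - I_i) (w - I_i))`. -/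
theorem sum_conodal_mul_sub (I f : Fin n → K) (w : K) :
    ∑ i, C (f i) * C ((conodal I i).eval w) * conodal I i * (C w - X)
      = C ((nodal I).eval w) * combo I f - C ((combo I f).eval w) * nodal I := by
  rw [combo, eval_finsetSum, map_sum, Finset.mul_sum, Finset.sum_mul, ← Finset.sum_sub_distrib]
  refine Finset.sum_congr rfl fun i _ => ?_
  -- Termwise, `w - X = (w - I_i) - (X - I_i)`, and each of the two factors completes one copy of
  -- `conodal I i` to `nodal I`.
  have h1 : C ((nodal I).eval w) = (C w - C (I i)) * C ((conodal I i).eval w) := by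
    rw [nodal_eq I i]; simp
  rw [h1, nodal_eq I i]
  simp only [eval_mul, eval_C, C_mul]
  ring

end Interpolation

/-! ### The polynomials `U`, `W`, `V` and the fundamental identity. -/

section Polynomials

variable {𝕜 : Type} [RCLike 𝕜] {n m : ℕ}

/-- `∑ q_i² ∏_{l ≠ i} (X - I_l)`; its roots are the spheroconic coordinates. -/
noncomputable def polyU (I : Fin n → 𝕜) (x : Phase 𝕜 n) : 𝕜[X] := combo I fun i => x.1 i ^ 2

/-- `∑ q_i p_i ∏_{l ≠ i} (X - I_l)`. -/
noncomputable def polyW (I : Fin n → 𝕜) (x : Phase 𝕜 n) : 𝕜[X] := combo I fun i => x.1 i * x.2 i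

/-- `∑ I_i p_i² ∏_{l ≠ i} (X - I_l)`. -/
noncomputable def polyV (I : Fin n → 𝕜) (x : Phase 𝕜 n) : 𝕜[X] :=
  combo I fun i => I i * x.2 i ^ 2

theorem sum_sum_symm_half {R : Type*} [CommRing R] (f : Fin n → Fin n → R)
    (h0 : ∀ i, f i i = 0) :
    ∑ i, ∑ j, f i j = ∑ i, ∑ j, if i < j then f i j + f j i else 0 := by
  have h1 : ∀ i j, f i j = (if i < j then f i j else 0) + (if j < i then f i j else 0) := by
    intro i j
    rcases lt_trichotomy i j with h | h | h
    · simp [h, h.not_gt]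
    · simp [h, h0]
    · simp [h, h.not_gt]
  calc ∑ i, ∑ j, f i j
      = ∑ i, ∑ j, (if i < j then f i j else 0) + ∑ i, ∑ j, (if j < i then f i j else 0) := by
        rw [← Finset.sum_add_distrib]
        refine Finset.sum_congr rfl fun i _ => ?_
        rw [← Finset.sum_add_distrib]
        exact Finset.sum_congr rfl fun j _ => h1 i j
    _ = ∑ i, ∑ j, (if i < j then f i j else 0) + ∑ i, ∑ j, (if i < j then f j i else 0) := by
        congr 1
        exact Finset.sum_comm
    _ = _ := by
        rw [← Finset.sum_add_distrib]
        refine Finset.sum_congr rfl fun i _ => ?_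
        rw [← Finset.sum_add_distrib]
        refine Finset.sum_congr rfl fun j _ => ?_
        split_ifs <;> simp

/-- This is Lagrange's identity: in the double sum for `U P - W²`, where `P` has the residues
`p_i²`, the terms `(i, j)` and `(j, i)` together give `(q_i p_j - q_j p_i)²`, and a product of two
conodal polynomials with different indices contains `nodal I`. -/
theorem nodal_mul_wedgeSum (I : Fin n → 𝕜) (x : Phase 𝕜 n) :
    nodal I * ∑ i, ∑ j, (if i < j then C ((x.1 i * x.2 j - x.1 j * x.2 i) ^ 2) *
          ∏ l ∈ (Finset.univ.erase i).erase j, (X - C (I l)) else 0)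
      = polyU I x * combo I (fun i => x.2 i ^ 2) - polyW I x ^ 2 := by
  have h1 : polyU I x * combo I (fun i => x.2 i ^ 2) - polyW I x ^ 2
      = ∑ i, ∑ j, C (x.1 i ^ 2 * x.2 j ^ 2 - x.1 i * x.2 i * (x.1 j * x.2 j)) *
          (conodal I i * conodal I j) := by
    rw [sq, polyU, polyW, combo, combo, combo, Finset.sum_mul_sum, Finset.sum_mul_sum,
      ← Finset.sum_sub_distrib]
    refine Finset.sum_congr rfl fun i _ => ?_
    rw [← Finset.sum_sub_distrib]
    refine Finset.sum_congr rfl fun j _ => ?_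
    simp only [C_sub, C_mul]
    ring
  rw [h1, sum_sum_symm_half (fun i j => C (x.1 i ^ 2 * x.2 j ^ 2 - x.1 i * x.2 i *
    (x.1 j * x.2 j)) * (conodal I i * conodal I j)) (by
      intro i; simp only [C_sub, C_mul, C_pow]; ring), Finset.mul_sum]
  refine Finset.sum_congr rfl fun i _ => ?_
  rw [Finset.mul_sum]
  refine Finset.sum_congr rfl fun j _ => ?_
  split_ifs with h
  · have h2 : conodal I i = (X - C (I j)) *
        ∏ l ∈ (Finset.univ.erase i).erase j, (X - C (I l)) :=
      (Finset.mul_prod_erase _ _ (Finset.mem_erase.2 ⟨h.ne', Finset.mem_univ j⟩)).symm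
    have h3 : nodal I * ∏ l ∈ (Finset.univ.erase i).erase j, (X - C (I l))
        = conodal I i * conodal I j := by
      rw [nodal_eq I j, h2]; ring
    rw [mul_left_comm, h3, mul_comm (conodal I j), ← add_mul, ← C_add]
    congr 2
    ring
  · simp

/-- The fundamental identity for the generating polynomial of the integrals. -/
theorem nodal_mul_integralPoly (I : Fin n → 𝕜) (x : Phase 𝕜 n) :
    nodal I * integralPoly I x
      = C (1 / 2) * (polyU I x * polyV I x - X * polyW I x ^ 2) := by
  -- The `(p, p)` term of the generating polynomial is exactly the correction that replaces the
  -- residues `p_i²` by `I_i p_i²`.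
  have h1 : polyV I x = X * combo I (fun i => x.2 i ^ 2) - C (x.2 ⬝ᵥ x.2) * nodal I := by
    rw [polyV, combo_node_mul]
    simp [dotProduct, sq]
  have h2 : ∑ i, C (x.1 i ^ 2) * ∏ l ∈ Finset.univ.erase i, (X - C (I l)) = polyU I x := rfl
  rw [integralPoly, h2, h1]
  linear_combination C (1 / 2) * X * nodal_mul_wedgeSum I x

theorem sum_fst_mul_fst {x : Phase 𝕜 n} (hx : x ∈ cotangentSphere 𝕜 n) : ∑ i, x.1 i ^ 2 = 1 := by
  rw [← hx.1]; simp [dotProduct, sq]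

theorem sum_fst_mul_snd {x : Phase 𝕜 n} (hx : x ∈ cotangentSphere 𝕜 n) :
    ∑ i, x.1 i * x.2 i = 0 := hx.2

theorem coeff_polyU {I : Fin (m + 2) → 𝕜} {x : Phase 𝕜 (m + 2)}
    (hx : x ∈ cotangentSphere 𝕜 (m + 2)) : (polyU I x).coeff (m + 1) = 1 := by
  have := coeff_combo I fun i => x.1 i ^ 2
  rwa [sum_fst_mul_fst hx] at this

theorem natDegree_polyU_le (I : Fin (m + 2) → 𝕜) (x : Phase 𝕜 (m + 2)) :
    (polyU I x).natDegree ≤ m + 1 := natDegree_combo_le _ _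

theorem natDegree_polyV_le (I : Fin (m + 2) → 𝕜) (x : Phase 𝕜 (m + 2)) :
    (polyV I x).natDegree ≤ m + 1 := natDegree_combo_le _ _

theorem natDegree_polyU {I : Fin (m + 2) → 𝕜} {x : Phase 𝕜 (m + 2)}
    (hx : x ∈ cotangentSphere 𝕜 (m + 2)) : (polyU I x).natDegree = m + 1 :=
  le_antisymm (natDegree_polyU_le I x) (le_natDegree_of_ne_zero (by simp [coeff_polyU hx]))

theorem polyU_monic {I : Fin (m + 2) → 𝕜} {x : Phase 𝕜 (m + 2)}
    (hx : x ∈ cotangentSphere 𝕜 (m + 2)) : (polyU I x).Monic := by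
  rw [Monic, leadingCoeff, natDegree_polyU hx, coeff_polyU hx]

theorem natDegree_polyW_le {I : Fin (m + 2) → 𝕜} {x : Phase 𝕜 (m + 2)}
    (hx : x ∈ cotangentSphere 𝕜 (m + 2)) : (polyW I x).natDegree ≤ m :=
  natDegree_combo_le_of_sum_eq_zero _ _ hx.2

theorem natDegree_X_mul_polyW_sq_le {I : Fin (m + 2) → 𝕜} {x : Phase 𝕜 (m + 2)}
    (hx : x ∈ cotangentSphere 𝕜 (m + 2)) : (X * polyW I x ^ 2).natDegree ≤ 2 * m + 1 := by
  have h1 := natDegree_polyW_le (I := I) hx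
  have h2 := natDegree_mul_le (p := (X : 𝕜[X])) (q := polyW I x ^ 2)
  have h3 := natDegree_pow_le (p := polyW I x) (n := 2)
  rw [natDegree_X] at h2
  omega

/-- The degree and the leading coefficient of a quotient by the monic `nodal I`. -/
theorem quotient_nodal {I : Fin (m + 2) → 𝕜} {P Q : 𝕜[X]} (h : nodal I * P = Q)
    (hQ : Q.natDegree ≤ 2 * m + 2) :
    P.natDegree ≤ m ∧ P.coeff m = Q.coeff (2 * m + 2) := by
  have h1 : P.natDegree ≤ m := by
    by_cases hP : P = 0
    · simp [hP]
    have h2 := (nodal_monic I).natDegree_mul' hP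
    rw [h, natDegree_nodal] at h2
    omega
  refine ⟨h1, ?_⟩
  have h3 := coeff_mul_add_eq_of_natDegree_le (natDegree_nodal I).le h1
  rw [h] at h3
  have h4 : (nodal I).coeff (m + 2) = 1 := by
    have := nodal_monic I
    rwa [Monic, leadingCoeff, natDegree_nodal] at this
  rw [h4, one_mul] at h3
  rw [← h3]
  congr 1
  omega

/-- Since `(q, p) = 0` lowers the degree of `W`, the term `X W²` has degree at most `2m + 1`, and
only `U V` contributes in degree `2m + 2`; there `U` is monic and `V` has coefficient `∑ I_i p_i²`.
-/
theorem integralPoly_degree_coeff (I : Fin (m + 2) → 𝕜) {x : Phase 𝕜 (m + 2)}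
    (hx : x ∈ cotangentSphere 𝕜 (m + 2)) :
    (integralPoly I x).natDegree ≤ m ∧ integral I m x = starHamiltonian I x := by
  have h1 := natDegree_X_mul_polyW_sq_le (I := I) hx
  have h2 : (polyU I x * polyV I x).natDegree ≤ (m + 1) + (m + 1) :=
    natDegree_mul_le.trans (add_le_add (natDegree_polyU_le I x) (natDegree_polyV_le I x))
  have h3 := quotient_nodal (nodal_mul_integralPoly I x) (by
    refine (natDegree_C_mul_le _ _).trans ((natDegree_sub_le _ _).trans (max_le ?_ ?_)) <;> omega)
  refine ⟨h3.1, ?_⟩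
  have h4 : (polyV I x).coeff (m + 1) = ∑ i, I i * x.2 i ^ 2 := coeff_combo _ _
  have h5 := coeff_mul_add_eq_of_natDegree_le (natDegree_polyU_le I x) (natDegree_polyV_le I x)
  rw [coeff_polyU hx, h4, one_mul, show m + 1 + (m + 1) = 2 * m + 2 by ring] at h5
  rw [integral, h3.2, coeff_C_mul, coeff_sub, h5,
    coeff_eq_zero_of_natDegree_lt (p := X * polyW I x ^ 2) (by omega), starHamiltonian, sub_zero]

/-! ### Spheroconic coordinates -/

theorem natDegree_prod_X_sub_C (lam : Fin n → 𝕜) : (∏ k, (X - C (lam k))).natDegree = n :=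
  natDegree_nodal lam

/-- The defining formula for `q_i²` is the Lagrange interpolation of `∏ (X - λ_k)` at the nodes, so
the spheroconic coordinates are the roots of `U`. -/
theorem isSpheroconic_iff {I : Fin (m + 2) → 𝕜} (hI : Function.Injective I)
    (x : Phase 𝕜 (m + 2)) (lam : Fin (m + 1) → 𝕜) :
    IsSpheroconic I x.1 lam ↔ polyU I x = ∏ k, (X - C (lam k)) := by
  have hd : (∏ k, (X - C (lam k))).degree < ((m + 2 : ℕ) : WithBot ℕ) := by
    refine lt_of_le_of_lt degree_le_natDegree ?_
    rw [natDegree_prod_X_sub_C]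
    exact_mod_cast Nat.lt_succ_self _
  constructor
  · intro h
    rw [← combo_interpolate hI hd, polyU]
    congr 1
    funext i
    rw [h i, eval_conodal]
    simp [eval_prod]
  · intro h i
    have h1 := eval_combo_node I (fun i => x.1 i ^ 2) i
    rw [← polyU, h, eval_prod] at h1
    rw [eq_div_iff (by simpa [eval_conodal] using eval_conodal_ne_zero hI i), ← eval_conodal,
      ← h1]
    simp

theorem ordinate_eq (I : Fin n → 𝕜) (κ : 𝕜) (x : Phase 𝕜 n) (z : 𝕜) :
    ordinate I κ x z = -(z * (polyW I x).eval z) / κ := by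
  rw [ordinate, polyW, eval_combo]

theorem radicand_eq (I : Fin (m + 2) → 𝕜) (c : Fin m → 𝕜) (z : 𝕜) :
    radicand I c z = -((nodal I).eval z * z * ∏ j, (z - c j)) := by
  rw [radicand, eval_nodal]

theorem eval_fundamental (I : Fin n → 𝕜) (x : Phase 𝕜 n) (z : 𝕜) :
    2 * ((nodal I).eval z * (integralPoly I x).eval z)
      = (polyU I x).eval z * (polyV I x).eval z - z * (polyW I x).eval z ^ 2 := by
  have h := congrArg (eval z) (nodal_mul_integralPoly I x)
  simp only [eval_mul, eval_C, eval_sub, eval_X, eval_pow] at h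
  rw [h]; ring

theorem eval_integralPoly_of_mem {I : Fin (m + 2) → 𝕜} {h : 𝕜} {c : Fin m → 𝕜}
    {x : Phase 𝕜 (m + 2)} (hx : x ∈ levelSet I h c) (z : 𝕜) :
    (integralPoly I x).eval z = h * ∏ j, (z - c j) := by
  rw [hx.2]; simp [eval_prod]

/-- At a root of `U` the fundamental identity is `2 a F = -z W²`; multiplied by `-z / 2h` it becomes
the equation of the curve. -/
theorem ordinate_sq {I : Fin (m + 2) → 𝕜} {h κ : 𝕜} {c : Fin m → 𝕜}
    {x : Phase 𝕜 (m + 2)} (hh : h ≠ 0) (hκ : κ ^ 2 = 2 * h) (hx : x ∈ levelSet I h c) {z : 𝕜}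
    (hz : (polyU I x).eval z = 0) : ordinate I κ x z ^ 2 = radicand I c z := by
  have h1 := eval_fundamental I x z
  rw [hz, eval_integralPoly_of_mem hx] at h1
  rw [ordinate_eq, radicand_eq, div_pow, hκ, div_eq_iff (by simpa using hh)]
  linear_combination z * h1

end Polynomials


/-! ### The correspondence between phase points and divisors on the curve. -/

section Divisors

variable {𝕜 : Type} [RCLike 𝕜] {n m : ℕ}

theorem nodal_dvd_of_eval_eq_zero {lam : Fin n → 𝕜} (hlam : Function.Injective lam) {P : 𝕜[X]}
    (h : ∀ k, P.eval (lam k) = 0) : nodal lam ∣ P :=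
  Finset.prod_dvd_of_coprime (fun _ _ _ _ hij => pairwise_coprime_X_sub_C hlam hij)
    fun k _ => dvd_iff_isRoot.2 (h k)

theorem eval_integralPoly_node_ne_zero {I : Fin (m + 2) → 𝕜} {h : 𝕜} {c : Fin m → 𝕜}
    (hh : h ≠ 0) (hc : IsGeneric I c) {x : Phase 𝕜 (m + 2)} (hx : x ∈ levelSet I h c)
    (i : Fin (m + 2)) : (integralPoly I x).eval (I i) ≠ 0 := by
  rw [eval_integralPoly_of_mem hx]
  exact mul_ne_zero hh (Finset.prod_ne_zero_iff.2 fun j _ => sub_ne_zero.2 ((hc.2 j).2 i).symm)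

theorem eval_integralPoly_zero_ne_zero {I : Fin (m + 2) → 𝕜} {h : 𝕜} {c : Fin m → 𝕜}
    (hh : h ≠ 0) (hc : IsGeneric I c) {x : Phase 𝕜 (m + 2)} (hx : x ∈ levelSet I h c) :
    (integralPoly I x).eval 0 ≠ 0 := by
  rw [eval_integralPoly_of_mem hx]
  exact mul_ne_zero hh (Finset.prod_ne_zero_iff.2 fun j _ => sub_ne_zero.2 (hc.2 j).1.symm)

/-- At `z = 0` the term with `W` drops out, so `U(0) V(0) = 2 a(0) F(0)`, and neither factor on the
right vanishes. -/
theorem eval_polyU_zero_ne_zero {I : Fin (m + 2) → 𝕜} (hI0 : ∀ i, I i ≠ 0) {h : 𝕜}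
    {c : Fin m → 𝕜} (hh : h ≠ 0) (hc : IsGeneric I c) {x : Phase 𝕜 (m + 2)}
    (hx : x ∈ levelSet I h c) : (polyU I x).eval 0 ≠ 0 := by
  intro h0
  have h1 := eval_fundamental I x 0
  rw [h0, zero_mul, zero_mul, sub_zero] at h1
  have h2 : (nodal I).eval 0 ≠ 0 := by
    rw [eval_nodal]
    exact Finset.prod_ne_zero_iff.2 fun i _ => sub_ne_zero.2 (hI0 i).symm
  exact mul_ne_zero two_ne_zero (mul_ne_zero h2 (eval_integralPoly_zero_ne_zero hh hc hx)) h1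

/-- On generic level sets `q_i` and `p_i` do not vanish simultaneously. -/
theorem fst_ne_zero_or_snd_ne_zero {I : Fin (m + 2) → 𝕜} (hI : Function.Injective I) {h : 𝕜}
    {c : Fin m → 𝕜} (hh : h ≠ 0) (hc : IsGeneric I c) {x : Phase 𝕜 (m + 2)}
    (hx : x ∈ levelSet I h c) (i : Fin (m + 2)) : x.1 i ≠ 0 ∨ x.2 i ≠ 0 := by
  by_contra! hqp
  have hd : ∀ f : Fin (m + 2) → 𝕜, f i = 0 → (X - C (I i)) ∣ combo I f := fun f hf =>
    dvd_iff_isRoot.2 (by rw [IsRoot, eval_combo_node, hf, zero_mul])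
  obtain ⟨u, hu⟩ := hd (fun i => x.1 i ^ 2) (by simp [hqp.1])
  obtain ⟨v, hv⟩ := hd (fun i => I i * x.2 i ^ 2) (by simp [hqp.2])
  obtain ⟨w, hw⟩ := hd (fun i => x.1 i * x.2 i) (by simp [hqp.1])
  -- If `q_i = p_i = 0`, then `X - I_i` divides `U`, `V` and `W`, so its square divides `U V - X
  -- W²`; but it divides `a F` only once.
  have h1 := nodal_mul_integralPoly I x
  rw [polyU, polyV, polyW, hu, hv, hw, nodal_eq I i] at h1
  have h2 : conodal I i * integralPoly I x
      = (X - C (I i)) * (C (1 / 2) * (u * v - X * w ^ 2)) :=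
    mul_left_cancel₀ (X_sub_C_ne_zero (I i)) (by linear_combination h1)
  have h3 := congrArg (eval (I i)) h2
  simp only [eval_mul, eval_sub, eval_X, eval_C, sub_self, zero_mul] at h3
  exact mul_ne_zero (eval_conodal_ne_zero hI i) (eval_integralPoly_node_ne_zero hh hc hx i) h3

theorem integralPoly_signChange (I : Fin n → 𝕜) (x : Phase 𝕜 n) {ε : Fin n → 𝕜}
    (hε : ∀ i, ε i ^ 2 = 1) : integralPoly I (ε * x.1, ε * x.2) = integralPoly I x := by
  have h1 : ∀ i j, (ε i * x.1 i * (ε j * x.2 j) - ε j * x.1 j * (ε i * x.2 i)) ^ 2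
      = (x.1 i * x.2 j - x.1 j * x.2 i) ^ 2 := by
    intro i j
    linear_combination (x.1 i * x.2 j - x.1 j * x.2 i) ^ 2 * (ε j ^ 2 * hε i + hε j)
  have h2 : ∀ i, (ε i * x.1 i) ^ 2 = x.1 i ^ 2 := by
    intro i; linear_combination x.1 i ^ 2 * hε i
  have h3 : ((ε * x.2) ⬝ᵥ (ε * x.2)) = x.2 ⬝ᵥ x.2 :=
    Finset.sum_congr rfl fun i _ => by
      simp only [Pi.mul_apply]; linear_combination x.2 i ^ 2 * hε i
  simp only [integralPoly, h3, Pi.mul_apply, h1, h2]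

theorem signChange_mem_levelSet {I : Fin (m + 2) → 𝕜} {h : 𝕜} {c : Fin m → 𝕜}
    {x : Phase 𝕜 (m + 2)} (hx : x ∈ levelSet I h c) {ε : Fin (m + 2) → 𝕜}
    (hε : ∀ i, ε i ^ 2 = 1) : (ε * x.1, ε * x.2) ∈ levelSet I h c := by
  refine ⟨⟨?_, ?_⟩, by rw [integralPoly_signChange I x hε, hx.2]⟩
  · rw [← hx.1.1]
    exact Finset.sum_congr rfl fun i _ => by
      simp only [Pi.mul_apply]; linear_combination x.1 i ^ 2 * hε i
  · rw [← hx.1.2]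
    exact Finset.sum_congr rfl fun i _ => by
      simp only [Pi.mul_apply]; linear_combination x.1 i * x.2 i * hε i

theorem eq_one_of_signChange_eq {I : Fin (m + 2) → 𝕜} (hI : Function.Injective I) {h : 𝕜}
    {c : Fin m → 𝕜} (hh : h ≠ 0) (hc : IsGeneric I c) {x : Phase 𝕜 (m + 2)}
    (hx : x ∈ levelSet I h c) {ε : Fin (m + 2) → 𝕜} (he : (ε * x.1, ε * x.2) = x) : ε = 1 := by
  funext i
  have h1 : ε i * x.1 i = x.1 i := congrFun (congrArg Prod.fst he) i
  have h2 : ε i * x.2 i = x.2 i := congrFun (congrArg Prod.snd he) i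
  rcases fst_ne_zero_or_snd_ne_zero hI hh hc hx i with h3 | h3
  · exact mul_right_cancel₀ h3 (by simpa using h1)
  · exact mul_right_cancel₀ h3 (by simpa using h2)

theorem eval_polyU_coord {I : Fin (m + 2) → 𝕜} (hI : Function.Injective I)
    {x : Phase 𝕜 (m + 2)} {lam : Fin (m + 1) → 𝕜} (hs : IsSpheroconic I x.1 lam)
    (k : Fin (m + 1)) : (polyU I x).eval (lam k) = 0 := by
  rw [(isSpheroconic_iff hI x lam).1 hs]
  exact eval_nodal_node lam k

theorem coord_ne_zero {I : Fin (m + 2) → 𝕜} (hI : Function.Injective I) (hI0 : ∀ i, I i ≠ 0)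
    {h : 𝕜} {c : Fin m → 𝕜} (hh : h ≠ 0) (hc : IsGeneric I c) {x : Phase 𝕜 (m + 2)}
    (hx : x ∈ levelSet I h c) {lam : Fin (m + 1) → 𝕜} (hs : IsSpheroconic I x.1 lam)
    (k : Fin (m + 1)) : lam k ≠ 0 := by
  intro h0
  have h1 := eval_polyU_coord hI hs k
  rw [h0] at h1
  exact eval_polyU_zero_ne_zero hI0 hh hc hx h1

theorem exists_sign_of_sq_eq {a b : 𝕜} (h : b ^ 2 = a ^ 2) : ∃ e : 𝕜, e ^ 2 = 1 ∧ b = e * a := by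
  rcases sq_eq_sq_iff_eq_or_eq_neg.1 h with h | h
  · exact ⟨1, by simp, by simp [h]⟩
  · exact ⟨-1, by simp, by simp [h]⟩

/-- Points with the same divisor differ by sign changes. -/
theorem exists_signChange {I : Fin (m + 2) → 𝕜} (hI : Function.Injective I)
    (hI0 : ∀ i, I i ≠ 0) {h κ : 𝕜} {c : Fin m → 𝕜} (hκ : κ ≠ 0)
    {x y : Phase 𝕜 (m + 2)} (hx : x ∈ levelSet I h c)
    (hy : y ∈ levelSet I h c) {lam : Fin (m + 1) → 𝕜} (hlam : Function.Injective lam)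
    (hlam0 : ∀ k, lam k ≠ 0)
    (hsx : IsSpheroconic I x.1 lam) (hsy : IsSpheroconic I y.1 lam)
    (hw : ∀ k, ordinate I κ y (lam k) = ordinate I κ x (lam k)) :
    ∃ ε : Fin (m + 2) → 𝕜, (∀ i, ε i ^ 2 = 1) ∧ y = (ε * x.1, ε * x.2) := by
  have hU : polyU I y = polyU I x := by
    rw [(isSpheroconic_iff hI x lam).1 hsx, (isSpheroconic_iff hI y lam).1 hsy]
  -- Both polynomials have degree at most `m` and agree at the `m + 1` abscissas, where division by
  -- `λ_k ≠ 0` is possible.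
  have hW : polyW I y = polyW I x := by
    refine eq_of_eval_node_eq hlam (degree_combo_lt_of_sum_eq_zero _ _ hy.1.2)
      (degree_combo_lt_of_sum_eq_zero _ _ hx.1.2) fun k => ?_
    have h1 := hw k
    rw [ordinate_eq, ordinate_eq, div_left_inj' hκ, neg_inj] at h1
    exact mul_left_cancel₀ (hlam0 k) h1
  have hV : polyV I y = polyV I x := by
    have h1 := nodal_mul_integralPoly I y
    rw [hy.2, ← hx.2, nodal_mul_integralPoly I x, hU, hW] at h1
    have h2 : (C (1 / 2) : 𝕜[X]) ≠ 0 := by simp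
    have h3 := mul_left_cancel₀ h2 h1
    exact (mul_left_cancel₀ (polyU_monic hx.1).ne_zero (by linear_combination h3)).symm
  have hq : ∀ i, y.1 i ^ 2 = x.1 i ^ 2 := fun i => congrFun (combo_injective hI hU) i
  have hqp : ∀ i, y.1 i * y.2 i = x.1 i * x.2 i := fun i => congrFun (combo_injective hI hW) i
  have hp : ∀ i, y.2 i ^ 2 = x.2 i ^ 2 := fun i =>
    mul_left_cancel₀ (hI0 i) (congrFun (combo_injective hI hV) i)
  -- The squares and the product `q_i p_i` determine the pair `(q_i, p_i)` up to one common sign,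
  -- read off `q_i`, or off `p_i` when `q_i = 0`.
  have key : ∀ i, ∃ e : 𝕜, e ^ 2 = 1 ∧ y.1 i = e * x.1 i ∧ y.2 i = e * x.2 i := by
    intro i
    by_cases h0 : x.1 i = 0
    · obtain ⟨e, he, he2⟩ := exists_sign_of_sq_eq (hp i)
      refine ⟨e, he, ?_, he2⟩
      have := hq i
      rw [h0] at this ⊢
      simpa using this
    · obtain ⟨e, he, he2⟩ := exists_sign_of_sq_eq (hq i)
      refine ⟨e, he, he2, ?_⟩
      have h1 := hqp i
      rw [he2] at h1
      have h2 : e * y.2 i = x.2 i := mul_left_cancel₀ h0 (by linear_combination h1)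
      rw [← h2]
      linear_combination (-y.2 i) * he
  choose ε h1 h2 h3 using key
  exact ⟨ε, h1, Prod.ext (funext h2) (funext h3)⟩

theorem isSpheroconic_signChange {I : Fin (m + 2) → 𝕜} {q : Fin (m + 2) → 𝕜}
    {lam : Fin (m + 1) → 𝕜} (hs : IsSpheroconic I q lam) {ε : Fin (m + 2) → 𝕜}
    (hε : ∀ i, ε i ^ 2 = 1) : IsSpheroconic I (ε * q) lam := by
  intro i
  rw [← hs i, Pi.mul_apply, mul_pow, hε, one_mul]

theorem ordinate_signChange (I : Fin n → 𝕜) (κ : 𝕜) (x : Phase 𝕜 n) {ε : Fin n → 𝕜}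
    (hε : ∀ i, ε i ^ 2 = 1) (z : 𝕜) :
    ordinate I κ (ε * x.1, ε * x.2) z = ordinate I κ x z := by
  have h1 : ∀ i, (ε * x.1) i * (ε * x.2) i = x.1 i * x.2 i := by
    intro i
    simp only [Pi.mul_apply]
    linear_combination x.1 i * x.2 i * hε i
  simp only [ordinate, h1]

/-- The interpolation polynomial of degree at most `m` with values `v_k` at `lam_k`. -/
noncomputable def interpolant (lam v : Fin (m + 1) → 𝕜) : 𝕜[X] :=
  combo lam fun k => v k / (conodal lam k).eval (lam k)

theorem natDegree_interpolant_le (lam v : Fin (m + 1) → 𝕜) : (interpolant lam v).natDegree ≤ m :=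
  natDegree_combo_le _ _

theorem eval_interpolant {lam : Fin (m + 1) → 𝕜} (hlam : Function.Injective lam)
    (v : Fin (m + 1) → 𝕜) (k : Fin (m + 1)) : (interpolant lam v).eval (lam k) = v k := by
  rw [interpolant, eval_combo_node, div_mul_cancel₀ _ (eval_conodal_ne_zero hlam k)]

theorem eq_interpolant {lam : Fin (m + 1) → 𝕜} (hlam : Function.Injective lam)
    {P : 𝕜[X]} (hP : P.natDegree ≤ m) {v : Fin (m + 1) → 𝕜} (hv : ∀ k, P.eval (lam k) = v k) :
    P = interpolant lam v := by
  have hlt : ∀ {Q : 𝕜[X]}, Q.natDegree ≤ m → Q.degree < (m + 1 : ℕ) := fun hQ =>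
    lt_of_le_of_lt (natDegree_le_iff_degree_le.1 hQ) (by exact_mod_cast Nat.lt_succ_self m)
  exact eq_of_eval_node_eq hlam (hlt hP) (hlt (natDegree_interpolant_le _ _)) fun k => by
    rw [hv, eval_interpolant hlam]

/-- For a divisor on the curve, the polynomial that is to become `polyV`. -/
theorem exists_complement {I : Fin (m + 2) → 𝕜} {h κ : 𝕜} {c : Fin m → 𝕜}
    (hκ : κ ^ 2 = 2 * h) {lam w : Fin (m + 1) → 𝕜} (hlam : Function.Injective lam)
    (hlam0 : ∀ k, lam k ≠ 0) (hw : ∀ k, w k ^ 2 = radicand I c (lam k)) :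
    ∃ V : 𝕜[X], V.natDegree ≤ m + 1 ∧
      nodal I * (C h * ∏ j, (X - C (c j))) = C (1 / 2) *
        (nodal lam * V - X * interpolant lam (fun k => -(κ * w k) / lam k) ^ 2) := by
  set W := interpolant lam (fun k => -(κ * w k) / lam k) with hWdef
  -- The fundamental identity demands `U V = 2 a F + X W²`; hence `V` has to be the quotient of `T`
  -- by `∏ (X - λ_k)`, and the curve equation says that `T` vanishes at the `λ_k`.
  set T := C 2 * (nodal I * (C h * ∏ j, (X - C (c j)))) + X * W ^ 2 with hT
  have hdvd : nodal lam ∣ T := by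
    refine nodal_dvd_of_eval_eq_zero hlam fun k => ?_
    have h1 : W.eval (lam k) = -(κ * w k) / lam k := eval_interpolant hlam _ k
    have h2 := hw k
    rw [radicand_eq] at h2
    have h3 : lam k * W.eval (lam k) ^ 2 * lam k = κ ^ 2 * w k ^ 2 := by
      rw [h1]; field_simp [hlam0 k]
    simp only [hT, eval_add, eval_mul, eval_C, eval_X, eval_pow, eval_prod, eval_sub]
    refine mul_right_cancel₀ (hlam0 k) ?_
    rw [add_mul, h3, hκ, h2]
    ring
  obtain ⟨V, hV⟩ := hdvd
  refine ⟨V, ?_, ?_⟩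
  · by_cases hV0 : V = 0
    · simp [hV0]
    have h1 := (nodal_monic lam).natDegree_mul' hV0
    rw [natDegree_nodal, ← hV] at h1
    have h2 : T.natDegree ≤ 2 * m + 2 := by
      refine (natDegree_add_le _ _).trans (max_le ?_ ?_)
      · refine (natDegree_C_mul_le _ _).trans (natDegree_mul_le.trans ?_)
        rw [natDegree_nodal]
        have := natDegree_C_mul_le h (∏ j, (X - C (c j)))
        rw [natDegree_prod_X_sub_C] at this
        omega
      · refine natDegree_mul_le.trans ?_
        have h3 := natDegree_pow_le (p := W) (n := 2)
        have h4 := natDegree_interpolant_le lam (fun k => -(κ * w k) / lam k)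
        rw [← hWdef] at h4
        rw [natDegree_X]
        omega
    omega
  · rw [← hV, hT]
    have h12 : (C (1 / 2) : 𝕜[X]) * C 2 = 1 := by
      rw [← C_mul]; norm_num
    linear_combination (-(nodal I * (C h * ∏ j, (X - C (c j))))) * h12

/-- A point with given divisor, in terms of its coordinates, lies on the level set. -/
theorem mem_levelSet_of_divisor {I : Fin (m + 2) → 𝕜} (hI : Function.Injective I)
    {h κ : 𝕜} {c : Fin m → 𝕜} {lam w : Fin (m + 1) → 𝕜} (hlam0 : ∀ k, lam k ≠ 0)
    (hκ : κ ≠ 0) (hlam : Function.Injective lam) {V : 𝕜[X]} (hVd : V.natDegree ≤ m + 1)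
    (hV : nodal I * (C h * ∏ j, (X - C (c j))) = C (1 / 2) *
      (nodal lam * V - X * interpolant lam (fun k => -(κ * w k) / lam k) ^ 2))
    {x : Phase 𝕜 (m + 2)} (hs : IsSpheroconic I x.1 lam)
    (hW : ∀ i, x.1 i * x.2 i * (conodal I i).eval (I i)
      = (interpolant lam (fun k => -(κ * w k) / lam k)).eval (I i))
    (hx0 : ∀ i, x.1 i = 0 → I i * x.2 i ^ 2 * (conodal I i).eval (I i) = V.eval (I i)) :
    x ∈ levelSet I h c ∧ ∀ k, ordinate I κ x (lam k) = w k := by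
  set W := interpolant lam (fun k => -(κ * w k) / lam k) with hWdef
  have hlt : ∀ {Q : 𝕜[X]}, Q.natDegree ≤ m + 1 → Q.degree < (m + 2 : ℕ) := fun hQ =>
    lt_of_le_of_lt (natDegree_le_iff_degree_le.1 hQ) (by exact_mod_cast Nat.lt_succ_self (m + 1))
  have hWd : W.natDegree ≤ m := natDegree_interpolant_le _ _
  have hU : polyU I x = nodal lam := (isSpheroconic_iff hI x lam).1 hs
  have hWx : polyW I x = W := eq_of_eval_node_eq hI (degree_combo_lt _ _) (hlt (by omega))
    fun i => by rw [polyW, eval_combo_node, hW]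
  have hVx : polyV I x = V := by
    refine eq_of_eval_node_eq hI (degree_combo_lt _ _) (hlt hVd) fun i => ?_
    rw [polyV, eval_combo_node]
    by_cases hq : x.1 i = 0
    · exact hx0 i hq
    -- At a node the left side vanishes and leaves `U V = X W²`, which fixes `V(I_i)` as long as
    -- `q_i ≠ 0`; the case `q_i = 0` is the separate hypothesis `hx0`.
    · have h1 := congrArg (eval (I i)) hV
      simp only [eval_mul, eval_nodal_node, zero_mul, eval_C, eval_sub, eval_X, eval_pow,
        ← hW] at h1
      rw [← hU, polyU, eval_combo_node] at h1
      have hD := eval_conodal_ne_zero hI i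
      have h2 : x.1 i ^ 2 * (conodal I i).eval (I i) ≠ 0 := mul_ne_zero (pow_ne_zero _ hq) hD
      refine mul_left_cancel₀ h2 ?_
      linear_combination 2 * h1
  refine ⟨⟨⟨?_, ?_⟩, ?_⟩, fun k => ?_⟩
  · have h1 := coeff_combo I fun i => x.1 i ^ 2
    rw [← polyU, hU] at h1
    have h2 := nodal_monic lam
    rw [Monic, leadingCoeff, natDegree_nodal] at h2
    rw [show m + 2 - 1 = m + 1 from rfl, h2] at h1
    rw [h1]; simp [dotProduct, sq]
  · have h1 := coeff_combo I fun i => x.1 i * x.2 i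
    rw [← polyW, hWx, coeff_eq_zero_of_natDegree_lt (by omega)] at h1
    exact h1.symm
  · refine mul_left_cancel₀ (nodal_monic I).ne_zero ?_
    rw [nodal_mul_integralPoly, hU, hWx, hVx, hV]
  · rw [ordinate_eq, hWx, hWdef, eval_interpolant hlam]
    field_simp [hlam0 k]

/-- The values of `U`, `W`, `V` at the nodes prescribe `q_i²`, `q_i p_i` and `I_i p_i²`. Square
roots exist over `ℂ`, and the fundamental identity makes the three prescriptions compatible. -/
theorem exists_of_divisor {I : Fin (m + 2) → ℂ} (hI : Function.Injective I)
    (hI0 : ∀ i, I i ≠ 0) {h κ : ℂ} {c : Fin m → ℂ} (hh : h ≠ 0) (hκ : κ ^ 2 = 2 * h)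
    {lam w : Fin (m + 1) → ℂ} (hlam : Function.Injective lam)
    (hlw : ∀ k, lam k ≠ 0 ∧ w k ^ 2 = radicand I c (lam k)) :
    ∃ x ∈ levelSet I h c, IsSpheroconic I x.1 lam ∧ ∀ k, ordinate I κ x (lam k) = w k := by
  have hκ0 : κ ≠ 0 := by
    rintro rfl
    exact hh (by simpa using hκ.symm)
  obtain ⟨V, hVd, hV⟩ := exists_complement (c := c) hκ hlam (fun k => (hlw k).1)
    (fun k => (hlw k).2)
  set W := interpolant lam (fun k => -(κ * w k) / lam k) with hWdef
  have hsq : ∀ a : ℂ, ∃ b, b ^ 2 = a := fun a =>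
    IsAlgClosed.exists_pow_nat_eq a two_pos
  choose q hq using fun i => hsq ((∏ k, (I i - lam k)) / ∏ j ∈ Finset.univ.erase i, (I i - I j))
  -- If `q_i = 0`, some `λ_k` equals `I_i`, a branch point of the curve; so `w_k = 0`, and `W`
  -- vanishes there.
  have hWz : ∀ i, q i = 0 → W.eval (I i) = 0 := by
    intro i hi
    have h1 := hq i
    rw [hi, zero_pow two_ne_zero, eq_comm, ← eval_conodal,
      div_eq_zero_iff, or_iff_left (eval_conodal_ne_zero hI i), Finset.prod_eq_zero_iff] at h1
    obtain ⟨k, -, hk⟩ := h1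
    rw [sub_eq_zero.1 hk, hWdef, eval_interpolant hlam]
    have h2 := (hlw k).2
    rw [radicand_eq, ← sub_eq_zero.1 hk, eval_nodal_node] at h2
    have h3 : w k = 0 := by simpa using h2
    simp [h3]
  -- Where `q_i ≠ 0` the momentum is read off `W`; where `q_i = 0` it is a square root taken from
  -- `V`.
  have hp : ∀ i, ∃ p : ℂ, q i * p * (conodal I i).eval (I i) = W.eval (I i) ∧
      (q i = 0 → I i * p ^ 2 * (conodal I i).eval (I i) = V.eval (I i)) := by
    intro i
    have hD := eval_conodal_ne_zero hI i
    by_cases hi : q i = 0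
    · obtain ⟨p, hp⟩ := hsq (V.eval (I i) / (I i * (conodal I i).eval (I i)))
      refine ⟨p, by rw [hWz i hi, hi]; simp, fun _ => ?_⟩
      rw [hp]
      field_simp [hI0 i, hD]
    · exact ⟨W.eval (I i) / (q i * (conodal I i).eval (I i)), by field_simp,
        fun h0 => absurd h0 hi⟩
  choose p hp1 hp2 using hp
  have hs : IsSpheroconic I q lam := hq
  obtain ⟨h1, h2⟩ := mem_levelSet_of_divisor (x := (q, p)) hI (fun k => (hlw k).1) hκ0 hlam hVd
    hV hs hp1 hp2
  exact ⟨(q, p), h1, hs, h2⟩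

end Divisors


/-! ### Gradients of the integrals, their Hamiltonian fields, and involution. -/

section Derivatives

variable {𝕜 : Type} [RCLike 𝕜] {n m : ℕ}

/-- `P'` is the derivative at `s`, coefficient by coefficient, of the curve `P` of polynomials. -/
def HasCoeffDerivAt (P : 𝕜 → 𝕜[X]) (P' : 𝕜[X]) (s : 𝕜) : Prop :=
  ∀ l, HasDerivAt (fun r => (P r).coeff l) (P'.coeff l) s

theorem HasCoeffDerivAt.unique {P : 𝕜 → 𝕜[X]} {P' P'' : 𝕜[X]} {s : 𝕜}
    (h1 : HasCoeffDerivAt P P' s) (h2 : HasCoeffDerivAt P P'' s) : P' = P'' :=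
  Polynomial.ext fun l => (h1 l).unique (h2 l)

theorem HasCoeffDerivAt.const (P : 𝕜[X]) (s : 𝕜) : HasCoeffDerivAt (fun _ => P) 0 s := fun l => by
  simpa using hasDerivAt_const s (P.coeff l)

theorem HasCoeffDerivAt.sub {P Q : 𝕜 → 𝕜[X]} {P' Q' : 𝕜[X]} {s : 𝕜}
    (hP : HasCoeffDerivAt P P' s) (hQ : HasCoeffDerivAt Q Q' s) :
    HasCoeffDerivAt (fun r => P r - Q r) (P' - Q') s := fun l => by
  simpa using (hP l).fun_sub (hQ l)

theorem HasCoeffDerivAt.mul {P Q : 𝕜 → 𝕜[X]} {P' Q' : 𝕜[X]} {s : 𝕜}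
    (hP : HasCoeffDerivAt P P' s) (hQ : HasCoeffDerivAt Q Q' s) :
    HasCoeffDerivAt (fun r => P r * Q r) (P' * Q s + P s * Q') s := fun l => by
  simp only [coeff_add, coeff_mul, ← Finset.sum_add_distrib]
  exact HasDerivAt.fun_sum fun a _ => (hP a.1).fun_mul (hQ a.2)

theorem hasCoeffDerivAt_combo (I : Fin n → 𝕜) {f : 𝕜 → Fin n → 𝕜} {f' : Fin n → 𝕜} {s : 𝕜}
    (hf : ∀ i, HasDerivAt (fun r => f r i) (f' i) s) :
    HasCoeffDerivAt (fun r => combo I (f r)) (combo I f') s := fun l => by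
  simp only [combo, finsetSum_coeff, coeff_C_mul]
  exact HasDerivAt.fun_sum fun i _ => (hf i).mul_const _

theorem hasDerivAt_eval_combo (I : Fin n → 𝕜) {f : 𝕜 → Fin n → 𝕜} {f' : Fin n → 𝕜} {s : 𝕜}
    (hf : ∀ i, HasDerivAt (fun r => f r i) (f' i) s) (z : 𝕜) :
    HasDerivAt (fun r => (combo I (f r)).eval z) ((combo I f').eval z) s := by
  simp only [eval_combo]
  exact HasDerivAt.fun_sum fun i _ => (hf i).mul_const _

/-- Displays the coefficient as a polynomial in the coordinates, from which smoothness is evident.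
-/
theorem integral_eq (I : Fin n → 𝕜) (l : ℕ) (x : Phase 𝕜 n) :
    integral I l x = 1 / 2 * ((∑ i, ∑ j, (if i < j then (x.1 i * x.2 j - x.1 j * x.2 i) ^ 2 else 0)
        * (X * ∏ l ∈ (Finset.univ.erase i).erase j, (X - C (I l))).coeff l)
      - (∑ i, x.2 i * x.2 i) * ∑ i, x.1 i ^ 2 * (conodal I i).coeff l) := by
  simp only [integral, integralPoly, coeff_C_mul, coeff_sub, Finset.mul_sum, finsetSum_coeff]
  congr 2
  · refine Finset.sum_congr rfl fun i _ => Finset.sum_congr rfl fun j _ => ?_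
    split_ifs
    · rw [mul_left_comm, coeff_C_mul]
    · simp

theorem contDiff_integral (I : Fin n → 𝕜) (l : ℕ) {N : WithTop ℕ∞} :
    ContDiff 𝕜 N (integral I l) := by
  rw [funext (integral_eq I l)]
  have h1 : ∀ i, ContDiff 𝕜 N fun x : Phase 𝕜 n => x.1 i := fun i => by fun_prop
  have h2 : ∀ i, ContDiff 𝕜 N fun x : Phase 𝕜 n => x.2 i := fun i => by fun_prop
  refine contDiff_const.mul ((ContDiff.sum fun i _ => ContDiff.sum fun j _ =>
    ContDiff.mul ?_ contDiff_const).sub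
      ((ContDiff.sum fun i _ => (h2 i).mul (h2 i)).mul
        (ContDiff.sum fun i _ => ((h1 i).pow 2).mul contDiff_const)))
  split_ifs
  · exact (((h1 i).mul (h2 j)).sub ((h1 j).mul (h2 i))).pow 2
  · exact contDiff_const

theorem differentiable_integral (I : Fin n → 𝕜) (l : ℕ) : Differentiable 𝕜 (integral I l) :=
  (contDiff_integral I l (N := 1)).differentiable one_ne_zero

/-- A crude bound that holds on the whole ambient space, where `W` need not have lowered degree;
derivatives are taken there and not only along the cotangent bundle. -/
theorem natDegree_integralPoly_lt (I : Fin n → 𝕜) (x : Phase 𝕜 n) :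
    (integralPoly I x).natDegree < 2 * n + 2 := by
  by_cases h0 : integralPoly I x = 0
  · simp [h0]
  have h1 := (nodal_monic I).natDegree_mul' h0
  rw [nodal_mul_integralPoly] at h1
  have h2 := (natDegree_C_mul_le (1 / 2) (polyU I x * polyV I x - X * polyW I x ^ 2)).trans
    (natDegree_sub_le _ _)
  have h3 := natDegree_mul_le (p := polyU I x) (q := polyV I x)
  have h4 := natDegree_mul_le (p := (X : 𝕜[X])) (q := polyW I x ^ 2)
  have h5 := natDegree_pow_le (p := polyW I x) (n := 2)
  have h6 : (polyU I x).natDegree ≤ n - 1 := natDegree_combo_le _ _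
  have h7 : (polyV I x).natDegree ≤ n - 1 := natDegree_combo_le _ _
  have h8 : (polyW I x).natDegree ≤ n - 1 := natDegree_combo_le _ _
  rw [natDegree_X] at h4
  omega

/-- The derivative of `integralPoly I` at `x` in the direction `Y`. -/
noncomputable def derivPoly (I : Fin n → 𝕜) (x Y : Phase 𝕜 n) : 𝕜[X] :=
  ∑ l ∈ Finset.range (2 * n + 2), monomial l (fderiv 𝕜 (integral I l) x Y)

theorem coeff_derivPoly (I : Fin n → 𝕜) (x Y : Phase 𝕜 n) (l : ℕ) :
    (derivPoly I x Y).coeff l = fderiv 𝕜 (integral I l) x Y := by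
  simp only [derivPoly, finsetSum_coeff, coeff_monomial, Finset.sum_ite_eq', Finset.mem_range]
  split_ifs with h
  · rfl
  · have h1 : integral I l = fun _ => 0 := funext fun x =>
      coeff_eq_zero_of_natDegree_lt (lt_of_lt_of_le (natDegree_integralPoly_lt I x)
        (not_lt.1 h))
    simp [h1]

theorem hasCoeffDerivAt_integralPoly (I : Fin n → 𝕜) {γ : 𝕜 → Phase 𝕜 n} {Y : Phase 𝕜 n} {s : 𝕜}
    (hγ : HasDerivAt γ Y s) :
    HasCoeffDerivAt (fun r => integralPoly I (γ r)) (derivPoly I (γ s) Y) s := fun l => by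
  rw [coeff_derivPoly]
  exact (differentiable_integral I l (γ s)).hasFDerivAt.comp_hasDerivAt s hγ

theorem hasDerivAt_fst {γ : 𝕜 → Phase 𝕜 n} {Y : Phase 𝕜 n} {s : 𝕜} (hγ : HasDerivAt γ Y s)
    (i : Fin n) : HasDerivAt (fun r => (γ r).1 i) (Y.1 i) s :=
  hasDerivAt_pi.1 ((hasFDerivAt_fst (p := γ s)).comp_hasDerivAt s hγ) i

theorem hasDerivAt_snd {γ : 𝕜 → Phase 𝕜 n} {Y : Phase 𝕜 n} {s : 𝕜} (hγ : HasDerivAt γ Y s)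
    (i : Fin n) : HasDerivAt (fun r => (γ r).2 i) (Y.2 i) s :=
  hasDerivAt_pi.1 ((hasFDerivAt_snd (p := γ s)).comp_hasDerivAt s hγ) i

/-- The product rule applied to the fundamental identity along the line `x + r Y`, coefficient by
coefficient. -/
theorem nodal_mul_derivPoly (I : Fin n → 𝕜) (x Y : Phase 𝕜 n) :
    nodal I * derivPoly I x Y = combo I (fun i => x.1 i * Y.1 i) * polyV I x
      + polyU I x * combo I (fun i => I i * (x.2 i * Y.2 i))
      - X * polyW I x * combo I (fun i => Y.1 i * x.2 i + x.1 i * Y.2 i) := by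
  have hγ : HasDerivAt (fun r : 𝕜 => x + r • Y) Y 0 := by
    simpa using ((hasDerivAt_id (0 : 𝕜)).smul_const Y).const_add x
  have hx : x + (0 : 𝕜) • Y = x := by simp
  have h1 := hasDerivAt_fst hγ
  have h2 := hasDerivAt_snd hγ
  have hU := hasCoeffDerivAt_combo I fun i => (h1 i).fun_pow 2
  have hV := hasCoeffDerivAt_combo I fun i => ((h2 i).fun_pow 2).const_mul (I i)
  have hW := hasCoeffDerivAt_combo I fun i => (h1 i).fun_mul (h2 i)
  have hR := (HasCoeffDerivAt.const (C (1 / 2)) (0 : 𝕜)).mul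
    ((hU.mul hV).sub ((HasCoeffDerivAt.const X (0 : 𝕜)).mul (hW.mul hW)))
  have hL := (HasCoeffDerivAt.const (nodal I) (0 : 𝕜)).mul (hasCoeffDerivAt_integralPoly I hγ)
  have h3 : (fun r : 𝕜 => nodal I * integralPoly I (x + r • Y)) = fun r => C (1 / 2) *
      (combo I (fun i => (x + r • Y).1 i ^ 2) * combo I (fun i => I i * (x + r • Y).2 i ^ 2)
      - X * (combo I (fun i => (x + r • Y).1 i * (x + r • Y).2 i)
        * combo I (fun i => (x + r • Y).1 i * (x + r • Y).2 i))) := by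
    funext r
    rw [nodal_mul_integralPoly, ← sq]
    rfl
  rw [h3] at hL
  have h4 := hL.unique hR
  simp only [hx, zero_mul, zero_add] at h4
  rw [h4]
  have h5 : combo I (fun i => ((2 : ℕ) : 𝕜) * x.1 i ^ (2 - 1) * Y.1 i)
      = C 2 * combo I (fun i => x.1 i * Y.1 i) := by
    rw [← combo_smul]; congr 1; funext i; simp; ring
  have h6 : combo I (fun i => I i * (((2 : ℕ) : 𝕜) * x.2 i ^ (2 - 1) * Y.2 i))
      = C 2 * combo I (fun i => I i * (x.2 i * Y.2 i)) := by
    rw [← combo_smul]; congr 1; funext i; simp; ring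
  have h7 : (C (1 / 2) : 𝕜[X]) * C 2 = 1 := by
    rw [← C_mul]; norm_num
  rw [h5, h6, polyU, polyV, polyW]
  have h8 : (2 : 𝕜[X]) = C 2 := rfl
  linear_combination (combo I (fun i => x.1 i * Y.1 i) * combo I (fun i => I i * x.2 i ^ 2)
    + combo I (fun i => x.1 i ^ 2) * combo I (fun i => I i * (x.2 i * Y.2 i))
    - X * combo I (fun i => x.1 i * x.2 i) * combo I (fun i => Y.1 i * x.2 i + x.1 i * Y.2 i)) * h7
    - C (1 / 2) * X * combo I (fun i => x.1 i * x.2 i)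
      * combo I (fun i => Y.1 i * x.2 i + x.1 i * Y.2 i) * h8

theorem combo_mul_single (I f : Fin n → 𝕜) (i : Fin n) :
    combo I (fun j => f j * (Pi.single i 1 : Fin n → 𝕜) j) = C (f i) * conodal I i := by
  rw [combo, Finset.sum_eq_single i]
  · simp
  · intro j _ hj
    simp [hj]
  · simp

theorem conodal_ne_zero (I : Fin n → 𝕜) (i : Fin n) : conodal I i ≠ 0 := (conodal_monic I i).ne_zero

/-- The derivative of `integralPoly` with respect to `p_i`. -/
noncomputable def gradP (I : Fin n → 𝕜) (x : Phase 𝕜 n) (i : Fin n) : 𝕜[X] :=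
  derivPoly I x (0, Pi.single i 1)

/-- The derivative of `integralPoly` with respect to `q_i`. -/
noncomputable def gradQ (I : Fin n → 𝕜) (x : Phase 𝕜 n) (i : Fin n) : 𝕜[X] :=
  derivPoly I x (Pi.single i 1, 0)

/-- For a coordinate direction every polynomial in `nodal_mul_derivPoly` that contains the direction
is a multiple of `conodal I i`, which cancels. -/
theorem sub_mul_gradP (I : Fin n → 𝕜) (x : Phase 𝕜 n) (i : Fin n) :
    (X - C (I i)) * gradP I x i = C (I i * x.2 i) * polyU I x - C (x.1 i) * (X * polyW I x) := by
  refine mul_left_cancel₀ (conodal_ne_zero I i) ?_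
  have h := nodal_mul_derivPoly I x (0, Pi.single i 1)
  have h1 := combo_mul_single I (fun j => I j * x.2 j) i
  have h2 := combo_mul_single I x.1 i
  have h0 : combo I (fun _ => 0) = 0 := by simp [combo]
  simp only [Pi.zero_apply, mul_zero, zero_mul, zero_add, ← mul_assoc, h1, h2, h0] at h
  rw [gradP]
  rw [nodal_eq I i] at h
  linear_combination h

theorem sub_mul_gradQ (I : Fin n → 𝕜) (x : Phase 𝕜 n) (i : Fin n) :
    (X - C (I i)) * gradQ I x i = C (x.1 i) * polyV I x - C (x.2 i) * (X * polyW I x) := by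
  refine mul_left_cancel₀ (conodal_ne_zero I i) ?_
  have h := nodal_mul_derivPoly I x (Pi.single i 1, 0)
  have h1 := combo_mul_single I x.1 i
  have h2 := combo_mul_single I x.2 i
  have h0 : combo I (fun _ => 0) = 0 := by simp [combo]
  simp only [Pi.zero_apply, mul_zero, add_zero, h1, h0, mul_comm _ (x.2 _), h2] at h
  rw [gradQ]
  rw [nodal_eq I i] at h
  linear_combination h

/-- `∑ g_i ∂F/∂p_i`, up to the factor `nodal I`. -/
theorem nodal_mul_sum_gradP (I : Fin n → 𝕜) (x : Phase 𝕜 n) (g : Fin n → 𝕜) :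
    nodal I * ∑ i, C (g i) * gradP I x i = polyU I x * combo I (fun i => I i * (x.2 i * g i))
      - X * polyW I x * combo I (fun i => x.1 i * g i) := by
  simp only [combo, Finset.mul_sum, ← Finset.sum_sub_distrib]
  refine Finset.sum_congr rfl fun i _ => ?_
  rw [nodal_eq I i]
  simp only [C_mul]
  have h := sub_mul_gradP I x i
  simp only [C_mul] at h
  linear_combination conodal I i * C (g i) * h

theorem nodal_mul_sum_gradQ (I : Fin n → 𝕜) (x : Phase 𝕜 n) (g : Fin n → 𝕜) :
    nodal I * ∑ i, C (g i) * gradQ I x i = combo I (fun i => x.1 i * g i) * polyV I x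
      - X * polyW I x * combo I (fun i => g i * x.2 i) := by
  simp only [combo, Finset.mul_sum, Finset.sum_mul, ← Finset.sum_sub_distrib]
  refine Finset.sum_congr rfl fun i _ => ?_
  rw [nodal_eq I i]
  simp only [C_mul]
  have h := sub_mul_gradQ I x i
  linear_combination conodal I i * C (g i) * h

theorem derivPoly_eq (I : Fin n → 𝕜) (x Y : Phase 𝕜 n) :
    derivPoly I x Y = ∑ i, C (Y.2 i) * gradP I x i + ∑ i, C (Y.1 i) * gradQ I x i := by
  refine mul_left_cancel₀ (nodal_monic I).ne_zero ?_
  rw [mul_add, nodal_mul_sum_gradP, nodal_mul_sum_gradQ, nodal_mul_derivPoly]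
  have h : combo I (fun i => Y.1 i * x.2 i + x.1 i * Y.2 i)
      = combo I (fun i => Y.1 i * x.2 i) + combo I (fun i => x.1 i * Y.2 i) := combo_add _ _ _
  rw [h]
  ring

theorem fderiv_integral (I : Fin n → 𝕜) (l : ℕ) (x Y : Phase 𝕜 n) :
    fderiv 𝕜 (integral I l) x Y
      = ∑ i, Y.2 i * (gradP I x i).coeff l + ∑ i, Y.1 i * (gradQ I x i).coeff l := by
  rw [← coeff_derivPoly, derivPoly_eq]
  simp [finsetSum_coeff]

/-- The Hamiltonian vector field of the `l`-th integral. -/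
noncomputable def hamField (I : Fin n → 𝕜) (l : ℕ) (x : Phase 𝕜 n) : Phase 𝕜 n :=
  (fun i => (gradP I x i).coeff l, fun i => -(gradQ I x i).coeff l)

/-- Infinitesimally, `p ↦ p + s q` preserves all `q_i p_j - q_j p_i` and changes `(p, p)` by a
multiple of `(q, p) = 0`. This is one of the two conditions for `hamField` to be tangent to the
cotangent bundle. -/
theorem sum_fst_mul_gradP (I : Fin n → 𝕜) {x : Phase 𝕜 n} (hx : x.1 ⬝ᵥ x.2 = 0) :
    ∑ i, C (x.1 i) * gradP I x i = 0 := by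
  refine mul_left_cancel₀ (nodal_monic I).ne_zero ?_
  rw [nodal_mul_sum_gradP, mul_zero]
  have h1 : (fun i => I i * (x.2 i * x.1 i)) = fun i => I i * (x.1 i * x.2 i) := by
    funext i; ring
  have h2 : combo I (fun i => x.1 i * x.1 i) = polyU I x := by simp [polyU, sq]
  rw [h1, combo_node_mul, show ∑ i, x.1 i * x.2 i = 0 from hx, h2, ← polyW]
  simp
  ring

/-- The generating polynomial is invariant under `(q, p) ↦ (t q, t⁻¹ p)`. Together with
`sum_fst_mul_gradP` this makes the ambient Hamiltonian field tangent, so no constraint correction is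
needed. -/
theorem sum_fst_mul_gradQ_sub (I : Fin n → 𝕜) (x : Phase 𝕜 n) :
    ∑ i, C (x.1 i) * gradQ I x i - ∑ i, C (x.2 i) * gradP I x i = 0 := by
  refine mul_left_cancel₀ (nodal_monic I).ne_zero ?_
  rw [mul_sub, nodal_mul_sum_gradP, nodal_mul_sum_gradQ, mul_zero]
  have h1 : combo I (fun i => I i * (x.2 i * x.2 i)) = polyV I x := by simp [polyV, sq]
  have h2 : combo I (fun i => x.1 i * x.1 i) = polyU I x := by simp [polyU, sq]
  rw [h1, h2]
  ring

theorem isHamVec_hamField (I : Fin n → 𝕜) (l : ℕ) {x : Phase 𝕜 n}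
    (hx : x ∈ cotangentSphere 𝕜 n) : IsHamVec (integral I l) x (hamField I l x) := by
  refine ⟨⟨?_, ?_⟩, fun Y _ => ?_⟩
  · have h := congrArg (coeff · l) (sum_fst_mul_gradP I hx.2)
    simpa [finsetSum_coeff, dotProduct, hamField] using h
  · have h := congrArg (coeff · l) (sum_fst_mul_gradQ_sub I x)
    simp only [coeff_sub, finsetSum_coeff, coeff_C_mul, coeff_zero] at h
    simp only [dotProduct, hamField, mul_neg, Finset.sum_neg_distrib]
    linear_combination -h
  · rw [fderiv_integral]
    simp only [symp, dotProduct, hamField, neg_mul, Finset.sum_neg_distrib, sub_neg_eq_add]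
    congr 1 <;> exact Finset.sum_congr rfl fun i _ => mul_comm _ _

/-- Nondegeneracy of the symplectic form on the tangent space, tested against the projections of the
coordinate vectors. -/
theorem eq_zero_of_symp_eq_zero {x : Phase 𝕜 n} (hx : x ∈ cotangentSphere 𝕜 n) {Z : Phase 𝕜 n}
    (hZ : Z ∈ tangent x) (h : ∀ Y ∈ tangent x, symp Z Y = 0) : Z = 0 := by
  have hq := hx.1
  have hZ1 : Z.1 = 0 := by
    funext i
    have h1 := h (0, Pi.single i 1 - x.1 i • x.1) ⟨by simp, by
      simp [dotProduct_sub, dotProduct_smul, hq]⟩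
    have h2 : Z.1 ⬝ᵥ x.1 = 0 := by rw [dotProduct_comm]; exact hZ.1
    simpa [symp, dotProduct_sub, dotProduct_smul, h2] using h1
  have hZ2 : x.1 ⬝ᵥ Z.2 = 0 := by
    have := hZ.2
    rwa [hZ1, dotProduct_zero, add_zero] at this
  refine Prod.ext hZ1 ?_
  funext i
  -- The multiple of `q` in the momentum slot only restores tangency; it does not contribute to the
  -- pairing because `Z.1 = 0`.
  have h1 := h (Pi.single i 1 - x.1 i • x.1,
    -(x.2 ⬝ᵥ (Pi.single i 1 - x.1 i • x.1)) • x.1) ⟨by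
      simp [dotProduct_sub, dotProduct_smul, hq], by
      simp [dotProduct_smul, hq]⟩
  rw [dotProduct_comm] at hZ2
  simpa [symp, hZ1, dotProduct_sub, dotProduct_smul, hZ2] using h1

theorem IsHamVec.unique {F : Phase 𝕜 n → 𝕜} {x X Y : Phase 𝕜 n}
    (hx : x ∈ cotangentSphere 𝕜 n) (hX : IsHamVec F x X) (hY : IsHamVec F x Y) : X = Y := by
  refine sub_eq_zero.1 (eq_zero_of_symp_eq_zero hx (sub_mem hX.1 hY.1) fun Z hZ => ?_)
  have : symp (X - Y) Z = symp X Z - symp Y Z := by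
    simp only [symp, Prod.fst_sub, Prod.snd_sub, sub_dotProduct]; ring
  rw [this, hX.2 Z hZ, hY.2 Z hZ, sub_self]

theorem isHamVec_iff_eq_hamField (I : Fin n → 𝕜) (l : ℕ) {x X : Phase 𝕜 n}
    (hx : x ∈ cotangentSphere 𝕜 n) : IsHamVec (integral I l) x X ↔ X = hamField I l x :=
  ⟨fun h => h.unique hx (isHamVec_hamField I l hx), fun h => h ▸ isHamVec_hamField I l hx⟩

/-! ### Involution -/

/-- `(w - X) ∑ q_i a_i(w) ∂F/∂p_i`, with `a_i = conodal I i`. -/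
theorem sub_mul_sum_fst_gradP (I : Fin n → 𝕜) {x : Phase 𝕜 n} (hx : x.1 ⬝ᵥ x.2 = 0)
    (w : 𝕜) :
    (C w - X) * ∑ i, C (x.1 i * (conodal I i).eval w) * gradP I x i
      = C ((polyU I x).eval w) * (X * polyW I x) - C (w * (polyW I x).eval w) * polyU I x := by
  refine mul_left_cancel₀ (nodal_monic I).ne_zero ?_
  rw [mul_left_comm, nodal_mul_sum_gradP]
  have h1 := sum_conodal_mul_sub I (fun i => I i * (x.1 i * x.2 i)) w
  have h2 := sum_conodal_mul_sub I (fun i => x.1 i ^ 2) w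
  rw [combo_node_mul, show ∑ i, x.1 i * x.2 i = 0 from hx, ← polyW] at h1
  rw [← polyU] at h2
  simp only [map_zero, zero_mul, sub_zero, eval_mul, eval_X] at h1
  have h3 : (C w - X) * combo I (fun i => I i * (x.2 i * (x.1 i * (conodal I i).eval w)))
      = C ((nodal I).eval w) * (X * polyW I x) - C (w * (polyW I x).eval w) * nodal I := by
    rw [← h1, combo, Finset.mul_sum]
    refine Finset.sum_congr rfl fun i _ => ?_
    simp only [C_mul]; ring
  have h4 : (C w - X) * combo I (fun i => x.1 i * (x.1 i * (conodal I i).eval w))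
      = C ((nodal I).eval w) * polyU I x - C ((polyU I x).eval w) * nodal I := by
    rw [← h2, combo, Finset.mul_sum]
    refine Finset.sum_congr rfl fun i _ => ?_
    simp only [C_mul, C_pow]; ring
  linear_combination polyU I x * h3 - X * polyW I x * h4

/-- `(w - X) ∑ p_i a_i(w) ∂F/∂p_i`. -/
theorem sub_mul_sum_snd_gradP (I : Fin n → 𝕜) (x : Phase 𝕜 n) (w : 𝕜) :
    (C w - X) * ∑ i, C (x.2 i * (conodal I i).eval w) * gradP I x i
      = C (2 * (nodal I).eval w) * integralPoly I x - C ((polyV I x).eval w) * polyU I x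
        + C ((polyW I x).eval w) * (X * polyW I x) := by
  refine mul_left_cancel₀ (nodal_monic I).ne_zero ?_
  rw [mul_left_comm, nodal_mul_sum_gradP]
  have h1 := sum_conodal_mul_sub I (fun i => I i * x.2 i ^ 2) w
  have h2 := sum_conodal_mul_sub I (fun i => x.1 i * x.2 i) w
  rw [← polyV] at h1
  rw [← polyW] at h2
  have h3 : (C w - X) * combo I (fun i => I i * (x.2 i * (x.2 i * (conodal I i).eval w)))
      = C ((nodal I).eval w) * polyV I x - C ((polyV I x).eval w) * nodal I := by
    rw [← h1, combo, Finset.mul_sum]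
    refine Finset.sum_congr rfl fun i _ => ?_
    simp only [C_mul, C_pow]; ring
  have h4 : (C w - X) * combo I (fun i => x.1 i * (x.2 i * (conodal I i).eval w))
      = C ((nodal I).eval w) * polyW I x - C ((polyW I x).eval w) * nodal I := by
    rw [← h2, combo, Finset.mul_sum]
    refine Finset.sum_congr rfl fun i _ => ?_
    simp only [C_mul]; ring
  have h5 := nodal_mul_integralPoly I x
  have h6 : (C 2 : 𝕜[X]) * C (1 / 2) = 1 := by rw [← C_mul]; norm_num
  simp only [C_mul]
  linear_combination polyU I x * h3 - X * polyW I x * h4 - C 2 * C ((nodal I).eval w) * h5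
    - C ((nodal I).eval w) * (polyU I x * polyV I x - X * polyW I x ^ 2) * h6

/-- `(w - X) ∑ q_i a_i(w) ∂F/∂q_i`. -/
theorem sub_mul_sum_fst_gradQ (I : Fin n → 𝕜) (x : Phase 𝕜 n) (w : 𝕜) :
    (C w - X) * ∑ i, C (x.1 i * (conodal I i).eval w) * gradQ I x i
      = C (2 * (nodal I).eval w) * integralPoly I x - C ((polyU I x).eval w) * polyV I x
        + C ((polyW I x).eval w) * (X * polyW I x) := by
  refine mul_left_cancel₀ (nodal_monic I).ne_zero ?_
  rw [mul_left_comm, nodal_mul_sum_gradQ]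
  have h1 := sum_conodal_mul_sub I (fun i => x.1 i ^ 2) w
  have h2 := sum_conodal_mul_sub I (fun i => x.1 i * x.2 i) w
  rw [← polyU] at h1
  rw [← polyW] at h2
  have h3 : (C w - X) * combo I (fun i => x.1 i * (x.1 i * (conodal I i).eval w))
      = C ((nodal I).eval w) * polyU I x - C ((polyU I x).eval w) * nodal I := by
    rw [← h1, combo, Finset.mul_sum]
    refine Finset.sum_congr rfl fun i _ => ?_
    simp only [C_mul, C_pow]; ring
  have h4 : (C w - X) * combo I (fun i => x.1 i * (conodal I i).eval w * x.2 i)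
      = C ((nodal I).eval w) * polyW I x - C ((polyW I x).eval w) * nodal I := by
    rw [← h2, combo, Finset.mul_sum]
    refine Finset.sum_congr rfl fun i _ => ?_
    simp only [C_mul]; ring
  have h5 := nodal_mul_integralPoly I x
  have h6 : (C 2 : 𝕜[X]) * C (1 / 2) = 1 := by rw [← C_mul]; norm_num
  simp only [C_mul]
  linear_combination polyV I x * h3 - X * polyW I x * h4 - C 2 * C ((nodal I).eval w) * h5
    - C ((nodal I).eval w) * (polyU I x * polyV I x - X * polyW I x ^ 2) * h6

/-- `(w - X) ∑ p_i I_i a_i(w) ∂F/∂q_i`. -/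
theorem sub_mul_sum_snd_gradQ (I : Fin n → 𝕜) {x : Phase 𝕜 n} (hx : x.1 ⬝ᵥ x.2 = 0)
    (w : 𝕜) :
    (C w - X) * ∑ i, C (I i * x.2 i * (conodal I i).eval w) * gradQ I x i
      = C ((polyV I x).eval w) * (X * polyW I x) - C (w * (polyW I x).eval w) * polyV I x := by
  refine mul_left_cancel₀ (nodal_monic I).ne_zero ?_
  rw [mul_left_comm, nodal_mul_sum_gradQ]
  have h1 := sum_conodal_mul_sub I (fun i => I i * (x.1 i * x.2 i)) w
  have h2 := sum_conodal_mul_sub I (fun i => I i * x.2 i ^ 2) w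
  rw [combo_node_mul, show ∑ i, x.1 i * x.2 i = 0 from hx, ← polyW] at h1
  rw [← polyV] at h2
  simp only [map_zero, zero_mul, sub_zero, eval_mul, eval_X] at h1
  have h3 : (C w - X) * combo I (fun i => x.1 i * (I i * x.2 i * (conodal I i).eval w))
      = C ((nodal I).eval w) * (X * polyW I x) - C (w * (polyW I x).eval w) * nodal I := by
    rw [← h1, combo, Finset.mul_sum]
    refine Finset.sum_congr rfl fun i _ => ?_
    simp only [C_mul]; ring
  have h4 : (C w - X) * combo I (fun i => I i * x.2 i * (conodal I i).eval w * x.2 i)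
      = C ((nodal I).eval w) * polyV I x - C ((polyV I x).eval w) * nodal I := by
    rw [← h2, combo, Finset.mul_sum]
    refine Finset.sum_congr rfl fun i _ => ?_
    simp only [C_mul, C_pow]; ring
  linear_combination polyV I x * h3 - X * polyW I x * h4

/-- Allows division by `a(w)` in the computation of the brackets. -/
theorem poly_eq_zero_of_eval_off_nodes (I : Fin n → 𝕜) {P : 𝕜[X]}
    (h : ∀ w, (nodal I).eval w ≠ 0 → P.eval w = 0) : P = 0 := by
  have h1 : nodal I * P = 0 := by
    refine Polynomial.funext fun w => ?_
    rw [eval_mul, eval_zero]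
    by_cases hw : (nodal I).eval w = 0
    · rw [hw, zero_mul]
    · rw [h w hw, mul_zero]
  exact (mul_eq_zero.1 h1).resolve_left (nodal_monic I).ne_zero

/-- This is the Poisson bracket of `F(w)` with `F(X)`. Multiplied by `a(w)`, the gradient at `w`
becomes a combination of the four vectors of the preceding summation formulas. -/
theorem sum_grad_bracket (I : Fin n → 𝕜) {x : Phase 𝕜 n} (hx : x.1 ⬝ᵥ x.2 = 0) {w : 𝕜}
    (hw : (nodal I).eval w ≠ 0) :
    ∑ i, C ((gradP I x i).eval w) * gradQ I x i - ∑ i, C ((gradQ I x i).eval w) * gradP I x i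
      = 0 := by
  have hP : ∀ i, (nodal I).eval w * (gradP I x i).eval w
      = (polyU I x).eval w * (I i * x.2 i * (conodal I i).eval w)
        - w * (polyW I x).eval w * (x.1 i * (conodal I i).eval w) := by
    intro i
    have h := congrArg (eval w) (sub_mul_gradP I x i)
    simp only [eval_mul, eval_sub, eval_X, eval_C] at h
    rw [nodal_eq I i]
    simp only [eval_mul, eval_sub, eval_X, eval_C]
    linear_combination (conodal I i).eval w * h
  have hQ : ∀ i, (nodal I).eval w * (gradQ I x i).eval w
      = (polyV I x).eval w * (x.1 i * (conodal I i).eval w)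
        - w * (polyW I x).eval w * (x.2 i * (conodal I i).eval w) := by
    intro i
    have h := congrArg (eval w) (sub_mul_gradQ I x i)
    simp only [eval_mul, eval_sub, eval_X, eval_C] at h
    rw [nodal_eq I i]
    simp only [eval_mul, eval_sub, eval_X, eval_C]
    linear_combination (conodal I i).eval w * h
  have h1 : C ((nodal I).eval w) * ∑ i, C ((gradP I x i).eval w) * gradQ I x i
      = C ((polyU I x).eval w) * ∑ i, C (I i * x.2 i * (conodal I i).eval w) * gradQ I x i
        - C (w * (polyW I x).eval w) * ∑ i, C (x.1 i * (conodal I i).eval w) * gradQ I x i := by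
    rw [Finset.mul_sum, Finset.mul_sum, Finset.mul_sum, ← Finset.sum_sub_distrib]
    refine Finset.sum_congr rfl fun i _ => ?_
    rw [← mul_assoc, ← C_mul, hP]
    simp only [C_mul, C_sub]; ring
  have h2 : C ((nodal I).eval w) * ∑ i, C ((gradQ I x i).eval w) * gradP I x i
      = C ((polyV I x).eval w) * ∑ i, C (x.1 i * (conodal I i).eval w) * gradP I x i
        - C (w * (polyW I x).eval w) * ∑ i, C (x.2 i * (conodal I i).eval w) * gradP I x i := by
    rw [Finset.mul_sum, Finset.mul_sum, Finset.mul_sum, ← Finset.sum_sub_distrib]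
    refine Finset.sum_congr rfl fun i _ => ?_
    rw [← mul_assoc, ← C_mul, hQ]
    simp only [C_mul, C_sub]; ring
  have hwX : (C w - X : 𝕜[X]) ≠ 0 := by
    rw [← neg_sub]; exact neg_ne_zero.2 (X_sub_C_ne_zero w)
  have hn : (C ((nodal I).eval w) : 𝕜[X]) ≠ 0 := by simpa using hw
  refine mul_left_cancel₀ hn (mul_left_cancel₀ hwX ?_)
  rw [mul_sub, h1, h2]
  have e1 := sub_mul_sum_fst_gradP I hx w
  have e2 := sub_mul_sum_snd_gradP I x w
  have e3 := sub_mul_sum_fst_gradQ I x w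
  have e4 := sub_mul_sum_snd_gradQ I hx w
  -- The two terms with `F(X)` cancel, and the remaining products of values at `w` with polynomials
  -- in `X` cancel in pairs.
  linear_combination C ((polyU I x).eval w) * e4 - C (w * (polyW I x).eval w) * e3
    - C ((polyV I x).eval w) * e1 + C (w * (polyW I x).eval w) * e2

/-- The integrals are in involution. -/
theorem fderiv_integral_hamField (I : Fin n → 𝕜) {x : Phase 𝕜 n} (hx : x.1 ⬝ᵥ x.2 = 0)
    (l l' : ℕ) : fderiv 𝕜 (integral I l') x (hamField I l x) = 0 := by
  rw [fderiv_integral]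
  have h : ∑ i, C (-(gradQ I x i).coeff l) * gradP I x i
      + ∑ i, C ((gradP I x i).coeff l) * gradQ I x i = 0 := by
    -- The bracket of the `l`-th integral with the generating polynomial is treated as a polynomial
    -- in `w`; its value at `w` is, up to sign, the coefficient of `X^l` in `sum_grad_bracket`.
    refine poly_eq_zero_of_eval_off_nodes I fun w hw => ?_
    have h1 := congrArg (coeff · l) (sum_grad_bracket I hx hw)
    simp only [coeff_sub, finsetSum_coeff, coeff_C_mul, coeff_zero] at h1
    simp only [eval_add, eval_finsetSum, eval_mul, eval_C, neg_mul, Finset.sum_neg_distrib]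
    rw [← neg_eq_zero, ← h1]
    simp only [mul_comm]
    ring
  have h2 := congrArg (coeff · l') h
  simpa [finsetSum_coeff, hamField] using h2

end Derivatives


/-! ### Independence of the integrals, and the Abel-Jacobi quadratures. -/

section Independence

variable {𝕜 : Type} [RCLike 𝕜] {n m : ℕ}

/-- The divided difference `(P - P(w)) / (X - w)`. -/
noncomputable def dividedDiff (w : 𝕜) (P : 𝕜[X]) : 𝕜[X] :=
  ∑ k ∈ Finset.range (P.natDegree + 1),
    C (P.coeff k) * ∑ t ∈ Finset.range k, C w ^ t * X ^ (k - 1 - t)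

/-- The polynomial `w ↦ ℓ ((P - P(w)) / (X - w))`. -/
noncomputable def sharp (ℓ : 𝕜[X] →ₗ[𝕜] 𝕜) (P : 𝕜[X]) : 𝕜[X] :=
  ∑ k ∈ Finset.range (P.natDegree + 1),
    C (P.coeff k) * ∑ t ∈ Finset.range k, C (ℓ (X ^ (k - 1 - t))) * X ^ t

theorem eq_dividedDiff (w : 𝕜) (P : 𝕜[X]) : P = C (P.eval w) + (X - C w) * dividedDiff w P := by
  have h1 : ∀ k, (∑ t ∈ Finset.range k, C w ^ t * X ^ (k - 1 - t)) * (C w - X) = C w ^ k - X ^ k :=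
    fun k => (Commute.all (C w) (X : 𝕜[X])).geom_sum₂_mul k
  have h2 : (X - C w) * dividedDiff w P
      = ∑ k ∈ Finset.range (P.natDegree + 1), (C (P.coeff k) * X ^ k - C (P.coeff k) * C w ^ k) := by
    rw [dividedDiff, Finset.mul_sum]
    refine Finset.sum_congr rfl fun k _ => ?_
    linear_combination (-C (P.coeff k)) * h1 k
  rw [h2, Finset.sum_sub_distrib, ← P.as_sum_range_C_mul_X_pow, eval_eq_sum_range, map_sum]
  simp

theorem map_C_mul (ℓ : 𝕜[X] →ₗ[𝕜] 𝕜) (a : 𝕜) (P : 𝕜[X]) : ℓ (C a * P) = a * ℓ P := by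
  rw [C_mul', map_smul, smul_eq_mul]

theorem map_dividedDiff (ℓ : 𝕜[X] →ₗ[𝕜] 𝕜) (w : 𝕜) (P : 𝕜[X]) :
    ℓ (dividedDiff w P) = (sharp ℓ P).eval w := by
  simp only [dividedDiff, sharp, map_sum, map_C_mul, eval_finsetSum, eval_mul, eval_C, eval_pow,
    eval_X, ← C_pow, mul_comm (w ^ _)]

theorem natDegree_sharp_lt (ℓ : 𝕜[X] →ₗ[𝕜] 𝕜) {P : 𝕜[X]} (hP : 0 < P.natDegree) :
    (sharp ℓ P).natDegree < P.natDegree := by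
  refine lt_of_le_of_lt (natDegree_sum_le_of_forall_le (n := P.natDegree - 1) _ _ fun k hk => ?_)
    (by omega)
  refine (natDegree_C_mul_le _ _).trans (natDegree_sum_le_of_forall_le _ _ fun t ht => ?_)
  refine (natDegree_C_mul_le _ _).trans ((natDegree_X_pow_le t).trans ?_)
  have := Finset.mem_range.1 hk
  have := Finset.mem_range.1 ht
  omega

theorem coeff_sharp (ℓ : 𝕜[X] →ₗ[𝕜] 𝕜) (P : 𝕜[X]) (t : ℕ) :
    (sharp ℓ P).coeff t = ∑ k ∈ Finset.range (P.natDegree + 1),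
      P.coeff k * (if t < k then ℓ (X ^ (k - 1 - t)) else 0) := by
  simp only [sharp, finsetSum_coeff, coeff_C_mul, coeff_X_pow]
  refine Finset.sum_congr rfl fun k _ => ?_
  simp [Finset.sum_ite_eq, Finset.mem_range]

/-- For monic `P` of degree `m + 1`, the coefficient of `w^{m-j}` in `sharp ℓ P` is `ℓ(X^j)` plus a
combination of values at lower powers; this triangular system is solved from `j = 0` upwards. -/
theorem map_X_pow_eq_zero_of_sharp (ℓ : 𝕜[X] →ₗ[𝕜] 𝕜) {P : 𝕜[X]} (hP : P.Monic)
    (hd : P.natDegree = m + 1) (h : sharp ℓ P = 0) (j : ℕ) (hj : j ≤ m) : ℓ (X ^ j) = 0 := by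
  induction j using Nat.strong_induction_on with
  | _ j ih =>
    have h1 := coeff_sharp ℓ P (m - j)
    rw [h, coeff_zero, hd, Finset.sum_range_succ, ← hd, hP.coeff_natDegree, hd, one_mul,
      if_pos (by omega), show m + 1 - 1 - (m - j) = j by omega, Finset.sum_eq_zero, zero_add] at h1
    · exact h1.symm
    · intro k hk
      have hk := Finset.mem_range.1 hk
      split_ifs with h2
      · rw [ih _ (by omega) (by omega), mul_zero]
      · rw [mul_zero]

/-- At a common root `r` the square of `X - r` divides `U V - X W² = 2 a F`, but `a ∏ (X - c_j)` is
squarefree for generic constants. The point `r = 0`, where `X W` vanishes for a trivial reason, is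
excluded beforehand. -/
theorem polyUWV_no_common_root {I : Fin (m + 2) → 𝕜} (hI : Function.Injective I)
    (hI0 : ∀ i, I i ≠ 0) {h : 𝕜} {c : Fin m → 𝕜} (hh : h ≠ 0) (hc : IsGeneric I c)
    {x : Phase 𝕜 (m + 2)} (hx : x ∈ levelSet I h c) {r : 𝕜} (hU : (polyU I x).eval r = 0)
    (hW : (X * polyW I x).eval r = 0) (hV : (polyV I x).eval r = 0) : False := by
  have hr : r ≠ 0 := by
    rintro rfl
    exact eval_polyU_zero_ne_zero hI0 hh hc hx hU
  have hW' : (polyW I x).eval r = 0 := by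
    rw [eval_mul, eval_X] at hW
    exact (mul_eq_zero.1 hW).resolve_left hr
  obtain ⟨u, hu⟩ := dvd_iff_isRoot.2 hU
  obtain ⟨v, hv⟩ := dvd_iff_isRoot.2 hV
  obtain ⟨w, hw⟩ := dvd_iff_isRoot.2 hW'
  have h1 := nodal_mul_integralPoly I x
  rw [hu, hv, hw, hx.2] at h1
  have hinj : Function.Injective (Sum.elim I c) := by
    refine hI.sumElim hc.1 fun i j => (hc.2 j).2 i |>.symm
  have hsq := ((separable_prod_X_sub_C_iff (f := Sum.elim I c)).2 hinj).squarefree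
  have h2 : ∏ i, (X - C (Sum.elim I c i)) = nodal I * ∏ j, (X - C (c j)) := by
    rw [Fintype.prod_sum_type]; rfl
  have h3 : (C (h⁻¹) : 𝕜[X]) * C h = 1 := by rw [← C_mul, inv_mul_cancel₀ hh, C_1]
  have h4 : (X - C r) * (X - C r) ∣ ∏ i, (X - C (Sum.elim I c i)) := by
    refine ⟨C (h⁻¹) * (C (1 / 2) * (u * v - X * w ^ 2)), ?_⟩
    rw [h2]
    linear_combination C (h⁻¹) * h1 - nodal I * (∏ j, (X - C (c j))) * h3
  exact not_isUnit_X_sub_C r (hsq _ h4)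

/-- On generic level sets, a functional that annihilates the differentials of the generating
polynomial of the integrals is zero. -/
theorem functional_eq_zero {I : Fin (m + 2) → 𝕜} (hI : Function.Injective I)
    (hI0 : ∀ i, I i ≠ 0) {h : 𝕜} {c : Fin m → 𝕜} (hh : h ≠ 0) (hc : IsGeneric I c)
    {x : Phase 𝕜 (m + 2)} (hx : x ∈ levelSet I h c) (ℓ : 𝕜[X] →ₗ[𝕜] 𝕜)
    (hP : ∀ i, ℓ (gradP I x i) = 0) (hQ : ∀ i, ℓ (gradQ I x i) = 0) (j : ℕ) (hj : j ≤ m) :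
    ℓ (X ^ j) = 0 := by
  set U := polyU I x with hUdef
  set V := polyV I x with hVdef
  set W := polyW I x with hWdef
  set a := nodal I with ha
  have hS : ∀ (f : Fin (m + 2) → 𝕜) (g : Fin (m + 2) → 𝕜[X]), (∀ i, ℓ (g i) = 0) →
      ℓ (∑ i, C (f i) * g i) = 0 := fun f g hg => by
    rw [map_sum]; exact Finset.sum_eq_zero fun i _ => by rw [map_C_mul, hg, mul_zero]
  have hcancel : ∀ (w : 𝕜) (S T : 𝕜[X]), (C w - X) * S = (X - C w) * T → ℓ S = 0 → ℓ T = 0 := by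
    intro w S T hST h0
    have : T = -S := mul_left_cancel₀ (X_sub_C_ne_zero w) (by linear_combination -hST)
    rw [this, map_neg, h0, neg_zero]
  -- In the summation formula both sides vanish at `X = w`; dividing by `X - w` and applying `ℓ`,
  -- which kills the sum of gradients, leaves an identity between values at `w`. The relations `e2`
  -- and `e3` arise in the same way.
  have e1 : U * sharp ℓ (X * W) = X * W * sharp ℓ U := by
    refine Polynomial.funext fun w => ?_
    have h0 := hcancel w _ (C (U.eval w) * dividedDiff w (X * W)
      - C ((X * W).eval w) * dividedDiff w U) (by
        rw [sub_mul_sum_fst_gradP I hx.1.2 w]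
        have hA := eq_dividedDiff w (X * W)
        have hB := eq_dividedDiff w U
        rw [← hUdef, ← hWdef, show w * W.eval w = (X * W).eval w by simp]
        linear_combination C (U.eval w) * hA - C ((X * W).eval w) * hB) (hS _ _ hP)
    rw [map_sub, map_C_mul, map_C_mul, map_dividedDiff, map_dividedDiff] at h0
    rw [eval_mul, eval_mul (p := X * W)]
    linear_combination h0
  have e2 : C 2 * a * sharp ℓ (integralPoly I x) - V * sharp ℓ U + W * sharp ℓ (X * W) = 0 := by
    refine Polynomial.funext fun w => ?_
    have h0 := hcancel w _ (C (2 * a.eval w) * dividedDiff w (integralPoly I x)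
      - C (V.eval w) * dividedDiff w U + C (W.eval w) * dividedDiff w (X * W)) (by
        rw [sub_mul_sum_snd_gradP I x w]
        have hA := eq_dividedDiff w (X * W)
        have hB := eq_dividedDiff w U
        have hC := eq_dividedDiff w (integralPoly I x)
        have hD := congrArg C (eval_fundamental I x w)
        rw [← hUdef, ← hWdef, ← hVdef, ← ha] at hD ⊢
        rw [eval_mul, eval_X] at hA
        simp only [C_mul, C_sub, C_pow] at hA hD ⊢
        linear_combination C 2 * C (a.eval w) * hC - C (V.eval w) * hB + C (W.eval w) * hA + hD)
      (hS _ _ hP)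
    simp only [map_add, map_sub, map_C_mul, map_dividedDiff] at h0
    simpa using h0
  have e3 : C 2 * a * sharp ℓ (integralPoly I x) - U * sharp ℓ V + W * sharp ℓ (X * W) = 0 := by
    refine Polynomial.funext fun w => ?_
    have h0 := hcancel w _ (C (2 * a.eval w) * dividedDiff w (integralPoly I x)
      - C (U.eval w) * dividedDiff w V + C (W.eval w) * dividedDiff w (X * W)) (by
        rw [sub_mul_sum_fst_gradQ I x w]
        have hA := eq_dividedDiff w (X * W)
        have hB := eq_dividedDiff w V
        have hC := eq_dividedDiff w (integralPoly I x)
        have hD := congrArg C (eval_fundamental I x w)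
        rw [← hUdef, ← hWdef, ← hVdef, ← ha] at hD ⊢
        rw [eval_mul, eval_X] at hA
        simp only [C_mul, C_sub, C_pow] at hA hD ⊢
        linear_combination C 2 * C (a.eval w) * hC - C (U.eval w) * hB + C (W.eval w) * hA + hD)
      (hS _ _ hQ)
    simp only [map_add, map_sub, map_C_mul, map_dividedDiff] at h0
    simpa using h0
  have d1 : U ∣ sharp ℓ U * (X * W) := ⟨sharp ℓ (X * W), by linear_combination -e1⟩
  -- In the difference of `e2` and `e3` the unknown contribution of `F` cancels.
  have d2 : U ∣ sharp ℓ U * V := ⟨sharp ℓ V, by linear_combination e3 - e2⟩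
  set d0 := EuclideanDomain.gcd U (X * W) with hd0
  set d := EuclideanDomain.gcd d0 V with hd
  have d3 : U ∣ sharp ℓ U * d0 := by
    rw [hd0, EuclideanDomain.gcd_eq_gcd_ab, mul_add]
    refine dvd_add ⟨sharp ℓ U * EuclideanDomain.gcdA U (X * W), by ring⟩ ?_
    rw [← mul_assoc]
    exact d1.mul_right _
  have d4 : U ∣ sharp ℓ U * d := by
    rw [hd, EuclideanDomain.gcd_eq_gcd_ab, mul_add, ← mul_assoc, ← mul_assoc]
    exact dvd_add (d3.mul_right _) (d2.mul_right _)
  have hdU : d ∣ U := (EuclideanDomain.gcd_dvd_left _ _).trans (EuclideanDomain.gcd_dvd_left _ _)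
  have hdW : d ∣ X * W :=
    (EuclideanDomain.gcd_dvd_left _ _).trans (EuclideanDomain.gcd_dvd_right _ _)
  have hdV : d ∣ V := EuclideanDomain.gcd_dvd_right _ _
  have hsplit : (a * integralPoly I x).Splits := by
    rw [hx.2]
    exact (Splits.prod fun i _ => Splits.X_sub_C _).mul
      ((Splits.C h).mul (Splits.prod fun i _ => Splits.X_sub_C _))
  have hne : a * integralPoly I x ≠ 0 := by
    rw [hx.2]
    exact mul_ne_zero (nodal_monic I).ne_zero (mul_ne_zero (C_ne_zero.2 hh)
      (nodal_monic c).ne_zero)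
  have hdF : d ∣ a * integralPoly I x := by
    rw [nodal_mul_integralPoly]
    refine Dvd.dvd.mul_left (dvd_sub (hdU.mul_right _) ?_) _
    rw [sq, ← mul_assoc]
    exact hdW.mul_right _
  -- The gcd divides `a F`, which is a product of linear factors over either field; hence a gcd that
  -- is not a unit has a root in `𝕜`, with no need of algebraic closedness.
  have hunit : IsUnit d := by
    by_contra hnu
    have hd_ne : d ≠ 0 := ne_zero_of_dvd_ne_zero hne hdF
    have hdeg : d.degree ≠ 0 := fun h0 => hnu (isUnit_iff_degree_eq_zero.2 h0)
    obtain ⟨r, hr⟩ := (hsplit.of_dvd hne hdF).exists_eval_eq_zero hdeg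
    exact polyUWV_no_common_root hI hI0 hh hc hx (eval_eq_zero_of_dvd_of_eval_eq_zero hdU hr)
      (eval_eq_zero_of_dvd_of_eval_eq_zero hdW hr) (eval_eq_zero_of_dvd_of_eval_eq_zero hdV hr)
  have d5 : U ∣ sharp ℓ U := (hunit.dvd_mul_right).1 d4
  have hUd : U.natDegree = m + 1 := natDegree_polyU hx.1
  have hzero : sharp ℓ U = 0 :=
    eq_zero_of_dvd_of_natDegree_lt d5 (natDegree_sharp_lt ℓ (by omega))
  exact map_X_pow_eq_zero_of_sharp ℓ (polyU_monic hx.1) hUd hzero j hj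

/-- By nondegeneracy a relation between the differentials on the tangent space is a relation between
the Hamiltonian fields, hence between all partial derivatives. The functional `P ↦ ∑ g_l coeff_l P`
therefore annihilates every gradient. -/
theorem linearIndependent_integrals {I : Fin (m + 2) → 𝕜} (hI : Function.Injective I)
    (hI0 : ∀ i, I i ≠ 0) {h : 𝕜} {c : Fin m → 𝕜} (hh : h ≠ 0) (hc : IsGeneric I c)
    {x : Phase 𝕜 (m + 2)} (hx : x ∈ levelSet I h c) :
    LinearIndependent 𝕜 fun l : Fin (m + 1) =>
      (fderiv 𝕜 (integral I l) x).toLinearMap ∘ₗ (tangent x).subtype := by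
  rw [Fintype.linearIndependent_iff]
  intro g hg
  set Z : Phase 𝕜 (m + 2) := ∑ l, g l • hamField I l x with hZdef
  have hZt : Z ∈ tangent x := Submodule.sum_mem _ fun l _ =>
    Submodule.smul_mem _ _ (isHamVec_hamField I l hx.1).1
  have hsymp : ∀ Y, symp Z Y = ∑ l, g l * symp (hamField I l x) Y := by
    intro Y
    simp only [hZdef, symp, Prod.fst_sum, Prod.snd_sum, sum_dotProduct, Prod.smul_fst,
      Prod.smul_snd, smul_dotProduct, smul_eq_mul, mul_sub, Finset.sum_sub_distrib]
  have hZ0 : Z = 0 := by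
    refine eq_zero_of_symp_eq_zero hx.1 hZt fun Y hY => ?_
    have h1 := LinearMap.congr_fun hg ⟨Y, hY⟩
    simp only [LinearMap.sum_apply, LinearMap.smul_apply, LinearMap.comp_apply,
      Submodule.subtype_apply, ContinuousLinearMap.coe_coe, LinearMap.zero_apply,
      smul_eq_mul] at h1
    rw [hsymp, ← h1]
    exact Finset.sum_congr rfl fun l _ => by rw [(isHamVec_hamField I l hx.1).2 Y hY]
  set ℓ : 𝕜[X] →ₗ[𝕜] 𝕜 := ∑ l : Fin (m + 1), g l • lcoeff 𝕜 (l : ℕ) with hℓ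
  have hℓ_apply : ∀ P, ℓ P = ∑ l : Fin (m + 1), g l * P.coeff l := by
    intro P; simp [hℓ, LinearMap.sum_apply]
  have h1 : ∀ i, ℓ (gradP I x i) = 0 := by
    intro i
    have := congrFun (congrArg Prod.fst hZ0) i
    rw [hℓ_apply]
    simpa [hZdef, Prod.fst_sum, hamField] using this
  have h2 : ∀ i, ℓ (gradQ I x i) = 0 := by
    intro i
    have := congrFun (congrArg Prod.snd hZ0) i
    rw [hℓ_apply]
    simpa [hZdef, Prod.snd_sum, hamField] using this
  intro l
  have h3 := functional_eq_zero hI hI0 hh hc hx ℓ h1 h2 l (by omega)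
  rw [hℓ_apply] at h3
  simpa [coeff_X_pow, Fin.val_inj] using h3

theorem isLiouvilleIntegrable {I : Fin (m + 2) → 𝕜} (hI : Function.Injective I)
    (hI0 : ∀ i, I i ≠ 0) : IsLiouvilleIntegrable I := by
  refine ⟨fun x hx => integralPoly_degree_coeff I hx, fun x hx l => ⟨⟨hamField I l x,
    isHamVec_hamField I l hx, fun Y hY => (isHamVec_iff_eq_hamField I l hx).1 hY⟩, ?_⟩,
    fun h c hh hc x hx => linearIndependent_integrals hI hI0 hh hc hx⟩
  intro Y hY k
  rw [(isHamVec_iff_eq_hamField I l hx).1 hY]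
  exact fderiv_integral_hamField I hx.2 l k

/-! ### The Hamiltonian `H*` among the integrals -/

theorem contDiff_starHamiltonian (I : Fin n → 𝕜) {N : WithTop ℕ∞} :
    ContDiff 𝕜 N (starHamiltonian I) := by
  refine contDiff_const.mul (ContDiff.sum fun i _ => contDiff_const.mul (ContDiff.pow ?_ 2))
  fun_prop

theorem fderiv_starHamiltonian (I : Fin n → 𝕜) (x Y : Phase 𝕜 n) :
    fderiv 𝕜 (starHamiltonian I) x Y = ∑ i, I i * (x.2 i * Y.2 i) := by
  have hγ : HasDerivAt (fun r : 𝕜 => x + r • Y) Y 0 := by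
    simpa using ((hasDerivAt_id (0 : 𝕜)).smul_const Y).const_add x
  have h1 : HasDerivAt (fun r : 𝕜 => starHamiltonian I (x + r • Y))
      (1 / 2 * ∑ i, I i * (((2 : ℕ) : 𝕜) * (x + (0 : 𝕜) • Y).2 i ^ (2 - 1) * Y.2 i)) 0 :=
    (HasDerivAt.fun_sum fun i _ => ((hasDerivAt_snd hγ i).fun_pow 2).const_mul (I i)).const_mul _
  have h2 := (((contDiff_starHamiltonian I (N := 1)).differentiable one_ne_zero
    (x + (0 : 𝕜) • Y)).hasFDerivAt).comp_hasDerivAt (0 : 𝕜) hγ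
  have h3 := h2.unique h1
  rw [zero_smul, add_zero] at h3
  rw [h3, Finset.mul_sum]
  refine Finset.sum_congr rfl fun i _ => ?_
  simp
  ring

/-- The two functions coincide only on the cotangent bundle, so the differentials are compared on
tangent vectors alone: tangency lowers the degrees of the other terms and isolates the top
coefficient. -/
theorem fderiv_integral_last (I : Fin (m + 2) → 𝕜) {x Y : Phase 𝕜 (m + 2)}
    (hx : x ∈ cotangentSphere 𝕜 (m + 2)) (hY : Y ∈ tangent x) :
    fderiv 𝕜 (integral I m) x Y = fderiv 𝕜 (starHamiltonian I) x Y := by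
  rw [fderiv_starHamiltonian, ← coeff_derivPoly]
  have h1 : (combo I fun i => x.1 i * Y.1 i).natDegree ≤ m :=
    natDegree_combo_le_of_sum_eq_zero _ _ hY.1
  have h2 : (combo I fun i => Y.1 i * x.2 i + x.1 i * Y.2 i).natDegree ≤ m := by
    refine natDegree_combo_le_of_sum_eq_zero _ _ ?_
    rw [Finset.sum_add_distrib, ← hY.2, add_comm]
    simp only [dotProduct, mul_comm]
  have h3 := natDegree_polyV_le I x
  have h4 := natDegree_polyU_le I x
  have h5 := natDegree_polyW_le (I := I) hx
  have h6 : (combo I fun i => I i * (x.2 i * Y.2 i)).natDegree ≤ m + 1 := natDegree_combo_le _ _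
  have n1 := natDegree_mul_le (p := combo I fun i => x.1 i * Y.1 i) (q := polyV I x)
  have n2 := natDegree_mul_le (p := polyU I x) (q := combo I fun i => I i * (x.2 i * Y.2 i))
  have n3 := natDegree_mul_le (p := X * polyW I x)
    (q := combo I fun i => Y.1 i * x.2 i + x.1 i * Y.2 i)
  have n4 := natDegree_mul_le (p := (X : 𝕜[X])) (q := polyW I x)
  rw [natDegree_X] at n4
  have h7 := (quotient_nodal (nodal_mul_derivPoly I x Y) (by
    refine (natDegree_sub_le _ _).trans (max_le ((natDegree_add_le _ _).trans (max_le ?_ ?_)) ?_)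
      <;> omega)).2
  have h8 := coeff_mul_add_eq_of_natDegree_le h4 h6
  rw [coeff_polyU hx, one_mul, show m + 1 + (m + 1) = 2 * m + 2 by ring] at h8
  rw [h7, coeff_sub, coeff_add, h8, coeff_eq_zero_of_natDegree_lt (by omega),
    coeff_eq_zero_of_natDegree_lt (p := X * polyW I x * _) (by omega), zero_add, sub_zero]
  exact coeff_combo _ _

theorem isHamVec_starHamiltonian_iff (I : Fin (m + 2) → 𝕜) {x Y : Phase 𝕜 (m + 2)}
    (hx : x ∈ cotangentSphere 𝕜 (m + 2)) :
    IsHamVec (starHamiltonian I) x Y ↔ Y = hamField I m x := by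
  rw [← isHamVec_iff_eq_hamField I m hx]
  refine and_congr_right fun _ => forall₂_congr fun Z hZ => ?_
  rw [fderiv_integral_last I hx hZ]

/-! ### The Abel-Jacobi quadratures -/

/-- Where `f` vanishes, the product rule needs only continuity of the other factor. This allows `λ`
to be merely continuous in the quadratures. -/
theorem hasDerivAt_mul_of_eq_zero {f g : 𝕜 → 𝕜} {f' : 𝕜} {s : 𝕜} (hf : HasDerivAt f f' s)
    (h0 : f s = 0) (hg : ContinuousAt g s) : HasDerivAt (fun r => f r * g r) (f' * g s) s := by
  rw [hasDerivAt_iff_tendsto_slope] at hf ⊢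
  have h1 : slope (fun r => f r * g r) s = fun r => slope f s r * g r := by
    funext r
    simp only [slope_def_field, h0]
    ring
  rw [h1]
  exact hf.mul (hg.tendsto.mono_left nhdsWithin_le_nhds)

/-- The velocity of a spheroconic coordinate, in terms of the velocity of the point. -/
theorem hasDerivAt_coord {I : Fin (m + 2) → 𝕜} (hI : Function.Injective I)
    {γ : 𝕜 → Phase 𝕜 (m + 2)} {Y : Phase 𝕜 (m + 2)} {s : 𝕜} (hγ : HasDerivAt γ Y s)
    {lam : 𝕜 → Fin (m + 1) → 𝕜} (hlam : ContinuousAt lam s) (hinj : Function.Injective (lam s))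
    (hs : ∀ᶠ r in nhds s, IsSpheroconic I (γ r).1 (lam r)) (k : Fin (m + 1)) :
    HasDerivAt (fun r => lam r k)
      (-(2 * (combo I (fun i => (γ s).1 i * Y.1 i)).eval (lam s k))
        / (conodal (lam s) k).eval (lam s k)) s := by
  set z := lam s k with hz
  have hU : HasDerivAt (fun r => (polyU I (γ r)).eval z)
      (2 * (combo I (fun i => (γ s).1 i * Y.1 i)).eval z) s := by
    have h1 := hasDerivAt_eval_combo I (fun i => (hasDerivAt_fst hγ i).fun_pow 2) z
    have h2 : (fun i => ((2 : ℕ) : 𝕜) * (γ s).1 i ^ (2 - 1) * Y.1 i)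
        = (2 : 𝕜) • fun i => (γ s).1 i * Y.1 i := by
      funext i; simp; ring
    rw [h2, combo_smul, eval_mul, eval_C] at h1
    exact h1
  have hU0 : (polyU I (γ s)).eval z = 0 := eval_polyU_coord hI hs.self_of_nhds k
  have hD : (conodal (lam s) k).eval z ≠ 0 := eval_conodal_ne_zero hinj k
  have hDc : ContinuousAt (fun r => (conodal (lam r) k).eval z) s := by
    simp only [eval_conodal]
    refine tendsto_finsetProd _ fun j _ => ?_
    exact (continuousAt_const.sub ((continuous_apply j).continuousAt.comp hlam))
  have h3 := ((hasDerivAt_mul_of_eq_zero hU hU0 (hDc.inv₀ hD)).fun_neg).const_add z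
  rw [neg_div, div_eq_mul_inv]
  refine h3.congr_of_eventuallyEq ?_
  filter_upwards [hs, hDc.eventually_ne hD] with r hr hr2
  -- With `z = λ_k(s)` frozen, the factorization of `U` solves for `λ_k(r) = z - U(z) / ∏_{l ≠ k} (z
  -- - λ_l(r))`, whose numerator vanishes at `r = s`.
  have h4 : (polyU I (γ r)).eval z = (z - lam r k) * (conodal (lam r) k).eval z := by
    rw [(isSpheroconic_iff hI (γ r) (lam r)).1 hr, ← nodal, nodal_eq (lam r) k]
    simp
  rw [h4, mul_assoc, Pi.inv_apply, mul_inv_cancel₀ hr2]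
  ring

/-- In `sub_mul_sum_fst_gradP` at `w = λ_k` the term with `U(w)` vanishes, and `X - λ_k` cancels
from the remaining `U`. -/
theorem sum_fst_mul_hamField {I : Fin (m + 2) → 𝕜} (hI : Function.Injective I) (l : ℕ)
    {x : Phase 𝕜 (m + 2)} (hx : x ∈ cotangentSphere 𝕜 (m + 2)) {lam : Fin (m + 1) → 𝕜}
    (hs : IsSpheroconic I x.1 lam) (k : Fin (m + 1)) :
    (combo I (fun i => x.1 i * (hamField I l x).1 i)).eval (lam k)
      = lam k * (polyW I x).eval (lam k) * (conodal lam k).coeff l := by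
  have h1 := sub_mul_sum_fst_gradP I hx.2 (lam k)
  rw [eval_polyU_coord hI hs k, (isSpheroconic_iff hI x lam).1 hs, ← nodal, nodal_eq lam k,
    map_zero, zero_mul, zero_sub] at h1
  have h2 : ∑ i, C (x.1 i * (conodal I i).eval (lam k)) * gradP I x i
      = C (lam k * (polyW I x).eval (lam k)) * conodal lam k :=
    mul_left_cancel₀ (X_sub_C_ne_zero (lam k)) (by linear_combination -h1)
  have h3 := congrArg (coeff · l) h2
  simp only [finsetSum_coeff, coeff_C_mul] at h3
  rw [← h3, eval_combo]
  refine Finset.sum_congr rfl fun i _ => ?_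
  rw [← eval_conodal]
  simp only [hamField]
  ring

/-- The coefficient of `X^l` in the Lagrange interpolation of `X^j` at the `λ_k`. -/
theorem sum_pow_mul_coeff {lam : Fin (m + 1) → 𝕜} (hlam : Function.Injective lam)
    (j l : Fin (m + 1)) :
    ∑ k, lam k ^ (j : ℕ) * ((conodal lam k).coeff l / (conodal lam k).eval (lam k))
      = if j = l then 1 else 0 := by
  have h1 := combo_interpolate (P := (X : 𝕜[X]) ^ (j : ℕ)) hlam (by
    rw [degree_X_pow]; exact_mod_cast j.2)
  have h2 := congrArg (coeff · (l : ℕ)) h1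
  simp only [combo, finsetSum_coeff, coeff_C_mul, eval_pow, eval_X, coeff_X_pow] at h2
  rw [show (if j = l then (1 : 𝕜) else 0) = if (l : ℕ) = (j : ℕ) then 1 else 0 by
    simp [Fin.ext_iff, eq_comm], ← h2]
  exact Finset.sum_congr rfl fun k _ => by ring

theorem abelJacobiQuadratures {I : Fin (m + 2) → 𝕜} (hI : Function.Injective I)
    {F : Phase 𝕜 (m + 2) → 𝕜} {l : Fin (m + 1)}
    (hF : ∀ x ∈ cotangentSphere 𝕜 (m + 2), ∀ Y, IsHamVec F x Y → Y = hamField I l x) :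
    AbelJacobiQuadratures I F l := by
  intro h κ c U γ lam hh hκ hU hγ hlev hlam hs s hsU
  have hκ0 : κ ≠ 0 := by
    rintro rfl
    exact hh (by simpa using hκ.symm)
  have hord : ∀ k, ordinate I κ (γ s) (lam s k) ^ 2 = radicand I c (lam s k) := fun k =>
    ordinate_sq hh hκ (hlev s hsU) (eval_polyU_coord hI (hs s hsU).2 k)
  obtain ⟨hsph, Y, hY, hYh⟩ := hγ s hsU
  obtain rfl := hF _ hsph _ hYh
  -- This `u` is the value of `dλ_k / (2 w_k)` along the flow; it stays finite where `w_k = 0`.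
  set u : Fin (m + 1) → 𝕜 := fun k =>
    κ * ((conodal (lam s) k).coeff l / (conodal (lam s) k).eval (lam s k)) with hu
  have hderiv : ∀ k, HasDerivAt (fun r => lam r k)
      (2 * ordinate I κ (γ s) (lam s k) * u k) s := by
    intro k
    have h1 := hasDerivAt_coord hI hY (hlam.continuousAt (hU.mem_nhds hsU)) (hs s hsU).1
      (Filter.eventually_of_mem (hU.mem_nhds hsU) fun r hr => (hs r hr).2) k
    convert h1 using 1
    rw [sum_fst_mul_hamField hI l hsph (hs s hsU).2 k, ordinate_eq, hu]
    field_simp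
  have hsum : ∀ j : Fin (m + 1), ∑ k, lam s k ^ (j : ℕ) * u k = if j = l then κ else 0 := by
    intro j
    have h1 := sum_pow_mul_coeff (hs s hsU).1 j l
    simp only [hu, mul_left_comm _ κ, ← Finset.mul_sum]
    rw [h1]
    simp
  refine ⟨hord, ⟨u, hderiv, hsum⟩, fun hne j => ?_⟩
  rw [← hsum j]
  refine Finset.sum_congr rfl fun k _ => ?_
  have h1 : ordinate I κ (γ s) (lam s k) ≠ 0 := by
    intro h0
    have := hord k
    rw [h0] at this
    exact hne k (by simpa using this.symm)
  rw [(hderiv k).deriv]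
  field_simp

theorem isAlgebraicallyIntegrable {I : Fin (m + 2) → ℂ} (hI : Function.Injective I)
    (hI0 : ∀ i, I i ≠ 0) : IsAlgebraicallyIntegrable I := by
  refine ⟨isLiouvilleIntegrable hI hI0, fun l => abelJacobiQuadratures hI fun x hx Y hY =>
    (isHamVec_iff_eq_hamField I l hx).1 hY, fun h κ c hh hκ hc => ?_⟩
  have hκ0 : κ ≠ 0 := by
    rintro rfl
    exact hh (by simpa using hκ.symm)
  refine ⟨fun x hx ε hε => ⟨signChange_mem_levelSet hx hε, eq_one_of_signChange_eq hI hh hc hx⟩,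
    fun x hx lam hs k => ⟨coord_ne_zero hI hI0 hh hc hx hs k,
      ordinate_sq hh hκ hx (eval_polyU_coord hI hs k)⟩, fun x hx y hy lam hlam hs => ⟨?_, ?_⟩,
    fun lam w hlam hlw => exists_of_divisor hI hI0 hh hκ hlam hlw⟩
  · rintro ⟨hsy, hw⟩
    exact exists_signChange hI hI0 hκ0 hx hy hlam (coord_ne_zero hI hI0 hh hc hx hs) hs hsy hw
  · rintro ⟨ε, hε, rfl⟩
    exact ⟨isSpheroconic_signChange hs hε, fun k => ordinate_signChange I κ x hε _⟩

end Independence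


/-! ### The reduced system, the time substitution and the geodesic flow. -/

section Mechanics

variable {n : ℕ}

/-! ### Calculus of the bilinear forms -/

theorem bil_eq_dotProduct (A x y : Fin n → ℝ) : bil A x y = (A * x) ⬝ᵥ y := rfl

theorem bil_comm (A x y : Fin n → ℝ) : bil A x y = bil A y x :=
  Finset.sum_congr rfl fun _ _ => by ring

theorem bil_sub_right (A x y z : Fin n → ℝ) : bil A x (y - z) = bil A x y - bil A x z := by
  simp only [bil_eq_dotProduct, dotProduct_sub]

theorem bil_smul_right (A x y : Fin n → ℝ) (c : ℝ) : bil A x (c • y) = c * bil A x y := by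
  simp only [bil_eq_dotProduct, dotProduct_smul, smul_eq_mul]

theorem bil_sub_left (A x y z : Fin n → ℝ) : bil A (y - z) x = bil A y x - bil A z x := by
  simp only [bil_comm A _ x, bil_sub_right]

theorem bil_smul_left (A x y : Fin n → ℝ) (c : ℝ) : bil A (c • y) x = c * bil A y x := by
  simp only [bil_comm A _ x, bil_smul_right]

theorem bil_inv_mul {A : Fin n → ℝ} (hA : ∀ i, 0 < A i) (x y : Fin n → ℝ) :
    bil A x (A⁻¹ * y) = x ⬝ᵥ y :=
  Finset.sum_congr rfl fun i _ => by
    have := (hA i).ne'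
    simp only [Pi.mul_apply, Pi.inv_apply]
    field_simp

theorem bil_inv_mul_left {A : Fin n → ℝ} (hA : ∀ i, 0 < A i) (x y : Fin n → ℝ) :
    bil A⁻¹ (A * x) y = x ⬝ᵥ y :=
  Finset.sum_congr rfl fun i _ => by
    have := (hA i).ne'
    simp only [Pi.mul_apply, Pi.inv_apply]
    field_simp

theorem inv_mul_mul {A : Fin n → ℝ} (hA : ∀ i, 0 < A i) (x : Fin n → ℝ) : A⁻¹ * (A * x) = x := by
  funext i
  have := (hA i).ne'
  simp only [Pi.mul_apply, Pi.inv_apply]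
  field_simp

theorem mul_inv_mul {A : Fin n → ℝ} (hA : ∀ i, 0 < A i) (x : Fin n → ℝ) : A * (A⁻¹ * x) = x := by
  funext i
  have := (hA i).ne'
  simp only [Pi.mul_apply, Pi.inv_apply]
  field_simp

theorem bil_self_pos {A : Fin n → ℝ} (hA : ∀ i, 0 < A i) {x : Fin n → ℝ} (hx : x ≠ 0) :
    0 < bil A x x := by
  obtain ⟨i, hi⟩ := Function.ne_iff.1 hx
  refine Finset.sum_pos' (fun j _ => ?_) ⟨i, Finset.mem_univ i, ?_⟩
  · have := (hA j).le
    have := mul_self_nonneg (x j)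
    rw [mul_assoc]; positivity
  · rw [mul_assoc]
    exact mul_pos (hA i) (mul_self_pos.2 hi)

theorem bil_self_pos_of_sphere {A : Fin n → ℝ} (hA : ∀ i, 0 < A i) {x : Fin n → ℝ}
    (hx : x ⬝ᵥ x = 1) : 0 < bil A x x :=
  bil_self_pos hA (by rintro rfl; simp at hx)

theorem hasDerivAt_dotProduct {x y : ℝ → Fin n → ℝ} {x' y' : Fin n → ℝ} {t : ℝ}
    (hx : HasDerivAt x x' t) (hy : HasDerivAt y y' t) :
    HasDerivAt (fun s => x s ⬝ᵥ y s) (x' ⬝ᵥ y t + x t ⬝ᵥ y') t := by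
  simp only [dotProduct, ← Finset.sum_add_distrib]
  exact HasDerivAt.fun_sum fun i _ => (hasDerivAt_pi.1 hx i).fun_mul (hasDerivAt_pi.1 hy i)

theorem hasDerivAt_const_mul_vec (A : Fin n → ℝ) {x : ℝ → Fin n → ℝ} {x' : Fin n → ℝ} {t : ℝ}
    (hx : HasDerivAt x x' t) : HasDerivAt (fun s => A * x s) (A * x') t :=
  hasDerivAt_pi.2 fun i => (hasDerivAt_pi.1 hx i).const_mul (A i)

theorem hasDerivAt_bil (A : Fin n → ℝ) {x y : ℝ → Fin n → ℝ} {x' y' : Fin n → ℝ} {t : ℝ}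
    (hx : HasDerivAt x x' t) (hy : HasDerivAt y y' t) :
    HasDerivAt (fun s => bil A (x s) (y s)) (bil A x' (y t) + bil A (x t) y') t :=
  hasDerivAt_dotProduct (hasDerivAt_const_mul_vec A hx) hy

theorem contDiffOn_dotProduct {N : WithTop ℕ∞} {J : Set ℝ} {x y : ℝ → Fin n → ℝ}
    (hx : ContDiffOn ℝ N x J) (hy : ContDiffOn ℝ N y J) :
    ContDiffOn ℝ N (fun s => x s ⬝ᵥ y s) J :=
  ContDiffOn.sum fun i _ => (contDiffOn_pi.1 hx i).mul (contDiffOn_pi.1 hy i)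

theorem contDiffOn_const_mul_vec {N : WithTop ℕ∞} {J : Set ℝ} (A : Fin n → ℝ)
    {x : ℝ → Fin n → ℝ} (hx : ContDiffOn ℝ N x J) : ContDiffOn ℝ N (fun s => A * x s) J :=
  contDiffOn_pi.2 fun i => contDiffOn_const.mul (contDiffOn_pi.1 hx i)

theorem contDiffOn_bil {N : WithTop ℕ∞} {J : Set ℝ} (A : Fin n → ℝ) {x y : ℝ → Fin n → ℝ}
    (hx : ContDiffOn ℝ N x J) (hy : ContDiffOn ℝ N y J) :
    ContDiffOn ℝ N (fun s => bil A (x s) (y s)) J :=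
  contDiffOn_dotProduct (contDiffOn_const_mul_vec A hx) hy

theorem differentiableAt_bil (A : Fin n → ℝ) {f g : (Fin n → ℝ) → Fin n → ℝ} {x : Fin n → ℝ}
    (hf : DifferentiableAt ℝ f x) (hg : DifferentiableAt ℝ g x) :
    DifferentiableAt ℝ (fun z => bil A (f z) (g z)) x := by
  refine DifferentiableAt.fun_sum fun i _ => ?_
  exact ((differentiableAt_pi.1 hf i).const_mul _).mul (differentiableAt_pi.1 hg i)

/-- The derivative in a direction is the derivative along a line. -/
theorem fderiv_apply_eq {E : Type*} [NormedAddCommGroup E] [NormedSpace ℝ E] {f : E → ℝ} {x v : E}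
    {d : ℝ} (hf : DifferentiableAt ℝ f x) (h : HasDerivAt (fun r : ℝ => f (x + r • v)) d 0) :
    fderiv ℝ f x v = d := by
  have hγ : HasDerivAt (fun r : ℝ => x + r • v) v 0 := by
    simpa using ((hasDerivAt_id (0 : ℝ)).smul_const v).const_add x
  have h1 : HasFDerivAt f (fderiv ℝ f x) (x + (0 : ℝ) • v) := by simpa using hf.hasFDerivAt
  exact (h1.comp_hasDerivAt (0 : ℝ) hγ).unique h

theorem hasDerivAt_line (x v : Fin n → ℝ) : HasDerivAt (fun r : ℝ => x + r • v) v 0 := by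
  simpa using ((hasDerivAt_id (0 : ℝ)).smul_const v).const_add x

theorem hasDerivAt_bil_line (A x v y : Fin n → ℝ) :
    HasDerivAt (fun r : ℝ => bil A (x + r • v) y) (bil A v y) 0 := by
  have h := hasDerivAt_bil A (hasDerivAt_line x v) (hasDerivAt_const (0 : ℝ) y)
  simpa [bil] using h

theorem hasDerivAt_bil_line_self (A x v : Fin n → ℝ) :
    HasDerivAt (fun r : ℝ => bil A (x + r • v) (x + r • v)) (2 * bil A x v) 0 := by
  have h := hasDerivAt_bil A (hasDerivAt_line x v) (hasDerivAt_line x v)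
  simp only [zero_smul, add_zero] at h
  rwa [bil_comm A v x, ← two_mul] at h

theorem eq_smul_of_orthogonal {q r : Fin n → ℝ} (hq : q ⬝ᵥ q = 1)
    (h : ∀ ξ, q ⬝ᵥ ξ = 0 → r ⬝ᵥ ξ = 0) : r = (q ⬝ᵥ r) • q := by
  have h1 : q ⬝ᵥ (r - (q ⬝ᵥ r) • q) = 0 := by
    rw [dotProduct_sub, dotProduct_smul, hq]; simp
  have h2 := h _ h1
  have h3 : (r - (q ⬝ᵥ r) • q) ⬝ᵥ (r - (q ⬝ᵥ r) • q) = 0 := by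
    rw [sub_dotProduct, h2, smul_dotProduct, h1]; simp
  exact sub_eq_zero.1 (dotProduct_self_eq_zero.1 h3)

/-! ### Curves of class `C²` -/

theorem contDiffOn_two_iff {E : Type*} [NormedAddCommGroup E] [NormedSpace ℝ E] {J : Set ℝ}
    (hJ : IsOpen J) {q : ℝ → E} :
    ContDiffOn ℝ 2 q J ↔ DifferentiableOn ℝ q J ∧ ContDiffOn ℝ 1 (deriv q) J := by
  rw [show (2 : WithTop ℕ∞) = 1 + 1 by norm_num, contDiffOn_succ_iff_deriv_of_isOpen hJ]
  simp

theorem hasDerivAt_of_contDiffOn_two {E : Type*} [NormedAddCommGroup E] [NormedSpace ℝ E]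
    {J : Set ℝ} (hJ : IsOpen J) {q : ℝ → E} (hq : ContDiffOn ℝ 2 q J) {t : ℝ} (ht : t ∈ J) :
    HasDerivAt q (deriv q t) t ∧ HasDerivAt (deriv q) (deriv (deriv q) t) t := by
  obtain ⟨h1, h2⟩ := (contDiffOn_two_iff hJ).1 hq
  exact ⟨(h1.differentiableAt (hJ.mem_nhds ht)).hasDerivAt,
    ((h2.differentiableOn one_ne_zero).differentiableAt (hJ.mem_nhds ht)).hasDerivAt⟩

theorem contDiffOn_one_of_hasDerivAt {E : Type*} [NormedAddCommGroup E] [NormedSpace ℝ E]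
    {J : Set ℝ} (hJ : IsOpen J) {q v : ℝ → E} (h : ∀ t ∈ J, HasDerivAt q (v t) t)
    (hv : ContinuousOn v J) : ContDiffOn ℝ 1 q J := by
  rw [show (1 : WithTop ℕ∞) = 0 + 1 by norm_num, contDiffOn_succ_iff_deriv_of_isOpen hJ]
  refine ⟨fun t ht => (h t ht).differentiableAt.differentiableWithinAt, by simp, ?_⟩
  exact contDiffOn_zero.2 (hv.congr fun t ht => (h t ht).deriv)

theorem contDiffOn_two_of_hasDerivAt {E : Type*} [NormedAddCommGroup E] [NormedSpace ℝ E]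
    {J : Set ℝ} (hJ : IsOpen J) {q v : ℝ → E} (h : ∀ t ∈ J, HasDerivAt q (v t) t)
    (hv : ContDiffOn ℝ 1 v J) : ContDiffOn ℝ 2 q J :=
  (contDiffOn_two_iff hJ).2 ⟨fun t ht => (h t ht).differentiableAt.differentiableWithinAt,
    hv.congr fun t ht => (h t ht).deriv⟩

theorem dotProduct_deriv_eq_zero {J : Set ℝ} (hJ : IsOpen J) {q : ℝ → Fin n → ℝ}
    (hq : ∀ t ∈ J, q t ⬝ᵥ q t = 1) {t : ℝ} (ht : t ∈ J) {v : Fin n → ℝ} (hv : HasDerivAt q v t) :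
    q t ⬝ᵥ v = 0 := by
  have h1 := hasDerivAt_dotProduct hv hv
  have h2 : HasDerivAt (fun s => q s ⬝ᵥ q s) 0 t :=
    (hasDerivAt_const t (1 : ℝ)).congr_of_eventuallyEq
      (Filter.eventually_of_mem (hJ.mem_nhds ht) fun s hs => hq s hs)
  have h3 := h1.unique h2
  rw [dotProduct_comm v] at h3
  linarith

/-! ### The reduced Lagrangian system -/

/-- The force of the reduced system is exactly `∂L/∂q`. The two cancel in the Lagrange-d'Alembert
equations, which then state that the tangential part of `ṗ` vanishes. -/
theorem fderiv_redLagrangian_fst (A q v ξ : Fin n → ℝ) :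
    fderiv ℝ (fun x => redLagrangian A x v) q ξ = redForce A q v ξ := by
  have hd : DifferentiableAt ℝ (fun x => redLagrangian A x v) q := by
    unfold redLagrangian
    have h1 := differentiableAt_bil A (f := fun x => x) (g := fun x => x) (x := q)
      differentiableAt_id differentiableAt_id
    have h2 := differentiableAt_bil A (f := fun x => x) (g := fun _ => v) (x := q)
      differentiableAt_id (differentiableAt_const _)
    exact ((h1.const_mul _).sub (h2.pow 2)).const_mul _
  refine fderiv_apply_eq hd ?_
  have h := (((hasDerivAt_bil_line_self A q ξ).const_mul (bil A v v)).fun_sub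
    ((hasDerivAt_bil_line A q ξ v).fun_pow 2)).const_mul (1 / (2 * ∏ l, A l))
  refine h.congr_deriv ?_
  rw [redForce, bil_comm A ξ v]
  simp
  ring

theorem fderiv_redLagrangian_snd (A q v ξ : Fin n → ℝ) :
    fderiv ℝ (redLagrangian A q) v ξ
      = (∏ l, A l)⁻¹ * (bil A q q * bil A v ξ - bil A q v * bil A q ξ) := by
  have hd : DifferentiableAt ℝ (redLagrangian A q) v := by
    unfold redLagrangian
    have h1 := differentiableAt_bil A (f := fun x => x) (g := fun x => x) (x := v)
      differentiableAt_id differentiableAt_id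
    have h2 := differentiableAt_bil A (f := fun _ => q) (g := fun x => x) (x := v)
      (differentiableAt_const _) differentiableAt_id
    exact ((h1.mul_const _).sub (h2.pow 2)).const_mul _
  refine fderiv_apply_eq hd ?_
  have h := (((hasDerivAt_bil_line_self A v ξ).mul_const (bil A q q)).fun_sub
    ((hasDerivAt_bil_line A v ξ q).fun_pow 2)).const_mul (1 / (2 * ∏ l, A l))
  simp only [bil_comm A _ q] at h
  refine h.congr_deriv ?_
  simp
  ring

theorem bil_single (A x : Fin n → ℝ) (i : Fin n) : bil A x (Pi.single i 1) = A i * x i := by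
  simp [bil_eq_dotProduct]

theorem momentum_redLagrangian (A q v : Fin n → ℝ) :
    momentum (redLagrangian A) q v
      = (∏ l, A l)⁻¹ • (bil A q q • (A * v) - bil A q v • (A * q)) := by
  funext i
  rw [momentum, fderiv_redLagrangian_snd]
  simp [bil_single]

/-- The Lagrangian is a Gram determinant of `q` and `v`, unchanged by `v ↦ v + s q`; so the momentum
is orthogonal to `q`. -/
theorem dotProduct_momentum_red {A q : Fin n → ℝ} (v : Fin n → ℝ) :
    q ⬝ᵥ momentum (redLagrangian A) q v = 0 := by
  rw [momentum_redLagrangian, dotProduct_smul, dotProduct_sub, dotProduct_smul, dotProduct_smul,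
    dotProduct_comm q (A * v), dotProduct_comm q (A * q), ← bil_eq_dotProduct,
    ← bil_eq_dotProduct, bil_comm A v q]
  simp only [smul_eq_mul]
  ring

/-- The velocity from the momentum. -/
theorem velocity_of_momentum {A : Fin n → ℝ} (hA : ∀ i, 0 < A i) {q v : Fin n → ℝ}
    (hq : q ⬝ᵥ q = 1) (hv : q ⬝ᵥ v = 0) :
    v = ((∏ l, A l) / bil A q q) • (A⁻¹ * momentum (redLagrangian A) q v
      - bil A⁻¹ (momentum (redLagrangian A) q v) q • q) := by
  have hb := (bil_self_pos_of_sphere hA hq).ne'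
  have hD := (Finset.prod_pos fun i (_ : i ∈ Finset.univ) => hA i).ne'
  have h1 : A⁻¹ * momentum (redLagrangian A) q v
      = (∏ l, A l)⁻¹ • (bil A q q • v - bil A q v • q) := by
    rw [momentum_redLagrangian, mul_smul_comm, mul_sub, mul_smul_comm, mul_smul_comm,
      inv_mul_mul hA, inv_mul_mul hA]
  have h2 : bil A⁻¹ (momentum (redLagrangian A) q v) q = -((∏ l, A l)⁻¹ * bil A q v) := by
    rw [momentum_redLagrangian, bil_smul_left, bil_sub_left, bil_smul_left, bil_smul_left,
      bil_inv_mul_left hA, bil_inv_mul_left hA, hq, dotProduct_comm v, hv]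
    ring
  rw [h1, h2]
  funext i
  simp only [Pi.smul_apply, Pi.sub_apply, smul_eq_mul]
  field_simp
  ring

/-- The momentum from the velocity. -/
theorem momentum_of_velocity {A : Fin n → ℝ} (hA : ∀ i, 0 < A i) {q p : Fin n → ℝ}
    (hq : q ⬝ᵥ q = 1) (hp : q ⬝ᵥ p = 0) :
    momentum (redLagrangian A) q (((∏ l, A l) / bil A q q) • (A⁻¹ * p - bil A⁻¹ p q • q)) = p := by
  have hb := (bil_self_pos_of_sphere hA hq).ne'
  have hD := (Finset.prod_pos fun i (_ : i ∈ Finset.univ) => hA i).ne'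
  have h1 : bil A q (((∏ l, A l) / bil A q q) • (A⁻¹ * p - bil A⁻¹ p q • q))
      = -((∏ l, A l) * bil A⁻¹ p q) := by
    rw [bil_smul_right, bil_sub_right, bil_smul_right, bil_inv_mul hA, hp]
    field_simp
    ring
  have h2 : A * (((∏ l, A l) / bil A q q) • (A⁻¹ * p - bil A⁻¹ p q • q))
      = ((∏ l, A l) / bil A q q) • (p - bil A⁻¹ p q • (A * q)) := by
    rw [mul_smul_comm, mul_sub, mul_inv_mul hA, mul_smul_comm]
  rw [momentum_redLagrangian, h1, h2]
  funext i
  simp only [Pi.smul_apply, Pi.sub_apply, smul_eq_mul]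
  field_simp
  ring

/-- The Lagrange-d'Alembert equations of the reduced system say that the momentum has a normal
derivative. -/
theorem isLagrangeDAlembert_red_iff (A : Fin n → ℝ) (J : Set ℝ) (q : ℝ → Fin n → ℝ) :
    IsLagrangeDAlembert (redLagrangian A) (redForce A) J q ↔
      ContDiffOn ℝ 2 q J ∧ (∀ t ∈ J, q t ⬝ᵥ q t = 1) ∧ ∀ t ∈ J, ∀ ξ, q t ⬝ᵥ ξ = 0 →
        deriv (fun s => momentum (redLagrangian A) (q s) (deriv q s) ⬝ᵥ ξ) t = 0 := by
  constructor
  · rintro ⟨h1, h2, h3⟩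
    refine ⟨h1, h2, fun t ht ξ hξ => ?_⟩
    have := h3 t ht ξ hξ
    rw [fderiv_redLagrangian_fst] at this
    linarith
  · rintro ⟨h1, h2, h3⟩
    refine ⟨h1, h2, fun t ht ξ hξ => ?_⟩
    rw [fderiv_redLagrangian_fst, h3 t ht ξ hξ, sub_zero]

theorem hasDerivAt_momentum_red (A : Fin n → ℝ) {q : ℝ → Fin n → ℝ} {t : ℝ} {a : Fin n → ℝ}
    (h1 : HasDerivAt q (deriv q t) t) (h2 : HasDerivAt (deriv q) a t) :
    HasDerivAt (fun s => momentum (redLagrangian A) (q s) (deriv q s))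
      ((∏ l, A l)⁻¹ • (bil A (q t) (q t) • (A * a) + bil A (q t) (deriv q t) • (A * deriv q t)
        - (bil A (deriv q t) (deriv q t) + bil A (q t) a) • (A * q t))) t := by
  simp only [momentum_redLagrangian]
  have h := (((hasDerivAt_bil A h1 h1).fun_smul (hasDerivAt_const_mul_vec A h2)).fun_sub
    ((hasDerivAt_bil A h1 h2).fun_smul (hasDerivAt_const_mul_vec A h1))).const_smul ((∏ l, A l)⁻¹)
  refine h.congr_deriv ?_
  rw [bil_comm A (deriv q t) (q t)]
  funext i
  simp only [Pi.smul_apply, Pi.sub_apply, Pi.add_apply, smul_eq_mul]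
  ring

theorem isReducedFlow_iff {A : Fin n → ℝ} (hA : ∀ i, 0 < A i) {J : Set ℝ} (hJ : IsOpen J)
    (q p : ℝ → Fin n → ℝ) :
    IsReducedFlow A J q p ↔
      IsLagrangeDAlembert (redLagrangian A) (redForce A) J q ∧
        ∀ t ∈ J, p t = momentum (redLagrangian A) (q t) (deriv q t) := by
  rw [isLagrangeDAlembert_red_iff]
  constructor
  · rintro ⟨h1, h2, h3⟩
    have hb : ∀ t ∈ J, bil A (q t) (q t) ≠ 0 := fun t ht =>
      (bil_self_pos_of_sphere hA (h1 t ht).1).ne'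
    have hmom : ∀ t ∈ J, momentum (redLagrangian A) (q t) (deriv q t) = p t := by
      intro t ht
      rw [(h2 t ht).deriv]
      exact momentum_of_velocity hA (h1 t ht).1 (h1 t ht).2
    have hq0 : ContDiffOn ℝ 0 q J := contDiffOn_zero.2 fun t ht =>
      (h2 t ht).continuousAt.continuousWithinAt
    have hp0 : ContDiffOn ℝ 0 p J := contDiffOn_zero.2 fun t ht =>
      (h3 t ht).continuousAt.continuousWithinAt
    have hvel : ∀ N : WithTop ℕ∞, ContDiffOn ℝ N q J → ContDiffOn ℝ N p J →
        ContDiffOn ℝ N (fun t => ((∏ l, A l) / bil A (q t) (q t)) •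
          ((fun i => (A i)⁻¹ * p t i) - bil A⁻¹ (p t) (q t) • q t)) J := fun N hq hp =>
      (contDiffOn_const.div (contDiffOn_bil A hq hq) hb).smul
        ((contDiffOn_const_mul_vec A⁻¹ hp).sub ((contDiffOn_bil A⁻¹ hp hq).smul hq))
    -- Bootstrap: continuity of `q`, `p` makes the right-hand sides continuous, hence `q` and `p`
    -- are `C¹`; then the velocity is `C¹` and `q` is `C²`.
    have hq1 := contDiffOn_one_of_hasDerivAt hJ h2 (contDiffOn_zero.1 (hvel 0 hq0 hp0))
    have hp1 := contDiffOn_one_of_hasDerivAt hJ h3 (contDiffOn_zero.1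
      ((((contDiffOn_const.mul ((contDiffOn_bil A⁻¹ hp0 hp0).sub ((contDiffOn_dotProduct hp0 hq0).mul
        (contDiffOn_bil A⁻¹ hq0 hp0)))).div (contDiffOn_bil A hq0 hq0) hb).neg).smul hq0))
    refine ⟨⟨contDiffOn_two_of_hasDerivAt hJ h2 (hvel 1 hq1 hp1), fun t ht => (h1 t ht).1,
      fun t ht ξ hξ => ?_⟩, fun t ht => (hmom t ht).symm⟩
    have h4 := hasDerivAt_dotProduct (h3 t ht) (hasDerivAt_const t ξ)
    rw [smul_dotProduct, hξ, dotProduct_zero, smul_zero, add_zero] at h4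
    refine (h4.congr_of_eventuallyEq ?_).deriv
    filter_upwards [hJ.mem_nhds ht] with s hs
    rw [hmom s hs]
  · rintro ⟨⟨h1, h2, h3⟩, h4⟩
    have hsphere : ∀ t ∈ J, q t ⬝ᵥ q t = 1 ∧ q t ⬝ᵥ p t = 0 := fun t ht =>
      ⟨h2 t ht, by rw [h4 t ht]; exact dotProduct_momentum_red _⟩
    have hvel : ∀ t ∈ J, HasDerivAt q (((∏ l, A l) / bil A (q t) (q t)) •
        ((fun i => (A i)⁻¹ * p t i) - bil A⁻¹ (p t) (q t) • q t)) t := by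
      intro t ht
      have h5 := (hasDerivAt_of_contDiffOn_two hJ h1 ht).1
      have h6 := velocity_of_momentum hA (h2 t ht) (dotProduct_deriv_eq_zero hJ h2 ht h5)
      rw [← h4 t ht] at h6
      exact h5.congr_deriv h6
    refine ⟨hsphere, hvel, fun t ht => ?_⟩
    obtain ⟨h5, h6⟩ := hasDerivAt_of_contDiffOn_two hJ h1 ht
    have h7 := hasDerivAt_momentum_red A h5 h6
    set P := (∏ l, A l)⁻¹ • (bil A (q t) (q t) • (A * deriv (deriv q) t)
      + bil A (q t) (deriv q t) • (A * deriv q t)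
        - (bil A (deriv q t) (deriv q t) + bil A (q t) (deriv (deriv q) t)) • (A * q t))
    have h8 : HasDerivAt p P t := h7.congr_of_eventuallyEq
      (Filter.eventually_of_mem (hJ.mem_nhds ht) fun s hs => h4 s hs)
    have h9 : P = (q t ⬝ᵥ P) • q t := by
      refine eq_smul_of_orthogonal (h2 t ht) fun ξ hξ => ?_
      have := h3 t ht ξ hξ
      rw [(hasDerivAt_dotProduct h7 (hasDerivAt_const t ξ)).deriv] at this
      simpa using this
    -- The normal component of `ṗ` is not determined by the tangential equations; it comes from
    -- differentiating `(q, p) = 0`.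
    have h10 : q t ⬝ᵥ P = -(((∏ l, A l) / bil A (q t) (q t)) * bil A⁻¹ (p t) (p t)) := by
      have e1 := hasDerivAt_dotProduct (hvel t ht) h8
      have e2 : HasDerivAt (fun s => q s ⬝ᵥ p s) 0 t :=
        (hasDerivAt_const t (0 : ℝ)).congr_of_eventuallyEq
          (Filter.eventually_of_mem (hJ.mem_nhds ht) fun s hs => (hsphere s hs).2)
      have e3 := e1.unique e2
      have e4 : (fun i => (A i)⁻¹ * p t i) ⬝ᵥ p t = bil A⁻¹ (p t) (p t) := rfl
      rw [smul_dotProduct, sub_dotProduct, smul_dotProduct, (hsphere t ht).2, e4] at e3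
      simp only [smul_eq_mul, mul_zero, sub_zero] at e3
      linarith
    rw [h9, h10] at h8
    refine h8.congr_deriv ?_
    rw [dotProduct_comm, (hsphere t ht).2, zero_mul, sub_zero]
    congr 1
    ring

/-! ### The Hamiltonian system of `H*` -/

/-- The Hamiltonian vector field of `H*`. -/
theorem isHamVec_star_iff (I : Fin n → ℝ) {x Y : Phase ℝ n} (hx : x ∈ cotangentSphere ℝ n) :
    IsHamVec (starHamiltonian I) x Y ↔ Y = (I * x.2 - bil I x.2 x.1 • x.1,
      bil I x.2 x.1 • x.2 - bil I x.2 x.2 • x.1) := by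
  have hq := hx.1
  have hqp := hx.2
  have h : IsHamVec (starHamiltonian I) x (I * x.2 - bil I x.2 x.1 • x.1,
      bil I x.2 x.1 • x.2 - bil I x.2 x.2 • x.1) := by
    have e1 : x.1 ⬝ᵥ (I * x.2) = bil I x.2 x.1 := by rw [dotProduct_comm]; rfl
    have e2 : x.2 ⬝ᵥ (I * x.2) = bil I x.2 x.2 := by rw [dotProduct_comm]; rfl
    have e3 : x.2 ⬝ᵥ x.1 = 0 := by rw [dotProduct_comm]; exact hqp
    refine ⟨⟨?_, ?_⟩, fun Z hZ => ?_⟩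
    · simp [dotProduct_sub, dotProduct_smul, hq, e1]
    · simp [dotProduct_sub, dotProduct_smul, hq, hqp, e2, e3]
    · rw [fderiv_starHamiltonian]
      have e4 : (I * x.2) ⬝ᵥ Z.2 = ∑ i, I i * (x.2 i * Z.2 i) :=
        Finset.sum_congr rfl fun i _ => by simp only [Pi.mul_apply]; ring
      simp only [symp, sub_dotProduct, smul_dotProduct, e4, hZ.1, smul_eq_mul]
      linear_combination (-bil I x.2 x.1) * hZ.2
  exact ⟨fun hY => hY.unique hx h, fun hY => hY ▸ h⟩

theorem isHamCurve_star_iff (I : Fin n → ℝ) (K : Set ℝ) (Q P : ℝ → Fin n → ℝ) :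
    IsHamCurve (starHamiltonian I) K (fun s => (Q s, P s)) ↔ ∀ s ∈ K,
      (Q s ⬝ᵥ Q s = 1 ∧ Q s ⬝ᵥ P s = 0) ∧
      HasDerivAt Q (I * P s - bil I (P s) (Q s) • Q s) s ∧
      HasDerivAt P (bil I (P s) (Q s) • P s - bil I (P s) (P s) • Q s) s := by
  refine forall₂_congr fun s _ => and_congr_right fun hx => ⟨?_, ?_⟩
  · rintro ⟨Y, hY, hYh⟩
    rw [isHamVec_star_iff I hx] at hYh
    subst hYh
    exact ⟨hasDerivAt_pi.2 fun i => hasDerivAt_fst hY i, hasDerivAt_pi.2 fun i => hasDerivAt_snd hY i⟩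
  · rintro ⟨h1, h2⟩
    exact ⟨_, h1.prodMk h2, (isHamVec_star_iff I hx).2 rfl⟩

/-! ### Chaplygin's time substitution -/

theorem multiplier_pos {A : Fin n → ℝ} (hA : ∀ i, 0 < A i) {q : Fin n → ℝ} (hq : q ⬝ᵥ q = 1) :
    0 < multiplier A q :=
  Real.sqrt_pos.2 (div_pos (Finset.prod_pos fun i _ => hA i) (bil_self_pos_of_sphere hA hq))

theorem multiplier_sq {A : Fin n → ℝ} (hA : ∀ i, 0 < A i) {q : Fin n → ℝ} (hq : q ⬝ᵥ q = 1) :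
    multiplier A q ^ 2 = (∏ l, A l) / bil A q q :=
  Real.sq_sqrt (div_pos (Finset.prod_pos fun i _ => hA i) (bil_self_pos_of_sphere hA hq)).le

/-- Since `𝒩` is a constant times `(q, A q)^{-1/2}`, its logarithmic derivative is `-(q, A q̇) / (q,
A q)`. -/
theorem hasDerivAt_multiplier {A : Fin n → ℝ} (hA : ∀ i, 0 < A i) {q : ℝ → Fin n → ℝ}
    {v : Fin n → ℝ} {t : ℝ} (hq : q t ⬝ᵥ q t = 1) (hv : HasDerivAt q v t) :
    HasDerivAt (fun s => multiplier A (q s))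
      (-(multiplier A (q t) * (bil A (q t) v / bil A (q t) (q t)))) t := by
  have hb := (bil_self_pos_of_sphere hA hq).ne'
  have hN := (multiplier_pos hA hq).ne'
  have hD := (Finset.prod_pos fun i (_ : i ∈ Finset.univ) => hA i)
  have h1 := ((hasDerivAt_const t (∏ l, A l)).fun_div (hasDerivAt_bil A hv hv) hb).sqrt
    (div_pos hD (bil_self_pos_of_sphere hA hq)).ne'
  refine h1.congr_deriv ?_
  have h2 : √((∏ l, A l) / bil A (q t) (q t)) = multiplier A (q t) := rfl
  have h3 := multiplier_sq hA hq
  rw [h2, bil_comm A v (q t), div_eq_iff (by positivity)]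
  rw [eq_div_iff hb] at h3
  field_simp
  linear_combination (2 * bil A (q t) v) * h3

theorem reduced_velocity_eq {A : Fin n → ℝ} (hA : ∀ i, 0 < A i) {q p : Fin n → ℝ}
    (hq : q ⬝ᵥ q = 1) :
    (multiplier A q)⁻¹ • (((∏ l, A l) / bil A q q) • ((fun i => (A i)⁻¹ * p i)
        - bil A⁻¹ p q • q))
      = A⁻¹ * (multiplier A q • p) - bil A⁻¹ (multiplier A q • p) q • q := by
  have hN := (multiplier_pos hA hq).ne'
  rw [← multiplier_sq hA hq, bil_smul_left]
  funext i
  simp only [Pi.smul_apply, Pi.sub_apply, Pi.mul_apply, Pi.inv_apply, smul_eq_mul]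
  field_simp

/-- Along the reduced flow this gives `d𝒩/dτ = 𝒩² (A⁻¹p, q)`, which produces the term `(A⁻¹p̃, q)
p̃` missing from the reduced equation for the momentum. -/
theorem reduced_bil_velocity {A : Fin n → ℝ} (hA : ∀ i, 0 < A i) {q p : Fin n → ℝ}
    (hq : q ⬝ᵥ q = 1) (hqp : q ⬝ᵥ p = 0) :
    bil A q (((∏ l, A l) / bil A q q) • ((fun i => (A i)⁻¹ * p i) - bil A⁻¹ p q • q))
      / bil A q q = -(multiplier A q ^ 2 * bil A⁻¹ p q) := by
  have hb := (bil_self_pos_of_sphere hA hq).ne'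
  have h1 : (fun i => (A i)⁻¹ * p i) = A⁻¹ * p := rfl
  rw [multiplier_sq hA hq, h1, bil_smul_right, bil_sub_right, bil_smul_right, bil_inv_mul hA, hqp]
  field_simp
  ring

/-- The velocity of the rescaled momentum. -/
theorem reduced_force_eq {A : Fin n → ℝ} (hA : ∀ i, 0 < A i) {q p : Fin n → ℝ}
    (hq : q ⬝ᵥ q = 1) (hqp : q ⬝ᵥ p = 0) :
    (multiplier A q)⁻¹ • (multiplier A q •
        (-((∏ l, A l) * (bil A⁻¹ p p - (p ⬝ᵥ q) * bil A⁻¹ q p) / bil A q q) • q)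
        + -(multiplier A q * -(multiplier A q ^ 2 * bil A⁻¹ p q)) • p)
      = bil A⁻¹ (multiplier A q • p) q • multiplier A q • p
        - bil A⁻¹ (multiplier A q • p) (multiplier A q • p) • q := by
  have hN := (multiplier_pos hA hq).ne'
  have h1 : (∏ l, A l) * (bil A⁻¹ p p - (p ⬝ᵥ q) * bil A⁻¹ q p) / bil A q q
      = multiplier A q ^ 2 * bil A⁻¹ p p := by
    rw [multiplier_sq hA hq, dotProduct_comm, hqp]; ring
  rw [h1, bil_smul_left, bil_smul_left, bil_smul_right]
  funext i
  simp only [Pi.smul_apply, Pi.sub_apply, Pi.add_apply, smul_eq_mul]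
  field_simp
  ring

theorem isReducedFlow_iff_isHamCurve {A : Fin n → ℝ} (hA : ∀ i, 0 < A i) {J : Set ℝ}
    (hJ : IsOpen J) {q p : ℝ → Fin n → ℝ} {τ : ℝ → ℝ} {Q P : ℝ → Fin n → ℝ}
    (hτ : ∀ t ∈ J, HasDerivAt τ (multiplier A (q t)) t)
    (hQP : ∀ t ∈ J, Q (τ t) = q t ∧ P (τ t) = multiplier A (q t) • p t) :
    IsReducedFlow A J q p ↔
      IsHamCurve (starHamiltonian fun i => (A i)⁻¹) (τ '' J) fun s => (Q s, P s) := by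
  have hAinv : (fun i => (A i)⁻¹) = A⁻¹ := rfl
  rw [hAinv, isHamCurve_star_iff]
  constructor
  · rintro ⟨h1, h2, h3⟩ _ ⟨t, ht, rfl⟩
    obtain ⟨hq, hqp⟩ := h1 t ht
    have hN := (multiplier_pos hA hq).ne'
    have hmul := hasDerivAt_multiplier hA hq (h2 t ht)
    -- The derivative of `τ` is continuous and positive, so `τ` has a differentiable local inverse;
    -- only this local inverse is used to express `Q` and `P` through `q` and `p`.
    have hstrict : HasStrictDerivAt τ (multiplier A (q t)) t :=
      hasStrictDerivAt_of_hasDerivAt_of_continuousAt (f' := fun s => multiplier A (q s))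
        (Filter.eventually_of_mem (hJ.mem_nhds ht) hτ) hmul.continuousAt
    set σ := hstrict.localInverse τ _ t hN with hσ
    have hσd : HasDerivAt σ (multiplier A (q t))⁻¹ (τ t) := (hstrict.to_localInverse hN).hasDerivAt
    have hσt : σ (τ t) = t := HasStrictFDerivAt.localInverse_apply_image _
    have hσr : ∀ᶠ s in nhds (τ t), τ (σ s) = s := HasStrictDerivAt.eventually_right_inverse ..
    have hσJ : ∀ᶠ s in nhds (τ t), σ s ∈ J := by
      refine hσd.continuousAt.eventually_mem ?_
      rw [hσt]; exact hJ.mem_nhds ht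
    have hQ : Q =ᶠ[nhds (τ t)] fun s => q (σ s) := by
      filter_upwards [hσr, hσJ] with s e1 e2
      rw [← (hQP _ e2).1, e1]
    have hP : P =ᶠ[nhds (τ t)] fun s => multiplier A (q (σ s)) • p (σ s) := by
      filter_upwards [hσr, hσJ] with s e1 e2
      rw [← (hQP _ e2).2, e1]
    rw [(hQP t ht).1, (hQP t ht).2, ← reduced_velocity_eq hA hq, ← reduced_force_eq hA hq hqp]
    refine ⟨⟨hq, by rw [dotProduct_smul, hqp, smul_zero]⟩, ?_, ?_⟩
    · have h4 := h2 t ht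
      rw [← hσt] at h4
      have h5 := (h4.scomp (τ t) hσd).congr_of_eventuallyEq hQ
      rw [hσt] at h5
      exact h5
    · rw [reduced_bil_velocity hA hq hqp] at hmul
      have h4 := hmul.fun_smul (h3 t ht)
      rw [← hσt] at h4
      have h5 := (h4.scomp (τ t) hσd).congr_of_eventuallyEq hP
      rw [hσt] at h5
      exact h5
  · intro h
    have h' : ∀ t ∈ J, _ := fun t ht => h (τ t) ⟨t, ht, rfl⟩
    have hq : ∀ t ∈ J, q t ⬝ᵥ q t = 1 := fun t ht => by
      have := (h' t ht).1.1
      rwa [(hQP t ht).1] at this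
    have hNpos : ∀ t ∈ J, multiplier A (q t) ≠ 0 := fun t ht => (multiplier_pos hA (hq t ht)).ne'
    have hqp : ∀ t ∈ J, q t ⬝ᵥ p t = 0 := fun t ht => by
      have := (h' t ht).1.2
      rw [(hQP t ht).1, (hQP t ht).2, dotProduct_smul, smul_eq_mul] at this
      exact (mul_eq_zero.1 this).resolve_left (hNpos t ht)
    have hvel : ∀ t ∈ J, HasDerivAt q (((∏ l, A l) / bil A (q t) (q t)) •
        ((fun i => (A i)⁻¹ * p t i) - bil A⁻¹ (p t) (q t) • q t)) t := by
      intro t ht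
      have h1 := ((h' t ht).2.1).scomp t (hτ t ht)
      rw [(hQP t ht).1, (hQP t ht).2, ← reduced_velocity_eq hA (hq t ht), smul_smul,
        mul_inv_cancel₀ (hNpos t ht), one_smul] at h1
      exact h1.congr_of_eventuallyEq
        (Filter.eventually_of_mem (hJ.mem_nhds ht) fun s hs => ((hQP s hs).1).symm)
    refine ⟨fun t ht => ⟨hq t ht, hqp t ht⟩, hvel, fun t ht => ?_⟩
    have hmul := hasDerivAt_multiplier hA (hq t ht) (hvel t ht)
    rw [reduced_bil_velocity hA (hq t ht) (hqp t ht)] at hmul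
    have h1 := ((h' t ht).2.2).scomp t (hτ t ht)
    rw [(hQP t ht).1, (hQP t ht).2, ← reduced_force_eq hA (hq t ht) (hqp t ht), smul_smul,
      mul_inv_cancel₀ (hNpos t ht), one_smul] at h1
    -- The momentum is recovered as `𝒩⁻¹ (P ∘ τ)`, and the derivative of `𝒩⁻¹` removes the term
    -- `(A⁻¹p̃, q) p̃`.
    have h2 := (hmul.fun_inv (hNpos t ht)).fun_smul h1
    have h3 : p =ᶠ[nhds t] fun s => (multiplier A (q s))⁻¹ • (P ∘ τ) s := by
      filter_upwards [hJ.mem_nhds ht] with s hs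
      rw [Function.comp_apply, (hQP s hs).2, smul_smul, inv_mul_cancel₀ (hNpos s hs), one_smul]
    refine (h2.congr_of_eventuallyEq h3).congr_deriv ?_
    have hN := hNpos t ht
    rw [Function.comp_apply, (hQP t ht).2]
    funext i
    simp only [Pi.smul_apply, Pi.add_apply, smul_eq_mul]
    field_simp
    ring

/-! ### The geodesic flow -/

theorem fderiv_starLagrangian_snd (A q v ξ : Fin n → ℝ) :
    fderiv ℝ (starLagrangian A q) v ξ
      = (bil A q q)⁻¹ * (bil A q q * bil A v ξ - bil A q v * bil A q ξ) := by
  have hd : DifferentiableAt ℝ (starLagrangian A q) v := by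
    unfold starLagrangian
    have h1 := differentiableAt_bil A (f := fun x => x) (g := fun x => x) (x := v)
      differentiableAt_id differentiableAt_id
    have h2 := differentiableAt_bil A (f := fun _ => q) (g := fun x => x) (x := v)
      (differentiableAt_const _) differentiableAt_id
    exact ((h1.mul_const _).sub (h2.pow 2)).const_mul _
  refine fderiv_apply_eq hd ?_
  have h := (((hasDerivAt_bil_line_self A v ξ).mul_const (bil A q q)).fun_sub
    ((hasDerivAt_bil_line A v ξ q).fun_pow 2)).const_mul (1 / 2 * (bil A q q)⁻¹)
  simp only [bil_comm A _ q] at h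
  refine h.congr_deriv ?_
  simp
  ring

theorem momentum_starLagrangian {A q : Fin n → ℝ} (hb : bil A q q ≠ 0) (v : Fin n → ℝ) :
    momentum (starLagrangian A) q v = A * v - (bil A q v / bil A q q) • (A * q) := by
  funext i
  rw [momentum, fderiv_starLagrangian_snd]
  simp only [bil_single, Pi.sub_apply, Pi.mul_apply, Pi.smul_apply, smul_eq_mul]
  field_simp

/-- The gradient in `q` is a multiple of the momentum itself. By `velocity_of_momentum_star` the
factor is `(A⁻¹p, q)`, the coefficient of `p` in Hamilton's equations on the sphere. -/
theorem fderiv_starLagrangian_fst {A q : Fin n → ℝ} (hb : bil A q q ≠ 0) (v ξ : Fin n → ℝ) :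
    fderiv ℝ (fun x => starLagrangian A x v) q ξ
      = -(bil A q v / bil A q q) * (momentum (starLagrangian A) q v ⬝ᵥ ξ) := by
  have hd : DifferentiableAt ℝ (fun x => starLagrangian A x v) q := by
    unfold starLagrangian
    have h1 := differentiableAt_bil A (f := fun x => x) (g := fun x => x) (x := q)
      differentiableAt_id differentiableAt_id
    have h2 := differentiableAt_bil A (f := fun x => x) (g := fun _ => v) (x := q)
      differentiableAt_id (differentiableAt_const _)
    exact ((h1.inv hb).const_mul _).mul ((h1.const_mul _).sub (h2.pow 2))
  refine fderiv_apply_eq hd ?_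
  have hb' : bil A (q + (0 : ℝ) • ξ) (q + (0 : ℝ) • ξ) ≠ 0 := by simpa using hb
  have h := (((hasDerivAt_bil_line_self A q ξ).fun_inv hb').const_mul (1 / 2)).fun_mul
    (((hasDerivAt_bil_line_self A q ξ).const_mul (bil A v v)).fun_sub
      ((hasDerivAt_bil_line A q ξ v).fun_pow 2))
  refine h.congr_deriv ?_
  rw [momentum_starLagrangian hb, sub_dotProduct, smul_dotProduct, ← bil_eq_dotProduct,
    ← bil_eq_dotProduct, bil_comm A ξ v]
  simp only [zero_smul, add_zero, smul_eq_mul]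
  field_simp
  ring

theorem starLagrangian_pos {A : Fin n → ℝ} (hA : ∀ i, 0 < A i) {q v : Fin n → ℝ}
    (hq : q ⬝ᵥ q = 1) (hqv : q ⬝ᵥ v = 0) (hv : v ≠ 0) : 0 < starLagrangian A q v := by
  have hb := bil_self_pos_of_sphere hA hq
  -- The standard vector of the Cauchy-Schwarz inequality: `(A w, w)` is `(A q, q)` times the Gram
  -- determinant, and `w ≠ 0` because `v ⊥ q`.
  set w := bil A q q • v - bil A q v • q with hw
  have hw0 : w ≠ 0 := by
    intro h0
    have h1 : q ⬝ᵥ w = -bil A q v := by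
      simp [hw, dotProduct_sub, dotProduct_smul, hq, hqv]
    rw [h0, dotProduct_zero] at h1
    have h2 : bil A q v = 0 := by linarith
    rw [hw, h2, zero_smul, sub_zero, smul_eq_zero] at h0
    exact h0.elim hb.ne' hv
  have h3 := bil_self_pos hA hw0
  have h4 : bil A w w = bil A q q * (bil A v v * bil A q q - bil A q v ^ 2) := by
    simp only [hw, bil_sub_left, bil_sub_right, bil_smul_left, bil_smul_right, bil_comm A v q]
    ring
  rw [h4] at h3
  have h5 := (mul_pos_iff_of_pos_left hb).1 h3
  exact mul_pos (mul_pos (by norm_num) (inv_pos.2 hb)) h5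

theorem dotProduct_momentum_star {A q : Fin n → ℝ} (hb : bil A q q ≠ 0) (v : Fin n → ℝ) :
    q ⬝ᵥ momentum (starLagrangian A) q v = 0 := by
  rw [momentum_starLagrangian hb, dotProduct_sub, dotProduct_smul, dotProduct_comm q (A * v),
    dotProduct_comm q (A * q), ← bil_eq_dotProduct, ← bil_eq_dotProduct, bil_comm A v q,
    smul_eq_mul, div_mul_cancel₀ _ hb, sub_self]

theorem legendre_star {A : Fin n → ℝ} (hA : ∀ i, 0 < A i) {q : Fin n → ℝ} (hq : q ⬝ᵥ q = 1)
    (v : Fin n → ℝ) :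
    starHamiltonian (fun i => (A i)⁻¹) (q, momentum (starLagrangian A) q v)
      = momentum (starLagrangian A) q v ⬝ᵥ v - starLagrangian A q v := by
  have hb := (bil_self_pos_of_sphere hA hq).ne'
  have h1 : starHamiltonian (fun i => (A i)⁻¹) (q, momentum (starLagrangian A) q v)
      = 1 / 2 * bil A⁻¹ (momentum (starLagrangian A) q v) (momentum (starLagrangian A) q v) := by
    simp only [starHamiltonian, bil, Pi.inv_apply]
    congr 1
    exact Finset.sum_congr rfl fun i _ => by ring
  have h2 : A * v - (bil A q v / bil A q q) • (A * q) = A * (v - (bil A q v / bil A q q) • q) := by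
    rw [mul_sub, mul_smul_comm]
  rw [h1, momentum_starLagrangian hb]
  nth_rewrite 1 [h2]
  rw [bil_inv_mul_left hA]
  simp only [sub_dotProduct, dotProduct_sub, smul_dotProduct, dotProduct_smul, starLagrangian,
    ← bil_eq_dotProduct, smul_eq_mul, dotProduct_comm v (A * _), dotProduct_comm q (A * _),
    bil_comm A v q]
  field_simp
  ring

theorem velocity_of_momentum_star {A : Fin n → ℝ} (hA : ∀ i, 0 < A i) {q v : Fin n → ℝ}
    (hq : q ⬝ᵥ q = 1) (hqv : q ⬝ᵥ v = 0) :
    bil A⁻¹ (momentum (starLagrangian A) q v) q = -(bil A q v / bil A q q) ∧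
    A⁻¹ * momentum (starLagrangian A) q v
      - bil A⁻¹ (momentum (starLagrangian A) q v) q • q = v := by
  have hb := (bil_self_pos_of_sphere hA hq).ne'
  have h1 : bil A⁻¹ (momentum (starLagrangian A) q v) q = -(bil A q v / bil A q q) := by
    rw [momentum_starLagrangian hb, bil_sub_left, bil_smul_left, bil_inv_mul_left hA,
      bil_inv_mul_left hA, hq, dotProduct_comm, hqv]
    ring
  refine ⟨h1, ?_⟩
  rw [h1, momentum_starLagrangian hb, mul_sub, mul_smul_comm, inv_mul_mul hA, inv_mul_mul hA]
  funext i
  simp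

theorem momentum_star_of_velocity {A : Fin n → ℝ} (hA : ∀ i, 0 < A i) {q p : Fin n → ℝ}
    (hq : q ⬝ᵥ q = 1) (hqp : q ⬝ᵥ p = 0) :
    momentum (starLagrangian A) q (A⁻¹ * p - bil A⁻¹ p q • q) = p := by
  have hb := (bil_self_pos_of_sphere hA hq).ne'
  rw [momentum_starLagrangian hb, bil_sub_right, bil_smul_right, bil_inv_mul hA, hqp, mul_sub,
    mul_inv_mul hA, mul_smul_comm]
  funext i
  simp only [Pi.sub_apply, Pi.smul_apply, smul_eq_mul, Pi.mul_apply]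
  field_simp
  ring

theorem isHamCurve_star_iff_geodesic {A : Fin n → ℝ} (hA : ∀ i, 0 < A i) {K : Set ℝ}
    (hK : IsOpen K) (Q P : ℝ → Fin n → ℝ) :
    IsHamCurve (starHamiltonian fun i => (A i)⁻¹) K (fun s => (Q s, P s)) ↔
      IsLagrangeDAlembert (starLagrangian A) (fun _ _ _ => 0) K Q ∧
        ∀ s ∈ K, P s = momentum (starLagrangian A) (Q s) (deriv Q s) := by
  have hAinv : (fun i => (A i)⁻¹) = A⁻¹ := rfl
  rw [hAinv, isHamCurve_star_iff]
  constructor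
  · intro h
    have h2 : ∀ s ∈ K, _ := fun s hs => (h s hs).2.1
    have h3 : ∀ s ∈ K, _ := fun s hs => (h s hs).2.2
    have hmom : ∀ s ∈ K, momentum (starLagrangian A) (Q s) (deriv Q s) = P s := by
      intro s hs
      rw [(h2 s hs).deriv]
      exact momentum_star_of_velocity hA (h s hs).1.1 (h s hs).1.2
    have hq0 : ContDiffOn ℝ 0 Q K := contDiffOn_zero.2 fun t ht =>
      (h2 t ht).continuousAt.continuousWithinAt
    have hp0 : ContDiffOn ℝ 0 P K := contDiffOn_zero.2 fun t ht =>
      (h3 t ht).continuousAt.continuousWithinAt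
    have hvel : ∀ N : WithTop ℕ∞, ContDiffOn ℝ N Q K → ContDiffOn ℝ N P K →
        ContDiffOn ℝ N (fun t => A⁻¹ * P t - bil A⁻¹ (P t) (Q t) • Q t) K := fun N hq hp =>
      (contDiffOn_const_mul_vec A⁻¹ hp).sub ((contDiffOn_bil A⁻¹ hp hq).smul hq)
    have hq1 := contDiffOn_one_of_hasDerivAt hK h2 (contDiffOn_zero.1 (hvel 0 hq0 hp0))
    have hp1 := contDiffOn_one_of_hasDerivAt hK h3 (contDiffOn_zero.1
      (((contDiffOn_bil A⁻¹ hp0 hq0).smul hp0).sub ((contDiffOn_bil A⁻¹ hp0 hp0).smul hq0)))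
    refine ⟨⟨contDiffOn_two_of_hasDerivAt hK h2 (hvel 1 hq1 hp1), fun t ht => (h t ht).1.1,
      fun t ht ξ hξ => ?_⟩, fun t ht => (hmom t ht).symm⟩
    have hb := (bil_self_pos_of_sphere hA (h t ht).1.1).ne'
    have hv := dotProduct_deriv_eq_zero hK (fun s hs => (h s hs).1.1) ht (h2 t ht)
    have h4 := hasDerivAt_dotProduct (h3 t ht) (hasDerivAt_const t ξ)
    have h5 : HasDerivAt (fun s => momentum (starLagrangian A) (Q s) (deriv Q s) ⬝ᵥ ξ) _ t :=
      h4.congr_of_eventuallyEq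
        (Filter.eventually_of_mem (hK.mem_nhds ht) fun s hs => by simp only [hmom s hs])
    have h6 := (velocity_of_momentum_star hA (h t ht).1.1 hv).1
    rw [← (h2 t ht).deriv, hmom t ht] at h6
    rw [h5.deriv, fderiv_starLagrangian_fst hb, hmom t ht, ← h6, sub_dotProduct, smul_dotProduct,
      smul_dotProduct, hξ]
    simp
  · rintro ⟨⟨h1, h2, h3⟩, h4⟩ t ht
    have hb : ∀ s ∈ K, bil A (Q s) (Q s) ≠ 0 := fun s hs =>
      (bil_self_pos_of_sphere hA (h2 s hs)).ne'
    obtain ⟨h5, h6⟩ := hasDerivAt_of_contDiffOn_two hK h1 ht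
    have hperp : ∀ s ∈ K, Q s ⬝ᵥ P s = 0 := fun s hs => by
      rw [h4 s hs]; exact dotProduct_momentum_star (hb s hs) _
    have hvel := velocity_of_momentum_star hA (h2 t ht) (dotProduct_deriv_eq_zero hK h2 ht h5)
    rw [← h4 t ht] at hvel
    have h7 : HasDerivAt Q (A⁻¹ * P t - bil A⁻¹ (P t) (Q t) • Q t) t := h5.congr_deriv hvel.2.symm
    obtain ⟨P', h8⟩ : ∃ P', HasDerivAt P P' t := by
      refine ⟨_, HasDerivAt.congr_of_eventuallyEq ((hasDerivAt_const_mul_vec A h6).fun_sub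
        (((hasDerivAt_bil A h5 h6).fun_div (hasDerivAt_bil A h5 h5) (hb t ht)).fun_smul
          (hasDerivAt_const_mul_vec A h5))) ?_⟩
      filter_upwards [hK.mem_nhds ht] with s hs
      rw [h4 s hs, momentum_starLagrangian (hb s hs)]
    refine ⟨⟨h2 t ht, hperp t ht⟩, h7, ?_⟩
    set β := bil A⁻¹ (P t) (Q t) with hβ
    -- The Euler-Lagrange equations say that `P' - β P` is normal to the sphere; its normal
    -- component follows from `(Q, P) = 0`.
    have h9 : P' - β • P t = (Q t ⬝ᵥ (P' - β • P t)) • Q t := by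
      refine eq_smul_of_orthogonal (h2 t ht) fun ξ hξ => ?_
      have e1 := h3 t ht ξ hξ
      have e2 : HasDerivAt (fun s => momentum (starLagrangian A) (Q s) (deriv Q s) ⬝ᵥ ξ) _ t :=
        (hasDerivAt_dotProduct h8 (hasDerivAt_const t ξ)).congr_of_eventuallyEq
          (Filter.eventually_of_mem (hK.mem_nhds ht) fun s hs => by simp only [h4 s hs])
      rw [e2.deriv, fderiv_starLagrangian_fst (hb t ht), ← h4 t ht, ← hvel.1,
        dotProduct_zero, add_zero] at e1
      rw [sub_dotProduct, smul_dotProduct, smul_eq_mul]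
      linarith
    have h10 : Q t ⬝ᵥ P' = -bil A⁻¹ (P t) (P t) := by
      have e1 := hasDerivAt_dotProduct h7 h8
      have e2 : HasDerivAt (fun s => Q s ⬝ᵥ P s) 0 t :=
        (hasDerivAt_const t (0 : ℝ)).congr_of_eventuallyEq
          (Filter.eventually_of_mem (hK.mem_nhds ht) fun s hs => hperp s hs)
      have e3 := e1.unique e2
      rw [sub_dotProduct, smul_dotProduct, hperp t ht, smul_zero, sub_zero,
        ← bil_eq_dotProduct] at e3
      linarith
    rw [dotProduct_sub, dotProduct_smul, hperp t ht, smul_zero, sub_zero, h10] at h9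
    refine h8.congr_deriv ?_
    rw [sub_eq_iff_eq_add] at h9
    rw [h9]
    funext i
    simp only [Pi.add_apply, Pi.sub_apply, Pi.smul_apply, smul_eq_mul]
    ring

end Mechanics


/-! ### Global solutions of skew-symmetric linear equations. -/

section LinearODE

variable {n : ℕ}

theorem eqOn_const_of_hasDerivWithinAt_zero {f : ℝ → ℝ} {S : Set ℝ} (hS : Convex ℝ S)
    (h : ∀ t ∈ S, HasDerivWithinAt f 0 S t) {s t : ℝ} (hs : s ∈ S) (ht : t ∈ S) : f s = f t := by
  have := hS.norm_image_sub_le_of_norm_hasDerivWithin_le (C := 0) h (by simp) ht hs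
  rw [zero_mul, norm_le_zero_iff, sub_eq_zero] at this
  exact this

theorem hasDerivWithinAt_dotProduct {x y : ℝ → Fin n → ℝ} {x' y' : Fin n → ℝ} {t : ℝ} {S : Set ℝ}
    (hx : HasDerivWithinAt x x' S t) (hy : HasDerivWithinAt y y' S t) :
    HasDerivWithinAt (fun s => x s ⬝ᵥ y s) (x' ⬝ᵥ y t + x t ⬝ᵥ y') S t := by
  simp only [dotProduct, ← Finset.sum_add_distrib]
  exact HasDerivWithinAt.fun_sum fun i _ =>
    (hasDerivWithinAt_pi.1 hx i).fun_mul (hasDerivWithinAt_pi.1 hy i)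

theorem dotProduct_self_nonneg (x : Fin n → ℝ) : 0 ≤ x ⬝ᵥ x :=
  Finset.sum_nonneg fun _ _ => mul_self_nonneg _

theorem norm_le_one_add_dotProduct (x : Fin n → ℝ) : ‖x‖ ≤ 1 + x ⬝ᵥ x := by
  rw [pi_norm_le_iff_of_nonneg (by have := dotProduct_self_nonneg x; linarith)]
  intro i
  have h1 : x i * x i ≤ x ⬝ᵥ x :=
    Finset.single_le_sum (f := fun i => x i * x i) (fun j _ => mul_self_nonneg _)
      (Finset.mem_univ i)
  rw [Real.norm_eq_abs]
  nlinarith [sq_abs (x i), sq_nonneg (|x i| - 1), abs_nonneg (x i)]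

/-- Solutions of a skew-symmetric linear equation on a compact interval. -/
theorem exists_solution_Icc {a b : ℝ} {M : ℝ → (Fin n → ℝ) →L[ℝ] (Fin n → ℝ)}
    (hM : ContinuousOn M (Set.Icc a b)) (hskew : ∀ t ∈ Set.Icc a b, ∀ x, x ⬝ᵥ M t x = 0)
    {t₀ : ℝ} (ht₀ : t₀ ∈ Set.Icc a b) (x₀ : Fin n → ℝ) :
    ∃ x : ℝ → Fin n → ℝ, x t₀ = x₀ ∧
      ∀ t ∈ Set.Icc a b, HasDerivWithinAt x (M t (x t)) (Set.Icc a b) t := by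
  obtain ⟨K, hK⟩ := isCompact_Icc.exists_bound_of_continuousOn hM
  have hK0 : 0 ≤ K := (norm_nonneg _).trans (hK t₀ ht₀)
  set R : ℝ := 1 + x₀ ⬝ᵥ x₀ with hR
  have hRpos : 0 < R := by have := dotProduct_self_nonneg x₀; linarith
  -- The cutoff makes the field bounded and globally Lipschitz, so Picard-Lindelöf covers the whole
  -- interval. Skewness survives multiplication by a scalar, so `(x, x)` is constant along the
  -- solution, which remains where the cutoff is `1`.
  let φ : ContDiffBump (0 : Fin n → ℝ) := ⟨R, R + 1, hRpos, by linarith⟩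
  have hφ1 : ∀ x, ‖x‖ ≤ R → φ x = 1 := fun x hx =>
    φ.one_of_mem_closedBall (by simpa using hx)
  have hg : ContDiff ℝ 1 fun x => φ x • x := φ.contDiff.smul contDiff_id
  have hgc : HasCompactSupport fun x => φ x • x := φ.hasCompactSupport.smul_right
  obtain ⟨C, hC⟩ := hg.lipschitzWith_of_hasCompactSupport hgc one_ne_zero
  obtain ⟨B, hB⟩ := hgc.exists_bound_of_continuous hg.continuous
  have hB0 : 0 ≤ B := (norm_nonneg _).trans (hB 0)
  set f : ℝ → (Fin n → ℝ) → Fin n → ℝ := fun t x => M t (φ x • x) with hf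
  have hpl : IsPicardLindelof f (⟨t₀, ht₀⟩ : Set.Icc a b) x₀
      ⟨K * B * max (b - t₀) (t₀ - a), by
        have : 0 ≤ b - t₀ := sub_nonneg.2 ht₀.2
        positivity⟩ 0 ⟨K * B, by positivity⟩ (⟨K, hK0⟩ * C) := by
    refine ⟨fun t ht => ?_, fun x _ => ?_, fun t ht x _ => ?_, ?_⟩
    · have h1 : LipschitzWith ⟨K, hK0⟩ (M t) :=
        (M t).lipschitz.weaken (by exact_mod_cast hK t ht)
      exact (h1.comp hC).lipschitzOnWith
    · exact hM.clm_apply continuousOn_const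
    · exact ((M t).le_opNorm _).trans (mul_le_mul (hK t ht) (hB x) (norm_nonneg _) hK0)
    · change K * B * max (b - t₀) (t₀ - a) ≤ K * B * max (b - t₀) (t₀ - a) - 0
      rw [sub_zero]
  obtain ⟨x, hx0, hx⟩ := hpl.exists_eq_forall_mem_Icc_hasDerivWithinAt₀
  have hx0' : x t₀ = x₀ := hx0
  refine ⟨x, hx0', fun t ht => ?_⟩
  have hconst : ∀ s ∈ Set.Icc a b, x s ⬝ᵥ x s = x₀ ⬝ᵥ x₀ := by
    intro s hs
    rw [← hx0']
    refine eqOn_const_of_hasDerivWithinAt_zero (convex_Icc a b) (f := fun s => x s ⬝ᵥ x s)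
      (fun r hr => ?_) hs ht₀
    have h1 := hasDerivWithinAt_dotProduct (hx r hr) (hx r hr)
    have h2 : x r ⬝ᵥ f r (x r) = 0 := by
      simp only [hf, map_smul, dotProduct_smul, hskew r hr, smul_zero]
    rwa [dotProduct_comm, h2, add_zero] at h1
  have h1 := hx t ht
  have h2 : φ (x t) = 1 := hφ1 _ (by rw [hR, ← hconst t ht]; exact norm_le_one_add_dotProduct _)
  simp only [hf, h2, one_smul] at h1
  exact h1

theorem eqOn_of_solutions {S : Set ℝ} (hS : Convex ℝ S)
    {M : ℝ → (Fin n → ℝ) →L[ℝ] (Fin n → ℝ)} (hskew : ∀ t ∈ S, ∀ x, x ⬝ᵥ M t x = 0)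
    {x y : ℝ → Fin n → ℝ} (hx : ∀ t ∈ S, HasDerivWithinAt x (M t (x t)) S t)
    (hy : ∀ t ∈ S, HasDerivWithinAt y (M t (y t)) S t) {t₀ t : ℝ} (ht₀ : t₀ ∈ S) (ht : t ∈ S)
    (h0 : x t₀ = y t₀) : x t = y t := by
  have h1 : (x t - y t) ⬝ᵥ (x t - y t) = (x t₀ - y t₀) ⬝ᵥ (x t₀ - y t₀) := by
    refine eqOn_const_of_hasDerivWithinAt_zero hS
      (f := fun s => (x s - y s) ⬝ᵥ (x s - y s)) (fun r hr => ?_) ht ht₀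
    have h2 := (hx r hr).fun_sub (hy r hr)
    rw [← map_sub] at h2
    have h3 := hasDerivWithinAt_dotProduct h2 h2
    rwa [dotProduct_comm, hskew r hr, add_zero] at h3
  rw [h0, sub_self, dotProduct_zero] at h1
  exact sub_eq_zero.1 (dotProduct_self_eq_zero.1 h1)

/-- Solutions of a skew-symmetric linear equation on an open interval. -/
theorem exists_solution_of_isOpen {J : Set ℝ} (hJ : IsOpen J) (hJc : J.OrdConnected)
    {M : ℝ → (Fin n → ℝ) →L[ℝ] (Fin n → ℝ)} (hM : ContinuousOn M J)
    (hskew : ∀ t ∈ J, ∀ x, x ⬝ᵥ M t x = 0) {t₀ : ℝ} (ht₀ : t₀ ∈ J) (x₀ : Fin n → ℝ) :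
    ∃ x : ℝ → Fin n → ℝ, x t₀ = x₀ ∧ ∀ t ∈ J, HasDerivAt x (M t (x t)) t := by
  have hab : ∀ t ∈ J, ∃ a ∈ J, ∃ b ∈ J, a < min t t₀ ∧ max t t₀ < b := by
    intro t ht
    have h1 : min t t₀ ∈ J := by rcases min_choice t t₀ with h | h <;> rw [h] <;> assumption
    have h2 : max t t₀ ∈ J := by rcases max_choice t t₀ with h | h <;> rw [h] <;> assumption
    obtain ⟨l₁, u₁, h3, h4⟩ := mem_nhds_iff_exists_Ioo_subset.1 (hJ.mem_nhds h1)
    obtain ⟨l₂, u₂, h5, h6⟩ := mem_nhds_iff_exists_Ioo_subset.1 (hJ.mem_nhds h2)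
    obtain ⟨c, hc⟩ := exists_between h5.2
    obtain ⟨d, hd⟩ := exists_between h3.1
    exact ⟨d, h4 ⟨hd.1, hd.2.trans h3.2⟩, c, h6 ⟨h5.1.trans hc.1, hc.2⟩, hd.2, hc.1⟩
  choose! a haJ b hbJ hlt hgt using hab
  have hsub : ∀ t ∈ J, Set.Icc (a t) (b t) ⊆ J := fun t ht => hJc.out (haJ t ht) (hbJ t ht)
  have ht₀' : ∀ t ∈ J, t₀ ∈ Set.Ioo (a t) (b t) := fun t ht =>
    ⟨(hlt t ht).trans_le (min_le_right _ _), (le_max_right _ _).trans_lt (hgt t ht)⟩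
  have ht' : ∀ t ∈ J, t ∈ Set.Ioo (a t) (b t) := fun t ht =>
    ⟨(hlt t ht).trans_le (min_le_left _ _), (le_max_left _ _).trans_lt (hgt t ht)⟩
  have hsol : ∀ t ∈ J, ∃ x : ℝ → Fin n → ℝ, x t₀ = x₀ ∧
      ∀ s ∈ Set.Icc (a t) (b t), HasDerivWithinAt x (M s (x s)) (Set.Icc (a t) (b t)) s :=
    fun t ht => exists_solution_Icc (hM.mono (hsub t ht)) (fun s hs => hskew s (hsub t ht hs))
      (Set.Ioo_subset_Icc_self (ht₀' t ht)) x₀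
  choose! y hy0 hy using hsol
  -- Each `y t` solves the equation on its own compact interval containing `t₀`; the diagonal `y t
  -- t` is locally one of them, because two solutions agree on the overlap of their intervals.
  refine ⟨fun t => y t t, hy0 t₀ ht₀, fun t ht => ?_⟩
  have hd : HasDerivAt (y t) (M t (y t t)) t :=
    (hy t ht t (Set.Ioo_subset_Icc_self (ht' t ht))).hasDerivAt
      (Icc_mem_nhds (ht' t ht).1 (ht' t ht).2)
  refine hd.congr_of_eventuallyEq ?_
  filter_upwards [Ioo_mem_nhds (ht' t ht).1 (ht' t ht).2] with s hs
  have hsJ : s ∈ J := hsub t ht (Set.Ioo_subset_Icc_self hs)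
  have hS : Convex ℝ (Set.Icc (a t) (b t) ∩ Set.Icc (a s) (b s)) :=
    (convex_Icc _ _).inter (convex_Icc _ _)
  exact eqOn_of_solutions hS (fun r hr => hskew r (hsub t ht hr.1))
    (fun r hr => (hy s hsJ r hr.2).mono Set.inter_subset_right)
    (fun r hr => (hy t ht r hr.1).mono Set.inter_subset_left)
    ⟨Set.Ioo_subset_Icc_self (ht₀' t ht), Set.Ioo_subset_Icc_self (ht₀' s hsJ)⟩
    ⟨Set.Ioo_subset_Icc_self hs, Set.Ioo_subset_Icc_self (ht' s hsJ)⟩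
    ((hy0 s hsJ).trans (hy0 t ht).symm)

/-- The infinitesimal rotation `x ↦ (q, x) v - (v, x) q`. -/
noncomputable def transport (q v : Fin n → ℝ) : (Fin n → ℝ) →L[ℝ] (Fin n → ℝ) :=
  LinearMap.toContinuousLinearMap
    { toFun := fun x => (q ⬝ᵥ x) • v - (v ⬝ᵥ x) • q
      map_add' := fun x y => by
        simp only [dotProduct_add, add_smul]; abel
      map_smul' := fun c x => by
        simp only [dotProduct_smul, smul_eq_mul, mul_smul, RingHom.id_apply, smul_sub] }

theorem transport_apply (q v x : Fin n → ℝ) :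
    transport q v x = (q ⬝ᵥ x) • v - (v ⬝ᵥ x) • q := rfl

theorem dotProduct_transport (q v x y : Fin n → ℝ) :
    x ⬝ᵥ transport q v y = (q ⬝ᵥ y) * (x ⬝ᵥ v) - (v ⬝ᵥ y) * (x ⬝ᵥ q) := by
  rw [transport_apply, dotProduct_sub, dotProduct_smul, dotProduct_smul, smul_eq_mul, smul_eq_mul]

theorem dotProduct_transport_self (q v x : Fin n → ℝ) : x ⬝ᵥ transport q v x = 0 := by
  rw [dotProduct_transport, dotProduct_comm x v, dotProduct_comm x q]; ring

end LinearODE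

/-! ### Frames, angular velocities and reaction forces at one instant. -/

section Frames

variable {m n : ℕ}

theorem exists_specialOrthogonal_with_row {q : Fin (m + 2) → ℝ} (hq : q ⬝ᵥ q = 1) :
    ∃ G ∈ Matrix.specialOrthogonalGroup (Fin (m + 2)) ℝ, frame G 0 = q := by
  have hv : Orthonormal ℝ (({0} : Set (Fin (m + 2))).domRestrict
      fun _ => (WithLp.toLp 2 q : EuclideanSpace ℝ (Fin (m + 2)))) := by
    refine ⟨fun i => ?_, fun i j hij => (hij (Subsingleton.elim i j)).elim⟩
    have h1 : ∑ i, q i ^ 2 = 1 := by rw [← hq]; simp [dotProduct, sq]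
    simp [EuclideanSpace.norm_eq, h1]
  obtain ⟨b, hb⟩ := hv.exists_orthonormalBasis_extension_of_card_eq (by simp)
  set G : Matrix (Fin (m + 2)) (Fin (m + 2)) ℝ := Matrix.of fun i j => b i j with hG
  have hGG : G * G.transpose = 1 := by
    ext i j
    have h1 := orthonormal_iff_ite.1 b.orthonormal j i
    rw [PiLp.inner_apply] at h1
    rw [Matrix.mul_apply, Matrix.one_apply]
    simp only [hG, Matrix.of_apply, Matrix.transpose_apply]
    simpa [eq_comm] using h1
  have hdet : G.det * G.det = 1 := by
    have := congrArg Matrix.det hGG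
    rwa [Matrix.det_mul, Matrix.det_transpose, Matrix.det_one] at this
  -- An orthonormal basis starting with `q` may have determinant `-1`; multiplying the row with
  -- index `1` by the determinant corrects this and leaves `q` in row `0`.
  set d : Fin (m + 2) → ℝ := Function.update 1 1 G.det with hd
  have hd0 : d 0 = 1 := by simp [hd]
  have hd2 : Matrix.diagonal d * Matrix.diagonal d = 1 := by
    rw [Matrix.diagonal_mul_diagonal, ← Matrix.diagonal_one]
    congr 1
    funext i
    simp only [hd, Function.update_apply]
    split_ifs
    · exact hdet
    · simp
  have hddet : (Matrix.diagonal d).det = G.det := by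
    rw [Matrix.det_diagonal, hd, Finset.prod_update_of_mem (Finset.mem_univ _)]
    simp
  refine ⟨Matrix.diagonal d * G, Matrix.mem_specialOrthogonalGroup_iff.2 ⟨?_, ?_⟩, ?_⟩
  · rw [Matrix.mem_orthogonalGroup_iff,
      Matrix.transpose_mul, Matrix.diagonal_transpose, Matrix.mul_assoc, ← Matrix.mul_assoc G,
      hGG, Matrix.one_mul, hd2]
  · rw [Matrix.det_mul, hddet, hdet]
  · funext k
    simp only [frame, Matrix.diagonal_mul, hd0, one_mul, hG, Matrix.of_apply]
    rw [hb 0 rfl]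

theorem trace_mul_vecMulVec (M : Matrix (Fin n) (Fin n) ℝ) (x y : Fin n → ℝ) :
    (M * Matrix.vecMulVec x y).trace = y ⬝ᵥ M.mulVec x := by
  simp only [Matrix.trace, Matrix.diag, Matrix.mul_apply, Matrix.vecMulVec_apply, dotProduct,
    Matrix.mulVec, Finset.mul_sum]
  exact Finset.sum_congr rfl fun i _ => Finset.sum_congr rfl fun j _ => by ring

theorem killing_wedge (M : Matrix (Fin n) (Fin n) ℝ) (x y : Fin n → ℝ) :
    killing M (wedge x y) = 1 / 2 * (x ⬝ᵥ M.mulVec y - y ⬝ᵥ M.mulVec x) := by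
  rw [killing, wedge, Matrix.mul_sub, Matrix.trace_sub, trace_mul_vecMulVec, trace_mul_vecMulVec]
  ring

theorem wedge_mulVec (x y z : Fin n → ℝ) :
    (wedge x y).mulVec z = (y ⬝ᵥ z) • x - (x ⬝ᵥ z) • y := by
  rw [wedge, Matrix.sub_mulVec]
  funext i
  simp only [Matrix.mulVec, Matrix.vecMulVec_apply, dotProduct, Pi.sub_apply, Pi.smul_apply,
    smul_eq_mul, Finset.sum_mul]
  congr 1 <;> exact Finset.sum_congr rfl fun j _ => by ring

theorem frame_dotProduct_frame {G : Matrix (Fin n) (Fin n) ℝ} (hG : G * G.transpose = 1)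
    (a b : Fin n) : frame G a ⬝ᵥ frame G b = if a = b then 1 else 0 := by
  have := congrFun (congrFun hG a) b
  rw [Matrix.mul_apply, Matrix.one_apply] at this
  exact this

theorem mulVec_transpose_mul_frame {G : Matrix (Fin n) (Fin n) ℝ} (hG : G * G.transpose = 1)
    (D : Matrix (Fin n) (Fin n) ℝ) (p r : Fin n) :
    frame G p ⬝ᵥ (G.transpose * D).mulVec (frame G r) = frame D p ⬝ᵥ frame G r := by
  have h1 : ∀ v : Fin n → ℝ, frame G p ⬝ᵥ G.transpose.mulVec v = v p := by
    intro v
    rw [Matrix.dotProduct_mulVec]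
    have : Matrix.vecMul (frame G p) G.transpose = Pi.single p 1 := by
      funext j
      have := frame_dotProduct_frame hG p j
      rw [Pi.single_apply, show (if j = p then (1 : ℝ) else 0) = if p = j then 1 else 0 by
        simp only [eq_comm], ← this]
      rfl
    rw [this, single_dotProduct, one_mul]
  rw [← Matrix.mulVec_mulVec, h1]
  rfl

/-- For an orthogonal frame with skew velocity that satisfies the constraints, the angular
velocity is the wedge product of `q` and its velocity. -/
theorem transpose_mul_eq_wedge {G D : Matrix (Fin (m + 2)) (Fin (m + 2)) ℝ}
    (hG : G * G.transpose = 1)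
    (hskew : ∀ p r, frame D p ⬝ᵥ frame G r + frame G p ⬝ᵥ frame D r = 0)
    (hcon : ∀ p r : Fin (m + 2), 0 < p → p < r → frame D p ⬝ᵥ frame G r = 0) :
    G.transpose * D = wedge (frame G 0) (frame D 0) := by
  have hG' : G.transpose * G = 1 := mul_eq_one_comm.1 hG
  -- The constraints cover `p < r`; skewness of the velocity gives the diagonal and the other
  -- triangle.
  have hS : ∀ p r : Fin (m + 1), frame D p.succ ⬝ᵥ frame G r.succ = 0 := by
    intro p r
    have hs := hskew p.succ r.succ
    rw [dotProduct_comm (frame G p.succ)] at hs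
    rcases lt_trichotomy p r with h | h | h
    · exact hcon _ _ (Fin.succ_pos p) (Fin.succ_lt_succ_iff.2 h)
    · subst h; linarith
    · have := hcon _ _ (Fin.succ_pos r) (Fin.succ_lt_succ_iff.2 h)
      linarith
  have hD : D = (D * G.transpose) * G := by rw [Matrix.mul_assoc, hG', Matrix.mul_one]
  have hentry : ∀ p j, D p j = ∑ r, (frame D p ⬝ᵥ frame G r) * G r j := by
    intro p j
    have := congrFun (congrFun hD p) j
    rwa [Matrix.mul_apply] at this
  have h00 : frame D 0 ⬝ᵥ frame G 0 = 0 := by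
    have := hskew 0 0
    rw [dotProduct_comm (frame G 0)] at this
    linarith
  ext i j
  rw [Matrix.mul_apply, wedge, Matrix.sub_apply, Matrix.vecMulVec_apply, Matrix.vecMulVec_apply,
    Fin.sum_univ_succ]
  have h1 : ∀ p : Fin (m + 1), G.transpose i p.succ * D p.succ j
      = -((frame D 0 ⬝ᵥ frame G p.succ) * G p.succ i) * G 0 j := by
    intro p
    rw [hentry, Fin.sum_univ_succ, Finset.sum_eq_zero fun r _ => by rw [hS, zero_mul], add_zero]
    have := hskew p.succ 0
    rw [dotProduct_comm (frame G p.succ)] at this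
    rw [Matrix.transpose_apply, show frame D p.succ ⬝ᵥ frame G 0
      = -(frame D 0 ⬝ᵥ frame G p.succ) by linarith]
    ring
  rw [Finset.sum_congr rfl fun p _ => h1 p, ← Finset.sum_mul, Finset.sum_neg_distrib]
  have h2 : D 0 i = ∑ p : Fin (m + 1), (frame D 0 ⬝ᵥ frame G p.succ) * G p.succ i := by
    rw [hentry, Fin.sum_univ_succ, h00, zero_mul, zero_add]
  simp only [frame] at h2 ⊢
  rw [h2]
  simp only [Matrix.transpose_apply]
  ring

/-- The reaction forces are the skew matrices that annihilate `q`. -/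
theorem exists_multipliers_iff {G : Matrix (Fin (m + 2)) (Fin (m + 2)) ℝ}
    (hG : G * G.transpose = 1) {Z : Matrix (Fin (m + 2)) (Fin (m + 2)) ℝ}
    (hZ : ∀ i j, Z i j = -Z j i) :
    (∃ μ : Fin (m + 2) → Fin (m + 2) → ℝ, Z = ∑ p, ∑ r, (if 0 < p ∧ p < r then
        μ p r • wedge (frame G p) (frame G r) else 0)) ↔ Z.mulVec (frame G 0) = 0 := by
  have hG' : G.transpose * G = 1 := mul_eq_one_comm.1 hG
  constructor
  · rintro ⟨μ, rfl⟩
    simp only [Matrix.sum_mulVec]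
    refine Finset.sum_eq_zero fun p _ => Finset.sum_eq_zero fun r _ => ?_
    split_ifs with h
    · rw [Matrix.smul_mulVec, wedge_mulVec, frame_dotProduct_frame hG, frame_dotProduct_frame hG,
        if_neg h.1.ne', if_neg (h.1.trans h.2).ne']
      simp
    · simp
  · intro h0
    -- The entries of `Y` are the components of `Z` in the moving frame. The condition `Z q = 0`
    -- removes row and column `0`, and the remaining entries above the diagonal are the multipliers.
    set Y := G * Z * G.transpose with hY
    have hYZ : Z = G.transpose * Y * G := by
      rw [hY, ← Matrix.mul_assoc, ← Matrix.mul_assoc, hG', Matrix.one_mul, Matrix.mul_assoc, hG',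
        Matrix.mul_one]
    have hZt : Z.transpose = -Z := by ext i j; rw [Matrix.transpose_apply, Matrix.neg_apply, hZ j i]
    have hYt : Y.transpose = -Y := by
      rw [hY, Matrix.transpose_mul, Matrix.transpose_mul, Matrix.transpose_transpose, hZt,
        ← Matrix.mul_assoc]
      simp
    have hYs : ∀ a b, Y b a = -Y a b := fun a b => by
      have := congrFun (congrFun hYt a) b
      rwa [Matrix.transpose_apply, Matrix.neg_apply] at this
    have hY0 : ∀ a, Y a 0 = 0 := by
      intro a
      have h1 : Y a 0 = (G.mulVec (Z.mulVec (frame G 0))) a := by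
        rw [hY, Matrix.mulVec_mulVec]
        simp only [Matrix.mul_apply, Matrix.mulVec, dotProduct, frame, Matrix.transpose_apply]
      rw [h1, h0, Matrix.mulVec_zero]; rfl
    refine ⟨Y, ?_⟩
    ext i j
    have h1 : Z i j = ∑ a, ∑ b, G a i * Y a b * G b j := by
      conv_lhs => rw [hYZ]
      rw [Matrix.mul_apply, Finset.sum_comm]
      refine Finset.sum_congr rfl fun b _ => ?_
      rw [Matrix.mul_apply, Finset.sum_mul]
      rfl
    rw [h1, sum_sum_symm_half (fun a b => G a i * Y a b * G b j) (fun a => by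
      have := hYs a a
      rw [show Y a a = 0 by linarith]; ring)]
    simp only [Matrix.sum_apply]
    refine Finset.sum_congr rfl fun a _ => Finset.sum_congr rfl fun b _ => ?_
    by_cases hab : a < b
    · rw [if_pos hab]
      by_cases ha : 0 < a
      · rw [if_pos ⟨ha, hab⟩, hYs a b]
        simp only [Matrix.smul_apply, wedge, Matrix.sub_apply, Matrix.vecMulVec_apply, frame,
          smul_eq_mul]
        ring
      · rw [if_neg fun h => ha h.1]
        obtain rfl : a = 0 := by
          rcases Fin.eq_zero_or_eq_succ a with h | ⟨j, rfl⟩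
          · exact h
          · exact absurd (Fin.succ_pos j) ha
        have h2 : Y 0 b = 0 := by rw [hYs b 0, hY0, neg_zero]
        rw [hY0, h2]
        simp
    · rw [if_neg hab, if_neg fun h => hab h.2]
      simp

theorem inertia_wedge (A x y : Fin n → ℝ) :
    inertia A (wedge x y) = (∏ l, A l)⁻¹ • wedge (A * x) (A * y) := by
  ext i j
  simp only [inertia, wedge, Matrix.of_apply, Matrix.sub_apply, Matrix.vecMulVec_apply,
    Matrix.smul_apply, Pi.mul_apply, smul_eq_mul]
  ring

theorem wedge_skew (x y : Fin n → ℝ) (i j : Fin n) : wedge x y i j = -wedge x y j i := by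
  simp only [wedge, Matrix.sub_apply, Matrix.vecMulVec_apply]; ring

/-- The equations of motion at one instant, for `ω = q ∧ v`, are the reduced equations. -/
theorem exists_multipliers_iff_reduced {A : Fin (m + 2) → ℝ}
    {G : Matrix (Fin (m + 2)) (Fin (m + 2)) ℝ} (hG : G * G.transpose = 1)
    {q v a : Fin (m + 2) → ℝ} (hq : frame G 0 = q) (hqv : q ⬝ᵥ v = 0) :
    (∃ μ : Fin (m + 2) → Fin (m + 2) → ℝ, (∏ l, A l)⁻¹ • wedge (A * q) (A * a)
        = inertia A (wedge q v) * wedge q v - wedge q v * inertia A (wedge q v)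
          + ∑ p, ∑ r, (if 0 < p ∧ p < r then
            μ p r • wedge (frame G p) (frame G r) else 0)) ↔
      ∀ ξ, q ⬝ᵥ ξ = 0 → ((∏ l, A l)⁻¹ • (bil A q q • (A * a) + bil A q v • (A * v)
        - (bil A v v + bil A q a) • (A * q))) ⬝ᵥ ξ = 0 := by
  have hqq : q ⬝ᵥ q = 1 := by rw [← hq, frame_dotProduct_frame hG, if_pos rfl]
  set Z := (∏ l, A l)⁻¹ • wedge (A * q) (A * a)
    - (inertia A (wedge q v) * wedge q v - wedge q v * inertia A (wedge q v)) with hZdef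
  have hZ : ∀ i j, Z i j = -Z j i := by
    intro i j
    simp only [hZdef, inertia_wedge, Matrix.sub_apply, Matrix.smul_apply, smul_eq_mul,
      Matrix.smul_mul, Matrix.mul_smul, Matrix.mul_apply]
    rw [wedge_skew (A * q) (A * a) i j]
    have h1 : ∑ k, wedge (A * q) (A * v) i k * wedge q v k j
        = ∑ k, wedge q v j k * wedge (A * q) (A * v) k i := by
      refine Finset.sum_congr rfl fun k _ => ?_
      rw [wedge_skew (A * q) (A * v) i k, wedge_skew q v k j]; ring
    have h2 : ∑ k, wedge q v i k * wedge (A * q) (A * v) k j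
        = ∑ k, wedge (A * q) (A * v) j k * wedge q v k i := by
      refine Finset.sum_congr rfl fun k _ => ?_
      rw [wedge_skew (A * q) (A * v) k j, wedge_skew q v i k]; ring
    rw [h1, h2]
    ring
  have h1 := exists_multipliers_iff hG hZ
  have hshape : ∀ S : Matrix (Fin (m + 2)) (Fin (m + 2)) ℝ,
      ((∏ l, A l)⁻¹ • wedge (A * q) (A * a)
        = inertia A (wedge q v) * wedge q v - wedge q v * inertia A (wedge q v) + S) ↔ Z = S :=
    fun S => by rw [hZdef, sub_eq_iff_eq_add']
  simp only [hshape]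
  rw [h1, hq]
  have hvq : v ⬝ᵥ q = 0 := by rw [dotProduct_comm]; exact hqv
  have hZq : Z.mulVec q = (∏ l, A l)⁻¹ • ((bil A q a + bil A v v) • (A * q)
      - bil A q q • (A * a) - bil A q v • (A * v))
      + (v ⬝ᵥ ((∏ l, A l)⁻¹ • (bil A q v • (A * q) - bil A q q • (A * v)))) • q := by
    have e1 : ∀ x, (A * x) ⬝ᵥ q = bil A q x := fun x => bil_comm A x q
    have e2 : (wedge q v).mulVec q = -v := by
      rw [wedge_mulVec, hvq, hqq, zero_smul, one_smul, zero_sub]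
    have e3 : (inertia A (wedge q v)).mulVec q
        = (∏ l, A l)⁻¹ • (bil A q v • (A * q) - bil A q q • (A * v)) := by
      rw [inertia_wedge, Matrix.smul_mulVec, wedge_mulVec, e1, e1]
    have e4 : q ⬝ᵥ ((∏ l, A l)⁻¹ • (bil A q v • (A * q) - bil A q q • (A * v))) = 0 := by
      rw [dotProduct_smul, dotProduct_sub, dotProduct_smul, dotProduct_smul,
        dotProduct_comm q (A * q), dotProduct_comm q (A * v), e1, e1]
      simp only [smul_eq_mul]; ring
    have e5 : (inertia A (wedge q v)).mulVec v
        = (∏ l, A l)⁻¹ • (bil A v v • (A * q) - bil A q v • (A * v)) := by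
      rw [inertia_wedge, Matrix.smul_mulVec, wedge_mulVec]; rfl
    rw [hZdef, Matrix.sub_mulVec, Matrix.sub_mulVec, Matrix.smul_mulVec, wedge_mulVec, e1, e1,
      ← Matrix.mulVec_mulVec, ← Matrix.mulVec_mulVec, e2, e3, Matrix.mulVec_neg, e5, wedge_mulVec,
      e4, zero_smul, sub_zero]
    funext i
    simp only [Pi.add_apply, Pi.sub_apply, Pi.smul_apply, Pi.neg_apply, smul_eq_mul, Pi.mul_apply]
    ring
  -- As `Z` is skew, `Z q` is tangent to the sphere at `q`; so it vanishes as soon as its products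
  -- with tangent vectors do.
  have hqZq : q ⬝ᵥ Z.mulVec q = 0 := by
    have e1 : q ⬝ᵥ Z.mulVec q = -(q ⬝ᵥ Z.mulVec q) := by
      conv_lhs => rw [Matrix.dotProduct_mulVec, dotProduct_comm, ← Matrix.mulVec_transpose]
      have : Z.transpose = -Z := by
        ext i j; rw [Matrix.transpose_apply, Matrix.neg_apply, hZ j i]
      rw [this, Matrix.neg_mulVec, dotProduct_neg]
    linarith
  have hdot : ∀ ξ, q ⬝ᵥ ξ = 0 → Z.mulVec q ⬝ᵥ ξ
      = -(((∏ l, A l)⁻¹ • (bil A q q • (A * a) + bil A q v • (A * v)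
        - (bil A v v + bil A q a) • (A * q))) ⬝ᵥ ξ) := by
    intro ξ hξ
    rw [hZq, add_dotProduct, smul_dotProduct _ q, hξ, smul_zero, add_zero, ← neg_dotProduct]
    congr 1
    funext i
    simp only [Pi.add_apply, Pi.sub_apply, Pi.smul_apply, Pi.neg_apply, smul_eq_mul, Pi.mul_apply]
    ring
  constructor
  · intro h ξ hξ
    have := hdot ξ hξ
    rw [h, zero_dotProduct] at this
    linarith
  · intro h
    have h2 := eq_smul_of_orthogonal hqq (r := Z.mulVec q) fun ξ hξ => by
      rw [hdot ξ hξ, h ξ hξ, neg_zero]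
    rw [h2, hqZq, zero_smul]

end Frames

/-! ### Reduction of Veselova motions, and their reconstruction. -/

section Lift

variable {m : ℕ}

theorem hasDerivAt_frame {g : ℝ → Matrix (Fin (m + 2)) (Fin (m + 2)) ℝ} {t : ℝ}
    (hg : ∀ i j, DifferentiableAt ℝ (fun s => g s i j) t) (i : Fin (m + 2)) :
    HasDerivAt (fun s => frame (g s) i)
      (frame (Matrix.of fun i j => deriv (fun s => g s i j) t) i) t :=
  hasDerivAt_pi.2 fun j => (hg i j).hasDerivAt

theorem mul_transpose_of_mem {G : Matrix (Fin (m + 2)) (Fin (m + 2)) ℝ}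
    (hG : G ∈ Matrix.specialOrthogonalGroup (Fin (m + 2)) ℝ) : G * G.transpose = 1 := by
  exact (Matrix.mem_orthogonalGroup_iff _ _).1 (Matrix.mem_specialOrthogonalGroup_iff.1 hG).1

theorem frame_velocity_skew {J : Set ℝ} (hJ : IsOpen J)
    {g : ℝ → Matrix (Fin (m + 2)) (Fin (m + 2)) ℝ}
    (hmem : ∀ t ∈ J, g t ∈ Matrix.specialOrthogonalGroup (Fin (m + 2)) ℝ)
    (hg : ∀ t ∈ J, ∀ i j, DifferentiableAt ℝ (fun s => g s i j) t) {t : ℝ} (ht : t ∈ J)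
    (p r : Fin (m + 2)) :
    frame (Matrix.of fun i j => deriv (fun s => g s i j) t) p ⬝ᵥ frame (g t) r
      + frame (g t) p ⬝ᵥ frame (Matrix.of fun i j => deriv (fun s => g s i j) t) r = 0 := by
  refine (hasDerivAt_dotProduct (hasDerivAt_frame (hg t ht) p)
    (hasDerivAt_frame (hg t ht) r)).unique ?_
  refine (hasDerivAt_const t (if p = r then (1 : ℝ) else 0)).congr_of_eventuallyEq ?_
  filter_upwards [hJ.mem_nhds ht] with s hs
  exact frame_dotProduct_frame (mul_transpose_of_mem (hmem s hs)) p r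

theorem killing_angularVelocity {J : Set ℝ} (hJ : IsOpen J)
    {g : ℝ → Matrix (Fin (m + 2)) (Fin (m + 2)) ℝ}
    (hmem : ∀ t ∈ J, g t ∈ Matrix.specialOrthogonalGroup (Fin (m + 2)) ℝ)
    (hg : ∀ t ∈ J, ∀ i j, DifferentiableAt ℝ (fun s => g s i j) t) {t : ℝ} (ht : t ∈ J)
    (p r : Fin (m + 2)) :
    killing (angularVelocity g t) (wedge (frame (g t) p) (frame (g t) r))
      = frame (Matrix.of fun i j => deriv (fun s => g s i j) t) p ⬝ᵥ frame (g t) r := by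
  have hG := mul_transpose_of_mem (hmem t ht)
  have h1 := frame_velocity_skew hJ hmem hg ht p r
  rw [killing_wedge, angularVelocity, mulVec_transpose_mul_frame hG,
    mulVec_transpose_mul_frame hG]
  rw [dotProduct_comm (frame (g t) p)] at h1
  linarith

theorem angularVelocity_eq_wedge {J : Set ℝ} (hJ : IsOpen J)
    {g : ℝ → Matrix (Fin (m + 2)) (Fin (m + 2)) ℝ}
    (hmem : ∀ t ∈ J, g t ∈ Matrix.specialOrthogonalGroup (Fin (m + 2)) ℝ)
    (hg : ∀ t ∈ J, ∀ i j, DifferentiableAt ℝ (fun s => g s i j) t)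
    (hcon : ∀ t ∈ J, ∀ p r : Fin (m + 2), 0 < p → p < r →
      killing (angularVelocity g t) (wedge (frame (g t) p) (frame (g t) r)) = 0)
    {q : ℝ → Fin (m + 2) → ℝ} (hq : ∀ t ∈ J, frame (g t) 0 = q t) {t : ℝ} (ht : t ∈ J) :
    angularVelocity g t = wedge (q t) (deriv q t) := by
  have h1 : deriv q t = frame (Matrix.of fun i j => deriv (fun s => g s i j) t) 0 := by
    refine ((hasDerivAt_frame (hg t ht) 0).congr_of_eventuallyEq ?_).deriv
    filter_upwards [hJ.mem_nhds ht] with s hs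
    exact (hq s hs).symm
  rw [h1, ← hq t ht]
  refine transpose_mul_eq_wedge (mul_transpose_of_mem (hmem t ht))
    (frame_velocity_skew hJ hmem hg ht) fun p r hp hpr => ?_
  rw [← killing_angularVelocity hJ hmem hg ht, hcon t ht p r hp hpr]

theorem hasDerivAt_inertia (A : Fin (m + 2) → ℝ) {q : ℝ → Fin (m + 2) → ℝ} {t : ℝ}
    {a : Fin (m + 2) → ℝ} (h1 : HasDerivAt q (deriv q t) t) (h2 : HasDerivAt (deriv q) a t)
    (i j : Fin (m + 2)) :
    HasDerivAt (fun s => inertia A (wedge (q s) (deriv q s)) i j)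
      (((∏ l, A l)⁻¹ • wedge (A * q t) (A * a)) i j) t := by
  simp only [inertia_wedge]
  simp only [Matrix.smul_apply, wedge, Matrix.sub_apply, Matrix.vecMulVec_apply,
    Pi.mul_apply, smul_eq_mul]
  have q1 := hasDerivAt_pi.1 h1
  have q2 := hasDerivAt_pi.1 h2
  have h := ((((q1 i).const_mul (A i)).fun_mul ((q2 j).const_mul (A j))).fun_sub
    (((q2 i).const_mul (A i)).fun_mul ((q1 j).const_mul (A j)))).const_mul ((∏ l, A l)⁻¹)
  refine h.congr_deriv ?_
  ring

/-- The curves `e_1` of Veselova motions are the trajectories of the reduced system. -/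
theorem isLagrangeDAlembert_of_motion {A : Fin (m + 2) → ℝ} {J : Set ℝ} (hJ : IsOpen J)
    {g : ℝ → Matrix (Fin (m + 2)) (Fin (m + 2)) ℝ} (hg : IsVeselovaMotion A J g)
    {q : ℝ → Fin (m + 2) → ℝ} (hq : ∀ t ∈ J, frame (g t) 0 = q t) :
    IsLagrangeDAlembert (redLagrangian A) (redForce A) J q := by
  have hdiff : ∀ t ∈ J, ∀ i j, DifferentiableAt ℝ (fun s => g s i j) t := fun t ht i j =>
    ((hg.smooth i j).differentiableOn two_ne_zero).differentiableAt (hJ.mem_nhds ht)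
  have hqs : ContDiffOn ℝ 2 q J := contDiffOn_pi.2 fun j => (hg.smooth 0 j).congr fun t ht => by
    rw [← hq t ht]; rfl
  have hqq : ∀ t ∈ J, q t ⬝ᵥ q t = 1 := fun t ht => by
    rw [← hq t ht, frame_dotProduct_frame (mul_transpose_of_mem (hg.mem t ht)), if_pos rfl]
  rw [isLagrangeDAlembert_red_iff]
  refine ⟨hqs, hqq, fun t ht ξ hξ => ?_⟩
  obtain ⟨h1, h2⟩ := hasDerivAt_of_contDiffOn_two hJ hqs ht
  rw [(hasDerivAt_dotProduct (hasDerivAt_momentum_red A h1 h2) (hasDerivAt_const t ξ)).deriv,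
    dotProduct_zero, add_zero]
  have hω : ∀ s ∈ J, angularVelocity g s = wedge (q s) (deriv q s) := fun s hs =>
    angularVelocity_eq_wedge hJ hg.mem hdiff hg.constraint hq hs
  refine (exists_multipliers_iff_reduced (mul_transpose_of_mem (hg.mem t ht)) (hq t ht)
    (dotProduct_deriv_eq_zero hJ hqq ht h1)).1 ?_ ξ hξ
  obtain ⟨μ, hμ⟩ := hg.eqn t ht
  refine ⟨μ, ?_⟩
  ext i j
  rw [← hω t ht]
  refine ((hasDerivAt_inertia A h1 h2 i j).congr_of_eventuallyEq ?_).unique (hμ i j)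
  filter_upwards [hJ.mem_nhds ht] with s hs
  rw [hω s hs]

/-- Every row of the frame is transported by `ẋ = (q, x) q̇ - (q̇, x) q`. The curve `q` itself
solves this equation, and a row orthogonal to `q` moves only in the direction of `q`, which is the
constraint. -/
theorem exists_motion {A : Fin (m + 2) → ℝ} {J : Set ℝ} (hJ : IsOpen J) (hJc : J.OrdConnected)
    {q : ℝ → Fin (m + 2) → ℝ}
    (hq : IsLagrangeDAlembert (redLagrangian A) (redForce A) J q) :
    ∃ g, IsVeselovaMotion A J g ∧ ∀ t ∈ J, frame (g t) 0 = q t := by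
  rw [isLagrangeDAlembert_red_iff] at hq
  obtain ⟨hqs, hqq, heq⟩ := hq
  rcases J.eq_empty_or_nonempty with rfl | ⟨t₀, ht₀⟩
  · exact ⟨fun _ => 1, ⟨by simp, fun i j => contDiffOn_const, by simp, by simp⟩, by simp⟩
  have hv1 := ((contDiffOn_two_iff hJ).1 hqs).2
  have hq1 : ContDiffOn ℝ 1 q J := hqs.of_le (by norm_num)
  have hM : ContinuousOn (fun t => transport (q t) (deriv q t)) J := by
    rw [continuousOn_clm_apply]
    intro y
    simp only [transport_apply]
    exact ((contDiffOn_dotProduct hq1 contDiffOn_const).smul hv1).continuousOn.sub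
      ((contDiffOn_dotProduct hv1 contDiffOn_const).smul hq1).continuousOn
  have hskew : ∀ t ∈ J, ∀ x, x ⬝ᵥ transport (q t) (deriv q t) x = 0 := fun t _ x =>
    dotProduct_transport_self _ _ x
  obtain ⟨G, hG, hG0⟩ := exists_specialOrthogonal_with_row (hqq t₀ ht₀)
  choose e he0 he using fun i => exists_solution_of_isOpen hJ hJc hM hskew ht₀ (frame G i)
  have hJconv : Convex ℝ J := hJc.convex
  have hrow0 : ∀ t ∈ J, e 0 t = q t := by
    intro t ht
    refine eqOn_of_solutions hJconv hskew (fun s hs => (he 0 s hs).hasDerivWithinAt)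
      (fun s hs => ?_) ht₀ ht ((he0 0).trans hG0)
    obtain ⟨h1, -⟩ := hasDerivAt_of_contDiffOn_two hJ hqs hs
    have h2 := dotProduct_deriv_eq_zero hJ hqq hs h1
    rw [transport_apply, hqq s hs, dotProduct_comm, h2, one_smul, zero_smul, sub_zero]
    exact h1.hasDerivWithinAt
  have hdot : ∀ i j, ∀ t ∈ J, e i t ⬝ᵥ e j t = if i = j then 1 else 0 := by
    intro i j t ht
    rw [← frame_dotProduct_frame (mul_transpose_of_mem hG) i j, ← he0 i, ← he0 j]
    refine eqOn_const_of_hasDerivWithinAt_zero hJconv (f := fun s => e i s ⬝ᵥ e j s)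
      (fun s hs => ?_) ht ht₀
    refine ((hasDerivAt_dotProduct (he i s hs) (he j s hs)).congr_deriv ?_).hasDerivWithinAt
    rw [dotProduct_comm, dotProduct_transport, dotProduct_transport]
    simp only [dotProduct_comm (q s), dotProduct_comm (deriv q s)]
    ring
  have heC2 : ∀ i, ContDiffOn ℝ 2 (e i) J := by
    intro i
    have hvel : ∀ N : WithTop ℕ∞, ContDiffOn ℝ N q J → ContDiffOn ℝ N (deriv q) J →
        ContDiffOn ℝ N (e i) J →
        ContDiffOn ℝ N (fun t => transport (q t) (deriv q t) (e i t)) J := fun N h1 h2 h3 => by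
      simp only [transport_apply]
      exact ((contDiffOn_dotProduct h1 h3).smul h2).sub ((contDiffOn_dotProduct h2 h3).smul h1)
    have h0 : ContDiffOn ℝ 0 (e i) J := contDiffOn_zero.2 fun t ht =>
      (he i t ht).continuousAt.continuousWithinAt
    have h1 := contDiffOn_one_of_hasDerivAt hJ (he i) (hvel 0 (hq1.of_le (by norm_num))
      (hv1.of_le (by norm_num)) h0).continuousOn
    exact contDiffOn_two_of_hasDerivAt hJ (he i) (hvel 1 hq1 hv1 h1)
  set g : ℝ → Matrix (Fin (m + 2)) (Fin (m + 2)) ℝ := fun t => Matrix.of fun i j => e i t j with hg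
  have hframe : ∀ t i, frame (g t) i = e i t := fun t i => rfl
  have hsmooth : ∀ i j, ContDiffOn ℝ 2 (fun t => g t i j) J := fun i j =>
    contDiffOn_pi.1 (heC2 i) j
  have hgg : ∀ t ∈ J, g t * (g t).transpose = 1 := by
    intro t ht
    ext i j
    rw [Matrix.mul_apply, Matrix.one_apply]
    exact hdot i j t ht
  -- The determinant is continuous with square `1` on an interval, hence keeps its initial value.
  have hdet : ∀ t ∈ J, (g t).det = 1 := by
    have hcont : ContinuousOn (fun t => (g t).det) J := by
      have h1 : ∀ i j, ContinuousOn (fun t => g t i j) J := fun i j => (hsmooth i j).continuousOn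
      simp only [Matrix.det_apply]
      exact continuousOn_finsetSum _ fun σ _ =>
        ContinuousOn.const_smul (continuousOn_finsetProd _ fun i _ => h1 _ _) _
    have h1 := hJc.isPreconnected.eq_or_eq_neg_of_sq_eq hcont
      (continuousOn_const (c := (1 : ℝ))) (fun t ht => by
        have := congrArg Matrix.det (hgg t ht)
        rw [Matrix.det_mul, Matrix.det_transpose, Matrix.det_one] at this
        simpa [sq] using this) (by simp)
    have hG' : g t₀ = G := by ext i j; exact congrFun (he0 i) j
    rcases h1 with h | h
    · exact fun t ht => h ht
    · have h2 : (g t₀).det = -1 := h ht₀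
      rw [hG'] at h2
      have h3 := (Matrix.mem_specialOrthogonalGroup_iff.1 hG).2
      rw [h3] at h2
      norm_num at h2
  have hmem : ∀ t ∈ J, g t ∈ Matrix.specialOrthogonalGroup (Fin (m + 2)) ℝ := fun t ht =>
    Matrix.mem_specialOrthogonalGroup_iff.2 ⟨by
      rw [Matrix.mem_orthogonalGroup_iff, hgg t ht], hdet t ht⟩
  have hdiff : ∀ t ∈ J, ∀ i j, DifferentiableAt ℝ (fun s => g s i j) t := fun t ht i j =>
    ((hsmooth i j).differentiableOn two_ne_zero).differentiableAt (hJ.mem_nhds ht)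
  have hq0 : ∀ t ∈ J, frame (g t) 0 = q t := hrow0
  have hcon : ∀ t ∈ J, ∀ p r : Fin (m + 2), 0 < p → p < r →
      killing (angularVelocity g t) (wedge (frame (g t) p) (frame (g t) r)) = 0 := by
    intro t ht p r hp hpr
    rw [killing_angularVelocity hJ hmem hdiff ht]
    have h1 : frame (Matrix.of fun i j => deriv (fun s => g s i j) t) p
        = transport (q t) (deriv q t) (e p t) := (hasDerivAt_frame (hdiff t ht) p).unique (he p t ht)
    rw [h1, dotProduct_comm, dotProduct_transport, hframe, ← hrow0 t ht, hdot 0 p t ht,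
      hdot r 0 t ht, if_neg hp.ne, if_neg (hp.trans hpr).ne']
    ring
  refine ⟨g, ⟨hmem, hsmooth, hcon, fun t ht => ?_⟩, hq0⟩
  obtain ⟨h1, h2⟩ := hasDerivAt_of_contDiffOn_two hJ hqs ht
  have hω : ∀ s ∈ J, angularVelocity g s = wedge (q s) (deriv q s) := fun s hs =>
    angularVelocity_eq_wedge hJ hmem hdiff hcon hq0 hs
  obtain ⟨μ, hμ⟩ := (exists_multipliers_iff_reduced (A := A) (a := deriv (deriv q) t)
    (hgg t ht) (hq0 t ht) (dotProduct_deriv_eq_zero hJ hqq ht h1)).2 fun ξ hξ => by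
      have := heq t ht ξ hξ
      rwa [(hasDerivAt_dotProduct (hasDerivAt_momentum_red A h1 h2)
        (hasDerivAt_const t ξ)).deriv, dotProduct_zero, add_zero] at this
  refine ⟨μ, fun i j => ?_⟩
  rw [hω t ht, ← hμ]
  refine (hasDerivAt_inertia A h1 h2 i j).congr_of_eventuallyEq ?_
  filter_upwards [hJ.mem_nhds ht] with s hs
  rw [hω s hs]

end Lift


/-! ### Sign counts, alternation and real roots. -/

section Interlacing

variable {n m N : ℕ}

/-- Distributes the sign over the factors, so that positivity of a signed product is checked factor
by factor. -/
theorem neg_one_pow_eq_prod_erase (i : Fin n) :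
    (-1 : ℝ) ^ (i : ℕ) = ∏ l ∈ Finset.univ.erase i, if l < i then -1 else 1 := by
  rw [Finset.prod_ite, Finset.prod_const, Finset.prod_const_one, mul_one]
  congr 1
  rw [show (Finset.univ.erase i).filter (· < i) = Finset.Iio i by
    ext l; simp only [Finset.mem_filter, Finset.mem_erase, Finset.mem_univ, and_true,
      Finset.mem_Iio]; exact ⟨fun h => h.2, fun h => ⟨h.ne, h⟩⟩, Fin.card_Iio]

theorem neg_one_pow_eq_prod {j : ℕ} (hj : j ≤ n) :
    (-1 : ℝ) ^ j = ∏ l : Fin n, if (l : ℕ) < j then -1 else 1 := by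
  rw [Finset.prod_ite, Finset.prod_const, Finset.prod_const_one, mul_one, Fin.card_filter_val_lt,
    min_eq_right hj]

theorem neg_one_pow_mul_prod_pos {x : Fin n → ℝ} {z : ℝ} {j : ℕ} (hj : j ≤ n)
    (h1 : ∀ i : Fin n, (i : ℕ) < j → z < x i) (h2 : ∀ i : Fin n, j ≤ i → x i < z) :
    0 < (-1) ^ j * ∏ i, (z - x i) := by
  rw [neg_one_pow_eq_prod hj, ← Finset.prod_mul_distrib]
  refine Finset.prod_pos fun i _ => ?_
  split_ifs with h
  · linarith [h1 i h]
  · linarith [h2 i (not_lt.1 h)]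

theorem neg_one_pow_mul_prod_erase_pos {x : Fin n → ℝ} {z : ℝ} {i : Fin n}
    (h1 : ∀ l < i, z < x l) (h2 : ∀ l, i < l → x l < z) :
    0 < (-1) ^ (i : ℕ) * ∏ l ∈ Finset.univ.erase i, (z - x l) := by
  rw [neg_one_pow_eq_prod_erase, ← Finset.prod_mul_distrib]
  refine Finset.prod_pos fun l hl => ?_
  split_ifs with h
  · linarith [h1 l h]
  · linarith [h2 l (lt_of_le_of_ne (not_lt.1 h) (Finset.ne_of_mem_erase hl).symm)]

/-- A polynomial of degree at most `N` that takes values of alternating signs at `N + 1` points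
splits, with one root between any two neighbours. -/
theorem exists_roots_of_alternating {P : ℝ[X]} (hP : P.natDegree ≤ N) {x : Fin (N + 1) → ℝ}
    (hx : StrictAnti x) (h : ∀ i : Fin (N + 1), 0 < (-1) ^ (i : ℕ) * P.eval (x i)) :
    ∃ r : Fin N → ℝ, (∀ k, x k.succ < r k ∧ r k < x k.castSucc) ∧
      P = C (P.coeff N) * ∏ k, (X - C (r k)) := by
  have hroot : ∀ k : Fin N, ∃ r, (x k.succ < r ∧ r < x k.castSucc) ∧ P.eval r = 0 := by
    intro k
    have hlt : x k.succ < x k.castSucc := hx (Fin.castSucc_lt_succ)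
    have h1 := h k.succ
    have h2 := h k.castSucc
    rw [Fin.val_succ, pow_succ] at h1
    rw [Fin.val_castSucc] at h2
    rcases neg_one_pow_eq_or ℝ (k : ℕ) with hs | hs <;> rw [hs] at h1 h2
    · obtain ⟨r, hr, hr0⟩ := intermediate_value_Ioo hlt.le P.continuous.continuousOn
        (show (0 : ℝ) ∈ Set.Ioo _ _ from ⟨by linarith, by linarith⟩)
      exact ⟨r, hr, hr0⟩
    · obtain ⟨r, hr, hr0⟩ := intermediate_value_Ioo' hlt.le P.continuous.continuousOn
        (show (0 : ℝ) ∈ Set.Ioo _ _ from ⟨by linarith, by linarith⟩)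
      exact ⟨r, hr, hr0⟩
  choose r hr hr0 using hroot
  refine ⟨r, hr, ?_⟩
  have hanti : StrictAnti r := by
    intro j k hjk
    have h1 : x k.castSucc ≤ x j.succ := hx.antitone (Fin.succ_le_castSucc_iff.2 hjk)
    linarith [(hr j).1, (hr k).2]
  -- The `N` distinct roots exhaust the degree, so the cofactor is constant.
  obtain ⟨Q, hQ⟩ := nodal_dvd_of_eval_eq_zero hanti.injective hr0
  have hP0 : P ≠ 0 := by rintro rfl; simpa using h 0
  have hQ0 : Q ≠ 0 := by rintro rfl; exact hP0 (by simpa using hQ)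
  have hdeg : Q.natDegree = 0 := by
    have h1 := congrArg natDegree hQ
    rw [natDegree_mul (nodal_monic r).ne_zero hQ0, natDegree_nodal] at h1
    omega
  rw [eq_C_of_natDegree_eq_zero hdeg] at hQ
  have hc : P.coeff N = Q.coeff 0 := by
    have h1 : (nodal r).coeff N = 1 := by
      have := nodal_monic r
      rwa [Monic, leadingCoeff, natDegree_nodal] at this
    rw [hQ, coeff_mul_C, h1, one_mul]
  rw [hc, mul_comm]
  exact hQ

theorem exists_eq_of_nodal_eq {a b : Fin n → ℝ} (h : nodal a = nodal b) (j : Fin n) :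
    ∃ k, b j = a k := by
  have h1 : (nodal a).eval (b j) = 0 := by rw [h, eval_nodal_node]
  rw [eval_nodal, Finset.prod_eq_zero_iff] at h1
  obtain ⟨k, -, hk⟩ := h1
  exact ⟨k, sub_eq_zero.1 hk⟩

theorem injective_of_nodal_eq {a b : Fin n → ℝ} (h : nodal a = nodal b)
    (hb : Function.Injective b) : Function.Injective a := by
  choose f hf using exists_eq_of_nodal_eq h
  have hfi : Function.Injective f := fun i j hij => hb (by rw [hf, hf, hij])
  have hfs := Finite.surjective_of_injective hfi
  intro i j hij
  obtain ⟨i', rfl⟩ := hfs i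
  obtain ⟨j', rfl⟩ := hfs j
  rw [← hf, ← hf] at hij
  rw [hb hij]

theorem eq_of_nodal_eq_of_monotone {a b : Fin n → ℝ} (h : nodal a = nodal b)
    (ha : Monotone a) (hb : Monotone b) : a = b := by
  have key : ∀ c : Fin n → ℝ, (nodal c).roots = (List.ofFn c : Multiset ℝ) := fun c => by
    rw [← Fin.univ_val_map, ← roots_multiset_prod_X_sub_C (Finset.univ.val.map c),
      Multiset.map_map]
    rfl
  have h1 : (List.ofFn a : Multiset ℝ) = List.ofFn b := by rw [← key, ← key, h]
  exact List.ofFn_injective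
    ((Multiset.coe_eq_coe.1 h1).eq_of_sortedLE ha.sortedLE_ofFn hb.sortedLE_ofFn)

end Interlacing

/-! ### Existence and uniqueness of real spheroconic coordinates. -/

section Spheroconic

variable {m : ℕ} {I : Fin (m + 2) → ℝ}

theorem neg_one_pow_mul_conodal_pos (hI : StrictAnti I) (i : Fin (m + 2)) :
    0 < (-1) ^ (i : ℕ) * (conodal I i).eval (I i) := by
  rw [eval_conodal]
  exact neg_one_pow_mul_prod_erase_pos (fun l hl => hI hl) fun l hl => hI hl

theorem strictAnti_of_box (hI : StrictAnti I) {lam : Fin (m + 1) → ℝ}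
    (h : ∀ k, I k.succ < lam k ∧ lam k < I k.castSucc) : StrictAnti lam := by
  intro j k hjk
  have h1 : I k.castSucc ≤ I j.succ := hI.antitone (Fin.succ_le_castSucc_iff.2 hjk)
  linarith [(h j).1, (h k).2]

theorem eq_of_box (hI : StrictAnti I) {z : ℝ} {j k : Fin (m + 1)}
    (hj : I j.succ < z ∧ z < I j.castSucc) (hk : I k.succ < z ∧ z < I k.castSucc) : j = k := by
  rcases lt_trichotomy j k with h | h | h
  · have h1 : I k.castSucc ≤ I j.succ := hI.antitone (Fin.succ_le_castSucc_iff.2 h)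
    linarith [hj.1, hk.2]
  · exact h
  · have h1 : I j.castSucc ≤ I k.succ := hI.antitone (Fin.succ_le_castSucc_iff.2 h)
    linarith [hk.1, hj.2]

/-- At a node `U` equals `q_i² ∏_{l ≠ i} (I_i - I_l)`, whose sign is `(-1)^i` for decreasing `I`;
hence one root lies between any two neighbouring nodes. -/
theorem exists_nodal_of_coords_ne_zero (hI : StrictAnti I) {x : Phase ℝ (m + 2)}
    (hx : ∑ i, x.1 i ^ 2 = 1) (h0 : ∀ i, x.1 i ≠ 0) :
    ∃ lam : Fin (m + 1) → ℝ, (∀ k, I k.succ < lam k ∧ lam k < I k.castSucc) ∧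
      polyU I x = nodal lam := by
  obtain ⟨lam, h1, h2⟩ := exists_roots_of_alternating (natDegree_polyU_le I x) hI fun i => by
    have h1 : (polyU I x).eval (I i) = x.1 i ^ 2 * (conodal I i).eval (I i) :=
      eval_combo_node _ _ _
    rw [h1, mul_left_comm]
    exact mul_pos (pow_pos (abs_pos.2 (h0 i)) 2 |>.trans_eq (sq_abs _))
      (neg_one_pow_mul_conodal_pos hI i)
  have h3 : (polyU I x).coeff (m + 1) = 1 := (coeff_combo I _).trans hx
  rw [h3, C_1, one_mul] at h2
  exact ⟨lam, h1, h2⟩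

theorem existsUnique_spheroconic (hI : StrictAnti I) {q : Fin (m + 2) → ℝ} (hq : q ⬝ᵥ q = 1)
    (h0 : ∀ i, q i ≠ 0) :
    ∃! lam : Fin (m + 1) → ℝ, (∀ k, I k.succ < lam k ∧ lam k < I k.castSucc) ∧
      IsSpheroconic I q lam := by
  obtain ⟨lam, h1, h2⟩ := exists_nodal_of_coords_ne_zero (x := (q, 0)) hI
    (by simpa [dotProduct, sq] using hq) h0
  refine ⟨lam, ⟨h1, (isSpheroconic_iff hI.injective (q, 0) lam).2 h2⟩, ?_⟩
  rintro lam' ⟨h3, h4⟩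
  have h5 : nodal lam' = nodal lam :=
    ((isSpheroconic_iff hI.injective (q, 0) lam').1 h4).symm.trans h2
  funext k
  obtain ⟨j, hj⟩ := exists_eq_of_nodal_eq h5 k
  have : k = j := eq_of_box hI (h1 k) (hj ▸ h3 j)
  rw [hj, this]

theorem sum_sq_of_isSpheroconic (hI : Function.Injective I) {q : Fin (m + 2) → ℝ}
    {lam : Fin (m + 1) → ℝ} (h : IsSpheroconic I q lam) : ∑ i, q i ^ 2 = 1 := by
  have h1 : polyU I (q, 0) = nodal lam := (isSpheroconic_iff hI (q, 0) lam).1 h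
  have h2 : (polyU I (q, 0)).coeff (m + 1) = ∑ i, q i ^ 2 := coeff_combo I _
  rw [← h2, h1]
  have := nodal_monic lam
  rwa [Monic, leadingCoeff, natDegree_nodal] at this

/-- For `λ` in the box, numerator and denominator of the formula for `q_i²` both have the sign
`(-1)^i`, so the quotient is positive and only the sign of `q_i` is free. -/
theorem existsUnique_of_box (hI : StrictAnti I) {lam : Fin (m + 1) → ℝ}
    (h : ∀ k, I k.succ < lam k ∧ lam k < I k.castSucc) {ε : Fin (m + 2) → ℝ}
    (hε : ∀ i, ε i ^ 2 = 1) :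
    ∃! q : Fin (m + 2) → ℝ, q ⬝ᵥ q = 1 ∧ (∀ i, 0 < ε i * q i) ∧ IsSpheroconic I q lam := by
  set f : Fin (m + 2) → ℝ := fun i =>
    (∏ k, (I i - lam k)) / ∏ j ∈ Finset.univ.erase i, (I i - I j) with hf
  have hfpos : ∀ i, 0 < f i := by
    intro i
    have h1 := neg_one_pow_mul_conodal_pos hI i
    rw [eval_conodal] at h1
    have h2 : 0 < (-1) ^ (i : ℕ) * ∏ k, (I i - lam k) :=
      neg_one_pow_mul_prod_pos (Nat.lt_succ_iff.1 i.2)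
        (fun k hk => (hI.antitone (show k.succ ≤ i from hk)).trans_lt (h k).1)
        fun k hk => (h k).2.trans_le (hI.antitone (show i ≤ k.castSucc from hk))
    rw [hf]
    have h3 := div_pos h2 h1
    rwa [mul_div_mul_left _ _ (pow_ne_zero _ (by norm_num))] at h3
  have hs : IsSpheroconic I (fun i => ε i * √(f i)) lam := fun i => by
    rw [mul_pow, hε, one_mul, Real.sq_sqrt (hfpos i).le]
  refine ⟨fun i => ε i * √(f i), ⟨?_, fun i => ?_, hs⟩, ?_⟩
  · have := sum_sq_of_isSpheroconic hI.injective hs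
    simpa only [dotProduct, ← sq] using this
  · rw [← mul_assoc, ← sq, hε, one_mul]
    exact Real.sqrt_pos.2 (hfpos i)
  · rintro q ⟨-, h2, h3⟩
    funext i
    have h4 : ε i * q i = √(f i) := by
      rw [eq_comm, Real.sqrt_eq_iff_mul_self_eq (hfpos i).le (h2 i).le]
      have : q i ^ 2 = f i := h3 i
      rw [← this]
      linear_combination -(q i ^ 2) * hε i
    change q i = ε i * √(f i)
    rw [← h4, ← mul_assoc, ← sq, hε, one_mul]

end Spheroconic


/-! ### The Stäckel form of the Lagrangian. -/

section Staeckel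

variable {m : ℕ} {I : Fin (m + 2) → ℝ}

theorem prod_erase_eq_div {n : ℕ} {f : Fin n → ℝ} {i : Fin n} (h : f i ≠ 0) :
    ∏ l ∈ Finset.univ.erase i, f l = (∏ l, f l) / f i := by
  rw [← Finset.mul_prod_erase _ _ (Finset.mem_univ i), mul_div_cancel_left₀ _ h]

theorem eval_combo_eq_nodal_mul_sum {n : ℕ} {J f : Fin n → ℝ} {z : ℝ} (hz : ∀ i, z - J i ≠ 0) :
    (combo J f).eval z = (nodal J).eval z * ∑ i, f i / (z - J i) := by
  rw [eval_combo, Finset.mul_sum, eval_nodal]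
  refine Finset.sum_congr rfl fun i _ => ?_
  rw [prod_erase_eq_div (f := fun l => z - J l) (hz i)]
  ring

theorem sum_sq_div_sub_coord (hI : Function.Injective I) {q : Fin (m + 2) → ℝ}
    {lam : Fin (m + 1) → ℝ} (hs : IsSpheroconic I q lam) (hne : ∀ i k, lam k - I i ≠ 0)
    (k : Fin (m + 1)) : ∑ i, q i ^ 2 / (lam k - I i) = 0 := by
  have h1 : (polyU I (q, 0)).eval (lam k) = 0 := eval_polyU_coord hI (x := (q, 0)) hs k
  rw [polyU, eval_combo_eq_nodal_mul_sum fun i => hne i k] at h1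
  refine (mul_eq_zero.1 h1).resolve_left ?_
  rw [eval_nodal]
  exact Finset.prod_ne_zero_iff.2 fun i _ => hne i k

/-- Partial fractions of `∏_{l ≠ k} (z - λ_l) / ∏ (z - I_i)` at `z = λ_k`: its residue at `I_i` is
`q_i² / (I_i - λ_k)`. -/
theorem sum_sq_div_sub_coord_sq (hI : Function.Injective I) {q : Fin (m + 2) → ℝ}
    {lam : Fin (m + 1) → ℝ} (hs : IsSpheroconic I q lam) (hne : ∀ i k, lam k - I i ≠ 0)
    (k : Fin (m + 1)) : ∑ i, q i ^ 2 / (lam k - I i) ^ 2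
      = -(conodal lam k).eval (lam k) / (nodal I).eval (lam k) := by
  have hnod : (nodal I).eval (lam k) ≠ 0 := by
    rw [eval_nodal]; exact Finset.prod_ne_zero_iff.2 fun i _ => hne i k
  have hdeg : (conodal lam k).degree < ((m + 2 : ℕ) : WithBot ℕ) := by
    refine lt_of_le_of_lt degree_le_natDegree ?_
    rw [natDegree_conodal]
    exact_mod_cast (by omega : m + 1 - 1 < m + 2)
  have h1 := congrArg (eval (lam k)) (combo_interpolate hI hdeg)
  rw [eval_combo_eq_nodal_mul_sum fun i => hne i k] at h1
  rw [← h1, neg_div, mul_div_cancel_left₀ _ hnod, ← Finset.sum_neg_distrib]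
  refine Finset.sum_congr rfl fun i _ => ?_
  have h2 : q i ^ 2 = (nodal lam).eval (I i) / (conodal I i).eval (I i) := by
    rw [eval_nodal, eval_conodal]; exact hs i
  have h3 : (nodal lam).eval (I i) = (I i - lam k) * (conodal lam k).eval (I i) := by
    rw [nodal_eq lam k, eval_mul, eval_sub, eval_X, eval_C]
  rw [h2, h3]
  have h4 := hne i k
  have h5 := eval_conodal_ne_zero hI i
  field_simp
  ring

/-- In the velocities `μ_k` the matrix of `(A v, v)` is a diagonal one plus a rank-one part; the
rank-one part is exactly what `(A q, v)² / (A q, q)` subtracts. -/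
theorem starLagrangian_eq_of_coords (hI : Function.Injective I) (hI0 : ∀ i, I i ≠ 0)
    {A : Fin (m + 2) → ℝ} (hA : ∀ i, A i = (I i)⁻¹) {q v : Fin (m + 2) → ℝ}
    {lam μ : Fin (m + 1) → ℝ} (hs : IsSpheroconic I q lam) (hne : ∀ i k, lam k - I i ≠ 0)
    (hlam : Function.Injective lam) (hlam0 : ∀ k, lam k ≠ 0) (hb : bil A q q ≠ 0)
    (hv : ∀ i, v i = 1 / 2 * q i * ∑ k, μ k / (lam k - I i)) :
    starLagrangian A q v = -(1 / 8) * ∑ k, (conodal lam k).eval (lam k)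
      / ((nodal I).eval (lam k) * lam k) * μ k ^ 2 := by
  set b := bil A q q with hbdef
  have hb' : b = ∑ i, q i ^ 2 / I i := by
    simp only [hbdef, bil, hA]
    exact Finset.sum_congr rfl fun i _ => by ring
  have hT : ∀ k, ∑ i, q i ^ 2 / (I i * (lam k - I i)) = b / lam k := by
    intro k
    have h1 := sum_sq_div_sub_coord hI hs hne k
    rw [hb', Finset.sum_div, ← add_zero (∑ i, q i ^ 2 / I i / lam k),
      ← zero_div (lam k), ← h1, Finset.sum_div, ← Finset.sum_add_distrib]
    refine Finset.sum_congr rfl fun i _ => ?_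
    have h2 := hne i k
    have h3 := hI0 i
    have h4 := hlam0 k
    field_simp
    ring
  -- Off the diagonal, partial fractions in `I_i` reduce the sum to two instances of `hT`; on the
  -- diagonal, the double pole adds the sum of `sum_sq_div_sub_coord_sq`.
  have hTT : ∀ k s, ∑ i, q i ^ 2 / (I i * (lam k - I i) * (lam s - I i))
      = b / (lam k * lam s) + if k = s then
        -(conodal lam k).eval (lam k) / ((nodal I).eval (lam k) * lam k) else 0 := by
    intro k s
    split_ifs with hks
    · subst hks
      have h1 := hT k
      have h2 := sum_sq_div_sub_coord_sq hI hs hne k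
      have h5 : b / (lam k * lam k)
          + -(conodal lam k).eval (lam k) / ((nodal I).eval (lam k) * lam k)
          = (b / lam k) / lam k + (-(conodal lam k).eval (lam k) / (nodal I).eval (lam k)) / lam k := by
        rw [div_div, div_div]
      rw [h5, ← h1, ← h2, Finset.sum_div, Finset.sum_div, ← Finset.sum_add_distrib]
      refine Finset.sum_congr rfl fun i _ => ?_
      have h2 := hne i k
      have h3 := hI0 i
      have h4 := hlam0 k
      field_simp
      ring
    · have h0 : lam s - lam k ≠ 0 := sub_ne_zero.2 fun h => hks (hlam h.symm)
      have h3 := hlam0 k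
      have h4 := hlam0 s
      have h5 : b / (lam k * lam s) + 0 = (b / lam k - b / lam s) / (lam s - lam k) := by
        field_simp
        ring
      rw [h5, ← hT, ← hT, ← Finset.sum_sub_distrib, Finset.sum_div]
      refine Finset.sum_congr rfl fun i _ => ?_
      have h2 := hne i k
      have h2' := hne i s
      have h3 := hI0 i
      field_simp
      ring
  have hqv : bil A q v = 1 / 2 * b * ∑ k, μ k / lam k := by
    have : ∀ i, A i * q i * v i = ∑ k, 1 / 2 * μ k * (q i ^ 2 / (I i * (lam k - I i))) := by
      intro i
      rw [hA, hv, Finset.mul_sum, Finset.mul_sum]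
      refine Finset.sum_congr rfl fun k _ => ?_
      have h2 := hne i k
      have h3 := hI0 i
      field_simp
    simp only [bil, this]
    rw [Finset.sum_comm, Finset.mul_sum]
    refine Finset.sum_congr rfl fun k _ => ?_
    rw [← Finset.mul_sum, hT]
    ring
  have hvv : bil A v v = 1 / 4 * (b * (∑ k, μ k / lam k) ^ 2 - ∑ k, (conodal lam k).eval (lam k)
      / ((nodal I).eval (lam k) * lam k) * μ k ^ 2) := by
    have h1 : ∀ i, A i * v i * v i = ∑ k, ∑ s, 1 / 4 * (μ k * μ s) *
        (q i ^ 2 / (I i * (lam k - I i) * (lam s - I i))) := by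
      intro i
      have : A i * v i * v i = 1 / 4 * (q i ^ 2 / I i) *
          ((∑ k, μ k / (lam k - I i)) * ∑ k, μ k / (lam k - I i)) := by
        rw [hA, hv]
        ring
      rw [this, Finset.sum_mul_sum, Finset.mul_sum]
      refine Finset.sum_congr rfl fun k _ => ?_
      rw [Finset.mul_sum]
      refine Finset.sum_congr rfl fun s _ => ?_
      have h2 := hne i k
      have h2' := hne i s
      have h3 := hI0 i
      field_simp
    simp only [bil, h1]
    rw [Finset.sum_comm]
    have h2 : ∀ k, ∑ i, ∑ s, 1 / 4 * (μ k * μ s) *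
        (q i ^ 2 / (I i * (lam k - I i) * (lam s - I i)))
        = 1 / 4 * (∑ s, b * (μ k / lam k * (μ s / lam s)) - (conodal lam k).eval (lam k)
          / ((nodal I).eval (lam k) * lam k) * μ k ^ 2) := by
      intro k
      rw [Finset.sum_comm]
      simp only [← Finset.mul_sum, hTT, mul_add, Finset.sum_add_distrib, mul_ite, mul_zero,
        Finset.sum_ite_eq, Finset.mem_univ, if_true]
      rw [mul_sub, Finset.mul_sum, Finset.mul_sum, Finset.mul_sum, sub_eq_add_neg]
      congr 1
      · refine Finset.sum_congr rfl fun s _ => ?_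
        ring
      · ring
    simp only [h2]
    rw [← Finset.mul_sum, Finset.sum_sub_distrib, sq (∑ k, μ k / lam k), Finset.sum_mul_sum,
      Finset.mul_sum]
    simp only [Finset.mul_sum]
  rw [starLagrangian, hqv, hvv, ← hbdef]
  field_simp
  ring

theorem starLagrangian_staeckel (hI : StrictAnti I) (hpos : ∀ i, 0 < I i)
    {A : Fin (m + 2) → ℝ} (hA : ∀ i, A i = (I i)⁻¹) {Q : ℝ → Fin (m + 2) → ℝ}
    {lam : ℝ → Fin (m + 1) → ℝ} {s : ℝ} (hQ : DifferentiableAt ℝ Q s)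
    (hlam : DifferentiableAt ℝ lam s) (h0 : ∀ i, Q s i ≠ 0)
    (hs : ∀ᶠ r in nhds s, IsSpheroconic I (Q r) (lam r)) :
    starLagrangian A (Q s) (deriv Q s) =
      -(1 / 8) * ∑ k, (∏ l ∈ Finset.univ.erase k, (lam s k - lam s l))
        / ((∏ i, (lam s k - I i)) * lam s k) * (deriv (fun r => lam r k) s) ^ 2 := by
  have hss := hs.self_of_nhds
  have hsum := sum_sq_of_isSpheroconic hI.injective hss
  have hpoly : polyU I (Q s, 0) = nodal (lam s) :=
    (isSpheroconic_iff hI.injective (Q s, 0) (lam s)).1 hss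
  -- The given coordinates carry no prescribed order; comparison with the roots found in the boxes
  -- shows that they are distinct and positive.
  obtain ⟨lam₀, hbox, hpoly₀⟩ := exists_nodal_of_coords_ne_zero (x := (Q s, 0)) hI hsum h0
  have hnod : nodal lam₀ = nodal (lam s) := hpoly₀.symm.trans hpoly
  have hinj : Function.Injective (lam s) :=
    injective_of_nodal_eq hnod.symm (strictAnti_of_box hI hbox).injective
  have hlampos : ∀ k, lam s k ≠ 0 := fun k => by
    obtain ⟨j, hj⟩ := exists_eq_of_nodal_eq hnod k
    rw [hj]
    exact ((hpos _).trans (hbox j).1).ne'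
  have hcon := fun i => eval_conodal_ne_zero hI.injective i
  have hne : ∀ i k, lam s k - I i ≠ 0 := by
    intro i k h
    have h1 := hss i
    rw [Finset.prod_eq_zero (Finset.mem_univ k) (by linarith), zero_div] at h1
    exact h0 i (pow_eq_zero_iff two_ne_zero |>.1 h1)
  have hb : bil A (Q s) (Q s) ≠ 0 := by
    refine (Finset.sum_pos (fun i _ => ?_) Finset.univ_nonempty).ne'
    rw [mul_assoc]
    exact mul_pos (by rw [hA]; exact inv_pos.2 (hpos i)) (mul_self_pos.2 (h0 i))
  have key := starLagrangian_eq_of_coords hI.injective (fun i => (hpos i).ne') hA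
    (v := deriv Q s) (μ := fun k => deriv (fun r => lam r k) s) hss hne hinj hlampos hb ?_
  · simpa only [eval_conodal, eval_nodal] using key
  -- Logarithmic differentiation of the formula for `q_i²` gives `v_i` in the form required by
  -- `starLagrangian_eq_of_coords`.
  intro i
  have hQi : HasDerivAt (fun r => Q r i) (deriv Q s i) s := hasDerivAt_pi.1 hQ.hasDerivAt i
  have hli : ∀ k, HasDerivAt (fun r => lam r k) (deriv (fun r => lam r k) s) s := fun k =>
    (hasDerivAt_pi.1 hlam.hasDerivAt k).differentiableAt.hasDerivAt
  have h1 : HasDerivAt (fun r => Q r i ^ 2) (2 * Q s i * deriv Q s i) s := by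
    simpa using hQi.fun_pow 2
  have h2 : HasDerivAt (fun r => (∏ k, (I i - lam r k)) / ∏ j ∈ Finset.univ.erase i, (I i - I j))
      ((∑ k, (∏ l ∈ Finset.univ.erase k, (I i - lam s l)) • -deriv (fun r => lam r k) s)
        / ∏ j ∈ Finset.univ.erase i, (I i - I j)) s := by
    exact (HasDerivAt.fun_finsetProd fun k _ => (hli k).const_sub (I i)).div_const _
  have h3 := h1.unique (h2.congr_of_eventuallyEq (hs.mono fun r hr => hr i))
  have h4 : ∀ k, (∏ l ∈ Finset.univ.erase k, (I i - lam s l))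
      = (∏ l, (I i - lam s l)) / (I i - lam s k) := fun k =>
    prod_erase_eq_div (f := fun l => I i - lam s l) (by have := hne i k; intro h; apply this; linarith)
  simp only [h4, smul_eq_mul] at h3
  have h5 : (∏ l, (I i - lam s l)) = Q s i ^ 2 * ∏ j ∈ Finset.univ.erase i, (I i - I j) := by
    rw [hss i, div_mul_cancel₀]
    have := hcon i
    rwa [eval_conodal] at this
  have h6 : ∏ j ∈ Finset.univ.erase i, (I i - I j) ≠ 0 := by
    have := hcon i
    rwa [eval_conodal] at this
  have h7 : (∑ k, (∏ l, (I i - lam s l)) / (I i - lam s k) * -deriv (fun r => lam r k) s)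
      = (Q s i ^ 2 * ∏ j ∈ Finset.univ.erase i, (I i - I j)) *
        ∑ k, deriv (fun r => lam r k) s / (lam s k - I i) := by
    rw [h5, Finset.mul_sum]
    refine Finset.sum_congr rfl fun k _ => ?_
    have h8 := hne i k
    rw [← neg_sub (lam s k)]
    field_simp
  rw [h7] at h3
  have h8 := h0 i
  field_simp at h3 ⊢
  exact h3

end Staeckel


/-! ### Real constants of motion, and density of the generic ones. -/

section Constants

variable {m : ℕ} {I : Fin (m + 2) → ℝ}

/-- Projection along a compact factor is closed. It extends the existence of constants by density,
and also shows that the generic set is relatively open. -/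
theorem isClosed_exists_mem_compact {X Y : Type*} [TopologicalSpace X] [TopologicalSpace Y]
    {K : Set Y} (hK : IsCompact K) {S : Set (X × Y)} (hS : IsClosed S) :
    IsClosed {x | ∃ y ∈ K, (x, y) ∈ S} := by
  have : CompactSpace K := isCompact_iff_compactSpace.1 hK
  have h1 : IsClosed ((fun z : X × K => (z.1, (z.2 : Y))) ⁻¹' S) :=
    hS.preimage (by fun_prop)
  convert isClosedMap_fst_of_compactSpace _ h1 using 1
  ext x
  constructor
  · rintro ⟨y, hy, h⟩
    exact ⟨(x, ⟨y, hy⟩), h, rfl⟩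
  · rintro ⟨⟨x', y⟩, h, rfl⟩
    exact ⟨y, y.2, h⟩

theorem isClosed_cotangentSphere (n : ℕ) : IsClosed (cotangentSphere ℝ n) :=
  (isClosed_eq (by fun_prop) continuous_const).inter (isClosed_eq (by fun_prop) continuous_const)

theorem continuous_eval_integralPoly {n : ℕ} (J : Fin n → ℝ) (z : ℝ) :
    Continuous fun x : Phase ℝ n => (integralPoly J x).eval z := by
  have h : (fun x : Phase ℝ n => (integralPoly J x).eval z)
      = fun x => ∑ l ∈ Finset.range (2 * n + 2), integral J l x * z ^ l := by
    funext x
    exact eval_eq_sum_range' (natDegree_integralPoly_lt J x) z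
  rw [h]
  exact continuous_finsetSum _ fun l _ => ((contDiff_integral J l (N := 0)).continuous).mul
    continuous_const

theorem continuous_eval_polyU {n : ℕ} (J : Fin n → ℝ) (z : ℝ) :
    Continuous fun x : Phase ℝ n => (polyU J x).eval z := by
  simp only [polyU, eval_combo]
  fun_prop

theorem continuous_starHamiltonian {n : ℕ} (J : Fin n → ℝ) : Continuous (starHamiltonian J) :=
  (contDiff_starHamiltonian J (N := 0)).continuous

theorem continuous_eval_nodal {n : ℕ} (z : ℝ) :
    Continuous fun c : Fin n → ℝ => (nodal c).eval z := by
  simp only [eval_nodal]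
  fun_prop

/-- The closed conditions satisfied by the spheroconic coordinates and the constants of motion. -/
def interlacingSet (I : Fin (m + 2) → ℝ) :
    Set (Phase ℝ (m + 2) × ((Fin (m + 1) → ℝ) × (Fin m → ℝ))) :=
  {y | (∀ k, I k.succ ≤ y.2.1 k ∧ y.2.1 k ≤ I k.castSucc) ∧
    (∀ j, y.2.1 j.succ ≤ y.2.2 j ∧ y.2.2 j ≤ y.2.1 j.castSucc) ∧
    polyU I y.1 = nodal y.2.1 ∧
    integralPoly I y.1 = C (starHamiltonian I y.1) * nodal y.2.2}

theorem isClosed_interlacingSet (I : Fin (m + 2) → ℝ) : IsClosed (interlacingSet I) := by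
  have h1 : interlacingSet I =
      (⋂ k, {y | I k.succ ≤ y.2.1 k} ∩ {y | y.2.1 k ≤ I k.castSucc}) ∩
      ((⋂ j, {y | y.2.1 j.succ ≤ y.2.2 j} ∩ {y | y.2.2 j ≤ y.2.1 j.castSucc}) ∩
      ((⋂ z, {y | (polyU I y.1).eval z = (nodal y.2.1).eval z}) ∩
      ⋂ z, {y | (integralPoly I y.1).eval z = starHamiltonian I y.1 * (nodal y.2.2).eval z})) := by
    ext y
    simp only [interlacingSet, Set.mem_ofPred_eq, Set.mem_inter_iff, Set.mem_iInter]
    refine and_congr Iff.rfl (and_congr Iff.rfl (and_congr ⟨fun h z => by rw [h], fun h =>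
      Polynomial.funext h⟩ ⟨fun h z => by rw [h, eval_mul, eval_C], fun h =>
      Polynomial.funext fun z => by rw [h, eval_mul, eval_C]⟩))
  rw [h1]
  refine (isClosed_iInter fun k => ?_).inter ((isClosed_iInter fun j => ?_).inter
    ((isClosed_iInter fun z => ?_).inter (isClosed_iInter fun z => ?_)))
  · exact (isClosed_le (by fun_prop) (by fun_prop)).inter (isClosed_le (by fun_prop) (by fun_prop))
  · exact (isClosed_le (by fun_prop) (by fun_prop)).inter (isClosed_le (by fun_prop) (by fun_prop))
  · exact isClosed_eq ((continuous_eval_polyU I z).comp continuous_fst)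
      ((continuous_eval_nodal z).comp (by fun_prop))
  · exact isClosed_eq ((continuous_eval_integralPoly I z).comp continuous_fst)
      (((continuous_starHamiltonian I).comp continuous_fst).mul
      ((continuous_eval_nodal z).comp (by fun_prop)))

/-- Points in general position: no coordinate of `q` vanishes, `polyU` and `polyW` have no common
root and no node is a root of `integralPoly`. -/
def generalPoints (I : Fin (m + 2) → ℝ) : Set (Phase ℝ (m + 2)) :=
  {x | x ∈ cotangentSphere ℝ (m + 2) ∧ (∀ i, x.1 i ≠ 0) ∧
    (∀ z, (polyU I x).eval z = 0 → (polyW I x).eval z ≠ 0) ∧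
    ∀ i, (integralPoly I x).eval (I i) ≠ 0}

theorem neg_one_pow_mul_nodal_box (hI : StrictAnti I) {lam : Fin (m + 1) → ℝ}
    (h : ∀ k, I k.succ < lam k ∧ lam k < I k.castSucc) (k : Fin (m + 1)) :
    0 < (-1) ^ ((k : ℕ) + 1) * (nodal I).eval (lam k) := by
  rw [eval_nodal]
  refine neg_one_pow_mul_prod_pos (by omega) (fun i hi => ?_) fun i hi => ?_
  · exact (h k).2.trans_le (hI.antitone (show i ≤ k.castSucc from Nat.lt_succ_iff.1 hi))
  · exact (hI.antitone (show k.succ ≤ i from hi)).trans_lt (h k).1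

/-- At the `λ_k` the relation `2 a F = -λ_k W²` with `W ≠ 0` and alternating `a` makes `F`
alternate. Its `m` roots then lie strictly between neighbouring `λ_k`, so they are distinct and
positive; they avoid the nodes by assumption. -/
theorem exists_constants_of_mem_generalPoints (hI : StrictAnti I) (hpos : ∀ i, 0 < I i)
    {x : Phase ℝ (m + 2)} (hx : x ∈ generalPoints I) :
    ∃ lam : Fin (m + 1) → ℝ, ∃ c : Fin m → ℝ, (x, lam, c) ∈ interlacingSet I ∧ IsGeneric I c := by
  obtain ⟨hT, h0, hW, hF⟩ := hx
  obtain ⟨lam, hbox, hU⟩ := exists_nodal_of_coords_ne_zero hI (sum_fst_mul_fst hT) h0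
  have hanti := strictAnti_of_box hI hbox
  have hUlam : ∀ k, (polyU I x).eval (lam k) = 0 := fun k => by rw [hU, eval_nodal_node]
  obtain ⟨hdeg, hlead⟩ := integralPoly_degree_coeff I hT
  obtain ⟨c, hc, hcF⟩ := exists_roots_of_alternating hdeg hanti fun k => by
    have h1 := eval_fundamental I x (lam k)
    rw [hUlam, zero_mul, zero_sub] at h1
    have h2 := neg_one_pow_mul_nodal_box hI hbox k
    have h3 : 0 < lam k * (polyW I x).eval (lam k) ^ 2 :=
      mul_pos ((hpos _).trans (hbox k).1) (pow_pos (abs_pos.2 (hW _ (hUlam k))) 2 |>.trans_eq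
        (sq_abs _))
    rw [pow_succ] at h2
    have h4 : ((-1) ^ (k : ℕ) * -1 * (nodal I).eval (lam k)) *
        ((-1) ^ (k : ℕ) * (integralPoly I x).eval (lam k))
        = 1 / 2 * (lam k * (polyW I x).eval (lam k) ^ 2) := by
      have h5 : ((-1 : ℝ) ^ (k : ℕ)) * (-1) ^ (k : ℕ) = 1 := by
        rw [← mul_pow]; simp
      linear_combination (-1 / 2) * h1 -
        (nodal I).eval (lam k) * (integralPoly I x).eval (lam k) * h5
    exact (pos_iff_pos_of_mul_pos (by rw [h4]; positivity)).1 h2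
  have hcanti : StrictAnti c := by
    intro j k hjk
    have h1 : lam k.castSucc ≤ lam j.succ := hanti.antitone (Fin.succ_le_castSucc_iff.2 hjk)
    linarith [(hc j).1, (hc k).2]
  have hcF' : integralPoly I x = C (starHamiltonian I x) * nodal c := by
    rw [← hlead]; exact hcF
  refine ⟨lam, c, ⟨fun k => ⟨(hbox k).1.le, (hbox k).2.le⟩, fun j => ⟨(hc j).1.le, (hc j).2.le⟩,
    hU, hcF'⟩, hcanti.injective, fun j => ⟨?_, fun i hi => ?_⟩⟩
  · exact ((hpos _).trans ((hbox _).1.trans (hc j).1)).ne'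
  · exact hF i (by rw [hcF', eval_mul, ← hi, eval_nodal_node, mul_zero])

theorem eventually_eval_ne_zero {P : ℝ[X]} (hP : P ≠ 0) (a : ℝ) :
    ∀ᶠ s in nhdsWithin a {a}ᶜ, P.eval s ≠ 0 := by
  have h1 : (↑(P.roots.toFinset.erase a) : Set ℝ)ᶜ ∈ nhds a :=
    (Finset.finite_toSet _).isClosed.isOpen_compl.mem_nhds (by simp)
  filter_upwards [mem_nhdsWithin_of_mem_nhds h1, self_mem_nhdsWithin] with s hs hs' h
  exact hs (Finset.mem_coe.2 (Finset.mem_erase.2 ⟨hs', by simpa [hP] using h⟩))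

theorem eval_interpolant_eq {lam : Fin (m + 1) → ℝ} (v : Fin (m + 1) → ℝ) (z : ℝ) :
    (interpolant lam v).eval z
      = ∑ k, v k * ((conodal lam k).eval z / (conodal lam k).eval (lam k)) := by
  rw [interpolant, combo, eval_finsetSum]
  refine Finset.sum_congr rfl fun k _ => ?_
  rw [eval_mul, eval_C]
  ring

/-- With `q` fixed, `p` is perturbed so that `W(λ_k)` changes by `s^{k+1}`. All quantities that must
not vanish become nonzero polynomials in `s`, so they are nonzero for small `s ≠ 0`. -/
theorem mem_closure_generalPoints_of_ne_zero (hI : StrictAnti I) (hpos : ∀ i, 0 < I i)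
    {x : Phase ℝ (m + 2)} (hT : x ∈ cotangentSphere ℝ (m + 2)) (h0 : ∀ i, x.1 i ≠ 0) :
    x ∈ closure (generalPoints I) := by
  obtain ⟨lam, hbox, hU⟩ := exists_nodal_of_coords_ne_zero hI (sum_fst_mul_fst hT) h0
  have hanti := strictAnti_of_box hI hbox
  have hinj := hanti.injective
  have hne : ∀ i k, I i - lam k ≠ 0 := by
    intro i k h
    have h1 := (isSpheroconic_iff hI.injective x lam).2 hU i
    rw [Finset.prod_eq_zero (Finset.mem_univ k) h, zero_div] at h1
    exact h0 i (pow_eq_zero_iff two_ne_zero |>.1 h1)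
  have hnodne : ∀ k, (nodal I).eval (lam k) ≠ 0 := fun k h => by
    have := neg_one_pow_mul_nodal_box hI hbox k
    rw [h, mul_zero] at this
    exact lt_irrefl _ this
  set d : ℝ → ℝ[X] := fun s => interpolant lam fun k => s ^ ((k : ℕ) + 1) with hd
  set γ : ℝ → Phase ℝ (m + 2) := fun s =>
    (x.1, fun i => x.2 i + (d s).eval (I i) / (conodal I i).eval (I i) / x.1 i) with hγ
  have hWγ : ∀ s, polyW I (γ s) = polyW I x + d s := by
    intro s
    have hdeg : (d s).degree < ((m + 2 : ℕ) : WithBot ℕ) :=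
      lt_of_le_of_lt degree_le_natDegree (by
        exact_mod_cast (natDegree_interpolant_le lam _).trans_lt (by omega))
    rw [← combo_interpolate hI.injective hdeg, polyW, polyW, ← combo_add]
    congr 1
    funext i
    simp only [hγ, Pi.add_apply]
    have := h0 i
    field_simp
  have hTγ : ∀ s, γ s ∈ cotangentSphere ℝ (m + 2) := by
    intro s
    refine ⟨hT.1, ?_⟩
    have h1 : (polyW I (γ s)).coeff (m + 1) = ∑ i, (γ s).1 i * (γ s).2 i := coeff_combo I _
    have h2 : (polyW I x).coeff (m + 1) = ∑ i, x.1 i * x.2 i := coeff_combo I _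
    change ∑ i, (γ s).1 i * (γ s).2 i = 0
    rw [← h1, hWγ, coeff_add, h2, sum_fst_mul_snd hT, zero_add]
    exact coeff_eq_zero_of_natDegree_lt ((natDegree_interpolant_le lam _).trans_lt (by omega))
  have hUγ : ∀ s, polyU I (γ s) = nodal lam := fun s => hU
  have hWlam : ∀ s k, (polyW I (γ s)).eval (lam k)
      = (polyW I x).eval (lam k) + s ^ ((k : ℕ) + 1) := by
    intro s k
    rw [hWγ, eval_add, hd, eval_interpolant hinj]
  have hFlam : ∀ s k, (integralPoly I (γ s)).eval (lam k) = -(lam k / (2 * (nodal I).eval (lam k)))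
      * ((polyW I x).eval (lam k) + s ^ ((k : ℕ) + 1)) ^ 2 := by
    intro s k
    have h1 := eval_fundamental I (γ s) (lam k)
    rw [hUγ, eval_nodal_node, zero_mul, zero_sub, hWlam] at h1
    have := hnodne k
    field_simp
    linear_combination h1
  set β : Fin (m + 2) → Fin (m + 1) → ℝ := fun i k => -(lam k / (2 * (nodal I).eval (lam k))) *
    ((conodal lam k).eval (I i) / (conodal lam k).eval (lam k)) with hβ
  have hβ0 : ∀ i k, β i k ≠ 0 := by
    intro i k
    refine mul_ne_zero (neg_ne_zero.2 (div_ne_zero ((hpos _).trans (hbox k).1).ne'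
      (mul_ne_zero two_ne_zero (hnodne k)))) (div_ne_zero ?_ (eval_conodal_ne_zero hinj k))
    rw [eval_conodal]
    exact Finset.prod_ne_zero_iff.2 fun l _ => hne i l
  have hFI : ∀ s i, (integralPoly I (γ s)).eval (I i)
      = ∑ k, β i k * ((polyW I x).eval (lam k) + s ^ ((k : ℕ) + 1)) ^ 2 := by
    intro s i
    rw [eq_interpolant hinj (integralPoly_degree_coeff I (hTγ s)).1 (fun k => rfl),
      eval_interpolant_eq]
    refine Finset.sum_congr rfl fun k _ => ?_
    rw [hFlam, hβ]
    ring
  have hlim : Filter.Tendsto γ (nhdsWithin 0 {0}ᶜ) (nhds x) := by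
    have hcont : Continuous γ := by
      simp only [hγ, hd, eval_interpolant_eq]
      fun_prop
    have h1 : γ 0 = x := by
      refine Prod.ext rfl ?_
      funext i
      simp [hγ, hd, eval_interpolant_eq]
    rw [← h1]
    exact (hcont.tendsto 0).mono_left nhdsWithin_le_nhds
  refine mem_closure_of_tendsto hlim ?_
  have e1 : ∀ k, ∀ᶠ s in nhdsWithin (0 : ℝ) {0}ᶜ,
      (C ((polyW I x).eval (lam k)) + X ^ ((k : ℕ) + 1) : ℝ[X]).eval s ≠ 0 := fun k => by
    refine eventually_eval_ne_zero (fun h => ?_) 0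
    have := congrArg (fun P => coeff P ((k : ℕ) + 1)) h
    simp at this
  have e2 : ∀ i, ∀ᶠ s in nhdsWithin (0 : ℝ) {0}ᶜ,
      (∑ k, C (β i k) * (C ((polyW I x).eval (lam k)) + X ^ ((k : ℕ) + 1)) ^ 2 : ℝ[X]).eval s
        ≠ 0 := fun i => by
    refine eventually_eval_ne_zero (fun h => hβ0 i (Fin.last m) ?_) 0
    -- The different exponents prevent cancellation between different `k`: the power `s^{2(m+1)}`
    -- comes from the last index alone.
    have h1 := congrArg (fun P => coeff P (2 * (m + 1))) h
    simp only [finsetSum_coeff, coeff_C_mul, coeff_zero] at h1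
    rw [← h1, Finset.sum_eq_single (Fin.last m)]
    · have : (C (eval (lam (Fin.last m)) (polyW I x)) + X ^ (m + 1) : ℝ[X]) ^ 2
          = C (eval (lam (Fin.last m)) (polyW I x) ^ 2)
          + C (2 * eval (lam (Fin.last m)) (polyW I x)) * X ^ (m + 1) + X ^ (2 * (m + 1)) := by
        simp only [C_mul, C_pow, C_ofNat]
        ring
      rw [Fin.val_last, this, coeff_add, coeff_add, coeff_C_mul, coeff_X_pow, coeff_X_pow,
        coeff_C]
      rw [if_neg (by omega), if_neg (by omega), if_pos rfl]
      ring
    · intro k _ hk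
      have hk' : (k : ℕ) < m := lt_of_le_of_ne (Nat.lt_succ_iff.1 k.2) fun h => hk (Fin.ext h)
      rw [coeff_eq_zero_of_natDegree_lt, mul_zero]
      refine lt_of_le_of_lt natDegree_pow_le ?_
      refine lt_of_le_of_lt (Nat.mul_le_mul_left 2 (natDegree_add_le_of_degree_le (n := k + 1)
        (by simp) (natDegree_X_pow_le _))) ?_
      omega
    · simp
  filter_upwards [Filter.eventually_all.2 e1, Filter.eventually_all.2 e2] with s h1 h2
  refine ⟨hTγ s, h0, fun z hz => ?_, fun i => ?_⟩
  · rw [hUγ, eval_nodal, Finset.prod_eq_zero_iff] at hz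
    obtain ⟨k, -, hk⟩ := hz
    rw [sub_eq_zero.1 hk, hWlam]
    simpa using h1 k
  · rw [hFI]
    simpa [eval_finsetSum] using h2 i

theorem mem_closure_ne_zero {n : ℕ} {x : Phase ℝ n} (hT : x ∈ cotangentSphere ℝ n) :
    x ∈ closure {y : Phase ℝ n | y ∈ cotangentSphere ℝ n ∧ ∀ i, y.1 i ≠ 0} := by
  -- All coordinates are shifted by `s`, the vector is normalized, and `p` is projected onto its
  -- orthogonal complement.
  set r : ℝ → Fin n → ℝ := fun s i => x.1 i + s with hr
  set u : ℝ → Fin n → ℝ := fun s => (√(r s ⬝ᵥ r s))⁻¹ • r s with hu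
  set γ : ℝ → Phase ℝ n := fun s => (u s, x.2 - (u s ⬝ᵥ x.2) • u s) with hγ
  have hr0 : r 0 = x.1 := by simp [hr]
  have hrr : r 0 ⬝ᵥ r 0 = 1 := by rw [hr0]; exact hT.1
  have hrc : Continuous r := by simp only [hr]; fun_prop
  have huc : ContinuousAt u 0 := by
    refine ContinuousAt.fun_smul (ContinuousAt.fun_inv₀ (f := fun s => √(r s ⬝ᵥ r s)) ?_ ?_)
      hrc.continuousAt
    · exact (Real.continuous_sqrt.comp (by fun_prop)).continuousAt
    · rw [hrr]; simp
  have hu0 : u 0 = x.1 := by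
    simp only [hu]
    rw [hrr, hr0, Real.sqrt_one, inv_one, one_smul]
  have hγ0 : γ 0 = x := by
    refine Prod.ext hu0 ?_
    simp only [hγ, hu0]
    rw [hT.2, zero_smul, sub_zero]
  have hγc : ContinuousAt γ 0 := by
    refine huc.prodMk (continuousAt_const.sub (ContinuousAt.fun_smul ?_ huc))
    exact ContinuousAt.comp (g := fun v : Fin n → ℝ => v ⬝ᵥ x.2) (by fun_prop) huc
  have hlim : Filter.Tendsto γ (nhdsWithin 0 {0}ᶜ) (nhds x) := by
    have := hγc.tendsto
    rw [hγ0] at this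
    exact this.mono_left nhdsWithin_le_nhds
  refine mem_closure_of_tendsto hlim ?_
  have e1 : ∀ i, ∀ᶠ s in nhdsWithin (0 : ℝ) {0}ᶜ, x.1 i + s ≠ 0 := fun i => by
    have := eventually_eval_ne_zero (P := X + C (x.1 i)) (X_add_C_ne_zero _) 0
    filter_upwards [this] with s hs
    simpa [add_comm] using hs
  have e2 : ∀ᶠ s in nhdsWithin (0 : ℝ) {0}ᶜ, 0 < r s ⬝ᵥ r s := by
    have : ContinuousAt (fun s => r s ⬝ᵥ r s) 0 := by fun_prop
    exact (this.eventually_mem (Ioi_mem_nhds (by rw [hrr]; exact one_pos))).filter_mono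
      nhdsWithin_le_nhds
  filter_upwards [Filter.eventually_all.2 e1, e2] with s h1 h2
  have huu : u s ⬝ᵥ u s = 1 := by
    simp only [hu, smul_dotProduct, dotProduct_smul, smul_eq_mul]
    rw [← mul_assoc, ← mul_inv, Real.mul_self_sqrt h2.le, inv_mul_cancel₀ h2.ne']
  refine ⟨⟨huu, ?_⟩, fun i => mul_ne_zero (inv_ne_zero (Real.sqrt_pos.2 h2).ne') (h1 i)⟩
  simp only [hγ, dotProduct_sub, dotProduct_smul, smul_eq_mul]
  rw [huu, mul_one, sub_self]

theorem cotangentSphere_subset_closure (hI : StrictAnti I) (hpos : ∀ i, 0 < I i) :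
    cotangentSphere ℝ (m + 2) ⊆ closure (generalPoints I) := fun _ hx =>
  closure_minimal (fun _ hy => mem_closure_generalPoints_of_ne_zero hI hpos hy.1 hy.2)
    isClosed_closure (mem_closure_ne_zero hx)

/-- The inequalities and factorizations are closed conditions on `(x, λ, c)`, and `(λ, c)` ranges
over a compact box; so existence passes from the general points to their closure, which is
everything. -/
theorem exists_interlacing (hI : StrictAnti I) (hpos : ∀ i, 0 < I i) {x : Phase ℝ (m + 2)}
    (hx : x ∈ cotangentSphere ℝ (m + 2)) :
    ∃ lam : Fin (m + 1) → ℝ, ∃ c : Fin m → ℝ, (x, lam, c) ∈ interlacingSet I := by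
  set K : Set ((Fin (m + 1) → ℝ) × (Fin m → ℝ)) :=
    (Set.Icc (fun _ => I (Fin.last _)) fun _ => I 0) ×ˢ
      Set.Icc (fun _ => I (Fin.last _)) fun _ => I 0 with hK
  have hKc : IsCompact K := isCompact_Icc.prod isCompact_Icc
  have hcl := isClosed_exists_mem_compact hKc (isClosed_interlacingSet I)
  have hsub : generalPoints I ⊆ {x | ∃ y ∈ K, (x, y) ∈ interlacingSet I} := by
    intro y hy
    obtain ⟨lam, c, h, -⟩ := exists_constants_of_mem_generalPoints hI hpos hy
    have h1 : ∀ k, I (Fin.last _) ≤ lam k := fun k =>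
      (hI.antitone (Fin.le_last _)).trans (h.1 k).1
    have h2 : ∀ k, lam k ≤ I 0 := fun k => (h.1 k).2.trans (hI.antitone (Fin.zero_le _))
    exact ⟨(lam, c), ⟨⟨h1, h2⟩, fun j => (h1 _).trans (h.2.1 j).1,
      fun j => (h.2.1 j).2.trans (h2 _)⟩, h⟩
  obtain ⟨⟨lam, c⟩, -, h⟩ := closure_minimal hsub hcl (cotangentSphere_subset_closure hI hpos hx)
  exact ⟨lam, c, h⟩

theorem starHamiltonian_pos (hpos : ∀ i, 0 < I i) {x : Phase ℝ (m + 2)} (h : x.2 ≠ 0) :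
    0 < starHamiltonian I x := by
  obtain ⟨i, hi⟩ := Function.ne_iff.1 h
  refine mul_pos (by norm_num) (Finset.sum_pos' (fun j _ => mul_nonneg (hpos j).le (sq_nonneg _))
    ⟨i, Finset.mem_univ i, mul_pos (hpos i) ?_⟩)
  exact (pow_pos (abs_pos.2 hi) 2).trans_eq (sq_abs _)

theorem level_eq_starHamiltonian {h : ℝ} {c : Fin m → ℝ} {x : Phase ℝ (m + 2)}
    (hx : x ∈ levelSet I h c) : h = starHamiltonian I x := by
  rw [← (integralPoly_degree_coeff I hx.1).2, integral, hx.2, coeff_C_mul]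
  have h1 := nodal_monic c
  rw [Monic, leadingCoeff, natDegree_nodal] at h1
  exact (mul_one h).symm.trans (congrArg _ h1.symm)

theorem existsUnique_constants (hI : StrictAnti I) (hpos : ∀ i, 0 < I i) {x : Phase ℝ (m + 2)}
    (hx : x ∈ cotangentSphere ℝ (m + 2)) (hp : x.2 ≠ 0) :
    ∃! c : Fin m → ℝ, Monotone c ∧ x ∈ levelSet I (starHamiltonian I x) c := by
  obtain ⟨lam, c, h1, h2, h3, h4⟩ := exists_interlacing hI hpos hx
  have hH := (starHamiltonian_pos hpos hp).ne'
  have hlam : Antitone lam := Fin.antitone_iff_succ_le.2 fun j => (h2 j).1.trans (h2 j).2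
  have hc : Antitone c := by
    intro j k hjk
    rcases hjk.eq_or_lt with rfl | hlt
    · exact le_rfl
    · exact (h2 k).2.trans ((hlam (Fin.succ_le_castSucc_iff.2 hlt)).trans (h2 j).1)
  -- The `I_i` decrease, so the interlacing constants come out decreasing; reversing the index makes
  -- them increasing.
  have hrev : nodal (fun j => c (Fin.rev j)) = nodal c :=
    Fintype.prod_equiv Fin.revPerm _ _ fun j => rfl
  refine ⟨fun j => c (Fin.rev j), ⟨fun j k hjk => hc (Fin.rev_le_rev.2 hjk), hx, ?_⟩, ?_⟩
  · rw [h4, ← hrev]; rfl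
  · rintro c' ⟨hm, -, h5⟩
    refine eq_of_nodal_eq_of_monotone ?_ hm fun j k hjk => hc (Fin.rev_le_rev.2 hjk)
    rw [hrev]
    exact mul_left_cancel₀ (C_ne_zero.2 hH) (h5.symm.trans h4)

theorem isOpen_setOf_isGeneric (I : Fin (m + 2) → ℝ) : IsOpen {c : Fin m → ℝ | IsGeneric I c} := by
  have : {c : Fin m → ℝ | IsGeneric I c} =
      (⋂ j, ⋂ k, {c | j ≠ k → c j ≠ c k}) ∩ ⋂ j, {c | c j ≠ 0} ∩ ⋂ i, {c | c j ≠ I i} := by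
    ext c
    simp only [IsGeneric, Set.mem_ofPred_eq, Set.mem_inter_iff, Set.mem_iInter]
    exact and_congr ⟨fun h j k hjk e => hjk (h e), fun h j k e => by_contra fun hjk => h j k hjk e⟩
      Iff.rfl
  rw [this]
  refine (isOpen_iInter_of_finite fun j => isOpen_iInter_of_finite fun k => ?_).inter
    (isOpen_iInter_of_finite fun j => IsOpen.inter ?_ (isOpen_iInter_of_finite fun i => ?_))
  · by_cases hjk : j = k
    · simp [hjk]
    · simp only [ne_eq, hjk, not_false_eq_true, true_implies]
      exact isOpen_ne_fun (continuous_apply j) (continuous_apply k)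
  · exact isOpen_ne_fun (continuous_apply j) continuous_const
  · exact isOpen_ne_fun (continuous_apply j) continuous_const

theorem isGeneric_of_nodal_eq {c c' : Fin m → ℝ} (h : nodal c = nodal c') (hc : IsGeneric I c') :
    IsGeneric I c := by
  refine ⟨injective_of_nodal_eq h hc.1, fun j => ?_⟩
  obtain ⟨k, hk⟩ := exists_eq_of_nodal_eq h.symm j
  rw [hk]
  exact hc.2 k

theorem exists_open_generic (hI : StrictAnti I) (hpos : ∀ i, 0 < I i) :
    ∃ O : Set (Phase ℝ (m + 2)), IsOpen O ∧
      O ∩ cotangentSphere ℝ (m + 2) =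
        {x | ∃ h c, 0 < h ∧ IsGeneric I c ∧ x ∈ levelSet I h c} ∧
      cotangentSphere ℝ (m + 2) ⊆ closure (O ∩ cotangentSphere ℝ (m + 2)) := by
  set K : Set (Fin m → ℝ) := Set.Icc (fun _ => I (Fin.last _)) fun _ => I 0 with hK
  -- The bad points are those for which some admissible list of constants in the box is not generic,
  -- or for which `h = 0`. Lists with the same product have the same roots, so it does not matter
  -- which list is taken.
  set S : Set (Phase ℝ (m + 2) × (Fin m → ℝ)) :=
    {y | (∀ z, (integralPoly I y.1).eval z = starHamiltonian I y.1 * (nodal y.2).eval z) ∧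
      ¬ (starHamiltonian I y.1 ≠ 0 ∧ IsGeneric I y.2)} with hS
  have hScl : IsClosed S := by
    have h1 : S = (⋂ z, {y | (integralPoly I y.1).eval z
        = starHamiltonian I y.1 * (nodal y.2).eval z}) ∩
        ({y | starHamiltonian I y.1 ≠ 0} ∩ {y | IsGeneric I y.2})ᶜ := by
      ext y
      simp [hS]
    rw [h1]
    refine (isClosed_iInter fun z => ?_).inter (IsOpen.inter ?_ ?_).isClosed_compl
    · exact isClosed_eq ((continuous_eval_integralPoly I z).comp continuous_fst)
        (((continuous_starHamiltonian I).comp continuous_fst).mul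
        ((continuous_eval_nodal z).comp (by fun_prop)))
    · exact isOpen_ne_fun ((continuous_starHamiltonian I).comp continuous_fst) continuous_const
    · exact (isOpen_setOf_isGeneric I).preimage continuous_snd
  have hN := isClosed_exists_mem_compact (isCompact_Icc : IsCompact K) hScl
  have heq : {x | ∃ y ∈ K, (x, y) ∈ S}ᶜ ∩ cotangentSphere ℝ (m + 2)
      = {x | ∃ h c, 0 < h ∧ IsGeneric I c ∧ x ∈ levelSet I h c} := by
    ext x
    constructor
    · rintro ⟨h1, h2⟩
      obtain ⟨lam, c, h3, h4, -, h6⟩ := exists_interlacing hI hpos h2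
      have hcK : c ∈ K := ⟨fun j => (hI.antitone (Fin.le_last _)).trans ((h3 _).1.trans (h4 j).1),
        fun j => (h4 j).2.trans ((h3 _).2.trans (hI.antitone (Fin.zero_le _)))⟩
      by_contra h7
      refine h1 ⟨c, hcK, fun z => by rw [h6, eval_mul, eval_C], fun ⟨h8, h9⟩ => h7 ?_⟩
      refine ⟨starHamiltonian I x, c, lt_of_le_of_ne ?_ h8.symm, h9, h2, h6⟩
      exact mul_nonneg (by norm_num) (Finset.sum_nonneg fun i _ =>
        mul_nonneg (hpos i).le (sq_nonneg _))
    · rintro ⟨h, c, hh, hc, hx⟩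
      refine ⟨?_, hx.1⟩
      rintro ⟨c', -, h1, h2⟩
      have hH := level_eq_starHamiltonian hx
      refine h2 ⟨hH ▸ hh.ne', isGeneric_of_nodal_eq (c' := c) ?_ hc⟩
      refine mul_left_cancel₀ (C_ne_zero.2 hh.ne') (Eq.trans ?_ hx.2)
      refine Polynomial.funext fun z => ?_
      rw [h1, eval_mul, eval_C, hH]
  refine ⟨_, hN.isOpen_compl, heq, ?_⟩
  rw [heq]
  refine (cotangentSphere_subset_closure hI hpos).trans (closure_mono fun x hx => ?_)
  obtain ⟨lam, c, h1, h2⟩ := exists_constants_of_mem_generalPoints hI hpos hx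
  refine ⟨starHamiltonian I x, c, starHamiltonian_pos hpos fun h => ?_, h2, hx.1, h1.2.2.2⟩
  refine hx.2.2.2 0 ?_
  rw [h1.2.2.2, eval_mul, eval_C]
  simp [starHamiltonian, h]

theorem mem_levelSet_of_isHamCurve {K : Set ℝ} {γ : ℝ → Phase ℝ (m + 2)}
    (hK : K.OrdConnected) (hγ : IsHamCurve (starHamiltonian I) K γ) {h : ℝ} {c : Fin m → ℝ}
    {s r : ℝ} (hs : s ∈ K) (hr : r ∈ K) (hx : γ s ∈ levelSet I h c) : γ r ∈ levelSet I h c := by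
  refine ⟨(hγ r hr).1, ?_⟩
  rw [← hx.2]
  ext l
  refine eqOn_const_of_hasDerivWithinAt_zero hK.convex (f := fun t => integral I l (γ t))
    (fun t ht => ?_) hr hs
  obtain ⟨hT, Y, hY, hham⟩ := hγ t ht
  rw [isHamVec_starHamiltonian_iff I hT] at hham
  have h1 := ((differentiable_integral I l (γ t)).hasFDerivAt.comp_hasDerivAt t hY)
  rw [hham, fderiv_integral_hamField I hT.2] at h1
  exact h1.hasDerivWithinAt

end Constants


/-! ### Orbit maps of commuting vector fields on a compact invariant set. -/

section Orbits

variable {E V G : Type*} [NormedAddCommGroup E] [NormedSpace ℝ E] [NormedAddCommGroup V]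
  [NormedSpace ℝ V] [NormedAddCommGroup G] [NormedSpace ℝ G]

theorem exists_lipschitzOnWith_closedBall [FiniteDimensional ℝ E] {f : E → G}
    (hf : ContDiff ℝ 1 f) (R : ℝ) :
    ∃ C : NNReal, LipschitzOnWith C f (Metric.closedBall 0 R) := by
  have : ProperSpace E := FiniteDimensional.proper_real E
  obtain ⟨C, hC⟩ := (isCompact_closedBall (0 : E) R).exists_bound_of_continuousOn
    (hf.continuous_fderiv one_ne_zero).continuousOn
  refine ⟨C.toNNReal, (convex_closedBall 0 R).lipschitzOnWith_of_nnnorm_fderiv_le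
    (fun y _ => hf.differentiable one_ne_zero y) fun y hy => ?_⟩
  exact NNReal.coe_le_coe.1 ((hC y hy).trans (Real.le_coe_toNNReal C))

/-- Solutions on the unit interval of a vector field that leaves a compact set invariant. -/
theorem exists_solution_mem_compact [FiniteDimensional ℝ E] {v : E → E} (hv : ContDiff ℝ 1 v)
    {M : Set E} (hM : IsCompact M)
    (hinv : ∀ (ρ : ℝ → ℝ) (γ : ℝ → E), (∀ t ∈ Set.Icc (0 : ℝ) 1,
      HasDerivWithinAt γ (ρ t • v (γ t)) (Set.Icc 0 1) t) → γ 0 ∈ M →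
      ∀ t ∈ Set.Icc (0 : ℝ) 1, γ t ∈ M) {x : E} (hx : x ∈ M) :
    ∃ γ : ℝ → E, γ 0 = x ∧ ∀ t ∈ Set.Icc (0 : ℝ) 1, γ t ∈ M ∧
      HasDerivWithinAt γ (v (γ t)) (Set.Icc 0 1) t := by
  obtain ⟨R, hR0, hR⟩ := hM.isBounded.exists_pos_norm_le
  -- The cut-off field differs from `v` by a scalar factor only. Invariance under arbitrary
  -- reparametrizations `ρ` keeps its solution in `M`, where the cutoff equals `1`.
  let b : ContDiffBump (0 : E) := ⟨R, R + 1, hR0, by linarith⟩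
  have hg : ContDiff ℝ 1 fun y => b y • v y := b.contDiff.smul hv
  have hgc : HasCompactSupport fun y => b y • v y := b.hasCompactSupport.smul_right
  obtain ⟨C, hC⟩ := hg.lipschitzWith_of_hasCompactSupport hgc one_ne_zero
  obtain ⟨B, hB⟩ := hgc.exists_bound_of_continuous hg.continuous
  have hB0 : 0 ≤ B := (norm_nonneg _).trans (hB 0)
  have h01 : (0 : ℝ) ∈ Set.Icc (0 : ℝ) 1 := ⟨le_rfl, zero_le_one⟩
  have hpl : IsPicardLindelof (fun _ y => b y • v y) (⟨0, h01⟩ : Set.Icc (0 : ℝ) 1) x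
      ⟨B, hB0⟩ 0 ⟨B, hB0⟩ C := by
    refine ⟨fun t ht => hC.lipschitzOnWith, fun y _ => continuousOn_const,
      fun t ht y _ => hB y, ?_⟩
    change B * max (1 - 0) (0 - 0) ≤ B - 0
    norm_num
  obtain ⟨γ, h0, hγ⟩ := hpl.exists_eq_forall_mem_Icc_hasDerivWithinAt₀
  have h0' : γ 0 = x := h0
  have hmem := hinv (fun t => b (γ t)) γ hγ (h0' ▸ hx)
  refine ⟨γ, h0', fun t ht => ⟨hmem t ht, ?_⟩⟩
  have h1 := hγ t ht
  rwa [b.one_of_mem_closedBall (by simpa using hR _ (hmem t ht)), one_smul] at h1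

/-- `φ` parametrizes an orbit of the commuting fields `X · ν` in `M`. -/
def IsOrbitMap (X : E → V →L[ℝ] E) (M : Set E) (φ : V → E) : Prop :=
  ∀ θ, φ θ ∈ M ∧ HasFDerivAt φ (X (φ θ)) θ

/-- Reparametrized integral curves of the fields `X · ν` do not leave `M`. -/
def IsFlowInvariant (X : E → V →L[ℝ] E) (M : Set E) : Prop :=
  ∀ (θ : V) (ρ : ℝ → ℝ) (γ : ℝ → E), (∀ t ∈ Set.Icc (0 : ℝ) 1,
    HasDerivWithinAt γ (ρ t • X (γ t) θ) (Set.Icc 0 1) t) → γ 0 ∈ M →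
    ∀ t ∈ Set.Icc (0 : ℝ) 1, γ t ∈ M

theorem HasDerivWithinAt.Ici_of_Icc {γ : ℝ → E} {γ' : E} {t : ℝ} (ht : t ∈ Set.Ico (0 : ℝ) 1)
    (h : HasDerivWithinAt γ γ' (Set.Icc 0 1) t) : HasDerivWithinAt γ γ' (Set.Ici t) t :=
  h.mono_of_mem_nhdsWithin (Icc_mem_nhdsGE_of_mem ht)

/-- The orbit map sends `θ` to the time-one point of the field `X · θ`. Its differentiability is
proved by comparing the solution for `θ + ν` with an explicit approximate one, which commutation
makes accurate to second order in `ν`. -/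
theorem exists_isOrbitMap [FiniteDimensional ℝ E] {X : E → V →L[ℝ] E}
    (hX : ContDiff ℝ ∞ X) {M : Set E} (hM : IsCompact M) (hinv : IsFlowInvariant X M)
    (hcomm : ∀ y ∈ M, ∀ ν θ, fderiv ℝ X y (X y ν) θ = fderiv ℝ X y (X y θ) ν) {x : E}
    (hx : x ∈ M) : ∃ φ : V → E, IsOrbitMap X M φ ∧ φ 0 = x := by
  have hX1 : ContDiff ℝ 1 X := hX.of_le (by exact_mod_cast le_top)
  have hXd : Differentiable ℝ X := hX1.differentiable one_ne_zero
  have hX2 : ContDiff ℝ 1 (fderiv ℝ X) := (contDiff_infty_iff_fderiv.1 hX).2.of_le (by exact_mod_cast le_top)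
  have hXθ : ∀ θ, ContDiff ℝ 1 fun y => X y θ := fun θ => hX1.clm_apply contDiff_const
  choose η hη0 hη using fun θ => exists_solution_mem_compact (hXθ θ) hM (hinv θ) hx
  have h11 : (1 : ℝ) ∈ Set.Icc (0 : ℝ) 1 := ⟨zero_le_one, le_rfl⟩
  refine ⟨fun θ => η θ 1, fun θ => ⟨(hη θ 1 h11).1, ?_⟩, ?_⟩
  swap
  · have hη' := hη 0
    have : Set.EqOn (η 0) (fun _ => η 0 0) (Set.Icc 0 1) := by
      intro t ht
      have h1 := (convex_Icc (0 : ℝ) 1).norm_image_sub_le_of_norm_hasDerivWithin_le (C := 0)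
        (fun s hs => (hη' s hs).2) (by simp) ⟨le_rfl, zero_le_one⟩ ht
      rwa [zero_mul, norm_le_zero_iff, sub_eq_zero] at h1
    exact (this h11).trans (hη0 0)
  obtain ⟨R, hR0, hR⟩ := hM.isBounded.exists_pos_norm_le
  set B := Metric.closedBall (0 : E) (R + 1) with hB
  have hMB : ∀ y ∈ M, y ∈ B := fun y hy => by
    rw [hB, mem_closedBall_zero_iff]; linarith [hR y hy]
  obtain ⟨C₁, hC₁⟩ := exists_lipschitzOnWith_closedBall hX1 (R + 1)
  obtain ⟨C₂, hC₂⟩ := exists_lipschitzOnWith_closedBall hX2 (R + 1)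
  obtain ⟨C₀, hC₀⟩ := hM.exists_bound_of_continuousOn hX1.continuous.continuousOn
  have hC₀0 : 0 ≤ C₀ := (norm_nonneg _).trans (hC₀ x hx)
  set K : ℝ := C₂ * C₀ ^ 2 * ‖θ‖ + C₁ * C₀ with hK
  set L : NNReal := C₁ * (‖θ‖₊ + 1) + 1 with hL
  have hLpos : (0 : ℝ) < L := by rw [hL]; positivity
  have key : ∀ ν : V, ‖ν‖ ≤ 1 → C₀ * ‖ν‖ ≤ 1 →
      ‖η (θ + ν) 1 - η θ 1 - X (η θ 1) ν‖ ≤ K * ((Real.exp L - 1) / L) * (‖ν‖ * ‖ν‖) := by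
    intro ν hν1 hν2
    -- The approximate solution for `θ + ν`: the solution for `θ`, displaced by `s` times the field
    -- in the direction `ν`.
    set a : ℝ → E := fun s => η θ s + s • X (η θ s) ν with ha
    set a' : ℝ → E := fun s => X (η θ s) θ + (X (η θ s) ν + s • fderiv ℝ X (η θ s) (X (η θ s) ν) θ)
      with ha'
    have haη : ∀ s ∈ Set.Icc (0 : ℝ) 1, ‖a s - η θ s‖ ≤ C₀ * ‖ν‖ := by
      intro s hs
      rw [ha, add_sub_cancel_left, norm_smul, Real.norm_eq_abs, abs_of_nonneg hs.1]
      have h1 := (X (η θ s)).le_of_opNorm_le (hC₀ _ (hη θ s hs).1) ν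
      have h2 := norm_nonneg (X (η θ s) ν)
      nlinarith [hs.2]
    have haB : ∀ s ∈ Set.Icc (0 : ℝ) 1, a s ∈ B := by
      intro s hs
      rw [hB, mem_closedBall_zero_iff]
      have h1 := norm_add_le (η θ s) (a s - η θ s)
      rw [add_sub_cancel] at h1
      linarith [hR _ (hη θ s hs).1, haη s hs]
    have had : ∀ s ∈ Set.Icc (0 : ℝ) 1, HasDerivWithinAt a (a' s) (Set.Icc 0 1) s := by
      intro s hs
      have h1 := (hη θ s hs).2
      have h2 : HasDerivWithinAt (fun s => X (η θ s) ν) (fderiv ℝ X (η θ s) (X (η θ s) θ) ν)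
          (Set.Icc 0 1) s := by
        have h3 := ((hXd (η θ s)).hasFDerivAt.comp_hasDerivWithinAt s h1).clm_apply
          (hasDerivWithinAt_const s (Set.Icc 0 1) ν)
        simpa using h3
      have h3 := h1.fun_add ((hasDerivWithinAt_id s (Set.Icc 0 1)).fun_smul h2)
      refine h3.congr_deriv ?_
      -- Commutation exchanges `θ` and `ν` in the derivative, turning it into the first-order Taylor
      -- term of `X · θ` at the displaced point.
      simp only [ha', hcomm _ (hη θ s hs).1 ν θ, id_eq, one_smul]
      rw [add_comm (s • _)]
    have herr : ∀ s ∈ Set.Icc (0 : ℝ) 1,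
        dist (a' s) (X (a s) (θ + ν)) ≤ K * (‖ν‖ * ‖ν‖) := by
      intro s hs
      set y := η θ s with hy
      have hyB : y ∈ B := hMB _ (hη θ s hs).1
      have h1 : ‖X (a s) - X y - fderiv ℝ X y (a s - y)‖ ≤ C₂ * ‖a s - y‖ * ‖a s - y‖ := by
        refine (convex_segment y (a s)).norm_image_sub_le_of_norm_fderiv_le'
          (fun z _ => hXd z) (fun z hz => ?_) (left_mem_segment ℝ _ _) (right_mem_segment ℝ _ _)
        have hzB : z ∈ B := (convex_closedBall _ _).segment_subset hyB (haB s hs) hz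
        refine (hC₂.norm_sub_le hzB hyB).trans ?_
        gcongr
        exact norm_sub_le_of_mem_segment hz
      have h2 : ‖X (a s) - X y‖ ≤ C₁ * ‖a s - y‖ := hC₁.norm_sub_le (haB s hs) hyB
      have h3 : ‖a s - y‖ ≤ C₀ * ‖ν‖ := haη s hs
      -- What remains is a Taylor remainder paired with `θ` and a first-order difference paired with
      -- `ν`; both are quadratic in `ν`.
      have h4 : a s - y = s • X y ν := by rw [ha]; exact add_sub_cancel_left _ _
      have h5 : a' s - X (a s) (θ + ν)
          = -((X (a s) - X y - fderiv ℝ X y (a s - y)) θ + (X (a s) - X y) ν) := by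
        rw [ha', h4]
        simp only [map_add, map_smul, sub_apply, smul_apply]
        abel
      rw [dist_eq_norm, h5, norm_neg]
      have h6 := (X (a s) - X y - fderiv ℝ X y (a s - y)).le_of_opNorm_le h1 θ
      have h7 := (X (a s) - X y).le_of_opNorm_le h2 ν
      have h8 : C₂ * ‖a s - y‖ * ‖a s - y‖ ≤ C₂ * (C₀ * ‖ν‖) * (C₀ * ‖ν‖) := by gcongr
      have h9 : C₁ * ‖a s - y‖ ≤ C₁ * (C₀ * ‖ν‖) := by gcongr
      calc _ ≤ _ := norm_add_le _ _
        _ ≤ C₂ * (C₀ * ‖ν‖) * (C₀ * ‖ν‖) * ‖θ‖ + C₁ * (C₀ * ‖ν‖) * ‖ν‖ := by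
          refine add_le_add (h6.trans ?_) (h7.trans ?_) <;> gcongr
        _ = K * (‖ν‖ * ‖ν‖) := by rw [hK]; ring
    have hlip : LipschitzOnWith L (fun y => X y (θ + ν)) B := by
      refine LipschitzOnWith.of_dist_le_mul fun y hy z hz => ?_
      rw [dist_eq_norm, dist_eq_norm, ← sub_apply]
      refine ((X y - X z).le_of_opNorm_le (hC₁.norm_sub_le hy hz) _).trans ?_
      have h1 : ‖θ + ν‖ ≤ ‖θ‖ + 1 := (norm_add_le _ _).trans (by linarith)
      have h2 : (L : ℝ) = C₁ * (‖θ‖ + 1) + 1 := by rw [hL]; simp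
      rw [h2]
      have h3 : (C₁ : ℝ) * ‖y - z‖ * ‖θ + ν‖ ≤ C₁ * ‖y - z‖ * (‖θ‖ + 1) := by gcongr
      nlinarith [norm_nonneg (y - z)]
    -- Grönwall's inequality carries the quadratic defect to time `1`.
    have hgr := dist_le_of_approx_trajectories_ODE_of_mem (v := fun _ y => X y (θ + ν))
      (s := fun _ => B) (K := L) (f := a) (f' := a') (g := η (θ + ν))
      (g' := fun s => X (η (θ + ν) s) (θ + ν)) (εf := K * (‖ν‖ * ‖ν‖)) (εg := 0) (δ := 0)
      (a := 0) (b := 1) (fun _ _ => hlip) (fun s hs => (had s hs).continuousWithinAt)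
      (fun s hs => HasDerivWithinAt.Ici_of_Icc hs (had s (Set.Ico_subset_Icc_self hs)))
      (fun s hs => herr s (Set.Ico_subset_Icc_self hs))
      (fun s hs => haB s (Set.Ico_subset_Icc_self hs))
      (fun s hs => (hη (θ + ν) s hs).2.continuousWithinAt)
      (fun s hs => HasDerivWithinAt.Ici_of_Icc hs (hη (θ + ν) s (Set.Ico_subset_Icc_self hs)).2)
      (fun s hs => by simp) (fun s hs => hMB _ (hη (θ + ν) s (Set.Ico_subset_Icc_self hs)).1)
      (by simp [ha, hη0]) 1 h11
    rw [gronwallBound_of_K_ne_0 hLpos.ne'] at hgr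
    have h1 : a 1 - η (θ + ν) 1 = -(η (θ + ν) 1 - η θ 1 - X (η θ 1) ν) := by
      rw [ha]
      simp only [one_smul]
      abel
    rw [dist_eq_norm, h1, norm_neg] at hgr
    refine hgr.trans (le_of_eq ?_)
    simp only [zero_mul, zero_add, add_zero, sub_zero, mul_one]
    ring
  rw [hasFDerivAt_iff_isLittleO_nhds_zero]
  have hbig : (fun ν : V => η (θ + ν) 1 - η θ 1 - X (η θ 1) ν) =O[nhds 0]
      fun ν => ‖ν‖ * ‖ν‖ := by
    refine Asymptotics.IsBigO.of_bound (K * ((Real.exp L - 1) / L)) ?_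
    have e1 : ∀ᶠ ν : V in nhds 0, ‖ν‖ < 1 :=
      (continuous_norm.tendsto' (0 : V) 0 norm_zero).eventually_lt_const one_pos
    have e2 : ∀ᶠ ν : V in nhds 0, C₀ * ‖ν‖ < 1 :=
      ((continuous_const.mul continuous_norm).tendsto' (0 : V) 0 (by simp)).eventually_lt_const
        one_pos
    filter_upwards [e1, e2] with ν h1 h2
    have := key ν h1.le h2.le
    rwa [Real.norm_of_nonneg (by positivity : (0 : ℝ) ≤ ‖ν‖ * ‖ν‖)]
  refine hbig.trans_isLittleO ?_
  have h1 : (fun ν : V => ‖ν‖) =o[nhds 0] fun _ => (1 : ℝ) :=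
    (Asymptotics.isLittleO_one_iff ℝ).2 (continuous_norm.tendsto' (0 : V) 0 norm_zero)
  have h2 := h1.mul_isBigO (Asymptotics.isBigO_refl (fun ν : V => ‖ν‖) (nhds 0))
  simp only [one_mul] at h2
  exact h2.norm_right.trans_isBigO (Asymptotics.isBigO_of_le _ fun ν => by simp)

section

variable {X : E → V →L[ℝ] E} {M : Set E} {φ ψ : V → E}

/-- Bootstrap from `φ' = X ∘ φ`. -/
theorem IsOrbitMap.contDiff (hX : ContDiff ℝ ∞ X) (hφ : IsOrbitMap X M φ) : ContDiff ℝ ∞ φ := by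
  have hfd : fderiv ℝ φ = X ∘ φ := funext fun θ => (hφ θ).2.fderiv
  have hd : Differentiable ℝ φ := fun θ => (hφ θ).2.differentiableAt
  rw [contDiff_infty]
  intro n
  induction n with
  | zero => exact contDiff_zero.2 hd.continuous
  | succ n ih =>
    rw [Nat.cast_succ, contDiff_succ_iff_fderiv]
    refine ⟨hd, by simp, ?_⟩
    rw [hfd]
    exact (hX.of_le (by exact_mod_cast le_top)).comp ih

theorem IsOrbitMap.comp_add (hφ : IsOrbitMap X M φ) (a : V) :
    IsOrbitMap X M fun θ => φ (θ + a) := fun θ =>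
  ⟨(hφ (θ + a)).1, by
    have h := (hφ (θ + a)).2.comp θ ((hasFDerivAt_id θ).add_const a)
    rw [ContinuousLinearMap.comp_id] at h
    exact h⟩

theorem IsOrbitMap.hasDerivAt_line (hφ : IsOrbitMap X M φ) (a ν : V) (s : ℝ) :
    HasDerivAt (fun s : ℝ => φ (a + s • ν)) (X (φ (a + s • ν)) ν) s := by
  have h1 : HasDerivAt (fun s : ℝ => a + s • ν) ν s := by
    simpa using ((hasDerivAt_id s).smul_const ν).const_add a
  exact (hφ (a + s • ν)).2.comp_hasDerivAt s h1

variable [FiniteDimensional ℝ E]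

theorem IsOrbitMap.eq (hX : ContDiff ℝ ∞ X) (hM : IsCompact M) (hφ : IsOrbitMap X M φ)
    (hψ : IsOrbitMap X M ψ) (h0 : φ 0 = ψ 0) : φ = ψ := by
  funext θ
  obtain ⟨R, hR0, hR⟩ := hM.isBounded.exists_pos_norm_le
  have hX1 : ContDiff ℝ 1 X := hX.of_le (by exact_mod_cast le_top)
  obtain ⟨C, hC⟩ := exists_lipschitzOnWith_closedBall
    (hX1.clm_apply (contDiff_const (c := θ))) R
  have h1 := fun s => hφ.hasDerivAt_line 0 θ s
  have h2 := fun s => hψ.hasDerivAt_line 0 θ s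
  have h3 := ODE_solution_unique_of_mem_Icc_right (v := fun _ y => X y θ)
    (s := fun _ => Metric.closedBall 0 R) (K := C) (f := fun s : ℝ => φ (0 + s • θ))
    (g := fun s : ℝ => ψ (0 + s • θ)) (a := 0) (b := 1) (fun _ _ => hC)
    (fun s _ => (h1 s).continuousAt.continuousWithinAt) (fun s _ => (h1 s).hasDerivWithinAt)
    (fun s _ => mem_closedBall_zero_iff.2 (hR _ (hφ _).1))
    (fun s _ => (h2 s).continuousAt.continuousWithinAt) (fun s _ => (h2 s).hasDerivWithinAt)
    (fun s _ => mem_closedBall_zero_iff.2 (hR _ (hψ _).1)) (by simpa using h0)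
    (show (1 : ℝ) ∈ Set.Icc (0 : ℝ) 1 from ⟨zero_le_one, le_rfl⟩)
  simpa using h3

theorem IsOrbitMap.add_eq_of_eq (hX : ContDiff ℝ ∞ X) (hM : IsCompact M) (hφ : IsOrbitMap X M φ)
    {a b : V} (h : φ a = φ b) (θ : V) : φ (θ + a) = φ (θ + b) :=
  congrFun ((hφ.comp_add a).eq hX hM (hφ.comp_add b) (by simpa using h)) θ

/-- The lattice of periods. -/
def IsOrbitMap.periods (hX : ContDiff ℝ ∞ X) (hM : IsCompact M) (hφ : IsOrbitMap X M φ) :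
    AddSubgroup V where
  carrier := {a | φ a = φ 0}
  zero_mem' := rfl
  add_mem' := by
    intro a b ha hb
    have := hφ.add_eq_of_eq hX hM hb a
    rw [add_zero] at this
    exact this.trans ha
  neg_mem' := by
    intro a ha
    have := hφ.add_eq_of_eq hX hM ha (-a)
    rw [neg_add_cancel, add_zero] at this
    exact this.symm

theorem IsOrbitMap.eq_iff (hX : ContDiff ℝ ∞ X) (hM : IsCompact M) (hφ : IsOrbitMap X M φ)
    (a b : V) : φ a = φ b ↔ b - a ∈ hφ.periods hX hM := by
  constructor
  · intro h
    have := hφ.add_eq_of_eq hX hM h (-a)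
    rw [neg_add_cancel, neg_add_eq_sub] at this
    exact this.symm
  · intro h
    have := hφ.add_eq_of_eq hX hM (show φ (b - a) = φ 0 from h) a
    rw [add_sub_cancel, add_zero] at this
    exact this.symm

/-- The injective derivative at `0` makes `φ` differ from `φ 0` at all other points near `0`, so `0`
is an isolated period. -/
theorem IsOrbitMap.discreteTopology_periods [FiniteDimensional ℝ V] (hX : ContDiff ℝ ∞ X)
    (hM : IsCompact M) (hφ : IsOrbitMap X M φ)
    (hinj : ∀ y ∈ M, Function.Injective (X y)) : DiscreteTopology (hφ.periods hX hM) := by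
  refine discreteTopology_of_isOpen_singleton_zero ?_
  have h1 : ∀ᶠ a in nhdsWithin (0 : V) {0}ᶜ, φ a ≠ φ 0 := by
    refine (hφ 0).2.eventually_ne ?_
    obtain ⟨C, -, hC⟩ := (X (φ 0)).toLinearMap.exists_antilipschitzWith
      (LinearMap.ker_eq_bot.2 (hinj _ (hφ 0).1))
    exact ⟨C, hC⟩
  rw [eventually_nhdsWithin_iff] at h1
  rw [isOpen_singleton_iff_nhds_eq_pure, nhds_subtype_eq_comap]
  refine le_antisymm ?_ (by rw [← nhds_subtype_eq_comap]; exact pure_le_nhds _)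
  rw [Filter.le_pure_iff]
  refine Filter.mem_of_superset (Filter.preimage_mem_comap h1) fun a ha => ?_
  by_contra h
  exact ha (fun heq => h (Subtype.ext heq)) a.2

/-- The orbits are open in `M` if `M` is a level set of functions with independent differentials
that have no more common zeros than the values of the fields. -/
theorem IsOrbitMap.image_mem_nhdsWithin [FiniteDimensional ℝ V] [FiniteDimensional ℝ G]
    (hX : ContDiff ℝ ∞ X) (hφ : IsOrbitMap X M φ) {f : E → G} (hf : ContDiff ℝ 1 f)
    (hfM : ∀ y ∈ M, ∀ z ∈ M, f y = f z)
    (hsurj : ∀ y ∈ M, Function.Surjective (fderiv ℝ f y))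
    (hker : ∀ y ∈ M, ∀ Y, fderiv ℝ f y Y = 0 → ∃ ν, X y ν = Y) {U : Set V} (hU : U ∈ nhds 0) :
    φ '' U ∈ nhdsWithin (φ 0) M := by
  set x := φ 0 with hx
  have hxM : x ∈ M := (hφ 0).1
  have hstrict : HasStrictFDerivAt f (fderiv ℝ f x) x := hf.contDiffAt.hasStrictFDerivAt one_ne_zero
  obtain ⟨R, hR⟩ := (fderiv ℝ f x).toLinearMap.exists_rightInverse_of_surjective
    (LinearMap.range_eq_top.2 (hsurj x hxM))
  set R' : G →L[ℝ] E := LinearMap.toContinuousLinearMap R with hR'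
  have hRR : ∀ g, fderiv ℝ f x (R' g) = g := fun g => LinearMap.congr_fun hR g
  -- The orbit directions are complemented by the directions `R' g` in which `f` changes at the rate
  -- `g`; the two span `E`, so `Θ` covers a neighbourhood of `x`.
  set Θ : V × G → E := fun z => φ z.1 + R' z.2 with hΘ
  have hφs : HasStrictFDerivAt φ (X x) 0 := by
    have := (hφ.contDiff hX).contDiffAt (x := 0) |>.hasStrictFDerivAt (by simp)
    rwa [(hφ 0).2.fderiv] at this
  have hΘd : HasStrictFDerivAt Θ ((X x).comp (ContinuousLinearMap.fst ℝ V G)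
      + R'.comp (ContinuousLinearMap.snd ℝ V G)) (0, 0) := by
    refine HasStrictFDerivAt.fun_add ?_ (R'.comp (ContinuousLinearMap.snd ℝ V G)).hasStrictFDerivAt
    exact HasStrictFDerivAt.comp (g := φ) ((0 : V), (0 : G)) hφs hasStrictFDerivAt_fst
  have hΘ0 : Θ (0, 0) = x := by simp [hΘ, hx]
  have hmap := hΘd.map_nhds_eq_of_surj (by
    rw [LinearMap.range_eq_top]
    intro Y
    obtain ⟨ν, hν⟩ := hker x hxM (Y - R' (fderiv ℝ f x Y)) (by rw [map_sub, hRR, sub_self])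
    exact ⟨(ν, fderiv ℝ f x Y), by simp [hν]⟩)
  rw [hΘ0] at hmap
  have hinjf : ∀ᶠ z : V × G in nhds (0, 0), f (φ z.1 + R' z.2) = f (φ z.1) → z.2 = 0 := by
    have h1 := hstrict.isLittleO
    set c : ℝ := (‖R'‖ + 1)⁻¹ / 2 with hc
    have hcpos : 0 < c := by positivity
    have h2 := (Asymptotics.isLittleO_iff.1 h1) hcpos
    have h3 : Filter.Tendsto (fun z : V × G => (φ z.1 + R' z.2, φ z.1)) (nhds (0, 0))
        (nhds (x, x)) := by
      have : Continuous fun z : V × G => (φ z.1 + R' z.2, φ z.1) := by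
        have := (hφ.contDiff hX).continuous
        fun_prop
      exact this.tendsto' _ _ (by simp [hx])
    filter_upwards [h3.eventually h2] with z hz he
    simp only [he, sub_self, add_sub_cancel_left, zero_sub, norm_neg, hRR] at hz
    have h4 : ‖R' z.2‖ ≤ ‖R'‖ * ‖z.2‖ := R'.le_opNorm _
    have h5 : c * ‖R' z.2‖ ≤ 1 / 2 * ‖z.2‖ := by
      calc c * ‖R' z.2‖ ≤ c * ((‖R'‖ + 1) * ‖z.2‖) := by
            gcongr
            exact h4.trans (by gcongr; linarith)
        _ = 1 / 2 * ‖z.2‖ := by rw [hc]; field_simp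
    have h6 : ‖z.2‖ ≤ 0 := by linarith
    exact norm_le_zero_iff.1 h6
  have hmem : {z : V × G | z.1 ∈ U ∧ (f (φ z.1 + R' z.2) = f (φ z.1) → z.2 = 0)}
      ∈ nhds ((0 : V), (0 : G)) :=
    Filter.Eventually.and (continuous_fst.tendsto' ((0 : V), (0 : G)) 0 rfl hU) hinjf
  have h7 := Filter.image_mem_map hmem (m := Θ)
  rw [hmap] at h7
  refine Filter.mem_of_superset (inter_mem_nhdsWithin M h7) ?_
  rintro _ ⟨hyM, ⟨z, ⟨hzU, hz⟩, rfl⟩⟩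
  have h8 := hz (hfM _ hyM _ (hφ z.1).1)
  exact ⟨z.1, hzU, by simp [hΘ, h8]⟩

end

end Orbits


/-! ### Compact orbits as tori. -/

section Torus

variable {E G : Type*} [NormedAddCommGroup E] [NormedSpace ℝ E] [FiniteDimensional ℝ E]
  [NormedAddCommGroup G] [NormedSpace ℝ G] [FiniteDimensional ℝ G] {d : ℕ}

/-- Compact orbits of `d` independent commuting vector fields are tori. -/
theorem exists_torus {X : E → (Fin d → ℝ) →L[ℝ] E} (hX : ContDiff ℝ ∞ X) {M : Set E}
    (hM : IsCompact M) (hinv : IsFlowInvariant X M)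
    (hcomm : ∀ y ∈ M, ∀ ν θ, fderiv ℝ X y (X y ν) θ = fderiv ℝ X y (X y θ) ν)
    (hinj : ∀ y ∈ M, Function.Injective (X y)) {f : E → G} (hf : ContDiff ℝ 1 f)
    (hfM : ∀ y ∈ M, ∀ z ∈ M, f y = f z)
    (hsurj : ∀ y ∈ M, Function.Surjective (fderiv ℝ f y))
    (hker : ∀ y ∈ M, ∀ Y, fderiv ℝ f y Y = 0 → ∃ ν, X y ν = Y) {x : E} (hx : x ∈ M) :
    ∃ (ψ : (Fin d → ℝ) → E) (T : (Fin d → ℝ) ≃L[ℝ] (Fin d → ℝ)), ContDiff ℝ ∞ ψ ∧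
      (∀ θ, ψ θ ∈ M ∧ HasFDerivAt ψ ((X (ψ θ)).comp (T : (Fin d → ℝ) →L[ℝ] (Fin d → ℝ))) θ) ∧
      (∀ θ θ', ψ θ = ψ θ' ↔ ∃ k : Fin d → ℤ, ∀ i, θ' i = θ i + k i) ∧
      Set.range ψ = connectedComponentIn M x := by
  obtain ⟨φ, hφ, hφ0⟩ := exists_isOrbitMap hX hM hinv hcomm hx
  have hopen : ∀ ψ : (Fin d → ℝ) → E, IsOrbitMap X M ψ → ∀ θ, ∀ U ∈ nhds θ,
      ∀ᶠ y in nhds (ψ θ), y ∈ M → y ∈ ψ '' U := by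
    intro ψ hψ θ U hU
    have h1 : (fun a => a + θ) ⁻¹' U ∈ nhds 0 :=
      (continuous_add_const θ).tendsto' 0 θ (zero_add θ) hU
    have h2 := (hψ.comp_add θ).image_mem_nhdsWithin hX hf hfM hsurj hker h1
    rw [zero_add] at h2
    have h3 := eventually_nhdsWithin_iff.1 h2
    refine h3.mono fun y hy hyM => ?_
    obtain ⟨a, ha, rfl⟩ := hy hyM
    exact ⟨a + θ, ha, rfl⟩
  set O := Set.range φ with hO
  -- The orbit and its complement in `M` are both relatively open, the latter being a union of
  -- orbits; so the orbit is a connected component, and it is compact.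
  set u := {z | ∀ᶠ y in nhds z, y ∈ M → y ∈ O} with hu
  set v := {z | ∀ᶠ y in nhds z, y ∈ M → y ∉ O} with hv
  have huo : IsOpen u := isOpen_setOfPred_eventually_nhds
  have hvo : IsOpen v := isOpen_setOfPred_eventually_nhds
  have hOM : O ⊆ M := by rintro _ ⟨θ, rfl⟩; exact (hφ θ).1
  have hOu : O ⊆ u := by
    rintro _ ⟨θ, rfl⟩
    exact (hopen φ hφ θ Set.univ Filter.univ_mem).mono fun y hy hyM =>
      Set.image_subset_range _ _ (hy hyM)
  have hMv : M \ O ⊆ v := by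
    rintro z ⟨hz, hzO⟩
    obtain ⟨ψ, hψ, hψ0⟩ := exists_isOrbitMap hX hM hinv hcomm hz
    have h1 := hopen ψ hψ 0 Set.univ Filter.univ_mem
    rw [hψ0] at h1
    refine h1.mono fun y hy hyM hyO => hzO ?_
    obtain ⟨a, -, ha⟩ := hy hyM
    obtain ⟨b, hb⟩ := hyO
    have h2 := (hψ.comp_add a).eq hX hM (hφ.comp_add b) (by simp [ha, hb])
    have h3 := congrFun h2 (-a)
    simp only [neg_add_cancel, hψ0] at h3
    exact ⟨_, h3.symm⟩
  have huv : ∀ z ∈ M, z ∈ u → z ∈ v → False := fun z hz h1 h2 =>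
    h2.self_of_nhds hz (h1.self_of_nhds hz)
  have hcomp : O = connectedComponentIn M x := by
    refine subset_antisymm ?_ fun y hy => ?_
    · exact (isPreconnected_range (hφ.contDiff hX).continuous).subset_connectedComponentIn
        ⟨0, hφ0⟩ hOM
    · by_contra hyO
      have hyM := connectedComponentIn_subset M x hy
      obtain ⟨z, hz, hzu, hzv⟩ := isPreconnected_connectedComponentIn u v huo hvo
        (fun z hz => by
          have hzM := connectedComponentIn_subset M x hz
          by_cases h : z ∈ O
          · exact Or.inl (hOu h)
          · exact Or.inr (hMv ⟨hzM, h⟩))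
        ⟨x, mem_connectedComponentIn hx, hOu ⟨0, hφ0⟩⟩ ⟨y, hy, hMv ⟨hyM, hyO⟩⟩
      exact huv z (connectedComponentIn_subset M x hz) hzu hzv
  have hOc : IsCompact O := by
    have : O = M ∩ vᶜ := by
      ext y
      refine ⟨fun h => ⟨hOM h, fun h' => huv y (hOM h) (hOu h) h'⟩, fun h => ?_⟩
      by_contra hyO
      exact h.2 (hMv ⟨h.1, hyO⟩)
    rw [this]
    exact hM.inter_right hvo.isClosed_compl
  -- By compactness the image of one ball already covers the orbit.
  obtain ⟨N, hN⟩ : ∃ N : ℕ, O ⊆ {z | ∀ᶠ y in nhds z, y ∈ M → y ∈ φ '' Metric.ball 0 N} := by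
    refine hOc.elim_directed_cover _ (fun N => isOpen_setOfPred_eventually_nhds) ?_ ?_
    · rintro _ ⟨θ, rfl⟩
      obtain ⟨N, hN⟩ := exists_nat_gt ‖θ‖
      exact Set.mem_iUnion.2 ⟨N, hopen φ hφ θ _ (Metric.isOpen_ball.mem_nhds (by simpa using hN))⟩
    · refine Monotone.directed_le fun N N' hNN z hz => ?_
      refine Filter.Eventually.mono hz fun y hy hyM => ?_
      exact Set.image_mono (Metric.ball_subset_ball (by exact_mod_cast hNN)) (hy hyM)
  have hball : ∀ θ, ∃ a, ‖a‖ < N ∧ φ a = φ θ := fun θ => by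
    obtain ⟨a, ha, h⟩ := (hN ⟨θ, rfl⟩).self_of_nhds (hφ θ).1
    exact ⟨a, by simpa using ha, h⟩
  set L : Submodule ℤ (Fin d → ℝ) := AddSubgroup.toIntSubmodule (hφ.periods hX hM) with hL
  have hLmem : ∀ a b, φ a = φ b ↔ b - a ∈ L := hφ.eq_iff hX hM
  have : DiscreteTopology L := hφ.discreteTopology_periods hX hM hinj
  -- If the periods did not span, a nonzero functional `ℓ` would vanish on them; but modulo periods
  -- every vector lies in the ball of radius `N`, so `ℓ` would be bounded by `‖ℓ‖ N`, which fails on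
  -- a multiple of `e`.
  have : IsZLattice ℝ L := ⟨by
    by_contra hne
    obtain ⟨ℓ, hℓ0, hℓ⟩ := Submodule.exists_le_ker_of_lt_top _ (lt_top_iff_ne_top.2 hne)
    set ℓ' : (Fin d → ℝ) →L[ℝ] ℝ := LinearMap.toContinuousLinearMap ℓ
    obtain ⟨e, he⟩ : ∃ e, ℓ e ≠ 0 := by
      by_contra! h
      exact hℓ0 (LinearMap.ext h)
    obtain ⟨a, ha, hae⟩ := hball (((‖ℓ'‖ * N + 1) / ℓ e) • e)
    have h1 := hℓ (Submodule.subset_span ((hLmem _ _).1 hae))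
    rw [LinearMap.mem_ker, map_sub, map_smul, smul_eq_mul, div_mul_cancel₀ _ he, sub_eq_zero] at h1
    have h2 : ‖ℓ a‖ ≤ ‖ℓ'‖ * ‖a‖ := ℓ'.le_opNorm a
    have h3 := Real.norm_eq_abs (ℓ a) ▸ le_abs_self (ℓ a)
    have h4 : ‖ℓ'‖ * ‖a‖ ≤ ‖ℓ'‖ * N := by gcongr
    linarith⟩
  set b := (IsZLattice.basis L).ofZLatticeBasis ℝ L with hb
  set T : (Fin d → ℝ) ≃L[ℝ] (Fin d → ℝ) := b.equivFun.symm.toContinuousLinearEquiv with hT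
  refine ⟨φ ∘ T, T, (hφ.contDiff hX).comp T.contDiff, fun θ => ⟨(hφ _).1, ?_⟩, fun θ θ' => ?_, ?_⟩
  · exact (hφ (T θ)).2.comp θ T.hasFDerivAt
  · rw [Function.comp_apply, Function.comp_apply, hLmem, ← map_sub,
      ← (IsZLattice.basis L).ofZLatticeBasis_span ℝ L, ← hb, b.mem_span_iff_repr_mem ℤ]
    have h1 : ∀ i, b.repr (T (θ' - θ)) i = θ' i - θ i := fun i =>
      congrFun (b.equivFun.apply_symm_apply (θ' - θ)) i
    simp only [h1, Set.mem_range, eq_intCast]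
    constructor
    · intro h
      choose k hk using h
      exact ⟨k, fun i => by rw [hk]; ring⟩
    · rintro ⟨k, hk⟩ i
      exact ⟨k i, by rw [hk]; ring⟩
  · rw [← hcomp, hO, T.surjective.range_comp]

end Torus


/-! ### Commutation of the Hamiltonian fields. -/

section Commuting

variable {n m : ℕ}

theorem dotProduct_hamField_fst (I : Fin n → ℝ) (l : ℕ) {x : Phase ℝ n} (hx : x.1 ⬝ᵥ x.2 = 0) :
    x.1 ⬝ᵥ (hamField I l x).1 = 0 := by
  have h := congrArg (coeff · l) (sum_fst_mul_gradP I hx)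
  simp only [finsetSum_coeff, coeff_C_mul, coeff_zero] at h
  exact h

theorem dotProduct_hamField_snd (I : Fin n → ℝ) (l : ℕ) (x : Phase ℝ n) :
    x.1 ⬝ᵥ (hamField I l x).2 + x.2 ⬝ᵥ (hamField I l x).1 = 0 := by
  have h := congrArg (coeff · l) (sum_fst_mul_gradQ_sub I x)
  simp only [coeff_sub, finsetSum_coeff, coeff_C_mul, coeff_zero] at h
  simp only [hamField, dotProduct, mul_neg, Finset.sum_neg_distrib]
  linarith

theorem symp_hamField (I : Fin n → ℝ) (l : ℕ) (x Y : Phase ℝ n) :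
    symp (hamField I l x) Y = fderiv ℝ (integral I l) x Y := by
  rw [fderiv_integral, symp, hamField]
  simp only [dotProduct, neg_mul, Finset.sum_neg_distrib, sub_neg_eq_add]
  simp only [mul_comm]

theorem contDiff_fderiv_integral (I : Fin n → ℝ) (l : ℕ) :
    ContDiff ℝ ∞ (fderiv ℝ (integral I l)) :=
  (contDiff_infty_iff_fderiv.1 (contDiff_integral I l)).2

theorem contDiff_hamField (I : Fin n → ℝ) (l : ℕ) : ContDiff ℝ ∞ (hamField I l) := by
  have h : ∀ Y, ContDiff ℝ ∞ fun x => (derivPoly I x Y).coeff l := fun Y => by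
    simp only [coeff_derivPoly]
    exact (contDiff_fderiv_integral I l).clm_apply contDiff_const
  exact (contDiff_pi.2 fun i => h _).prodMk (contDiff_pi.2 fun i => (h _).neg)

theorem differentiable_hamField (I : Fin n → ℝ) (l : ℕ) : Differentiable ℝ (hamField I l) :=
  (contDiff_hamField I l).differentiable (by simp)

theorem hasDerivAt_phase_line (x Y : Phase ℝ n) (t : ℝ) :
    HasDerivAt (fun s : ℝ => x + s • Y) Y t := by
  simpa using ((hasDerivAt_id t).smul_const Y).const_add x

theorem HasDerivAt.fst_phase {γ : ℝ → Phase ℝ n} {Y : Phase ℝ n} {t : ℝ} (h : HasDerivAt γ Y t) :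
    HasDerivAt (fun s => (γ s).1) Y.1 t :=
  hasDerivAt_pi.2 fun i => hasDerivAt_fst h i

theorem HasDerivAt.snd_phase {γ : ℝ → Phase ℝ n} {Y : Phase ℝ n} {t : ℝ} (h : HasDerivAt γ Y t) :
    HasDerivAt (fun s => (γ s).2) Y.2 t :=
  hasDerivAt_pi.2 fun i => hasDerivAt_snd h i

/-- A function that vanishes on the cone `(q, p) = 0` is stationary along `T*S^{n-1}`. -/
theorem fderiv_eq_zero_of_vanishing {B : Phase ℝ n → ℝ} {x Y : Phase ℝ n}
    (hB : DifferentiableAt ℝ B x) (h0 : ∀ z : Phase ℝ n, z.1 ⬝ᵥ z.2 = 0 → B z = 0)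
    (hx : x ∈ cotangentSphere ℝ n) (hY : Y ∈ tangent x) : fderiv ℝ B x Y = 0 := by
  -- This map takes values in the cone, and its derivative at `x` fixes the tangent vectors; so the
  -- derivative of `B` along `Y` is that of the zero function `B ∘ ρ`.
  set ρ : Phase ℝ n → Phase ℝ n := fun z => (z.1, (z.1 ⬝ᵥ z.1) • z.2 - (z.1 ⬝ᵥ z.2) • z.1) with hρ
  have hρ0 : ∀ z, B (ρ z) = 0 := fun z => h0 _ (by
    simp only [hρ, dotProduct_sub, dotProduct_smul, smul_eq_mul]; ring)
  have hρx : ρ x = x := Prod.ext rfl (by simp only [hρ]; rw [hx.1, hx.2]; simp)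
  have hl := hasDerivAt_phase_line x Y 0
  have hd : HasDerivAt (fun s : ℝ => ρ (x + s • Y)) Y 0 := by
    have h1 := HasDerivAt.fst_phase hl
    have h2 := HasDerivAt.snd_phase hl
    have h3 := h1.prodMk (((hasDerivAt_dotProduct h1 h1).fun_smul h2).fun_sub
      ((hasDerivAt_dotProduct h1 h2).fun_smul h1))
    refine h3.congr_deriv (Prod.ext rfl ?_)
    have h4 : Y.1 ⬝ᵥ x.2 + x.1 ⬝ᵥ Y.2 = 0 := by
      rw [dotProduct_comm Y.1, add_comm]; exact hY.2
    have h5 : Y.1 ⬝ᵥ x.1 = 0 := by rw [dotProduct_comm]; exact hY.1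
    simp only [zero_smul, add_zero]
    rw [hx.1, hx.2, h4, h5, hY.1]
    simp
  have h6 : HasFDerivAt B (fderiv ℝ B x) (ρ (x + (0 : ℝ) • Y)) := by
    rw [zero_smul, add_zero, hρx]; exact hB.hasFDerivAt
  have h7 := h6.comp_hasDerivAt (0 : ℝ) hd
  refine h7.unique ?_
  have : (B ∘ fun s : ℝ => ρ (x + s • Y)) = fun _ => 0 := funext fun s => hρ0 _
  rw [this]
  exact hasDerivAt_const _ _

theorem hasDerivAt_hamField_line (I : Fin n → ℝ) (l : ℕ) (x Y : Phase ℝ n) :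
    HasDerivAt (fun s : ℝ => hamField I l (x + s • Y)) (fderiv ℝ (hamField I l) x Y) 0 := by
  have h1 : HasFDerivAt (hamField I l) (fderiv ℝ (hamField I l) x) (x + (0 : ℝ) • Y) := by
    rw [zero_smul, add_zero]; exact (differentiable_hamField I l x).hasFDerivAt
  exact h1.comp_hasDerivAt (0 : ℝ) (hasDerivAt_phase_line x Y 0)

theorem fderiv_eq_of_hasDerivAt_line {B : Phase ℝ n → ℝ} {x Y : Phase ℝ n} {b : ℝ}
    (hB : DifferentiableAt ℝ B x) (h : HasDerivAt (fun s : ℝ => B (x + s • Y)) b 0) :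
    fderiv ℝ B x Y = b := by
  have h1 : HasFDerivAt B (fderiv ℝ B x) (x + (0 : ℝ) • Y) := by
    rw [zero_smul, add_zero]; exact hB.hasFDerivAt
  exact (h1.comp_hasDerivAt (0 : ℝ) (hasDerivAt_phase_line x Y 0)).unique h

theorem differentiable_dotProduct_fst {H : Phase ℝ n → Phase ℝ n} (hH : Differentiable ℝ H) :
    Differentiable ℝ fun z : Phase ℝ n => z.1 ⬝ᵥ (H z).1 := by
  simp only [dotProduct]
  fun_prop

theorem dotProduct_fderiv_hamField_fst (I : Fin n → ℝ) (l : ℕ) {x Y : Phase ℝ n}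
    (hx : x ∈ cotangentSphere ℝ n) (hY : Y ∈ tangent x) :
    Y.1 ⬝ᵥ (hamField I l x).1 + x.1 ⬝ᵥ (fderiv ℝ (hamField I l) x Y).1 = 0 := by
  have hd := differentiable_dotProduct_fst (differentiable_hamField I l)
  rw [← fderiv_eq_zero_of_vanishing (hd x) (fun z hz => dotProduct_hamField_fst I l hz) hx hY]
  refine (fderiv_eq_of_hasDerivAt_line (hd x) ?_).symm
  have h := hasDerivAt_dotProduct (HasDerivAt.fst_phase (hasDerivAt_phase_line x Y 0))
    (HasDerivAt.fst_phase (hasDerivAt_hamField_line I l x Y))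
  simpa using h

theorem dotProduct_fderiv_hamField_snd (I : Fin n → ℝ) (l : ℕ) (x Y : Phase ℝ n) :
    Y.1 ⬝ᵥ (hamField I l x).2 + x.1 ⬝ᵥ (fderiv ℝ (hamField I l) x Y).2
      + (Y.2 ⬝ᵥ (hamField I l x).1 + x.2 ⬝ᵥ (fderiv ℝ (hamField I l) x Y).1) = 0 := by
  have hl := hasDerivAt_phase_line x Y 0
  have hh := hasDerivAt_hamField_line I l x Y
  have h := (hasDerivAt_dotProduct (HasDerivAt.fst_phase hl) (HasDerivAt.snd_phase hh)).fun_add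
    (hasDerivAt_dotProduct (HasDerivAt.snd_phase hl) (HasDerivAt.fst_phase hh))
  simp only [dotProduct_hamField_snd, zero_smul, add_zero] at h
  exact h.unique (hasDerivAt_const _ _)

theorem hasDerivAt_apply_line {E : Type*} [NormedAddCommGroup E] [NormedSpace ℝ E]
    {G : E → E →L[ℝ] ℝ} {x : E} (hG : DifferentiableAt ℝ G x) (Y : E) {H : ℝ → E} {H' : E}
    (hH : HasDerivAt H H' 0) :
    HasDerivAt (fun s : ℝ => G (x + s • Y) (H s)) (fderiv ℝ G x Y (H 0) + G x H') 0 := by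
  have h1 : HasDerivAt (fun s : ℝ => x + s • Y) Y 0 := by
    simpa using ((hasDerivAt_id (0 : ℝ)).smul_const Y).const_add x
  have h2 : HasFDerivAt G (fderiv ℝ G x) (x + (0 : ℝ) • Y) := by
    rw [zero_smul, add_zero]
    exact hG.hasFDerivAt
  have h3 : HasDerivAt (fun s : ℝ => G (x + s • Y)) (fderiv ℝ G x Y) 0 :=
    h2.comp_hasDerivAt (0 : ℝ) h1
  have h4 := h3.clm_apply hH
  rw [zero_smul, add_zero] at h4
  exact h4

theorem symp_fderiv_hamField (I : Fin n → ℝ) (l : ℕ) (x Y Z : Phase ℝ n) :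
    symp (fderiv ℝ (hamField I l) x Y) Z = fderiv ℝ (fderiv ℝ (integral I l)) x Y Z := by
  have hh := hasDerivAt_hamField_line I l x Y
  have h1 := (hasDerivAt_dotProduct (HasDerivAt.fst_phase hh) (hasDerivAt_const (0 : ℝ) Z.2)).fun_sub
    (hasDerivAt_dotProduct (HasDerivAt.snd_phase hh) (hasDerivAt_const (0 : ℝ) Z.1))
  have h3 := hasDerivAt_apply_line
    ((contDiff_fderiv_integral I l).differentiable (by simp) x) Y (hasDerivAt_const (0 : ℝ) Z)
  have h4 : (fun s : ℝ => (hamField I l (x + s • Y)).1 ⬝ᵥ Z.2 - (hamField I l (x + s • Y)).2 ⬝ᵥ Z.1)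
      = fun s : ℝ => fderiv ℝ (integral I l) (x + s • Y) Z :=
    funext fun s => symp_hamField I l (x + s • Y) Z
  rw [h4] at h1
  have h5 := h1.unique h3
  simpa [symp] using h5

/-- The Hamiltonian fields of the integrals commute. -/
theorem fderiv_hamField_comm (I : Fin n → ℝ) {x : Phase ℝ n} (hx : x ∈ cotangentSphere ℝ n)
    (k l : ℕ) : fderiv ℝ (hamField I k) x (hamField I l x)
      = fderiv ℝ (hamField I l) x (hamField I k x) := by
  have hk := (isHamVec_hamField I k hx).1
  have hl := (isHamVec_hamField I l hx).1
  refine sub_eq_zero.1 (eq_zero_of_symp_eq_zero hx ⟨?_, ?_⟩ fun Y hY => ?_)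
  · have h1 := dotProduct_fderiv_hamField_fst I k hx hl
    have h2 := dotProduct_fderiv_hamField_fst I l hx hk
    rw [dotProduct_comm] at h1
    rw [Prod.fst_sub, dotProduct_sub]
    linarith
  · have h1 := dotProduct_fderiv_hamField_snd I k x (hamField I l x)
    have h2 := dotProduct_fderiv_hamField_snd I l x (hamField I k x)
    rw [dotProduct_comm, dotProduct_comm (hamField I l x).2] at h1
    rw [Prod.fst_sub, Prod.snd_sub, dotProduct_sub, dotProduct_sub]
    linarith
  · have hsym : ∀ j, IsSymmSndFDerivAt ℝ (integral I j) x := fun j =>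
      (contDiff_integral I j (N := 2)).contDiffAt.isSymmSndFDerivAt (by simp)
    have hd : Differentiable ℝ fun z : Phase ℝ n => fderiv ℝ (integral I k) z (hamField I l z) :=
      ((contDiff_fderiv_integral I k).clm_apply (contDiff_hamField I l)).differentiable (by simp)
    -- The involution is differentiated along `Y`; it holds only where `(q, p) = 0`, hence the
    -- restriction to tangent `Y`. Symmetry of second derivatives turns the result into the pairing
    -- of the commutator with `Y`.
    have h1 := fderiv_eq_zero_of_vanishing (hd x)
      (fun z hz => fderiv_integral_hamField I hz l k) hx hY
    have h3 := hasDerivAt_apply_line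
      ((contDiff_fderiv_integral I k).differentiable (by simp) x) Y
      (hasDerivAt_hamField_line I l x Y)
    have h4 := fderiv_eq_of_hasDerivAt_line (hd x) h3
    rw [h1] at h4
    rw [zero_smul, add_zero, ← symp_hamField I k x] at h4
    have hanti : ∀ Z W : Phase ℝ n, symp Z W = -symp W Z := fun Z W => by
      simp only [symp, dotProduct_comm Z.1, dotProduct_comm Z.2]; ring
    have hsub : ∀ Z W : Phase ℝ n, symp (Z - W) Y = symp Z Y - symp W Y := fun Z W => by
      simp only [symp, Prod.fst_sub, Prod.snd_sub, sub_dotProduct]; ring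
    rw [hanti, symp_fderiv_hamField, (hsym k).eq, (hsym l).eq] at h4
    rw [hsub, symp_fderiv_hamField, symp_fderiv_hamField]
    linarith

end Commuting


/-! ### Liouville's theorem on the generic level sets. -/

section InvariantTori

variable {m : ℕ} {I : Fin (m + 2) → ℝ}

/-- The Hamiltonian fields of the integrals at a point, as a linear map. -/
noncomputable def hamFrame (I : Fin (m + 2) → ℝ) (x : Phase ℝ (m + 2)) :
    (Fin (m + 1) → ℝ) →L[ℝ] Phase ℝ (m + 2) :=
  ∑ l : Fin (m + 1), (ContinuousLinearMap.proj (R := ℝ) (φ := fun _ => ℝ) l).smulRight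
    (hamField I l x)

theorem hamFrame_apply (I : Fin (m + 2) → ℝ) (x : Phase ℝ (m + 2)) (ν : Fin (m + 1) → ℝ) :
    hamFrame I x ν = ∑ l : Fin (m + 1), ν l • hamField I l x := by
  simp [hamFrame]

theorem contDiff_hamFrame (I : Fin (m + 2) → ℝ) : ContDiff ℝ ∞ (hamFrame I) :=
  ContDiff.sum fun l _ => contDiff_const.smulRight (contDiff_hamField I l)

theorem fderiv_hamFrame_apply (I : Fin (m + 2) → ℝ) (x Y : Phase ℝ (m + 2))
    (ν : Fin (m + 1) → ℝ) :
    fderiv ℝ (hamFrame I) x Y ν = ∑ l : Fin (m + 1), ν l • fderiv ℝ (hamField I l) x Y := by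
  have h1 : HasFDerivAt (fun z => hamFrame I z ν)
      (∑ l : Fin (m + 1), ν l • fderiv ℝ (hamField I l) x) x := by
    simp only [hamFrame_apply]
    exact HasFDerivAt.fun_sum fun l _ => (differentiable_hamField I l x).hasFDerivAt.const_smul (ν l)
  have h2 := (((contDiff_hamFrame I).differentiable (by simp) x).hasFDerivAt.clm_apply
    (hasFDerivAt_const ν x)).unique h1
  have h3 := congrArg (fun T => T Y) h2
  simpa using h3

theorem fderiv_hamFrame_comm (I : Fin (m + 2) → ℝ) {x : Phase ℝ (m + 2)}
    (hx : x ∈ cotangentSphere ℝ (m + 2)) (ν θ : Fin (m + 1) → ℝ) :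
    fderiv ℝ (hamFrame I) x (hamFrame I x ν) θ = fderiv ℝ (hamFrame I) x (hamFrame I x θ) ν := by
  rw [fderiv_hamFrame_apply, fderiv_hamFrame_apply]
  simp only [hamFrame_apply, map_sum, map_smul, Finset.smul_sum]
  rw [Finset.sum_comm]
  refine Finset.sum_congr rfl fun k _ => Finset.sum_congr rfl fun l _ => ?_
  rw [fderiv_hamField_comm I hx, smul_comm]

theorem fderiv_integral_hamFrame (I : Fin (m + 2) → ℝ) {x : Phase ℝ (m + 2)}
    (hx : x.1 ⬝ᵥ x.2 = 0) (l : ℕ) (ν : Fin (m + 1) → ℝ) :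
    fderiv ℝ (integral I l) x (hamFrame I x ν) = 0 := by
  rw [hamFrame_apply, map_sum]
  exact Finset.sum_eq_zero fun k _ => by rw [map_smul, fderiv_integral_hamField I hx, smul_zero]

theorem dotProduct_hamFrame_fst (I : Fin (m + 2) → ℝ) {x : Phase ℝ (m + 2)}
    (hx : x.1 ⬝ᵥ x.2 = 0) (ν : Fin (m + 1) → ℝ) : x.1 ⬝ᵥ (hamFrame I x ν).1 = 0 := by
  rw [hamFrame_apply, Prod.fst_sum, dotProduct_sum]
  exact Finset.sum_eq_zero fun k _ => by
    rw [Prod.smul_fst, dotProduct_smul, dotProduct_hamField_fst I k hx, smul_zero]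

theorem dotProduct_hamFrame_snd (I : Fin (m + 2) → ℝ) (x : Phase ℝ (m + 2))
    (ν : Fin (m + 1) → ℝ) :
    x.1 ⬝ᵥ (hamFrame I x ν).2 + x.2 ⬝ᵥ (hamFrame I x ν).1 = 0 := by
  rw [hamFrame_apply, Prod.fst_sum, Prod.snd_sum, dotProduct_sum, dotProduct_sum,
    ← Finset.sum_add_distrib]
  exact Finset.sum_eq_zero fun k _ => by
    rw [Prod.smul_fst, Prod.smul_snd, dotProduct_smul, dotProduct_smul, ← smul_add,
      dotProduct_hamField_snd, smul_zero]

theorem isFlowInvariant_levelSet (I : Fin (m + 2) → ℝ) (h : ℝ) (c : Fin m → ℝ) :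
    IsFlowInvariant (hamFrame I) (levelSet I h c) := by
  intro θ ρ γ hγ h0 t ht
  have hS : Convex ℝ (Set.Icc (0 : ℝ) 1) := convex_Icc 0 1
  have h00 : (0 : ℝ) ∈ Set.Icc (0 : ℝ) 1 := ⟨le_rfl, zero_le_one⟩
  have hfst : ∀ s ∈ Set.Icc (0 : ℝ) 1, HasDerivWithinAt (fun r => (γ r).1)
      (ρ s • (hamFrame I (γ s) θ).1) (Set.Icc 0 1) s := fun s hs => (hγ s hs).fst
  have hsnd : ∀ s ∈ Set.Icc (0 : ℝ) 1, HasDerivWithinAt (fun r => (γ r).2)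
      (ρ s • (hamFrame I (γ s) θ).2) (Set.Icc 0 1) s := fun s hs => (hγ s hs).snd
  have hqp : ∀ s ∈ Set.Icc (0 : ℝ) 1, (γ s).1 ⬝ᵥ (γ s).2 = 0 := by
    intro s hs
    rw [← h0.1.2]
    refine eqOn_const_of_hasDerivWithinAt_zero hS (f := fun r => (γ r).1 ⬝ᵥ (γ r).2)
      (fun r hr => ?_) hs h00
    refine (hasDerivWithinAt_dotProduct (hfst r hr) (hsnd r hr)).congr_deriv ?_
    rw [smul_dotProduct, dotProduct_smul, ← smul_add, dotProduct_comm, add_comm,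
      dotProduct_hamFrame_snd, smul_zero]
  refine ⟨⟨?_, hqp t ht⟩, ?_⟩
  · rw [← h0.1.1]
    refine eqOn_const_of_hasDerivWithinAt_zero hS (f := fun r => (γ r).1 ⬝ᵥ (γ r).1)
      (fun r hr => ?_) ht h00
    refine (hasDerivWithinAt_dotProduct (hfst r hr) (hfst r hr)).congr_deriv ?_
    rw [smul_dotProduct, dotProduct_smul, dotProduct_comm,
      dotProduct_hamFrame_fst I (hqp r hr), smul_zero, add_zero]
  · rw [← h0.2]
    ext l
    refine eqOn_const_of_hasDerivWithinAt_zero hS (f := fun r => integral I l (γ r))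
      (fun r hr => ?_) ht h00
    have h1 := (differentiable_integral I l (γ r)).hasFDerivAt.comp_hasDerivWithinAt r (hγ r hr)
    rw [map_smul, fderiv_integral_hamFrame I (hqp r hr), smul_zero] at h1
    exact h1

theorem isCompact_levelSet (hpos : ∀ i, 0 < I i) (h : ℝ) (c : Fin m → ℝ) :
    IsCompact (levelSet I h c) := by
  have hclosed : IsClosed (levelSet I h c) := by
    have : levelSet I h c = cotangentSphere ℝ (m + 2) ∩
        ⋂ z, {x | (integralPoly I x).eval z = (C h * ∏ j, (X - C (c j))).eval z} := by
      ext x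
      simp only [Set.mem_inter_iff, Set.mem_iInter]
      exact and_congr_right fun _ => ⟨fun h z => congrArg (eval z) h, fun h =>
        Polynomial.funext h⟩
    rw [this]
    exact (isClosed_cotangentSphere _).inter (isClosed_iInter fun z =>
      isClosed_eq (continuous_eval_integralPoly I z) continuous_const)
  -- With the smallest `I_i` the energy bounds `(p, p)`.
  obtain ⟨i₀, -, hi₀⟩ := Finset.exists_min_image Finset.univ I Finset.univ_nonempty
  refine Metric.isCompact_of_isClosed_isBounded hclosed
    (isBounded_iff_forall_norm_le.2 ⟨max 2 (1 + 2 * h / I i₀), fun x hx => ?_⟩)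
  rw [Prod.norm_def]
  refine max_le_max ((norm_le_one_add_dotProduct x.1).trans ?_)
    ((norm_le_one_add_dotProduct x.2).trans ?_)
  · rw [hx.1.1]; norm_num
  · have h1 := level_eq_starHamiltonian hx
    have h2 : I i₀ * (x.2 ⬝ᵥ x.2) ≤ ∑ i, I i * x.2 i ^ 2 := by
      rw [dotProduct, Finset.mul_sum]
      refine Finset.sum_le_sum fun i _ => ?_
      rw [← sq]
      exact mul_le_mul_of_nonneg_right (hi₀ i (Finset.mem_univ i)) (sq_nonneg _)
    have h3 : x.2 ⬝ᵥ x.2 ≤ 2 * h / I i₀ := by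
      rw [le_div_iff₀ (hpos i₀), h1, starHamiltonian]
      linarith
    linarith

/-- The defining functions of the level sets. -/
noncomputable def momentMap (I : Fin (m + 2) → ℝ) (x : Phase ℝ (m + 2)) :
    ℝ × ℝ × (Fin (m + 1) → ℝ) :=
  (x.1 ⬝ᵥ x.1, x.1 ⬝ᵥ x.2, fun l => integral I l x)

theorem contDiff_momentMap (I : Fin (m + 2) → ℝ) : ContDiff ℝ 1 (momentMap I) := by
  refine ContDiff.prodMk ?_ (ContDiff.prodMk ?_ (contDiff_pi.2 fun l => contDiff_integral I l))
  · simp only [dotProduct]; fun_prop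
  · simp only [dotProduct]; fun_prop

theorem fderiv_momentMap (I : Fin (m + 2) → ℝ) (x Y : Phase ℝ (m + 2)) :
    fderiv ℝ (momentMap I) x Y = (2 * (x.1 ⬝ᵥ Y.1), x.1 ⬝ᵥ Y.2 + x.2 ⬝ᵥ Y.1,
      fun l : Fin (m + 1) => fderiv ℝ (integral I l) x Y) := by
  have hl := hasDerivAt_phase_line x Y 0
  have h0 : x + (0 : ℝ) • Y = x := by rw [zero_smul, add_zero]
  have h1 : HasFDerivAt (momentMap I) (fderiv ℝ (momentMap I) x) (x + (0 : ℝ) • Y) := by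
    rw [h0]; exact ((contDiff_momentMap I).differentiable one_ne_zero x).hasFDerivAt
  have h2 := h1.comp_hasDerivAt (0 : ℝ) hl
  have h3 : ∀ l : Fin (m + 1), HasDerivAt (fun s : ℝ => integral I l (x + s • Y))
      (fderiv ℝ (integral I l) x Y) 0 := fun l => by
    have h4 : HasFDerivAt (integral I l) (fderiv ℝ (integral I l) x) (x + (0 : ℝ) • Y) := by
      rw [h0]; exact (differentiable_integral I l x).hasFDerivAt
    exact h4.comp_hasDerivAt (0 : ℝ) hl
  have h4 := (hasDerivAt_dotProduct (HasDerivAt.fst_phase hl) (HasDerivAt.fst_phase hl)).prodMk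
    ((hasDerivAt_dotProduct (HasDerivAt.fst_phase hl) (HasDerivAt.snd_phase hl)).prodMk
      (hasDerivAt_pi.2 h3))
  rw [h2.unique h4, h0, dotProduct_comm Y.1 x.1, dotProduct_comm Y.1 x.2, two_mul,
    add_comm (x.2 ⬝ᵥ Y.1)]

theorem momentMap_levelSet {h : ℝ} {c : Fin m → ℝ} {x y : Phase ℝ (m + 2)}
    (hx : x ∈ levelSet I h c) (hy : y ∈ levelSet I h c) : momentMap I x = momentMap I y := by
  simp only [momentMap, integral]
  rw [hx.1.1, hx.1.2, hy.1.1, hy.1.2, hx.2, hy.2]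

theorem exists_tangent_of_linearIndependent {W ι : Type*} [AddCommGroup W] [Module ℝ W]
    [Fintype ι] [DecidableEq ι] {ℓ : ι → W →ₗ[ℝ] ℝ} (hℓ : LinearIndependent ℝ ℓ) (w : ι → ℝ) :
    ∃ Y, ∀ i, ℓ i Y = w i := by
  have h1 : LinearMap.range (LinearMap.pi ℓ) = ⊤ := by
    by_contra hne
    obtain ⟨g, hg0, hg⟩ := Submodule.exists_le_ker_of_lt_top _ (lt_top_iff_ne_top.2 hne)
    refine hg0 (LinearMap.pi_ext' fun i => LinearMap.ext_ring ?_)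
    refine Fintype.linearIndependent_iff.1 hℓ (fun i => g (Pi.single i 1)) ?_ i
    refine LinearMap.ext fun Y => ?_
    have h2 : g (LinearMap.pi ℓ Y) = 0 := hg ⟨Y, rfl⟩
    rw [pi_eq_sum_univ' (LinearMap.pi ℓ Y)] at h2
    simpa [mul_comm, LinearMap.pi_apply] using h2
  obtain ⟨Y, hY⟩ := LinearMap.range_eq_top.1 h1 w
  exact ⟨Y, fun i => congrFun hY i⟩

theorem surjective_fderiv_momentMap (hI : Function.Injective I) (hI0 : ∀ i, I i ≠ 0) {h : ℝ}
    {c : Fin m → ℝ} (hh : h ≠ 0) (hc : IsGeneric I c) {x : Phase ℝ (m + 2)}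
    (hx : x ∈ levelSet I h c) : Function.Surjective (fderiv ℝ (momentMap I) x) := by
  rintro ⟨a, b, w⟩
  -- Multiples of `q` in both slots attain the first two components; a tangent vector, which does
  -- not affect them, adjusts the integrals.
  set Y₀ : Phase ℝ (m + 2) := ((a / 2) • x.1, b • x.1) with hY₀
  obtain ⟨Y, hY⟩ := exists_tangent_of_linearIndependent
    (linearIndependent_integrals hI hI0 hh hc hx) fun l => w l - fderiv ℝ (integral I l) x Y₀
  refine ⟨Y₀ + Y, ?_⟩
  have h1 : x.2 ⬝ᵥ x.1 = 0 := by rw [dotProduct_comm]; exact hx.1.2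
  have h2 : fderiv ℝ (momentMap I) x Y₀
      = (a, b, fun l : Fin (m + 1) => fderiv ℝ (integral I l) x Y₀) := by
    rw [fderiv_momentMap]
    simp only [hY₀, dotProduct_smul, smul_eq_mul]
    rw [hx.1.1, h1]
    refine Prod.ext (by ring) (Prod.ext (by simp) rfl)
  rw [map_add, h2, fderiv_momentMap, Y.2.1, Y.2.2]
  refine Prod.ext (by simp) (Prod.ext (by simp) (funext fun l => ?_))
  have := hY l
  simp only [LinearMap.comp_apply, Submodule.subtype_apply, ContinuousLinearMap.coe_coe] at this
  simp [this]

theorem injective_hamFrame (hI : Function.Injective I) (hI0 : ∀ i, I i ≠ 0) {h : ℝ}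
    {c : Fin m → ℝ} (hh : h ≠ 0) (hc : IsGeneric I c) {x : Phase ℝ (m + 2)}
    (hx : x ∈ levelSet I h c) : Function.Injective (hamFrame I x) := by
  rw [injective_iff_map_eq_zero]
  intro ν hν
  have hind := Fintype.linearIndependent_iff.1 (linearIndependent_integrals hI hI0 hh hc hx) ν
  funext l
  refine hind (LinearMap.ext fun Y => ?_) l
  have h1 : symp (hamFrame I x ν) Y = 0 := by rw [hν]; simp [symp]
  rw [hamFrame_apply, symp, Prod.fst_sum, Prod.snd_sum, sum_dotProduct, sum_dotProduct,
    ← Finset.sum_sub_distrib] at h1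
  simp only [LinearMap.sum_apply, LinearMap.smul_apply, LinearMap.comp_apply,
    Submodule.subtype_apply, ContinuousLinearMap.coe_coe, LinearMap.zero_apply]
  rw [← h1]
  refine Finset.sum_congr rfl fun k _ => ?_
  rw [← symp_hamField, symp, Prod.smul_fst, Prod.smul_snd, smul_dotProduct, smul_dotProduct,
    ← smul_sub]

/-- A dimension count: the kernel of the differential has dimension `2(m + 2) - (m + 3) = m + 1`,
the number of independent Hamiltonian fields it contains. -/
theorem exists_hamFrame_eq (hI : Function.Injective I) (hI0 : ∀ i, I i ≠ 0) {h : ℝ}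
    {c : Fin m → ℝ} (hh : h ≠ 0) (hc : IsGeneric I c) {x Y : Phase ℝ (m + 2)}
    (hx : x ∈ levelSet I h c) (hY : fderiv ℝ (momentMap I) x Y = 0) :
    ∃ ν, hamFrame I x ν = Y := by
  have hle : LinearMap.range (hamFrame I x).toLinearMap
      ≤ LinearMap.ker (fderiv ℝ (momentMap I) x).toLinearMap := by
    rintro _ ⟨ν, rfl⟩
    rw [LinearMap.mem_ker, ContinuousLinearMap.coe_coe, ContinuousLinearMap.coe_coe,
      fderiv_momentMap, dotProduct_hamFrame_fst I hx.1.2, dotProduct_hamFrame_snd, mul_zero]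
    refine Prod.ext rfl (Prod.ext rfl (funext fun l => ?_))
    exact fderiv_integral_hamFrame I hx.1.2 l ν
  have h1 := LinearMap.finrank_range_of_inj (f := (hamFrame I x).toLinearMap)
    (injective_hamFrame hI hI0 hh hc hx)
  have h2 := LinearMap.finrank_range_add_finrank_ker (fderiv ℝ (momentMap I) x).toLinearMap
  rw [LinearMap.range_eq_top.2 (surjective_fderiv_momentMap hI hI0 hh hc hx), finrank_top] at h2
  simp only [Module.finrank_prod, Module.finrank_fin_fun, Module.finrank_self] at h1 h2
  have h3 := Submodule.eq_of_le_of_finrank_eq hle (by rw [h1]; omega)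
  have h4 : Y ∈ LinearMap.ker (fderiv ℝ (momentMap I) x).toLinearMap := hY
  rw [← h3] at h4
  exact h4

/-- Liouville's theorem for the generic level sets. -/
theorem isInvariantTorus_connectedComponentIn (hI : Function.Injective I) (hpos : ∀ i, 0 < I i)
    {h : ℝ} {c : Fin m → ℝ} (hh : 0 < h) (hc : IsGeneric I c) {x : Phase ℝ (m + 2)}
    (hx : x ∈ levelSet I h c) :
    IsInvariantTorus (starHamiltonian I) (m + 1) (connectedComponentIn (levelSet I h c) x) := by
  have hI0 : ∀ i, I i ≠ 0 := fun i => (hpos i).ne'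
  obtain ⟨ψ, T, hψ, hd, hper, hrange⟩ := exists_torus (contDiff_hamFrame I)
    (isCompact_levelSet hpos h c) (isFlowInvariant_levelSet I h c)
    (fun y hy ν θ => fderiv_hamFrame_comm I hy.1 ν θ)
    (fun y hy => injective_hamFrame hI hI0 hh.ne' hc hy) (contDiff_momentMap I)
    (fun y hy z hz => momentMap_levelSet hy hz)
    (fun y hy => surjective_fderiv_momentMap hI hI0 hh.ne' hc hy)
    (fun y hy Y hY => exists_hamFrame_eq hI hI0 hh.ne' hc hy hY) hx
  -- The flow of `H*`, the last integral, is the translation along the last basis vector, seen in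
  -- the lattice coordinates.
  refine ⟨ψ, T.symm (Pi.single (Fin.last m) 1), hψ, fun θ => ?_, hper, hrange, fun θ s _ => ?_⟩
  · rw [(hd θ).2.fderiv]
    exact (injective_hamFrame hI hI0 hh.ne' hc (hd θ).1).comp T.injective
  · refine ⟨(hd _).1.1, hamField I m (ψ (θ + s • T.symm (Pi.single (Fin.last m) 1))), ?_,
      (isHamVec_starHamiltonian_iff I (hd _).1.1).2 rfl⟩
    have h1 : HasDerivAt (fun s : ℝ => θ + s • T.symm (Pi.single (Fin.last m) 1))
        (T.symm (Pi.single (Fin.last m) 1)) s := by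
      simpa using ((hasDerivAt_id s).smul_const (T.symm (Pi.single (Fin.last m) 1))).const_add θ
    refine ((hd _).2.comp_hasDerivAt s h1).congr_deriv ?_
    rw [ContinuousLinearMap.comp_apply, ContinuousLinearEquiv.coe_coe, T.apply_symm_apply,
      hamFrame_apply, Finset.sum_eq_single (Fin.last m)]
    · simp
    · intro k _ hk
      rw [Pi.single_eq_of_ne hk, zero_smul]
    · simp

end InvariantTori

end Veselova

theorem mainTheorem1 (m : ℕ) (A : Fin (m + 2) → ℝ) (hA : ∀ i, 0 < A i) :
    -- The reduced system: its trajectories are the curves `e_1(t)` of the Veselova LR system ...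
    (∀ J : Set ℝ, IsOpen J → J.OrdConnected → ∀ q : ℝ → Fin (m + 2) → ℝ,
      IsLagrangeDAlembert (redLagrangian A) (redForce A) J q ↔
        ∃ g, IsVeselovaMotion A J g ∧ ∀ t ∈ J, frame (g t) 0 = q t) ∧
    -- ... and its two forms, on the tangent and on the cotangent bundle, are equivalent.
    (∀ J : Set ℝ, IsOpen J → ∀ q p : ℝ → Fin (m + 2) → ℝ,
      IsReducedFlow A J q p ↔
        IsLagrangeDAlembert (redLagrangian A) (redForce A) J q ∧
          ∀ t ∈ J, p t = momentum (redLagrangian A) (q t) (deriv q t)) ∧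
    -- 1) The time substitution `dτ = 𝒩(q) dt` and the change of momenta `p ↦ 𝒩(q) p` transform the
    -- reduced system into the Hamiltonian system of `H*` ...
    (∀ J : Set ℝ, IsOpen J → J.OrdConnected →
      ∀ (q p : ℝ → Fin (m + 2) → ℝ) (τ : ℝ → ℝ) (Q P : ℝ → Fin (m + 2) → ℝ),
      (∀ t ∈ J, HasDerivAt τ (multiplier A (q t)) t) →
      (∀ t ∈ J, Q (τ t) = q t ∧ P (τ t) = multiplier A (q t) • p t) →
      (IsReducedFlow A J q p ↔
        IsHamCurve (starHamiltonian fun i => (A i)⁻¹) (τ '' J) fun s => (Q s, P s))) ∧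
    -- ... which is the geodesic flow of the Riemannian metric on the sphere with Lagrangian `L*`.
    (∀ q v : Fin (m + 2) → ℝ, q ⬝ᵥ q = 1 → q ⬝ᵥ v = 0 →
      (v ≠ 0 → 0 < starLagrangian A q v) ∧
      q ⬝ᵥ momentum (starLagrangian A) q v = 0 ∧
      starHamiltonian (fun i => (A i)⁻¹) (q, momentum (starLagrangian A) q v)
        = momentum (starLagrangian A) q v ⬝ᵥ v - starLagrangian A q v) ∧
    (∀ K : Set ℝ, IsOpen K → ∀ Q P : ℝ → Fin (m + 2) → ℝ,
      IsHamCurve (starHamiltonian fun i => (A i)⁻¹) K (fun s => (Q s, P s)) ↔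
        IsLagrangeDAlembert (starLagrangian A) (fun _ _ _ => 0) K Q ∧
          ∀ s ∈ K, P s = momentum (starLagrangian A) (Q s) (deriv Q s)) ∧
    -- 2) Integrability for `A_1 < ⋯ < A_n`.
    (StrictMono A → ∀ I : Fin (m + 2) → ℝ, (∀ i, I i = (A i)⁻¹) →
      -- Algebraic complete integrability (of the complexified flow), and complete integrability.
      IsAlgebraicallyIntegrable (fun i => (I i : ℂ)) ∧
      IsLiouvilleIntegrable I ∧
      -- Spheroconic coordinates: they map each open orthant of the sphere onto an open box.
      (∀ q : Fin (m + 2) → ℝ, q ⬝ᵥ q = 1 → (∀ i, q i ≠ 0) →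
        ∃! lam : Fin (m + 1) → ℝ, (∀ k, I k.succ < lam k ∧ lam k < I k.castSucc) ∧
          IsSpheroconic I q lam) ∧
      (∀ lam : Fin (m + 1) → ℝ, (∀ k, I k.succ < lam k ∧ lam k < I k.castSucc) →
        ∀ ε : Fin (m + 2) → ℝ, (∀ i, ε i ^ 2 = 1) →
        ∃! q : Fin (m + 2) → ℝ, q ⬝ᵥ q = 1 ∧ (∀ i, 0 < ε i * q i) ∧ IsSpheroconic I q lam) ∧
      -- The Stäckel form of `L*`.
      (∀ (Q : ℝ → Fin (m + 2) → ℝ) (lam : ℝ → Fin (m + 1) → ℝ) (s : ℝ),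
        DifferentiableAt ℝ Q s → DifferentiableAt ℝ lam s → (∀ i, Q s i ≠ 0) →
        (∀ᶠ r in nhds s, IsSpheroconic I (Q r) (lam r)) →
        starLagrangian A (Q s) (deriv Q s) =
          -(1 / 8) * ∑ k, (∏ l ∈ Finset.univ.erase k, (lam s k - lam s l))
            / ((∏ i, (lam s k - I i)) * lam s k) * (deriv (fun r => lam r k) s) ^ 2) ∧
      -- The constants of motion `h, c_2, …, c_{n-1}`.
      (∀ x ∈ cotangentSphere ℝ (m + 2), x.2 ≠ 0 →
        ∃! c : Fin m → ℝ, Monotone c ∧ x ∈ levelSet I (starHamiltonian I x) c) ∧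
      (∀ (K : Set ℝ) (γ : ℝ → Phase ℝ (m + 2)), IsOpen K → K.OrdConnected →
        IsHamCurve (starHamiltonian I) K γ →
        ∀ h c, ∀ s ∈ K, γ s ∈ levelSet I h c → ∀ r ∈ K, γ r ∈ levelSet I h c) ∧
      -- The Abel-Jacobi quadratures.
      AbelJacobiQuadratures I (starHamiltonian I) (Fin.last m) ∧
      -- The constants are generic on an open dense set, and then the connected components of the
      -- invariant manifolds are `(n - 1)`-dimensional tori.
      (∃ O : Set (Phase ℝ (m + 2)), IsOpen O ∧
        O ∩ cotangentSphere ℝ (m + 2) =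
          {x | ∃ h c, 0 < h ∧ IsGeneric I c ∧ x ∈ levelSet I h c} ∧
        cotangentSphere ℝ (m + 2) ⊆ closure (O ∩ cotangentSphere ℝ (m + 2))) ∧
      (∀ (h : ℝ) (c : Fin m → ℝ), 0 < h → IsGeneric I c → ∀ x ∈ levelSet I h c,
        IsInvariantTorus (starHamiltonian I) (m + 1)
          (connectedComponentIn (levelSet I h c) x))) := by
  refine ⟨fun J hJ hJc q => ⟨exists_motion hJ hJc, fun ⟨g, hg, hq⟩ =>
      isLagrangeDAlembert_of_motion hJ hg hq⟩,
    fun J hJ q p => isReducedFlow_iff hA hJ q p,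
    fun J hJ _ q p τ Q P hτ hQP => isReducedFlow_iff_isHamCurve hA hJ hτ hQP,
    fun q v hq hqv => ⟨starLagrangian_pos hA hq hqv,
      dotProduct_momentum_star (bil_self_pos_of_sphere hA hq).ne' v, legendre_star hA hq v⟩,
    fun K hK Q P => isHamCurve_star_iff_geodesic hA hK Q P, fun hmono I hI => ?_⟩
  have hpos : ∀ i, 0 < I i := fun i => by rw [hI]; exact inv_pos.2 (hA i)
  have hanti : StrictAnti I := fun i j hij => by
    rw [hI, hI]
    exact inv_strictAnti₀ (hA i) (hmono hij)
  have hI0 : ∀ i, I i ≠ 0 := fun i => (hpos i).ne'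
  exact ⟨isAlgebraicallyIntegrable (fun i j h => hanti.injective (by exact_mod_cast h))
      (fun i => by exact_mod_cast hI0 i),
    isLiouvilleIntegrable hanti.injective hI0,
    fun q hq h0 => existsUnique_spheroconic hanti hq h0,
    fun lam h ε hε => existsUnique_of_box hanti h hε,
    fun Q lam s hQ hlam h0 hs => starLagrangian_staeckel hanti hpos
      (fun i => by rw [hI, inv_inv]) hQ hlam h0 hs,
    fun x hx hp => existsUnique_constants hanti hpos hx hp,
    fun K γ _ hKc hγ h c s hs hx r hr => mem_levelSet_of_isHamCurve hKc hγ hs hr hx,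
    abelJacobiQuadratures hanti.injective fun x hx Y hY => (isHamVec_starHamiltonian_iff I hx).1 hY,
    exists_open_generic hanti hpos,
    fun h c hh hc x hx =>
      isInvariantTorus_connectedComponentIn hanti.injective hpos hh hc hx⟩
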